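/- Let $M$ be a smooth $7$-manifold and let $\varphi$ be a $G_2$-structure on $M$, i.e. a smooth $3$-form such that the $7$-form $B(v,v)=(v\lrcorner\varphi)\wedge(v\lrcorner\varphi)\wedge\varphi$ is non-zero for every non-zero tangent vector $v$. It determines a Riemannian metric $g$ and a volume form $d\mu$ by $B(v,w)=-6\,g(v,w)\,d\mu$, and the dual $4$-form $\psi=*\varphi$. Let $\nabla$, $\mathrm{Ric}$, $\mathrm{Scal}$ be the Levi-Civita connection and the Ricci and scalar curvatures of $g$. Forms are regarded as skew-symmetric tensors, inner products are those of tensors, and repeated indices are contracted with $g$. The torsion of $\varphi$ is the $2$-tensor $T$ with $\nabla_p\varphi_{ijk}=T_{pq}\psi_{qijk}$. For $2$-tensors $u,w$ and $1$-forms $X$ put $\mathsf V(w)_k=w_{ij}\varphi_{ijk}$, $(u\circ w)_{jk}=u_{jm}w_{mk}$, $w(X)_a=w_{ab}X_b$, $(X\lrcorner\varphi)_{jk}=X_l\varphi_{ljk}$, $(X\lrcorner\psi)_{ijk}=X_l\psi_{lijk}$, $(\mathrm{div}\,w)_b=\nabla_aw_{ab}$, $\mathrm{div}\,X=\nabla_aX_a$,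 $w_{\mathrm{sym}}=\frac12(w+w^t)$, and for symmetric $h$ put $(h\diamond\varphi)_{ijk}=h_{ip}\varphi_{pjk}+h_{jp}\varphi_{ipk}+h_{kp}\varphi_{ijp}$; write $\mathsf VT=\mathsf V(T)$ and let $\mathcal L_{\mathsf VT}g$ be the Lie derivative of $g$ along the vector field dual to $\mathsf VT$. Every $3$-form is uniquely of the form $h\diamond\varphi+X\lrcorner\psi$ with $h$ a symmetric $2$-tensor and $X$ a $1$-form. Put $$\mathsf F(\varphi)=\tfrac16\mathrm{Scal}-\tfrac13|T|^2-\tfrac16(\mathrm{tr}\,T)^2,$$ $$\hat P_1=-\mathrm{Ric}-\tfrac13\mathcal L_{\mathsf VT}g-\tfrac23\big(T\circ(\mathsf VT\lrcorner\varphi)\big)_{\mathrm{sym}}+\mathrm{tr}\,T\;T_{\mathrm{sym}},\qquad P_1=\hat P_1+\mathsf F(\varphi)\,g,$$ $$P_2=\tfrac23\mathrm{div}\,T+\tfrac13\nabla\mathrm{tr}\,T+\tfrac13\mathrm{tr}\,T\;\mathsf VT.$$ (1) Let $(\varphi_t)_{|t|<\varepsilon}$ be a smooth family of $G_2$-structures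 on $M$ with $\varphi_0=\varphi$ and $\frac{d}{dt}\big|_{t=0}\varphi_t=h\diamond\varphi+X\lrcorner\psi$ for a symmetric $2$-tensor $h$ and a $1$-form $X$. Then, at every point of $M$, $$\frac{d}{dt}\Big|_{t=0}\mathsf F(\varphi_t)=\langle h,\hat P_1\rangle+\langle X,P_2\rangle+\mathrm{div}\,A,$$ $$A=-\tfrac13\nabla\mathrm{tr}\,h+\tfrac13\mathrm{div}\,h-\tfrac23\mathsf V(h\circ T)-\tfrac23T(X)-\tfrac13\mathrm{tr}\,T\;X.$$ (2) Suppose in addition that $M$ is compact, and let $\mathcal F(\varphi)=\int_M\mathsf F(\varphi)\,d\mu$ be the $G_2$-Hilbert functional. Then, for every family as in (1), $\mathsf F(\varphi_t)$ is integrable for $|t|<\varepsilon$, the integrand below is integrable, and $$\frac{d}{dt}\Big|_{t=0}\mathcal F(\varphi_t)=\int_M\langle h,P_1\rangle+\langle X,P_2\rangle\,d\mu.$$ Consequently the gradient of $\mathcal F$ at $\varphi$ with respect to the inner product $$\langle h\diamond\varphi+X\lrcorner\psi,\;w\diamond\varphi+Y\lrcorner\psi\rangle_{L^2}=\int_M\langle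 h,w\rangle+\langle X,Y\rangle\,d\mu$$ on $3$-forms is the smooth $3$-form $P_1\diamond\varphi+P_2\lrcorner\psi$: for every smooth family $(\varphi_t)$ of $G_2$-structures through $\varphi$, $\frac{d}{dt}\big|_{t=0}\mathcal F(\varphi_t)=\big\langle P_1\diamond\varphi+P_2\lrcorner\psi,\ \frac{d}{dt}\big|_{t=0}\varphi_t\big\rangle_{L^2}$. -/

import Mathlib

open Set MeasureTheory
open scoped Manifold ContDiff ENNReal

noncomputable section

namespace G2Hilbert

/-- The model space of a 7-manifold. -/
abbrev E7 : Type := EuclideanSpace ℝ (Fin 7)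

/-- Components of a covariant `k`-tensor at a point, `k = 1, 2, 3, 4`.  Differential forms are
regarded as skew-symmetric tensors, `ω = (1 / k!) ω_{i₁ … i_k} dx^{i₁} ∧ … ∧ dx^{i_k}`. -/
abbrev C1 : Type := Fin 7 → ℝ
abbrev C2 : Type := Fin 7 → Fin 7 → ℝ
abbrev C3 : Type := Fin 7 → Fin 7 → Fin 7 → ℝ
abbrev C4 : Type := Fin 7 → Fin 7 → Fin 7 → Fin 7 → ℝ

/-! ### Algebra at a point

`c` denotes the components of a 3-form `φ` in some basis. -/

/-- The permutation symbol: the sign of `s` if `s` is a permutation, and `0` otherwise. -/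
def permSymbol (s : Fin 7 → Fin 7) : ℝ :=
  (Matrix.of fun r q : Fin 7 => if s r = q then (1 : ℝ) else 0).det

/-- `B(∂_i, ∂_j) = (∂_i ⌟ φ) ∧ (∂_j ⌟ φ) ∧ φ`, as a multiple of `dx¹ ∧ … ∧ dx⁷`.
The factor is `1 / (2! 2! 3!)`. -/
def bForm (c : C3) : C2 := fun i j =>
  (1 / 24) * ∑ s : Fin 7 → Fin 7,
    permSymbol s * (c i (s 0) (s 1) * c j (s 2) (s 3) * c (s 4) (s 5) (s 6))

/-- `φ` is a `G₂`-structure at the point: `B(v, v) ≠ 0` for all `v ≠ 0`. -/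
def IsG2At (c : C3) : Prop :=
  ∀ v : Fin 7 → ℝ, v ≠ 0 → ∑ i, ∑ j, bForm c i j * v i * v j ≠ 0

/-- The number `m` with `dμ = m dx¹ ∧ … ∧ dx⁷` for the volume form `dμ` of `φ`.
Since `B = -6 g m` and `m² = det g`, it is the real ninth root of `det (-B / 6) = m⁷ det g`. -/
def volCoeff (c : C3) : ℝ :=
  (SignType.sign (Matrix.of fun i j => -bForm c i j / 6).det : ℝ) *
    |(Matrix.of fun i j => -bForm c i j / 6).det| ^ ((1 : ℝ) / 9)

/-- The metric `g` of `φ`, determined by `B = -6 g dμ`. -/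
def metric (c : C3) : C2 := fun i j => -bForm c i j / (6 * volCoeff c)

/-- `g^{ij}`. -/
def cometric (c : C3) : C2 := fun i j => (Matrix.of (metric c))⁻¹ i j

/-- Raising all indices. -/
def raise1 (c : C3) (X : C1) : C1 := fun i => ∑ a, cometric c i a * X a

def raise2 (c : C3) (w : C2) : C2 := fun i j =>
  ∑ a, ∑ b, cometric c i a * cometric c j b * w a b

def raise3 (c : C3) (w : C3) : C3 := fun i j k =>
  ∑ a, ∑ b, ∑ d, cometric c i a * cometric c j b * cometric c k d * w a b d

/-- `ψ = *φ`. -/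
def psi (c : C3) : C4 := fun i j k l =>
  (1 / 6) * ∑ a, ∑ b, ∑ d,
    raise3 c c a b d * (volCoeff c * permSymbol ![a, b, d, i, j, k, l])

/-- `⟨X, Y⟩ = X_i Y_i`. -/
def ip1 (c : C3) (X Y : C1) : ℝ := ∑ i, raise1 c X i * Y i

/-- `⟨h, w⟩ = h_{ij} w_{ij}`. -/
def ip2 (c : C3) (h w : C2) : ℝ := ∑ i, ∑ j, raise2 c h i j * w i j

def tr (c : C3) (w : C2) : ℝ := ∑ i, ∑ j, cometric c i j * w i j

def sym (w : C2) : C2 := fun i j => (w i j + w j i) / 2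

/-- `(v ∘ w)_{jk} = v_{jm} w_{mk}`. -/
def comp (c : C3) (v w : C2) : C2 := fun j k => ∑ m, ∑ n, v j m * cometric c m n * w n k

/-- `w(X)_a = w_{ab} X_b`. -/
def act (c : C3) (w : C2) (X : C1) : C1 := fun a => ∑ b, w a b * raise1 c X b

/-- `(𝖵 w)_k = w_{ij} φ_{ijk}`. -/
def vop (c : C3) (w : C2) : C1 := fun k => ∑ i, ∑ j, raise2 c w i j * c i j k

/-- `(X ⌟ φ)_{jk} = X_l φ_{ljk}`. -/
def hookPhi (c : C3) (X : C1) : C2 := fun j k => ∑ l, raise1 c X l * c l j k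

/-- `(X ⌟ ψ)_{ijk} = X_l ψ_{lijk}`. -/
def hookPsi (c : C3) (X : C1) : C3 := fun i j k => ∑ l, raise1 c X l * psi c l i j k

/-- `(h ⋄ φ)_{ijk} = h_{ip} φ_{pjk} + h_{jp} φ_{ipk} + h_{kp} φ_{ijp}`. -/
def diamond (c : C3) (h : C2) : C3 := fun i j k =>
  ∑ p, ∑ q, cometric c p q * (h i p * c q j k + h j p * c i q k + h k p * c i j q)

/-! ### Tensor calculus in a coordinate chart

`f` denotes the field of components of a 3-form `φ` in a chart, a function of the coordinates. -/

/-- The partial derivative `∂_i u`. -/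
def pd (i : Fin 7) (u : E7 → ℝ) (y : E7) : ℝ := fderiv ℝ u y (EuclideanSpace.single i 1)

/-- The Christoffel symbols `Γ^k_{ij}` of the Levi-Civita connection of `g`
(argument order `k i j`). -/
def christoffel (f : E7 → C3) (y : E7) : C3 := fun k i j =>
  (1 / 2) * ∑ l, cometric (f y) k l *
    (pd i (fun z => metric (f z) j l) y + pd j (fun z => metric (f z) i l) y
      - pd l (fun z => metric (f z) i j) y)

/-- `∇_i X_j`. -/
def cov1 (f : E7 → C3) (X : E7 → C1) (y : E7) : C2 := fun i j =>
  pd i (fun z => X z j) y - ∑ a, christoffel f y a i j * X y a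

/-- `∇_i w_{jk}`. -/
def cov2 (f : E7 → C3) (w : E7 → C2) (y : E7) : C3 := fun i j k =>
  pd i (fun z => w z j k) y
    - ∑ a, (christoffel f y a i j * w y a k + christoffel f y a i k * w y j a)

/-- `∇_i w_{jkl}`. -/
def cov3 (f : E7 → C3) (w : E7 → C3) (y : E7) : C4 := fun i j k l =>
  pd i (fun z => w z j k l) y
    - ∑ a, (christoffel f y a i j * w y a k l + christoffel f y a i k * w y j a l
        + christoffel f y a i l * w y j k a)

/-- The curvature `R_{ijk}^l`, where `R(∂_i, ∂_j) ∂_k = R_{ijk}^l ∂_l`. -/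
def riemann (f : E7 → C3) (y : E7) : C4 := fun i j k l =>
  pd i (fun z => christoffel f z l j k) y - pd j (fun z => christoffel f z l i k) y
    + ∑ p, (christoffel f y l i p * christoffel f y p j k
        - christoffel f y l j p * christoffel f y p i k)

/-- `Ric_{jk} = R_{ijk}^i`. -/
def ricci (f : E7 → C3) (y : E7) : C2 := fun j k => ∑ i, riemann f y i j k i

def scal (f : E7 → C3) (y : E7) : ℝ := tr (f y) (ricci f y)

/-- `(div X) = ∇_a X_a`. -/
def div1 (f : E7 → C3) (X : E7 → C1) (y : E7) : ℝ := tr (f y) (cov1 f X y)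

/-- `(div w)_b = ∇_a w_{ab}`. -/
def div2 (f : E7 → C3) (w : E7 → C2) (y : E7) : C1 := fun k =>
  ∑ a, ∑ b, cometric (f y) a b * cov2 f w y a b k

/-- `(L_V g)_{ij}` for the vector field `V = V^k ∂_k`. -/
def lieMetric (f : E7 → C3) (V : E7 → C1) (y : E7) : C2 := fun i j =>
  ∑ k, (V y k * pd k (fun z => metric (f z) i j) y
    + metric (f y) k j * pd i (fun z => V z k) y + metric (f y) i k * pd j (fun z => V z k) y)

/-- The torsion, `∇_p φ_{ijk} = T_{pq} ψ_{qijk}`; since `ψ_{aijk} ψ_{bijk} = 24 g_{ab}`, this is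
`T_{pq} = (1 / 24) ∇_p φ_{ijk} ψ_{qijk}`. -/
def torsion (f : E7 → C3) (y : E7) : C2 := fun p q =>
  (1 / 24) * ∑ i, ∑ j, ∑ k, raise3 (f y) (cov3 f f y p) i j k * psi (f y) q i j k

/-- `tr T`. -/
def trT (f : E7 → C3) (y : E7) : ℝ := tr (f y) (torsion f y)

/-- `𝖵 T`. -/
def vT (f : E7 → C3) (y : E7) : C1 := vop (f y) (torsion f y)

/-- `𝖥 = (1/6) Scal - (1/3) |T|² - (1/6) (tr T)²`. -/
def lagr (f : E7 → C3) (y : E7) : ℝ :=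
  (1 / 6) * scal f y - (1 / 3) * ip2 (f y) (torsion f y) (torsion f y) - (1 / 6) * trT f y ^ 2

/-- `P̂₁ = -Ric - (1/3) L_{𝖵T} g - (2/3) (T ∘ (𝖵T ⌟ φ))_sym + tr T T_sym`. -/
def locP1hat (f : E7 → C3) (y : E7) : C2 := fun i j =>
  -ricci f y i j - (1 / 3) * lieMetric f (fun z => raise1 (f z) (vT f z)) y i j
    - (2 / 3) * sym (comp (f y) (torsion f y) (hookPhi (f y) (vT f y))) i j
    + trT f y * sym (torsion f y) i j

/-- `P₂ = (2/3) div T + (1/3) ∇ tr T + (1/3) tr T 𝖵T`. -/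
def locP2 (f : E7 → C3) (y : E7) : C1 := fun k =>
  (2 / 3) * div2 f (torsion f) y k + (1 / 3) * pd k (trT f) y + (1 / 3) * (trT f y * vT f y k)

/-- `A = -(1/3) ∇ tr h + (1/3) div h - (2/3) 𝖵(h ∘ T) - (2/3) T(X) - (1/3) tr T X`. -/
def locA (f : E7 → C3) (h : E7 → C2) (X : E7 → C1) (y : E7) : C1 := fun a =>
  -(1 / 3) * pd a (fun z => tr (f z) (h z)) y + (1 / 3) * div2 f h y a
    - (2 / 3) * vop (f y) (comp (f y) (h y) (torsion f y)) a
    - (2 / 3) * act (f y) (torsion f y) (X y) a - (1 / 3) * (trT f y * X y a)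

/-! ### Tensor fields on a 7-manifold -/

section Manifold

variable {M : Type*} [TopologicalSpace M] [ChartedSpace E7 M]

/-- The tangent space at `p`. -/
abbrev Tan (p : M) : Type := TangentSpace 𝓘(ℝ, E7) p

variable (M) in
/-- (Not necessarily smooth) 3-forms on `M`. -/
abbrev ThreeForm : Type _ := (p : M) → Tan p [⋀^Fin 3]→L[ℝ] ℝ

variable (M) in
/-- (Not necessarily smooth) covariant 2-tensor fields on `M`. -/
abbrev TwoTensor : Type _ := (p : M) → Tan p →L[ℝ] Tan p →L[ℝ] ℝ

variable (M) in
/-- (Not necessarily smooth) 1-forms on `M`. -/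
abbrev OneForm : Type _ := (p : M) → Tan p →L[ℝ] ℝ

/-- The coordinate vector `∂_i` of the chart `e` at the point with coordinates `y`. -/
def frame (e : OpenPartialHomeomorph M E7) (y : E7) (i : Fin 7) : Tan (e.symm y) :=
  mfderiv 𝓘(ℝ, E7) 𝓘(ℝ, E7) e.symm y (EuclideanSpace.single i (1 : ℝ) : E7)

/-- The components of tensor fields in the chart `e`. -/
def comps1 (e : OpenPartialHomeomorph M E7) (X : OneForm M) : E7 → C1 :=
  fun y i => X (e.symm y) (frame e y i)

def comps2 (e : OpenPartialHomeomorph M E7) (w : TwoTensor M) : E7 → C2 :=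
  fun y i j => w (e.symm y) (frame e y i) (frame e y j)

def comps3 (e : OpenPartialHomeomorph M E7) (φ : ThreeForm M) : E7 → C3 :=
  fun y i j k => φ (e.symm y) ![frame e y i, frame e y j, frame e y k]

/-- The coordinate differential `dx^i` at `p` of the preferred chart at `p`. -/
def dx (p : M) (i : Fin 7) : Tan p →L[ℝ] ℝ :=
  (EuclideanSpace.proj i : E7 →L[ℝ] ℝ) ∘L
    (mfderiv 𝓘(ℝ, E7) 𝓘(ℝ, E7) (chartAt E7 p) p : Tan p →L[ℝ] E7)

/-- The coordinate vector `∂_i` at `p` of the preferred chart at `p`. -/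
def vec (p : M) (i : Fin 7) : Tan p :=
  mfderiv 𝓘(ℝ, E7) 𝓘(ℝ, E7) (chartAt E7 p).symm (chartAt E7 p p)
    (EuclideanSpace.single i (1 : ℝ) : E7)

/-- The tensors at `p` with given components. All the tensors below are given by expressions that
are covariant under coordinate changes, so that they may be computed in the preferred chart. -/
def form1Of (p : M) (X : C1) : Tan p →L[ℝ] ℝ := ∑ i, X i • dx p i

def tensor2Of (p : M) (w : C2) : Tan p →L[ℝ] Tan p →L[ℝ] ℝ :=
  ∑ i, ∑ j, w i j • (dx p i).smulRight (dx p j)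

/-- `dx^i ∧ dx^j ∧ dx^k` at `p`. -/
def dx3 (p : M) (i j k : Fin 7) : Tan p [⋀^Fin 3]→L[ℝ] ℝ :=
  ContinuousMultilinearMap.alternatization
    ((ContinuousMultilinearMap.mkPiAlgebra ℝ (Fin 3) ℝ).compContinuousLinearMap
      ![dx p i, dx p j, dx p k])

/-- `(1/6) α_{ijk} dx^i ∧ dx^j ∧ dx^k`. -/
def form3Of (p : M) (α : C3) : Tan p [⋀^Fin 3]→L[ℝ] ℝ :=
  (1 / 6 : ℝ) • ∑ i, ∑ j, ∑ k, α i j k • dx3 p i j k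

/-- The components at `p` with respect to the preferred chart at `p`. -/
def at1 (p : M) (X : Tan p →L[ℝ] ℝ) : C1 := fun i => X (vec p i)

def at2 (p : M) (w : Tan p →L[ℝ] Tan p →L[ℝ] ℝ) : C2 := fun i j => w (vec p i) (vec p j)

def at3 (p : M) (α : Tan p [⋀^Fin 3]→L[ℝ] ℝ) : C3 := fun i j k => α ![vec p i, vec p j, vec p k]

/-- `φ` is smooth. -/
def IsSmooth3 (φ : ThreeForm M) : Prop :=
  ∀ e ∈ atlas E7 M, ∀ i j k, ContDiffOn ℝ ∞ (fun y => comps3 e φ y i j k) e.target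

/-- `φ` is a (smooth) `G₂`-structure on `M`. -/
def IsG2Structure (φ : ThreeForm M) : Prop := IsSmooth3 φ ∧ ∀ p, IsG2At (at3 p (φ p))

/-- `(φ_t)`, `|t| < ε`, is a smooth 1-parameter family of `G₂`-structures on `M`. -/
def IsG2Family (ε : ℝ) (φ : ℝ → ThreeForm M) : Prop :=
  0 < ε ∧
  (∀ e ∈ atlas E7 M, ∀ i j k,
    ContDiffOn ℝ ∞ (fun q : ℝ × E7 => comps3 e (φ q.1) q.2 i j k) (Ioo (-ε) ε ×ˢ e.target)) ∧
  ∀ t ∈ Ioo (-ε) ε, ∀ p, IsG2At (at3 p (φ t p))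

/-- The metric `g_φ` at `p`. -/
def metricAt (φ : ThreeForm M) (p : M) : Tan p →L[ℝ] Tan p →L[ℝ] ℝ :=
  tensor2Of p (metric (at3 p (φ p)))

/-- `h ⋄ φ` at `p`. -/
def diamondAt (φ : ThreeForm M) (p : M) (h : Tan p →L[ℝ] Tan p →L[ℝ] ℝ) :
    Tan p [⋀^Fin 3]→L[ℝ] ℝ :=
  form3Of p (diamond (at3 p (φ p)) (at2 p h))

/-- `X ⌟ ψ` at `p`, for `ψ = *φ`. -/
def hookPsiAt (φ : ThreeForm M) (p : M) (X : Tan p →L[ℝ] ℝ) : Tan p [⋀^Fin 3]→L[ℝ] ℝ :=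
  form3Of p (hookPsi (at3 p (φ p)) (at1 p X))

/-- `⟨h, w⟩` at `p`, with respect to `g_φ`. -/
def innerAt2 (φ : ThreeForm M) (p : M) (h w : Tan p →L[ℝ] Tan p →L[ℝ] ℝ) : ℝ :=
  ip2 (at3 p (φ p)) (at2 p h) (at2 p w)

/-- `⟨X, Y⟩` at `p`, with respect to `g_φ`. -/
def innerAt1 (φ : ThreeForm M) (p : M) (X Y : Tan p →L[ℝ] ℝ) : ℝ :=
  ip1 (at3 p (φ p)) (at1 p X) (at1 p Y)

/-- `𝖥(φ) = (1/6) Scal - (1/3) |T|² - (1/6) (tr T)²`, as a function on `M`. -/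
def lagrangian (φ : ThreeForm M) (p : M) : ℝ :=
  lagr (comps3 (chartAt E7 p) φ) (chartAt E7 p p)

/-- `P̂₁(φ)`. -/
def P1hat (φ : ThreeForm M) : TwoTensor M := fun p =>
  tensor2Of p (locP1hat (comps3 (chartAt E7 p) φ) (chartAt E7 p p))

/-- `P₁(φ) = P̂₁(φ) + 𝖥(φ) g`. -/
def P1 (φ : ThreeForm M) : TwoTensor M := fun p =>
  P1hat φ p + lagrangian φ p • metricAt φ p

/-- `P₂(φ)`. -/
def P2 (φ : ThreeForm M) : OneForm M := fun p =>
  form1Of p (locP2 (comps3 (chartAt E7 p) φ) (chartAt E7 p p))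

/-- `div A`, where `A` depends on `φ`, `h` and `X`. -/
def divA (φ : ThreeForm M) (h : TwoTensor M) (X : OneForm M) (p : M) : ℝ :=
  div1 (comps3 (chartAt E7 p) φ)
    (locA (comps3 (chartAt E7 p) φ) (comps2 (chartAt E7 p) h) (comps1 (chartAt E7 p) X))
    (chartAt E7 p p)

/-- `h` is a symmetric 2-tensor, and `∂φ_t/∂t = h ⋄ φ + X ⌟ ψ` at `t = 0`, where `φ = φ_0`. -/
def HasVariation (φ : ℝ → ThreeForm M) (h : TwoTensor M) (X : OneForm M) : Prop :=
  (∀ p u v, h p u v = h p v u) ∧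
  ∀ p v, HasDerivAt (fun t => φ t p v) ((diamondAt (φ 0) p (h p) + hookPsiAt (φ 0) p (X p)) v) 0

/-- The pair `(h, X)` in the decomposition `α = h ⋄ φ + X ⌟ ψ` at `p`, with `h` symmetric; it is
unique if `φ` is a `G₂`-structure. -/
def decomp (φ : ThreeForm M) (p : M) (α : Tan p [⋀^Fin 3]→L[ℝ] ℝ) :
    (Tan p →L[ℝ] Tan p →L[ℝ] ℝ) × (Tan p →L[ℝ] ℝ) :=
  Classical.epsilon fun q => (∀ u v, q.1 u v = q.1 v u) ∧ α = diamondAt φ p q.1 + hookPsiAt φ p q.2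

variable [MeasurableSpace M]

/-- The Riemannian volume measure `dμ_g` on `M`: over the domain of a chart, it is
`√(det g) dx = |m| dx`, and it is the least measure that dominates these. -/
def volMeasure (φ : ThreeForm M) : Measure M :=
  ⨆ e ∈ atlas E7 M, Measure.map e.symm
    ((volume.restrict e.target).withDensity fun y => ENNReal.ofReal |volCoeff (comps3 e φ y)|)

/-- The `G₂`-Hilbert functional `𝓕(φ) = ∫_M 𝖥(φ) dμ`. -/
def hilbertFunctional (φ : ThreeForm M) : ℝ := ∫ p, lagrangian φ p ∂volMeasure φ

/-- `⟨α, β⟩_{L²} = ∫_M ⟨h, w⟩ + ⟨X, Y⟩ dμ`, where `α = h ⋄ φ + X ⌟ ψ`, `β = w ⋄ φ + Y ⌟ ψ`. -/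
def innerL2 (φ α β : ThreeForm M) : ℝ :=
  ∫ p, (innerAt2 φ p (decomp φ p (α p)).1 (decomp φ p (β p)).1
    + innerAt1 φ p (decomp φ p (α p)).2 (decomp φ p (β p)).2) ∂volMeasure φ

/-- The smooth 3-form `η` is the gradient of `𝓖` at `φ` with respect to `⟨·, ·⟩_{L²}`: for every
smooth family of `G₂`-structures through `φ`, with velocity `β` at `t = 0`, the derivative of
`𝓖` along the family is `⟨η, β⟩_{L²}`. -/
def IsGradientL2 (𝓖 : ThreeForm M → ℝ) (φ η : ThreeForm M) : Prop :=
  IsSmooth3 η ∧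
  ∀ (ε : ℝ) (φt : ℝ → ThreeForm M) (β : ThreeForm M), IsG2Family ε φt → φt 0 = φ →
    (∀ p v, HasDerivAt (fun t => φt t p v) (β p v) 0) →
    HasDerivAt (fun t => 𝓖 (φt t)) (innerL2 φ η β) 0

end Manifold

end G2Hilbert

end

open G2Hilbert

open Set MeasureTheory
open scoped Manifold ContDiff ENNReal

noncomputable section

namespace G2Hilbert

/-! ### Change of basis -/

/-! The pointwise formula is a computation at one point, and two reductions make it tractable. Both
rest on naturality under changes of basis and of coordinates.

The first reduction is algebraic: a 3-form `φ` with `B(v, v) ≠ 0` for all `v ≠ 0` is a pullback of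
the model form `phi0` (`IsG2At.isModel`), so an identity between natural operations needs to be
checked only at `phi0`, where it is a finite computation. To obtain the normal form, note that the
infinitesimal action of 7 × 7 matrices on `phi0` is onto the 3-forms (`exists_inf3_phi0`), so the
orbit of `phi0` contains all 3-forms near it. On the orbit, the symmetrized contraction `φ_{ijk}
φ_{abk}` is the expected expression in the metric. Cubed and cleared of denominators this is a
polynomial identity in `φ`, so it continues analytically to all 3-forms (`IsAlt3.symContr_pow`). For
a non-degenerate form it says that `φ` defines a cross product for a definite metric, and three
suitable orthonormal vectors then generate an adapted basis, as for the octonions.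

The second reduction is geometric: all operators in the formula are covariant (the lemmas
`CoordChange.*_pf`), so coordinates may be chosen in which `φ = phi0` and all Christoffel symbols
vanish at the given point (`SmoothField.exists_normal`). There the first derivative of `φ` does not
change the metric, hence has the form `T ⌟ ψ`. Velocities of `φ` are of the form `inf3 H φ`, so
natural operations can be differentiated along the explicit curves `pull3 (1 + s H) φ`
(`hasDerivAt_natural`). This yields the first variations of the scalar curvature, of `|T|²` and of
`tr T`.

Comparing with the asserted formula, the divergence terms and the terms in `X` match directly; what
remains is the pairing of the symmetric tensor `h` with the tensor `NormalField.defect`. That tensor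
is skew (`NormalField.defect_skew`). The reason is the `G₂`-Bianchi identity, obtained by commuting
second derivatives of `φ`, which expresses the Ricci curvature through the torsion and its first
derivatives.

For the integrated statement, `dμ` has derivative `tr h dμ` and `tr h = ⟨h, g⟩`, which turns `P̂₁`
into `P₁`. The volume measure restricts on each chart to its coordinate density
(`volMeasure_restrict`), a partition of unity localizes the integrals, differentiation under the
integral sign applies on compact sets, and `div A` integrates to zero. The gradient statement
follows from existence and uniqueness of the decomposition `h ⋄ φ + X ⌟ ψ`, since `P₁` is symmetric.
-/

abbrev Mat : Type := Matrix (Fin 7) (Fin 7) ℝ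

section Basis

variable {V W : Type*} [AddCommGroup V] [Module ℝ V] [AddCommGroup W] [Module ℝ W]

/-- The action of a matrix on the first index of a family of vectors. -/
def mv (A : Mat) : (Fin 7 → V) →ₗ[ℝ] (Fin 7 → V) where
  toFun X := fun i => ∑ a, A i a • X a
  map_add' X Y := by ext i; simp [Finset.sum_add_distrib]
  map_smul' r X := by
    ext i
    simp only [Pi.smul_apply, RingHom.id_apply, Finset.smul_sum]
    exact Finset.sum_congr rfl fun a _ => smul_comm _ _ _

theorem mv_apply (A : Mat) (X : Fin 7 → V) (i : Fin 7) : mv A X i = ∑ a, A i a • X a := rfl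

theorem mv_mv (A B : Mat) (X : Fin 7 → V) : mv A (mv B X) = mv (A * B) X := by
  ext i
  simp only [mv_apply, Matrix.mul_apply, Finset.smul_sum, Finset.sum_smul, mul_smul]
  exact Finset.sum_comm

theorem mv_one (X : Fin 7 → V) : mv 1 X = X := by
  ext i
  simp [mv_apply, Matrix.one_apply]

theorem compLeft_mv (L : V →ₗ[ℝ] W) (B : Mat) (Y : Fin 7 → V) :
    L.compLeft (Fin 7) (mv B Y) = mv B (L.compLeft (Fin 7) Y) := by
  ext i
  simp [mv_apply, map_sum]

/-- Covariant indices are pulled back by `A.transpose` and contravariant ones pushed forward by `A`;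
a matrix crosses a contraction by transposition, which is why full contractions are invariant. -/
theorem mv_dual (A : Mat) (X : Fin 7 → ℝ) (Y : Fin 7 → V) :
    ∑ i, X i • mv A.transpose Y i = ∑ a, mv A X a • Y a := by
  simp only [mv_apply, Finset.smul_sum, Finset.sum_smul, Matrix.transpose_apply, smul_eq_mul]
  rw [Finset.sum_comm]
  refine Finset.sum_congr rfl fun a _ => Finset.sum_congr rfl fun i _ => ?_
  rw [smul_smul, mul_comm]

end Basis

/-- Nesting `mv` index by index makes linearity automatic and reduces multiplicativity to `mv_mv`.
The expanded sums are needed only where indices have to be matched. -/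
def tens2 (A : Mat) : C2 →ₗ[ℝ] C2 := mv A ∘ₗ (mv A).compLeft (Fin 7)

def tens3 (A : Mat) : C3 →ₗ[ℝ] C3 := mv A ∘ₗ (tens2 A).compLeft (Fin 7)

def tens4 (A : Mat) : C4 →ₗ[ℝ] C4 := mv A ∘ₗ (tens3 A).compLeft (Fin 7)

theorem mv_apply_real (A : Mat) (X : C1) (i : Fin 7) : mv A X i = ∑ a, A i a * X a := rfl

theorem tens2_apply (A : Mat) (w : C2) (i j : Fin 7) :
    tens2 A w i j = ∑ a, ∑ b, A i a * A j b * w a b := by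
  simp [tens2, mv_apply, Finset.mul_sum, mul_assoc]

theorem tens3_apply (A : Mat) (w : C3) (i j k : Fin 7) :
    tens3 A w i j k = ∑ a, ∑ b, ∑ d, A i a * A j b * A k d * w a b d := by
  simp [tens3, mv_apply, tens2_apply, Finset.mul_sum, mul_assoc]

theorem tens4_apply (A : Mat) (w : C4) (i j k l : Fin 7) :
    tens4 A w i j k l = ∑ a, ∑ b, ∑ d, ∑ e, A i a * A j b * A k d * A l e * w a b d e := by
  simp [tens4, mv_apply, tens3_apply, Finset.mul_sum, mul_assoc]

theorem tens2_mul (A B : Mat) (w : C2) : tens2 A (tens2 B w) = tens2 (A * B) w := by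
  simp only [tens2, LinearMap.comp_apply, compLeft_mv, mv_mv]
  congr 1
  ext a : 1
  simp [mv_mv]

theorem tens3_mul (A B : Mat) (w : C3) : tens3 A (tens3 B w) = tens3 (A * B) w := by
  simp only [tens3, LinearMap.comp_apply, compLeft_mv, mv_mv]
  congr 1
  ext a : 1
  simp [tens2_mul]

theorem tens4_mul (A B : Mat) (w : C4) : tens4 A (tens4 B w) = tens4 (A * B) w := by
  simp only [tens4, LinearMap.comp_apply, compLeft_mv, mv_mv]
  congr 1
  ext a : 1
  simp [tens3_mul]

theorem tens2_one (w : C2) : tens2 1 w = w := by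
  simp only [tens2, LinearMap.comp_apply, mv_one]
  ext a : 1
  simp [mv_one]

theorem tens3_one (w : C3) : tens3 1 w = w := by
  simp only [tens3, LinearMap.comp_apply, mv_one]
  ext a : 1
  simp [tens2_one]

theorem tens4_one (w : C4) : tens4 1 w = w := by
  simp only [tens4, LinearMap.comp_apply, mv_one]
  ext a : 1
  simp [tens3_one]

/-! ### Sums over several indices -/

theorem sum_fin_succ {n : ℕ} (F : (Fin (n + 1) → Fin 7) → ℝ) :
    ∑ s, F s = ∑ i, ∑ s : Fin n → Fin 7, F (Fin.cons i s) := by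
  rw [← Fintype.sum_prod_type']
  exact (Fintype.sum_equiv (Fin.consEquiv fun _ => Fin 7) _ _ fun x => rfl).symm

theorem sum_fun3 (F : (Fin 3 → Fin 7) → ℝ) :
    ∑ s, F s = ∑ i, ∑ j, ∑ k, F ![i, j, k] := by
  simp only [sum_fin_succ, Fintype.sum_unique]
  rfl

theorem sum_fun7 (F : (Fin 7 → Fin 7) → ℝ) :
    ∑ s, F s = ∑ a, ∑ b, ∑ c, ∑ d, ∑ e, ∑ f, ∑ g, F ![a, b, c, d, e, f, g] := by
  simp only [sum_fin_succ, Fintype.sum_unique]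
  rfl

theorem sum_fun7_prod (F : (Fin 7 → Fin 7) → ℝ) :
    ∑ s, F s = ∑ x : Fin 7 × Fin 7 × Fin 7, ∑ y : Fin 7 × Fin 7 × Fin 7 × Fin 7,
      F ![x.1, x.2.1, x.2.2, y.1, y.2.1, y.2.2.1, y.2.2.2] := by
  rw [sum_fun7]
  simp only [Fintype.sum_prod_type]

/-! ### The permutation symbol -/

theorem permSymbol_comp (A : Mat) (s : Fin 7 → Fin 7) :
    (Matrix.of fun r q => A (s r) q).det = permSymbol s * A.det := by
  rw [permSymbol, ← Matrix.det_mul]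
  congr 1
  ext r q
  simp [Matrix.mul_apply]

/-- Multilinear expansion of the rows in the standard basis. The sum may run over all maps, because
the remaining 0-1 determinant vanishes unless `u` is a permutation. -/
theorem det_eq_sum_fun {n : Type*} [Fintype n] [DecidableEq n] (M : Matrix n n ℝ) :
    M.det = ∑ u : n → n, (∏ k, M k (u k)) *
      (Matrix.of fun r q : n => if u r = q then (1 : ℝ) else 0).det := by
  have h : M = fun r => ∑ q, M r q • (fun q' => if q = q' then (1 : ℝ) else 0) := by
    ext r q
    simp
  have := (Matrix.detRowAlternating (R := ℝ) (n := n)).toMultilinearMap.map_sum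
    (fun r q => M r q • (fun q' => if q = q' then (1 : ℝ) else 0))
  simp only [AlternatingMap.coe_multilinearMap] at this
  rw [← h] at this
  refine this.trans (Finset.sum_congr rfl fun u _ => ?_)
  rw [AlternatingMap.map_smul_univ, smul_eq_mul]
  rfl

/-- The permutation symbol is an invariant tensor up to `det A`. This is where the factor `det A` in
the law for `B` comes from, and the one that matches the volume coefficient in the law for `ψ`. -/
theorem sum_permSymbol_mul (A : Mat) (s : Fin 7 → Fin 7) :
    ∑ u, permSymbol u * ∏ k, A (s k) (u k) = permSymbol s * A.det := by
  rw [← permSymbol_comp, det_eq_sum_fun]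
  exact Finset.sum_congr rfl fun u _ => mul_comm _ _

theorem sum_fin7_mul (A : Mat) (u v : C2) (w : C3) (s : Fin 7 → Fin 7) :
    tens2 A u (s 0) (s 1) * tens2 A v (s 2) (s 3) * tens3 A w (s 4) (s 5) (s 6) =
      ∑ a : Fin 7 → Fin 7, (∏ k, A (s k) (a k)) *
        (u (a 0) (a 1) * v (a 2) (a 3) * w (a 4) (a 5) (a 6)) := by
  rw [sum_fun7]
  have h : ∀ a b c d e f g : Fin 7, (∏ k, A (s k) (![a, b, c, d, e, f, g] k)) *
      (u a b * v c d * w e f g) = (A (s 0) a * A (s 1) b * u a b) *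
        ((A (s 2) c * A (s 3) d * v c d) * (A (s 4) e * A (s 5) f * A (s 6) g * w e f g)) := by
    intro a b c d e f g
    rw [Fin.prod_univ_seven]
    change A (s 0) a * A (s 1) b * A (s 2) c * A (s 3) d * A (s 4) e * A (s 5) f * A (s 6) g * _ = _
    ring
  change _ = ∑ a, ∑ b, ∑ c, ∑ d, ∑ e, ∑ f, ∑ g,
    (∏ k, A (s k) (![a, b, c, d, e, f, g] k)) * (u a b * v c d * w e f g)
  simp only [h]
  simp only [← Finset.mul_sum, ← Finset.sum_mul, tens2_apply, tens3_apply]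
  rw [mul_assoc]

/-- The pullback of a 3-form by a linear map. -/
abbrev pull3 (A : Mat) : C3 →ₗ[ℝ] C3 := tens3 A.transpose

/-- `B` is a quadratic form with values in 7-forms: the seven indices contracted with the
permutation symbol produce `det A`, and the two free indices transform as those of a covariant
2-tensor. -/
theorem bForm_pull (A : Mat) (c : C3) :
    bForm (pull3 A c) = A.det • tens2 A.transpose (bForm c) := by
  ext i j
  have h : ∀ s : Fin 7 → Fin 7, pull3 A c i (s 0) (s 1) * pull3 A c j (s 2) (s 3) *
      pull3 A c (s 4) (s 5) (s 6) = ∑ p, ∑ q, A p i * A q j *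
        ∑ a : Fin 7 → Fin 7, (∏ k, A (a k) (s k)) *
          (c p (a 0) (a 1) * c q (a 2) (a 3) * c (a 4) (a 5) (a 6)) := by
    intro s
    have := fun p q => sum_fin7_mul A.transpose (c p) (c q) c s
    simp only [Matrix.transpose_apply] at this
    simp only [← this]
    have e : ∀ i, pull3 A c i = ∑ p, A p i • tens2 A.transpose (c p) := fun i => rfl
    rw [e i, e j]
    simp only [Finset.sum_apply, Pi.smul_apply, smul_eq_mul, Finset.sum_mul, Finset.mul_sum]
    rw [Finset.sum_comm]
    refine Finset.sum_congr rfl fun p _ => Finset.sum_congr rfl fun q _ => ?_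
    ring
  simp only [bForm, h, Pi.smul_apply, smul_eq_mul, tens2_apply, Matrix.transpose_apply]
  have h2 : ∀ a : Fin 7 → Fin 7, ∑ s, permSymbol s * ∏ k, A (a k) (s k) = permSymbol a * A.det :=
    sum_permSymbol_mul A
  simp only [Finset.mul_sum]
  rw [Finset.sum_comm]
  refine Finset.sum_congr rfl fun p _ => ?_
  rw [Finset.sum_comm]
  refine Finset.sum_congr rfl fun q _ => ?_
  rw [Finset.sum_comm]
  refine Finset.sum_congr rfl fun a _ => ?_
  have e : ∀ s : Fin 7 → Fin 7, 1 / 24 * (permSymbol s * (A p i * A q j *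
      ((∏ k, A (a k) (s k)) * (c p (a 0) (a 1) * c q (a 2) (a 3) * c (a 4) (a 5) (a 6))))) =
      (permSymbol s * ∏ k, A (a k) (s k)) * (1 / 24 * A p i * A q j *
        (c p (a 0) (a 1) * c q (a 2) (a 3) * c (a 4) (a 5) (a 6))) := fun s => by ring
  simp only [e, ← Finset.sum_mul, h2]
  ring

/-! ### Covariance of the metric -/

/-- The real number `m` with `m ^ 9 = x`. -/
def ninthRoot (x : ℝ) : ℝ := (SignType.sign x : ℝ) * |x| ^ ((1 : ℝ) / 9)

theorem ninthRoot_pow (x : ℝ) : ninthRoot (x ^ 9) = x := by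
  have h : |x ^ 9| ^ ((1 : ℝ) / 9) = |x| := by
    rw [abs_pow, ← Real.rpow_natCast, ← Real.rpow_mul (abs_nonneg x)]
    norm_num
  rw [ninthRoot, h]
  rcases lt_trichotomy x 0 with hx | rfl | hx
  · rw [sign_neg (Odd.pow_neg (by decide) hx), abs_of_neg hx]
    simp
  · simp
  · rw [sign_pos (pow_pos hx 9), abs_of_pos hx]
    simp

theorem pow_ninthRoot (x : ℝ) : ninthRoot x ^ 9 = x := by
  have h : (|x| ^ ((1 : ℝ) / 9)) ^ 9 = |x| := by
    rw [← Real.rpow_natCast, ← Real.rpow_mul (abs_nonneg x)]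
    norm_num
  rw [ninthRoot, mul_pow, h]
  rcases lt_trichotomy x 0 with hx | rfl | hx
  · rw [sign_neg hx, abs_of_neg hx]
    norm_num
  · simp
  · rw [sign_pos hx, abs_of_pos hx]
    norm_num

theorem ninthRoot_mul (x y : ℝ) : ninthRoot (x ^ 9 * y) = x * ninthRoot y := by
  conv_lhs => rw [← pow_ninthRoot y, ← mul_pow, ninthRoot_pow]

/-- `B = -6 b`. -/
def bMat (c : C3) : Mat := Matrix.of fun i j => -bForm c i j / 6

theorem volCoeff_eq (c : C3) : volCoeff c = ninthRoot (bMat c).det := rfl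

theorem of_tens2 (A : Mat) (w : C2) :
    (Matrix.of (tens2 A w) : Mat) = A * Matrix.of w * A.transpose := by
  ext i j
  simp only [Matrix.of_apply, tens2_apply, Matrix.mul_apply, Matrix.transpose_apply,
    Finset.sum_mul]
  rw [Finset.sum_comm]
  exact Finset.sum_congr rfl fun a _ => Finset.sum_congr rfl fun b _ => by ring

theorem bMat_eq (c : C3) : bMat c = (-1 / 6 : ℝ) • Matrix.of (bForm c) := by
  ext i j
  simp [bMat]
  ring

theorem bMat_pull (A : Mat) (c : C3) :
    bMat (pull3 A c) = A.det • (A.transpose * bMat c * A) := by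
  have h : (Matrix.of (A.det • tens2 A.transpose (bForm c)) : Mat) =
      A.det • Matrix.of (tens2 A.transpose (bForm c)) := rfl
  rw [bMat_eq, bMat_eq, bForm_pull, h, of_tens2, Matrix.transpose_transpose,
    smul_comm, Matrix.mul_smul, Matrix.smul_mul]

/-- The matrix `b = -B / 6` becomes `det A • Aᵗ b A`, so its determinant picks up `(det A)⁷ (det A)²
= (det A)⁹`, and the real ninth root turns this into `det A` with its sign. -/
theorem volCoeff_pull (A : Mat) (c : C3) : volCoeff (pull3 A c) = A.det * volCoeff c := by
  rw [volCoeff_eq, volCoeff_eq, bMat_pull, Matrix.det_smul, Matrix.det_mul, Matrix.det_mul,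
    Matrix.det_transpose, ← ninthRoot_mul]
  congr 1
  simp
  ring

theorem of_metric (c : C3) : (Matrix.of (metric c) : Mat) = (volCoeff c)⁻¹ • bMat c := by
  ext i j
  simp [metric, bMat]
  ring

/-- The factor `det A` of `b` cancels against that of the volume coefficient. This is the point at
which `A` has to be invertible. -/
theorem of_metric_pull {A : Mat} (hA : A.det ≠ 0) (c : C3) :
    (Matrix.of (metric (pull3 A c)) : Mat) = A.transpose * Matrix.of (metric c) * A := by
  rw [of_metric, of_metric, volCoeff_pull, bMat_pull, smul_smul, Matrix.mul_smul, Matrix.smul_mul]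
  congr 1
  field_simp

theorem metric_pull {A : Mat} (hA : A.det ≠ 0) (c : C3) :
    metric (pull3 A c) = tens2 A.transpose (metric c) := by
  apply Matrix.of.injective
  rw [of_metric_pull hA, of_tens2, Matrix.transpose_transpose]

/-- The matrix `(g^{ij})`. -/
def coMat (c : C3) : Mat := (Matrix.of (metric c))⁻¹

theorem cometric_eq (c : C3) (i j : Fin 7) : cometric c i j = coMat c i j := rfl

/-- Contravariant quantities are compared after being pushed forward, so that `A⁻¹` does not enter
the transformation laws. -/
theorem coMat_pull {A : Mat} (hA : A.det ≠ 0) (c : C3) :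
    A * coMat (pull3 A c) * A.transpose = coMat c := by
  have hu : IsUnit A.det := hA.isUnit
  have hu' : IsUnit A.transpose.det := by rwa [Matrix.det_transpose]
  rw [coMat, coMat, of_metric_pull hA, Matrix.mul_inv_rev, Matrix.mul_inv_rev,
    Matrix.mul_assoc, Matrix.mul_assoc, Matrix.mul_assoc, Matrix.nonsing_inv_mul _ hu',
    Matrix.mul_one, ← Matrix.mul_assoc, Matrix.mul_nonsing_inv _ hu, Matrix.one_mul]

/-! ### Covariance of the operations on tensors -/

theorem raise1_eq (c : C3) (X : C1) : raise1 c X = mv (coMat c) X := rfl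

theorem raise2_eq (c : C3) (w : C2) : raise2 c w = tens2 (coMat c) w := by
  ext i j
  simp [raise2, tens2_apply, cometric_eq]

theorem raise3_eq (c : C3) (w : C3) : raise3 c w = tens3 (coMat c) w := by
  ext i j k
  simp [raise3, tens3_apply, cometric_eq]

theorem push_raise1 {A : Mat} (hA : A.det ≠ 0) (c : C3) (X : C1) : mv A (raise1 (pull3 A c) (mv A.transpose X)) = raise1 c X := by
  rw [raise1_eq, raise1_eq, mv_mv, mv_mv, coMat_pull hA]

theorem push_raise2 {A : Mat} (hA : A.det ≠ 0) (c : C3) (w : C2) :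
    tens2 A (raise2 (pull3 A c) (tens2 A.transpose w)) = raise2 c w := by
  rw [raise2_eq, raise2_eq, tens2_mul, tens2_mul, coMat_pull hA]

theorem push_raise3 {A : Mat} (hA : A.det ≠ 0) (c : C3) (w : C3) :
    tens3 A (raise3 (pull3 A c) (tens3 A.transpose w)) = raise3 c w := by
  rw [raise3_eq, raise3_eq, tens3_mul, tens3_mul, coMat_pull hA]

theorem sum2_eq_prod (F : Fin 7 → Fin 7 → ℝ) :
    ∑ i, ∑ j, F i j = ∑ x : Fin 7 × Fin 7, F x.1 x.2 := (Fintype.sum_prod_type' F).symm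

theorem sum3_eq_prod (F : Fin 7 → Fin 7 → Fin 7 → ℝ) :
    ∑ i, ∑ j, ∑ k, F i j k = ∑ x : Fin 7 × Fin 7 × Fin 7, F x.1 x.2.1 x.2.2 := by
  simp [Fintype.sum_prod_type]

theorem sum4_eq_prod (F : Fin 7 → Fin 7 → Fin 7 → Fin 7 → ℝ) :
    ∑ i, ∑ j, ∑ k, ∑ l, F i j k l =
      ∑ x : Fin 7 × Fin 7 × Fin 7 × Fin 7, F x.1 x.2.1 x.2.2.1 x.2.2.2 := by
  simp [Fintype.sum_prod_type]

theorem dual1 (A : Mat) (V X : C1) :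
    ∑ i, V i * mv A.transpose X i = ∑ i, mv A V i * X i := mv_dual A V X

theorem dual2 (A : Mat) (V w : C2) :
    ∑ i, ∑ j, V i j * tens2 A.transpose w i j = ∑ i, ∑ j, tens2 A V i j * w i j := by
  simp only [sum2_eq_prod, tens2_apply, Finset.mul_sum, Finset.sum_mul, Matrix.transpose_apply]
  rw [Finset.sum_comm]
  exact Finset.sum_congr rfl fun x _ => Finset.sum_congr rfl fun y _ => by ring

theorem dual3 (A : Mat) (V w : C3) :
    ∑ i, ∑ j, ∑ k, V i j k * tens3 A.transpose w i j k =
      ∑ i, ∑ j, ∑ k, tens3 A V i j k * w i j k := by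
  simp only [sum3_eq_prod, tens3_apply, Finset.mul_sum, Finset.sum_mul, Matrix.transpose_apply]
  rw [Finset.sum_comm]
  exact Finset.sum_congr rfl fun x _ => Finset.sum_congr rfl fun y _ => by ring

/-- Seven factors of `A` turn one permutation symbol into `det A` times another. Three of them are
absorbed by the contravariant `raise3` of `φ`, four act on the free indices of `ψ`, and the
determinant is the factor by which the volume coefficient changes. -/
theorem psi_pull {A : Mat} (hA : A.det ≠ 0) (c : C3) :
    psi (pull3 A c) = tens4 A.transpose (psi c) := by
  ext i j k l
  set R := raise3 (pull3 A c) (pull3 A c) with hR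
  have hp : tens3 A R = raise3 c c := push_raise3 hA c c
  have h1 : ∀ p q r s, psi c p q r s = (1 / 6) * volCoeff c * ∑ a, ∑ b, ∑ d, R a b d *
      tens3 A.transpose (fun a b d => permSymbol ![a, b, d, p, q, r, s]) a b d := by
    intro p q r s
    rw [dual3, hp, psi]
    simp only [Finset.mul_sum]
    exact Finset.sum_congr rfl fun a _ => Finset.sum_congr rfl fun b _ =>
      Finset.sum_congr rfl fun d _ => by ring
  have h2 : ∀ a b d, ∑ y : Fin 7 × Fin 7 × Fin 7 × Fin 7,
      A y.1 i * A y.2.1 j * A y.2.2.1 k * A y.2.2.2 l * tens3 A.transpose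
        (fun a b d => permSymbol ![a, b, d, y.1, y.2.1, y.2.2.1, y.2.2.2]) a b d =
      permSymbol ![a, b, d, i, j, k, l] * A.det := by
    intro a b d
    have := sum_permSymbol_mul A.transpose ![a, b, d, i, j, k, l]
    rw [sum_fun7_prod, Matrix.det_transpose] at this
    rw [← this]
    simp only [sum3_eq_prod, tens3_apply, Finset.mul_sum]
    rw [Finset.sum_comm]
    refine Finset.sum_congr rfl fun x _ => Finset.sum_congr rfl fun y _ => ?_
    rw [Fin.prod_univ_seven]
    change _ = _ * (A x.1 a * A x.2.1 b * A x.2.2 d * A y.1 i * A y.2.1 j * A y.2.2.1 k *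
      A y.2.2.2 l)
    simp only [Matrix.transpose_apply]
    ring
  have h3 : psi (pull3 A c) i j k l = (1 / 6) * volCoeff c * ∑ a, ∑ b, ∑ d, R a b d *
      (permSymbol ![a, b, d, i, j, k, l] * A.det) := by
    rw [psi, volCoeff_pull, ← hR]
    simp only [Finset.mul_sum]
    exact Finset.sum_congr rfl fun a _ => Finset.sum_congr rfl fun b _ =>
      Finset.sum_congr rfl fun d _ => by ring
  simp only [h3, ← h2]
  rw [tens4_apply, sum4_eq_prod]
  simp only [h1, Matrix.transpose_apply, sum3_eq_prod, Finset.mul_sum]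
  rw [Finset.sum_comm]
  exact Finset.sum_congr rfl fun x _ => Finset.sum_congr rfl fun y _ => by ring

theorem ip1_pull {A : Mat} (hA : A.det ≠ 0) (c : C3) (X Y : C1) :
    ip1 (pull3 A c) (mv A.transpose X) (mv A.transpose Y) = ip1 c X Y := by
  rw [ip1, dual1, push_raise1 hA, ip1]

theorem ip2_pull {A : Mat} (hA : A.det ≠ 0) (c : C3) (X Y : C2) :
    ip2 (pull3 A c) (tens2 A.transpose X) (tens2 A.transpose Y) = ip2 c X Y := by
  rw [ip2, dual2, push_raise2 hA, ip2]

theorem push_cometric {A : Mat} (hA : A.det ≠ 0) (c : C3) :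
    tens2 A (cometric (pull3 A c)) = cometric c := by
  apply Matrix.of.injective
  rw [of_tens2]
  exact coMat_pull hA c

theorem tr_pull {A : Mat} (hA : A.det ≠ 0) (c : C3) (w : C2) :
    tr (pull3 A c) (tens2 A.transpose w) = tr c w := by
  rw [tr, dual2, push_cometric hA, tr]

theorem comp_eq (c : C3) (v w : C2) :
    (Matrix.of (comp c v w) : Mat) = Matrix.of v * coMat c * Matrix.of w := by
  ext i j
  simp only [comp, cometric_eq, Matrix.mul_apply, Matrix.of_apply, Finset.sum_mul]
  exact Finset.sum_comm

theorem comp_pull {A : Mat} (hA : A.det ≠ 0) (c : C3) (v w : C2) :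
    comp (pull3 A c) (tens2 A.transpose v) (tens2 A.transpose w) =
      tens2 A.transpose (comp c v w) := by
  apply Matrix.of.injective
  rw [comp_eq, of_tens2, of_tens2, of_tens2, comp_eq, ← coMat_pull hA c]
  simp only [Matrix.transpose_transpose, Matrix.mul_assoc]

theorem act_eq (c : C3) (w : C2) (X : C1) :
    act c w X = (Matrix.of w : Mat).mulVec ((coMat c).mulVec X) := rfl

theorem mv_eq_mulVec (A : Mat) (X : C1) : mv A X = A.mulVec X := rfl

theorem act_pull {A : Mat} (hA : A.det ≠ 0) (c : C3) (w : C2) (X : C1) :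
    act (pull3 A c) (tens2 A.transpose w) (mv A.transpose X) =
      mv A.transpose (act c w X) := by
  simp only [act_eq, mv_eq_mulVec, of_tens2, ← coMat_pull hA c, Matrix.mulVec_mulVec,
    Matrix.transpose_transpose, Matrix.mul_assoc]

theorem sym_pull (A : Mat) (w : C2) :
    sym (tens2 A w) = tens2 A (sym w) := by
  ext i j
  simp only [sym, tens2_apply]
  rw [Finset.sum_comm (f := fun a b => A j a * A i b * w a b), ← Finset.sum_add_distrib,
    Finset.sum_div]
  refine Finset.sum_congr rfl fun a _ => ?_
  rw [← Finset.sum_add_distrib, Finset.sum_div]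
  exact Finset.sum_congr rfl fun b _ => by ring

theorem vop_pull {A : Mat} (hA : A.det ≠ 0) (c : C3) (w : C2) :
    vop (pull3 A c) (tens2 A.transpose w) = mv A.transpose (vop c w) := by
  ext k
  set R := raise2 (pull3 A c) (tens2 A.transpose w) with hR
  have h : ∀ i j, pull3 A c i j k = tens2 A.transpose (fun a b => ∑ d, A d k * c a b d) i j := by
    intro i j
    simp only [tens3_apply, tens2_apply, Finset.mul_sum, Matrix.transpose_apply, mul_assoc]
  simp only [vop, ← hR, h]
  rw [dual2, hR, push_raise2 hA, mv_apply_real]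
  simp only [vop, Finset.mul_sum, Matrix.transpose_apply]
  simp only [sum3_eq_prod]
  refine Fintype.sum_equiv ⟨fun x => (x.2.2, x.1, x.2.1), fun x => (x.2.1, x.2.2, x.1),
    fun _ => rfl, fun _ => rfl⟩ _ _ fun x => by simp; ring

theorem hookPhi_eq (c : C3) (X : C1) : hookPhi c X = ∑ l, raise1 c X l • c l := by
  ext j k
  simp [hookPhi]

theorem hookPhi_pull {A : Mat} (hA : A.det ≠ 0) (c : C3) (X : C1) :
    hookPhi (pull3 A c) (mv A.transpose X) = tens2 A.transpose (hookPhi c X) := by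
  rw [hookPhi_eq, hookPhi_eq, map_sum]
  have h : ∀ l, pull3 A c l = mv A.transpose (fun l => tens2 A.transpose (c l)) l := fun l => rfl
  simp only [h, map_smul]
  rw [mv_dual, push_raise1 hA]

theorem hookPsi_eq (c : C3) (X : C1) : hookPsi c X = ∑ l, raise1 c X l • psi c l := by
  ext i j k
  simp [hookPsi]

theorem hookPsi_pull {A : Mat} (hA : A.det ≠ 0) (c : C3) (X : C1) :
    hookPsi (pull3 A c) (mv A.transpose X) = tens3 A.transpose (hookPsi c X) := by
  rw [hookPsi_eq, hookPsi_eq, map_sum, psi_pull hA]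
  have h : ∀ l, tens4 A.transpose (psi c) l =
    mv A.transpose (fun l => tens3 A.transpose (psi c l)) l := fun l => rfl
  simp only [h, map_smul]
  rw [mv_dual, push_raise1 hA]

/-! ### The infinitesimal action -/

/-- The derivative of `pull3 A c` at `A = 1` in the direction `H`. -/
def inf3 (H : Mat) (c : C3) : C3 := fun i j k =>
  ∑ a, (H a i * c a j k + H a j * c i a k + H a k * c i j a)

/-! ### The model form -/

/-- The model `G₂`-form `∑ dx^i ∧ dx^{i+1} ∧ dx^{i+3}`, `i` modulo `7`, as a table of its
components in base `4`, where the digit `2` stands for `-1`. -/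
def phiTable : ℕ := 9577476485123227490256975893556512492422258354423410887897479952318116233048244701222412528462387190604657253701726179150820955789200147441815695304900617619153025947735439002329234810448461912080384

/-- A single numeral makes each component one shift and one remainder, and `mulD` discards its
second factor when the digit is zero. This keeps the evaluation of the identities below over all
index tuples feasible. -/
def phiD (i j k : Fin 7) : ℕ := (phiTable >>> (2 * (49 * i.val + 7 * j.val + k.val))) % 4

/-- Multiplication by the number that a digit stands for. -/
def mulD (d : ℕ) (x : ℤ) : ℤ :=
  match d with
  | 0 => 0
  | 1 => x
  | _ => -x

def phiZ (i j k : Fin 7) : ℤ := mulD (phiD i j k) 1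

theorem mulD_eq (d : ℕ) (x : ℤ) : mulD d x = mulD d 1 * x := by
  unfold mulD
  split <;> simp

def delZ (i j : Fin 7) : ℤ := bif Nat.beq i.val j.val then 1 else 0

/-- A sum of seven terms in a form suited to evaluation. -/
def sum7 (f : Fin 7 → ℤ) : ℤ := f 0 + f 1 + f 2 + f 3 + f 4 + f 5 + f 6

theorem sum7_eq (f : Fin 7 → ℤ) : sum7 f = ∑ i, f i := (Fin.sum_univ_seven f).symm

/-- The dual form is introduced through `φ_{ijm} φ_{klm} = δ_{ik} δ_{jl} - δ_{il} δ_{jk} -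
ψ_{ijkl}`, which therefore holds by definition. That it is the Hodge dual is the content of
`starZ_eq`. -/
def psiZ (i j k l : Fin 7) : ℤ :=
  delZ i k * delZ j l - delZ i l * delZ j k - sum7 fun m => mulD (phiD i j m) (phiZ k l m)

theorem phiZ_skew : ∀ i j k, phiZ j i k = -phiZ i j k ∧ phiZ i k j = -phiZ i j k := by
  decide +kernel

theorem psiZ_skew : ∀ i j k l, psiZ j i k l = -psiZ i j k l ∧ psiZ i k j l = -psiZ i j k l ∧
    psiZ i j l k = -psiZ i j k l := by
  decide +kernel

/-- Both sides are skew in `b`, `c`, `d`, so increasing triples suffice; the unrestricted form is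
`phi0_mul_psi0`. -/
theorem phiZ_psiZ : ∀ i a b c d : Fin 7, b < c → c < d → sum7 (fun m => mulD (phiD i a m) (psiZ m b c d)) =
    delZ a b * phiZ i c d + delZ a c * phiZ b i d + delZ a d * phiZ b c i
      - delZ i b * phiZ a c d - delZ i c * phiZ b a d - delZ i d * phiZ b c a := by
  decide +kernel

theorem phiZ_psiZ_two : ∀ i a b,
    sum7 (fun j => sum7 fun k => mulD (phiD i j k) (psiZ a b j k)) = -4 * phiZ i a b := by
  decide +kernel

def sgnZ (i j : Fin 7) : ℤ :=
  bif Nat.blt i.val j.val then 1 else bif Nat.blt j.val i.val then -1 else 0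

/-- The permutation symbol in a form suited to evaluation. -/
def epsZ (a b c d e f g : Fin 7) : ℤ :=
  sgnZ a b * (sgnZ a c * (sgnZ b c * (sgnZ a d * (sgnZ b d * (sgnZ c d * (sgnZ a e * (sgnZ b e *
  (sgnZ c e * (sgnZ d e * (sgnZ a f * (sgnZ b f * (sgnZ c f * (sgnZ d f * (sgnZ e f * (sgnZ a g *
  (sgnZ b g * (sgnZ c g * (sgnZ d g * (sgnZ e g * sgnZ f g)))))))))))))))))))

/-- The factor 6 is the `3!` in the Hodge star of a 3-form. By skewness it is enough to evaluate at
increasing indices. -/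
theorem starZ_eq : ∀ i j k l : Fin 7, i < j → j < k → k < l →
    sum7 (fun a => sum7 fun b => sum7 fun d => mulD (phiD a b d) (epsZ a b d i j k l)) =
      6 * psiZ i j k l := by
  decide +kernel

theorem phiZ_skew1 (i j k : Fin 7) : phiZ j i k = -phiZ i j k := (phiZ_skew i j k).1

theorem phiZ_skew2 (i j k : Fin 7) : phiZ i k j = -phiZ i j k := (phiZ_skew i j k).2

/-- The components of `dx^p ∧ dx^q ∧ dx^r`. -/
def elemZ (p q r i j k : Fin 7) : ℤ :=
  delZ p i * (delZ q j * delZ r k - delZ q k * delZ r j)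
  + delZ p j * (delZ q k * delZ r i - delZ q i * delZ r k)
  + delZ p k * (delZ q i * delZ r j - delZ q j * delZ r i)

/-- This is `E_{ijk} φ_{ajk}` for `E = dx^p ∧ dx^q ∧ dx^r`, the contraction with the model form that
nearly inverts the infinitesimal action. -/
def gramZ (p q r a i : Fin 7) : ℤ :=
  2 * (delZ i p * phiZ a q r + delZ i q * phiZ a r p + delZ i r * phiZ a p q)

/-- `36` times a matrix whose infinitesimal action on the model form is `dx^p ∧ dx^q ∧ dx^r`. -/
def liftZ (p q r a i : Fin 7) : ℤ :=
  6 * gramZ p q r a i + 3 * gramZ p q r i a - 6 * (delZ a i * phiZ p q r)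

/-- If `E` is the image of a matrix `H` and `G_{ai} = E_{ijk} φ_{ajk}`, then `G` is `18 H` for
multiples of the identity, `4 H` for trace-free symmetric `H`, `12 H` for `H` in the 7-dimensional
skew part, and `0` on the stabilizer algebra. Hence `6 G + 3 Gᵗ - (tr G) δ` equals `36 H` on the
first three pieces, and `tr G = 6 φ_{pqr}`. -/
theorem liftZ_eq : ∀ p q r : Fin 7, p < q → q < r → ∀ i j k : Fin 7, i < j → j < k →
    sum7 (fun a => mulD (phiD a j k) (liftZ p q r a i) + mulD (phiD i a k) (liftZ p q r a j)
      + mulD (phiD i j a) (liftZ p q r a k)) = 36 * elemZ p q r i j k := by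
  decide +kernel

/-! ### Skew-symmetry -/

/-- The components `c` are those of a 3-form. -/
def IsAlt3 (c : C3) : Prop := (∀ i j k, c j i k = -c i j k) ∧ ∀ i j k, c i k j = -c i j k

theorem IsAlt3.swap13 {c : C3} (h : IsAlt3 c) (i j k : Fin 7) : c k j i = -c i j k := by
  rw [h.1, h.2, h.1]; ring

theorem IsAlt3.cyc {c : C3} (h : IsAlt3 c) (i j k : Fin 7) : c j k i = c i j k := by
  rw [h.2, h.1]; ring

theorem IsAlt3.eq_zero {c : C3} (h : IsAlt3 c) (h0 : ∀ i j k, i < j → j < k → c i j k = 0) :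
    c = 0 := by
  have e1 : ∀ i k, c i i k = 0 := fun i k => by have := h.1 i i k; linarith
  have e2 : ∀ i k, c i k k = 0 := fun i k => by have := h.2 i k k; linarith
  have key : ∀ i j k, i < j → c i j k = 0 := by
    intro i j k hij
    rcases lt_trichotomy j k with hjk | rfl | hjk
    · exact h0 i j k hij hjk
    · exact e2 i j
    · rw [h.2 i k j, neg_eq_zero]
      rcases lt_trichotomy i k with hik | rfl | hik
      · exact h0 i k j hik hjk
      · exact e1 i j
      · rw [h.1 k i j, neg_eq_zero]
        exact h0 k i j hik hij
  ext i j k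
  rcases lt_trichotomy i j with hij | rfl | hij
  · exact key i j k hij
  · exact e1 i k
  · rw [h.1 j i k, key j i k hij]
    simp

theorem IsAlt3.add {c d : C3} (hc : IsAlt3 c) (hd : IsAlt3 d) : IsAlt3 (c + d) :=
  ⟨fun i j k => by simp only [Pi.add_apply, hc.1 i j k, hd.1 i j k]; ring,
    fun i j k => by simp only [Pi.add_apply, hc.2 i j k, hd.2 i j k]; ring⟩

theorem IsAlt3.smul {c : C3} (hc : IsAlt3 c) (r : ℝ) : IsAlt3 (r • c) :=
  ⟨fun i j k => by simp only [Pi.smul_apply, hc.1 i j k, smul_neg],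
    fun i j k => by simp only [Pi.smul_apply, hc.2 i j k, smul_neg]⟩

theorem IsAlt3.sub {c d : C3} (hc : IsAlt3 c) (hd : IsAlt3 d) : IsAlt3 (c - d) :=
  ⟨fun i j k => by simp only [Pi.sub_apply, hc.1 i j k, hd.1 i j k]; ring,
    fun i j k => by simp only [Pi.sub_apply, hc.2 i j k, hd.2 i j k]; ring⟩

theorem IsAlt3.sum {ι : Type*} {s : Finset ι} {c : ι → C3} (hc : ∀ i ∈ s, IsAlt3 (c i)) :
    IsAlt3 (∑ i ∈ s, c i) := by
  constructor
  · intro i j k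
    simp only [Finset.sum_apply, ← Finset.sum_neg_distrib]
    exact Finset.sum_congr rfl fun x hx => (hc x hx).1 i j k
  · intro i j k
    simp only [Finset.sum_apply, ← Finset.sum_neg_distrib]
    exact Finset.sum_congr rfl fun x hx => (hc x hx).2 i j k

theorem IsAlt3.ext {c d : C3} (hc : IsAlt3 c) (hd : IsAlt3 d)
    (h : ∀ i j k, i < j → j < k → c i j k = d i j k) : c = d :=
  sub_eq_zero.1 ((hc.sub hd).eq_zero fun i j k hij hjk => sub_eq_zero.2 (h i j k hij hjk))

/-- The components `c` are those of a 4-form. -/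
def IsAlt4 (c : C4) : Prop := (∀ i, IsAlt3 (c i)) ∧ ∀ i j k l, c j i k l = -c i j k l

theorem IsAlt4.ext {c d : C4} (hc : IsAlt4 c) (hd : IsAlt4 d)
    (h : ∀ i j k l, i < j → j < k → k < l → c i j k l = d i j k l) : c = d := by
  have main : ∀ j k l, j < k → k < l → ∀ i, c i j k l = d i j k l := by
    intro j k l hjk hkl i
    have e : ∀ {c : C4}, IsAlt4 c → ∀ i k l, c i i k l = 0 := fun hc i k l => by
      have := hc.2 i i k l; linarith
    rcases lt_trichotomy i j with hij | rfl | hij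
    · exact h i j k l hij hjk hkl
    · rw [e hc, e hd]
    · rw [hc.2 j i, hd.2 j i, neg_inj]
      rcases lt_trichotomy i k with hik | rfl | hik
      · exact h j i k l hij hik hkl
      · have h1 := (hc.1 j).1 i i l
        have h2 := (hd.1 j).1 i i l
        linarith
      · rw [(hc.1 j).1 k i, (hd.1 j).1 k i, neg_inj]
        rcases lt_trichotomy i l with hil | rfl | hil
        · exact h j k i l hjk hik hil
        · have h1 := (hc.1 j).2 k i i
          have h2 := (hd.1 j).2 k i i
          linarith
        · rw [(hc.1 j).2 k l i, (hd.1 j).2 k l i, neg_inj]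
          exact h j k l i hjk hkl hil
  ext i : 1
  exact (hc.1 i).ext (hd.1 i) fun j k l hjk hkl => main j k l hjk hkl i

/-! ### The permutation symbol -/

theorem permSymbol_perm (σ : Equiv.Perm (Fin 7)) (s : Fin 7 → Fin 7) :
    permSymbol (fun k => s (σ k)) = (Equiv.Perm.sign σ : ℝ) * permSymbol s := by
  unfold permSymbol
  rw [← Matrix.det_permute]
  rfl

/-- For a permutation this is the sign as a product over pairs, one factor per possible inversion; a
repeated value makes both sides zero. The product form can be evaluated and makes the symmetries of
the symbol visible. -/
theorem permSymbol_eq_prod (s : Fin 7 → Fin 7) :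
    permSymbol s = ∏ j, ∏ i ∈ Finset.Iio j, (sgnZ (s i) (s j) : ℝ) := by
  by_cases h : Function.Injective s
  · obtain ⟨σ, hσ⟩ : ∃ σ : Equiv.Perm (Fin 7), ∀ i, σ i = s i :=
      ⟨Equiv.ofBijective s (Finite.injective_iff_bijective.1 h), fun i => rfl⟩
    have h1 : permSymbol s = (Equiv.Perm.sign σ : ℝ) := by
      have h2 : permSymbol s = permSymbol fun k => (id : Fin 7 → Fin 7) (σ k) := by
        simp only [id, hσ]
      have h3 : permSymbol (id : Fin 7 → Fin 7) = 1 := Matrix.det_one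
      rw [h2, permSymbol_perm, h3, mul_one]
    rw [h1, Equiv.Perm.sign_eq_prod_prod_Iio]
    push_cast
    refine Finset.prod_congr rfl fun j _ => Finset.prod_congr rfl fun i hi => ?_
    have hij : s i ≠ s j := fun e => (Finset.mem_Iio.1 hi).ne (h e)
    rw [hσ, hσ, sgnZ]
    rcases lt_or_gt_of_ne hij with hlt | hlt
    · have : Nat.blt (s i).val (s j).val = true := by rw [Nat.blt_eq]; exact hlt
      simp [hlt, this]
    · have h1 : Nat.blt (s i).val (s j).val = false := by
        rw [← Bool.not_eq_true, Nat.blt_eq]; exact not_lt.2 (le_of_lt hlt)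
      have h2 : Nat.blt (s j).val (s i).val = true := by rw [Nat.blt_eq]; exact hlt
      simp [not_lt.2 hlt.le, h1, h2]
  · have h0 : ∃ i j, i < j ∧ s i = s j := by
      simp only [Function.Injective, not_forall] at h
      obtain ⟨i, j, e, hne⟩ := h
      rcases lt_or_gt_of_ne hne with hlt | hlt
      · exact ⟨i, j, hlt, e⟩
      · exact ⟨j, i, hlt, e.symm⟩
    obtain ⟨i, j, hij, e⟩ := h0
    rw [permSymbol, Matrix.det_zero_of_row_eq hij.ne (by ext q; simp [e])]
    symm
    refine Finset.prod_eq_zero (Finset.mem_univ j) (Finset.prod_eq_zero (Finset.mem_Iio.2 hij) ?_)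
    have h1 : Nat.blt (s j).val (s j).val = false := by
      rw [← Bool.not_eq_true, Nat.blt_eq]; exact lt_irrefl _
    simp [sgnZ, e, h1]

theorem permSymbol_eq_epsZ (a b c d e f g : Fin 7) :
    permSymbol ![a, b, c, d, e, f, g] = epsZ a b c d e f g := by
  rw [permSymbol_eq_prod, Fin.prod_univ_seven]
  have h0 : Finset.Iio (0 : Fin 7) = ∅ := by decide
  have h1 : Finset.Iio (1 : Fin 7) = {0} := by decide
  have h2 : Finset.Iio (2 : Fin 7) = {0, 1} := by decide
  have h3 : Finset.Iio (3 : Fin 7) = {0, 1, 2} := by decide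
  have h4 : Finset.Iio (4 : Fin 7) = {0, 1, 2, 3} := by decide
  have h5 : Finset.Iio (5 : Fin 7) = {0, 1, 2, 3, 4} := by decide
  have h6 : Finset.Iio (6 : Fin 7) = {0, 1, 2, 3, 4, 5} := by decide
  rw [h0, h1, h2, h3, h4, h5, h6]
  repeat rw [Finset.prod_insert (by decide)]
  simp only [Finset.prod_empty, Finset.prod_singleton, epsZ]
  push_cast
  change _ * (sgnZ a b : ℝ) * ((sgnZ a c : ℝ) * (sgnZ b c : ℝ)) * ((sgnZ a d : ℝ) * ((sgnZ b d : ℝ)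
    * (sgnZ c d : ℝ))) * ((sgnZ a e : ℝ) * ((sgnZ b e : ℝ) * ((sgnZ c e : ℝ) * (sgnZ d e : ℝ)))) *
    ((sgnZ a f : ℝ) * ((sgnZ b f : ℝ) * ((sgnZ c f : ℝ) * ((sgnZ d f : ℝ) * (sgnZ e f : ℝ))))) *
    ((sgnZ a g : ℝ) * ((sgnZ b g : ℝ) * ((sgnZ c g : ℝ) * ((sgnZ d g : ℝ) * ((sgnZ e g : ℝ) *
    (sgnZ f g : ℝ)))))) = _
  ring

/-! ### The model form over the reals -/

def phi0 : C3 := fun i j k => (phiZ i j k : ℝ)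

def psi0 : C4 := fun i j k l => (psiZ i j k l : ℝ)

theorem isAlt3_phi0 : IsAlt3 phi0 :=
  ⟨fun i j k => by simp [phi0, phiZ_skew1 i j k], fun i j k => by simp [phi0, phiZ_skew2 i j k]⟩

theorem isAlt4_psi0 : IsAlt4 psi0 :=
  ⟨fun i => ⟨fun j k l => by simp [psi0, (psiZ_skew i j k l).2.1],
    fun j k l => by simp [psi0, (psiZ_skew i j k l).2.2]⟩,
    fun i j k l => by simp [psi0, (psiZ_skew i j k l).1]⟩

def del (i j : Fin 7) : ℝ := if i = j then 1 else 0

theorem delZ_cast (i j : Fin 7) : (delZ i j : ℝ) = del i j := by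
  unfold delZ del
  by_cases h : i = j
  · have : Nat.beq i.val j.val = true := by simp [h]
    simp [h]
  · have : Nat.beq i.val j.val = false := by
      rw [← Bool.not_eq_true, Nat.beq_eq]; exact fun e => h (Fin.ext e)
    simp [h, this]

theorem mulD_phiD (i j k : Fin 7) (x : ℤ) : mulD (phiD i j k) x = phiZ i j k * x := mulD_eq _ _

theorem phi0_mul_phi0 (i j k l : Fin 7) :
    ∑ m, phi0 i j m * phi0 k l m = del i k * del j l - del i l * del j k - psi0 i j k l := by
  simp only [psi0, psiZ, sum7_eq, mulD_phiD, phi0]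
  push_cast
  simp only [delZ_cast]
  ring

theorem phi0_mul_psi0_two (i a b : Fin 7) :
    ∑ j, ∑ k, phi0 i j k * psi0 a b j k = -4 * phi0 i a b := by
  have h := phiZ_psiZ_two i a b
  simp only [sum7_eq, mulD_phiD] at h
  unfold phi0 psi0
  exact_mod_cast congrArg (Int.cast (R := ℝ)) h

theorem phi0_mul_psi0 (i a b c d : Fin 7) : ∑ m, phi0 i a m * psi0 m b c d =
    del a b * phi0 i c d + del a c * phi0 b i d + del a d * phi0 b c i
      - del i b * phi0 a c d - del i c * phi0 b a d - del i d * phi0 b c a := by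
  have h : (fun b c d => ∑ m, phi0 i a m * psi0 m b c d : C3) = fun b c d =>
      del a b * phi0 i c d + del a c * phi0 b i d + del a d * phi0 b c i
      - del i b * phi0 a c d - del i c * phi0 b a d - del i d * phi0 b c a := by
    have p := isAlt3_phi0
    refine IsAlt3.ext ⟨fun b c d => ?_, fun b c d => ?_⟩ ⟨fun b c d => ?_, fun b c d => ?_⟩ ?_
    · simp only [← Finset.sum_neg_distrib, ← mul_neg]
      exact Finset.sum_congr rfl fun m _ => by rw [(isAlt4_psi0.1 m).1 b c d]
    · simp only [← Finset.sum_neg_distrib, ← mul_neg]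
      exact Finset.sum_congr rfl fun m _ => by rw [(isAlt4_psi0.1 m).2 b c d]
    · simp only
      rw [p.1 b c i, p.1 b c a, p.1 i c d, p.1 a c d, p.1 i b d, p.1 a b d]
      ring
    · simp only
      rw [p.2 i c d, p.2 a c d, p.2 b i c, p.2 b i d, p.2 b a d, p.2 b a c]
      ring
    · intro b c d hbc hcd
      have h := phiZ_psiZ i a b c d hbc hcd
      simp only [sum7_eq, mulD_phiD] at h
      have h' := congrArg (Int.cast (R := ℝ)) h
      push_cast at h'
      simpa only [delZ_cast, phi0, psi0] using h'
  exact congrFun (congrFun (congrFun h b) c) d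

theorem sgnZ_skew (i j : Fin 7) : sgnZ j i = -sgnZ i j := by
  revert i j
  decide

theorem permSymbol_swap34 (a b d i j k l : Fin 7) :
    permSymbol ![a, b, d, j, i, k, l] = -permSymbol ![a, b, d, i, j, k, l] := by
  rw [permSymbol_eq_epsZ, permSymbol_eq_epsZ, epsZ, epsZ, sgnZ_skew i j]
  push_cast
  ring

theorem permSymbol_swap45 (a b d i j k l : Fin 7) :
    permSymbol ![a, b, d, i, k, j, l] = -permSymbol ![a, b, d, i, j, k, l] := by
  rw [permSymbol_eq_epsZ, permSymbol_eq_epsZ, epsZ, epsZ, sgnZ_skew j k]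
  push_cast
  ring

theorem permSymbol_swap56 (a b d i j k l : Fin 7) :
    permSymbol ![a, b, d, i, j, l, k] = -permSymbol ![a, b, d, i, j, k, l] := by
  rw [permSymbol_eq_epsZ, permSymbol_eq_epsZ, epsZ, epsZ, sgnZ_skew k l]
  push_cast
  ring

theorem permSymbol_rotate (a b c d e f g : Fin 7) :
    permSymbol ![a, b, c, d, e, f, g] = permSymbol ![e, f, g, a, b, c, d] := by
  rw [permSymbol_eq_epsZ, permSymbol_eq_epsZ, epsZ, epsZ, sgnZ_skew a e, sgnZ_skew b e,
    sgnZ_skew c e, sgnZ_skew d e, sgnZ_skew a f, sgnZ_skew b f, sgnZ_skew c f, sgnZ_skew d f,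
    sgnZ_skew a g, sgnZ_skew b g, sgnZ_skew c g, sgnZ_skew d g]
  push_cast
  ring

/-- `φ_{abd} ε_{abdijkl}`. -/
def star0 : C4 := fun i j k l =>
  ∑ a, ∑ b, ∑ d, phi0 a b d * permSymbol ![a, b, d, i, j, k, l]

theorem isAlt4_star0 : IsAlt4 star0 := by
  refine ⟨fun i => ⟨fun j k l => ?_, fun j k l => ?_⟩, fun i j k l => ?_⟩
  · simp only [star0, permSymbol_swap45 _ _ _ i j k l, mul_neg, Finset.sum_neg_distrib]
  · simp only [star0, permSymbol_swap56 _ _ _ i j k l, mul_neg, Finset.sum_neg_distrib]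
  · simp only [star0, permSymbol_swap34 _ _ _ i j k l, mul_neg, Finset.sum_neg_distrib]

theorem star0_eq : star0 = (6 : ℝ) • psi0 := by
  refine IsAlt4.ext isAlt4_star0 ⟨fun i => (isAlt4_psi0.1 i).smul 6, fun i j k l => ?_⟩ ?_
  · simp [isAlt4_psi0.2 i j k l]
  · intro i j k l hij hjk hkl
    have h := starZ_eq i j k l hij hjk hkl
    simp only [sum7_eq, mulD_phiD] at h
    simp only [star0, permSymbol_eq_epsZ, phi0, psi0, Pi.smul_apply, smul_eq_mul]
    exact_mod_cast congrArg (Int.cast (R := ℝ)) h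

theorem phi0_mul_permSymbol (i j k l : Fin 7) :
    ∑ a, ∑ b, ∑ d, phi0 a b d * permSymbol ![a, b, d, i, j, k, l] = 6 * psi0 i j k l := by
  have h := congrFun (congrFun (congrFun (congrFun star0_eq i) j) k) l
  simpa only [star0, Pi.smul_apply, smul_eq_mul] using h

theorem del_sum (f : Fin 7 → ℝ) (j : Fin 7) : ∑ i, del i j * f i = f j := by simp [del]

theorem del_sum' (f : Fin 7 → ℝ) (j : Fin 7) : ∑ i, del j i * f i = f j := by simp [del]

theorem phi0_mul_phi0_two (i j : Fin 7) :
    ∑ a, ∑ b, phi0 i a b * phi0 j a b = 6 * del i j := by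
  have h : ∀ a, ∑ b, phi0 i a b * phi0 j a b = del i j - del i a * del a j := by
    intro a
    rw [phi0_mul_phi0 i a j a]
    have := (isAlt4_psi0.1 i).2 a j a
    have h2 := (isAlt4_psi0.1 i).1 a a j
    rw [show psi0 i a j a = 0 by linarith]
    simp [del]
  simp only [h, Finset.sum_sub_distrib, del_sum']
  simp
  ring

/-- Contracting successively, `φ` with the permutation symbol gives `6 ψ`, `φ` with `ψ` over two
indices gives `-4 φ`, and `φ` with `φ` gives `6 δ`; the constant is `6 · (-4) · 6 / 24 = -6`. -/
theorem bForm_phi0 (i j : Fin 7) : bForm phi0 i j = -6 * del i j := by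
  have h1 : ∀ a b c d : Fin 7, ∑ e, ∑ f, ∑ g, phi0 e f g * permSymbol ![a, b, c, d, e, f, g] =
      6 * psi0 a b c d := by
    intro a b c d
    rw [← phi0_mul_permSymbol]
    refine Finset.sum_congr rfl fun e _ => Finset.sum_congr rfl fun f _ =>
      Finset.sum_congr rfl fun g _ => ?_
    rw [permSymbol_rotate]
  have h2 : ∀ a b c d : Fin 7, ∑ e, ∑ f, ∑ g, permSymbol ![a, b, c, d, e, f, g] *
      (phi0 i a b * phi0 j c d * phi0 e f g) = 6 * (phi0 i a b * (phi0 j c d * psi0 a b c d)) := by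
    intro a b c d
    have : ∀ e f g, permSymbol ![a, b, c, d, e, f, g] * (phi0 i a b * phi0 j c d * phi0 e f g) =
        (phi0 i a b * phi0 j c d) * (phi0 e f g * permSymbol ![a, b, c, d, e, f, g]) :=
      fun e f g => by ring
    simp only [this, ← Finset.mul_sum, h1]
    ring
  rw [bForm, sum_fun7]
  change 1 / 24 * (∑ a, ∑ b, ∑ c, ∑ d, ∑ e, ∑ f, ∑ g, permSymbol ![a, b, c, d, e, f, g] *
      (phi0 i a b * phi0 j c d * phi0 e f g)) = _
  simp only [h2, ← Finset.mul_sum, phi0_mul_psi0_two]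
  have h3 : ∀ a b, phi0 i a b * (-4 * phi0 j a b) = -4 * (phi0 i a b * phi0 j a b) :=
    fun a b => by ring
  simp only [h3, ← Finset.mul_sum, phi0_mul_phi0_two]
  ring

theorem bMat_phi0 : bMat phi0 = 1 := by
  ext i j
  rw [bMat, Matrix.of_apply, bForm_phi0, Matrix.one_apply, del]
  split <;> norm_num

theorem volCoeff_phi0 : volCoeff phi0 = 1 := by
  rw [volCoeff_eq, bMat_phi0, Matrix.det_one]
  simp [ninthRoot]

theorem of_metric_phi0 : (Matrix.of (metric phi0) : Mat) = 1 := by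
  rw [of_metric, volCoeff_phi0, bMat_phi0, inv_one, one_smul]

theorem metric_phi0 : metric phi0 = del := by
  ext i j
  have := congrFun (congrFun of_metric_phi0 i) j
  rw [Matrix.of_apply, Matrix.one_apply] at this
  exact this

theorem coMat_phi0 : coMat phi0 = 1 := by rw [coMat, of_metric_phi0, inv_one]

theorem cometric_phi0 : cometric phi0 = del := by
  ext i j
  rw [cometric_eq, coMat_phi0, Matrix.one_apply, del]

theorem psi_phi0 : psi phi0 = psi0 := by
  ext i j k l
  rw [psi, raise3_eq, coMat_phi0, tens3_one, volCoeff_phi0]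
  simp only [one_mul, phi0_mul_permSymbol]
  ring

/-! ### The infinitesimal action -/

theorem inf3_add (H K : Mat) (c : C3) : inf3 (H + K) c = inf3 H c + inf3 K c := by
  ext i j k
  simp only [inf3, Pi.add_apply, ← Finset.sum_add_distrib, Matrix.add_apply]
  exact Finset.sum_congr rfl fun a _ => by ring

theorem inf3_smul (r : ℝ) (H : Mat) (c : C3) : inf3 (r • H) c = r • inf3 H c := by
  ext i j k
  simp only [inf3, Pi.smul_apply, smul_eq_mul, Finset.mul_sum, Matrix.smul_apply]
  exact Finset.sum_congr rfl fun a _ => by ring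

theorem inf3_sub (H K : Mat) (c : C3) : inf3 (H - K) c = inf3 H c - inf3 K c := by
  rw [sub_eq_add_neg, inf3_add, ← neg_one_smul ℝ K, inf3_smul, neg_one_smul, sub_eq_add_neg]

theorem IsAlt3.inf3 {c : C3} (hc : IsAlt3 c) (H : Mat) : IsAlt3 (inf3 H c) := by
  constructor
  · intro i j k
    simp only [G2Hilbert.inf3, ← Finset.sum_neg_distrib]
    refine Finset.sum_congr rfl fun a _ => ?_
    rw [hc.1 i a k, hc.1 a j k, hc.1 i j a]
    ring
  · intro i j k
    simp only [G2Hilbert.inf3, ← Finset.sum_neg_distrib]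
    refine Finset.sum_congr rfl fun a _ => ?_
    rw [hc.2 a j k, hc.2 i a k, hc.2 i j a]
    ring

/-- The infinitesimal action as a linear map. -/
def infL (c : C3) : Mat →ₗ[ℝ] C3 where
  toFun H := inf3 H c
  map_add' H K := inf3_add H K c
  map_smul' r H := inf3_smul r H c

/-- The components of `dx^p ∧ dx^q ∧ dx^r`. -/
def elem3 (p q r : Fin 7) : C3 := fun i j k => (elemZ p q r i j k : ℝ)

theorem elem3_swap1 (p q r : Fin 7) : elem3 q p r = -elem3 p q r := by
  ext i j k
  simp only [elem3, elemZ, Pi.neg_apply]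
  push_cast
  ring

theorem elem3_swap2 (p q r : Fin 7) : elem3 p r q = -elem3 p q r := by
  ext i j k
  simp only [elem3, elemZ, Pi.neg_apply]
  push_cast
  ring

theorem isAlt3_elem3 (p q r : Fin 7) : IsAlt3 (elem3 p q r) := by
  constructor <;>
  · intro i j k
    simp only [elem3, elemZ]
    push_cast
    ring

theorem IsAlt3.eq_sum_elem3 {c : C3} (hc : IsAlt3 c) :
    c = ∑ p, ∑ q, ∑ r, (c p q r / 6) • elem3 p q r := by
  ext i j k
  have h : ∀ p q r, (c p q r / 6) • elem3 p q r i j k =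
      del p i * (del q j * (del r k * (c p q r / 6))) - del p i * (del q k * (del r j * (c p q r / 6)))
      + del p j * (del q k * (del r i * (c p q r / 6)))
      - del p j * (del q i * (del r k * (c p q r / 6)))
      + del p k * (del q i * (del r j * (c p q r / 6)))
      - del p k * (del q j * (del r i * (c p q r / 6))) := by
    intro p q r
    simp only [elem3, elemZ, smul_eq_mul]
    push_cast
    simp only [delZ_cast]
    ring
  simp only [Finset.sum_apply, Pi.smul_apply, h, Finset.sum_add_distrib, Finset.sum_sub_distrib,
    ← Finset.mul_sum, del_sum]
  rw [hc.swap13 i j k, hc.1 i j k, hc.2 i j k, hc.cyc i j k, hc.cyc k i j]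
  ring

theorem elem3_mem_range (p q r : Fin 7) : elem3 p q r ∈ LinearMap.range (infL phi0) := by
  have h0 : ∀ p q r : Fin 7, p < q → q < r → elem3 p q r ∈ LinearMap.range (infL phi0) := by
    intro p q r hpq hqr
    refine ⟨(1 / 36 : ℝ) • Matrix.of fun a i => (liftZ p q r a i : ℝ), ?_⟩
    change inf3 _ phi0 = _
    refine (isAlt3_phi0.inf3 _).ext (isAlt3_elem3 p q r) fun i j k hij hjk => ?_
    have h := liftZ_eq p q r hpq hqr i j k hij hjk
    simp only [sum7_eq, mulD_phiD] at h
    have h' := congrArg (Int.cast (R := ℝ)) h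
    push_cast at h'
    rw [inf3_smul]
    simp only [Pi.smul_apply, inf3, Matrix.of_apply, smul_eq_mul, phi0, elem3]
    rw [one_div, inv_mul_eq_iff_eq_mul₀ (by norm_num), ← h']
    exact Finset.sum_congr rfl fun a _ => by ring
  have e1 : ∀ p r, elem3 p p r = 0 := fun p r => by
    have h := elem3_swap1 p p r
    ext i j k
    have := congrFun (congrFun (congrFun h i) j) k
    simp only [Pi.neg_apply] at this
    simp only [Pi.zero_apply]
    linarith
  have e2 : ∀ p q, elem3 p q q = 0 := fun p q => by
    have h := elem3_swap2 p q q
    ext i j k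
    have := congrFun (congrFun (congrFun h i) j) k
    simp only [Pi.neg_apply] at this
    simp only [Pi.zero_apply]
    linarith
  have key : ∀ p q r : Fin 7, p < q → elem3 p q r ∈ LinearMap.range (infL phi0) := by
    intro i j k hij
    rcases lt_trichotomy j k with hjk | rfl | hjk
    · exact h0 i j k hij hjk
    · rw [e2]; exact zero_mem _
    · rw [elem3_swap2 i k j, neg_mem_iff]
      rcases lt_trichotomy i k with hik | rfl | hik
      · exact h0 i k j hik hjk
      · rw [e1]; exact zero_mem _
      · rw [elem3_swap1 k i j, neg_mem_iff]
        exact h0 k i j hik hij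
  rcases lt_trichotomy p q with hij | rfl | hij
  · exact key p q r hij
  · rw [e1]; exact zero_mem _
  · rw [elem3_swap1 q p r, neg_mem_iff]
    exact key q p r hij

/-- Every elementary 3-form is hit by the explicit lift `liftZ`, and these span. The dimensions are
`49 = 35 + 14`, where 14 is the dimension of the stabilizer `G₂`; surjectivity is what makes the
orbit of the model form open. -/
theorem exists_inf3_phi0 {c : C3} (hc : IsAlt3 c) : ∃ H, inf3 H phi0 = c := by
  rw [hc.eq_sum_elem3]
  exact Submodule.sum_mem _ fun p _ => Submodule.sum_mem _ fun q _ => Submodule.sum_mem _ fun r _ =>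
    Submodule.smul_mem _ _ (elem3_mem_range p q r)

/-! ### Forms near the model form -/

theorem of_del : (Matrix.of del : Mat) = 1 := by
  ext i j
  simp [del, Matrix.one_apply]

theorem hasDerivAt_one_add_smul (H : Mat) (a i : Fin 7) :
    HasDerivAt (fun s : ℝ => (1 + s • H) a i) (H a i) 0 := by
  simp only [Matrix.add_apply, Matrix.smul_apply, smul_eq_mul]
  simpa using ((hasDerivAt_id (0 : ℝ)).mul_const (H a i)).const_add ((1 : Mat) a i)

theorem one_add_zero_smul (H : Mat) : 1 + (0 : ℝ) • H = 1 := by simp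

theorem hasDerivAt_pull3 (H : Mat) (c : C3) :
    HasDerivAt (fun s : ℝ => pull3 (1 + s • H) c) (inf3 H c) 0 := by
  refine hasDerivAt_pi.2 fun i => hasDerivAt_pi.2 fun j => hasDerivAt_pi.2 fun k => ?_
  simp only [tens3_apply, Matrix.transpose_apply]
  have h : ∀ a b d, HasDerivAt (fun s : ℝ => (1 + s • H) a i * (1 + s • H) b j * (1 + s • H) d k *
      c a b d) ((H a i * del b j * del d k + del a i * H b j * del d k
        + del a i * del b j * H d k) * c a b d) 0 := by
    intro a b d
    have := (((hasDerivAt_one_add_smul H a i).mul (hasDerivAt_one_add_smul H b j)).mul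
      (hasDerivAt_one_add_smul H d k)).mul_const (c a b d)
    refine this.congr_deriv ?_
    simp only [one_add_zero_smul, Matrix.one_apply, del, Pi.mul_apply]
    ring
  convert HasDerivAt.fun_sum fun a _ => HasDerivAt.fun_sum fun b _ =>
    HasDerivAt.fun_sum fun d _ => h a b d using 1
  have e : ∀ a b d, (H a i * del b j * del d k + del a i * H b j * del d k
        + del a i * del b j * H d k) * c a b d = del b j * (del d k * (H a i * c a b d))
        + del a i * (del d k * (H b j * c a b d)) + del a i * (del b j * (H d k * c a b d)) :=
    fun a b d => by ring
  simp only [e, Finset.sum_add_distrib, ← Finset.mul_sum, del_sum, inf3]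

theorem contDiff_pull3 (c : C3) {n : WithTop ℕ∞} :
    ContDiff ℝ n fun A : C2 => pull3 (Matrix.of A) c := by
  refine contDiff_pi.2 fun i => contDiff_pi.2 fun j => contDiff_pi.2 fun k => ?_
  simp only [tens3_apply, Matrix.transpose_apply, Matrix.of_apply]
  fun_prop

theorem pull3_one (c : C3) : pull3 1 c = c := by
  change tens3 (1 : Mat).transpose c = c
  rw [Matrix.transpose_one, tens3_one]

/-- The alternating components, as a subspace. -/
def altSub : Submodule ℝ C3 where
  carrier := {c | IsAlt3 c}
  add_mem' := IsAlt3.add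
  zero_mem' := ⟨fun _ _ _ => by simp, fun _ _ _ => by simp⟩
  smul_mem' r _ h := h.smul r

theorem IsAlt3.pull3 {c : C3} (hc : IsAlt3 c) (A : Mat) : IsAlt3 (pull3 A c) := by
  constructor
  · intro i j k
    simp only [tens3_apply, ← Finset.sum_neg_distrib]
    rw [Finset.sum_comm]
    refine Finset.sum_congr rfl fun a _ => Finset.sum_congr rfl fun b _ =>
      Finset.sum_congr rfl fun d _ => ?_
    rw [hc.1]; ring
  · intro i j k
    simp only [tens3_apply, ← Finset.sum_neg_distrib]
    refine Finset.sum_congr rfl fun a _ => ?_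
    rw [Finset.sum_comm]
    refine Finset.sum_congr rfl fun b _ => Finset.sum_congr rfl fun d _ => ?_
    rw [hc.2]; ring

/-- The orbit map `A ↦ pull3 A phi0` into 3-forms has surjective derivative at the identity, so its
image is a neighbourhood of `phi0`. Only the beginning of the segment towards `c` is needed for the
continuation argument. -/
theorem nhds_phi0 {c : C3} (hc : IsAlt3 c) :
    ∀ᶠ s : ℝ in nhds 0, ∃ A : Mat, A.det ≠ 0 ∧ pull3 A phi0 = phi0 + s • (c - phi0) := by
  -- The 3-forms are a proper subspace of `C3`, so the derivative is onto only after composing with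
  -- a projection to that subspace.
  obtain ⟨π, hπ⟩ := altSub.subtype.exists_leftInverse_of_injective altSub.ker_subtype
  set πc : C3 →L[ℝ] altSub := LinearMap.toContinuousLinearMap π with hπc
  have hπ' : ∀ {c : C3} (hc : IsAlt3 c), πc c = ⟨c, hc⟩ := fun {c} hc =>
    LinearMap.congr_fun hπ ⟨c, hc⟩
  set Φ : C2 → C3 := fun A => pull3 (Matrix.of A) phi0 with hΦ
  have hs : HasStrictFDerivAt Φ (fderiv ℝ Φ del) del :=
    (contDiff_pull3 phi0 (n := 1)).contDiffAt.hasStrictFDerivAt one_ne_zero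
  have hd : ∀ H : C2, fderiv ℝ Φ del H = inf3 (Matrix.of H) phi0 := by
    intro H
    have h1 : HasDerivAt (fun s : ℝ => del + s • H) H 0 :=
      (((hasDerivAt_id (0 : ℝ)).smul_const H).const_add del).congr_deriv (one_smul ℝ H)
    have h2 : HasFDerivAt Φ (fderiv ℝ Φ del) (del + (0 : ℝ) • H) := by
      rw [zero_smul, add_zero]
      exact hs.hasFDerivAt
    refine (h2.comp_hasDerivAt 0 h1).unique ?_
    have h3 := hasDerivAt_pull3 (Matrix.of H) phi0
    rw [← of_del] at h3
    exact h3
  have hs2 : HasStrictFDerivAt (fun A => πc (Φ A)) (πc ∘L fderiv ℝ Φ del) del :=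
    πc.hasStrictFDerivAt.comp _ hs
  have hsurj : (πc ∘L fderiv ℝ Φ del).range = ⊤ := by
    rw [LinearMap.range_eq_top]
    rintro ⟨α, hα⟩
    obtain ⟨H, hH⟩ := exists_inf3_phi0 hα
    exact ⟨fun a i => H a i, (congrArg πc ((hd fun a i => H a i).trans hH)).trans (hπ' hα)⟩
  have hmap := hs2.map_nhds_eq_of_surj hsurj
  have hdet : ∀ᶠ A : C2 in nhds del, (Matrix.of A : Mat).det ≠ 0 := by
    have hc : Continuous fun A : C2 => (Matrix.of A : Mat).det := by
      simp only [Matrix.det_apply]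
      fun_prop
    refine hc.continuousAt.eventually_ne ?_
    rw [of_del, Matrix.det_one]
    exact one_ne_zero
  have h1 : ∀ᶠ β in nhds (πc (Φ del)), ∃ A : C2, (Matrix.of A : Mat).det ≠ 0 ∧
      πc (Φ A) = β := by
    rw [← hmap, Filter.eventually_map]
    filter_upwards [hdet] with A hA using ⟨A, hA, rfl⟩
  have hΦ1 : Φ del = phi0 := by
    simp only [hΦ, of_del, pull3_one]
  have h2 : Filter.Tendsto (fun s : ℝ => πc (phi0 + s • (c - phi0))) (nhds 0)
      (nhds (πc (Φ del))) := by
    have : Continuous fun s : ℝ => πc (phi0 + s • (c - phi0)) := by fun_prop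
    rw [hΦ1]
    convert this.tendsto 0 using 2
    simp
  filter_upwards [h2.eventually h1] with s ⟨A, hA, h⟩
  refine ⟨Matrix.of A, hA, ?_⟩
  rw [hπ' (isAlt3_phi0.pull3 _), hπ' (isAlt3_phi0.add ((hc.sub isAlt3_phi0).smul s))] at h
  exact congrArg Subtype.val h

/-! ### The fundamental identity on all nondegenerate forms -/

/-- `c_{ijk} c_{abk}`, contracted with the matrix `G`. -/
def contr (G : Mat) (c : C3) : C4 := fun i j a b => ∑ k, ∑ l, G k l * (c i j k * c a b l)

theorem contr_coMat_pull {A : Mat} (hA : A.det ≠ 0) (c : C3) :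
    contr (coMat (pull3 A c)) (pull3 A c) = tens4 A.transpose (contr (coMat c) c) := by
  ext i j a b
  have h : ∀ i j, pull3 A c i j = mv A.transpose
      (fun d => ∑ p, ∑ q, A p i * A q j * c p q d) := by
    intro i j
    ext k
    simp only [tens3_apply, mv_apply_real, Matrix.transpose_apply, Finset.mul_sum]
    simp only [sum3_eq_prod]
    exact Fintype.sum_equiv ⟨fun x => (x.2.2, x.1, x.2.1), fun x => (x.2.1, x.2.2, x.1),
      fun _ => rfl, fun _ => rfl⟩ _ _ fun x => by simp; ring
  have h2 : ∀ u v : C1, ∑ k, ∑ l, coMat (pull3 A c) k l *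
      (mv A.transpose u k * mv A.transpose v l) = ∑ k, ∑ l, coMat c k l * (u k * v l) := by
    intro u v
    have e : ∀ k l, mv A.transpose u k * mv A.transpose v l =
        tens2 A.transpose (fun k l => u k * v l) k l := by
      intro k l
      simp only [mv_apply_real, tens2_apply, Finset.sum_mul_sum]
      exact Finset.sum_congr rfl fun a _ => Finset.sum_congr rfl fun b _ => by ring
    simp only [e, ← cometric_eq]
    rw [dual2, push_cometric hA]
  simp only [contr, h, h2, tens4_apply]
  have e4 : ∀ F : Fin 7 → Fin 7 → Fin 7 → Fin 7 → ℝ, ∑ p, ∑ q, ∑ r, ∑ s, F p q r s =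
      ∑ x : Fin 7 × Fin 7, ∑ y : Fin 7 × Fin 7, F x.1 x.2 y.1 y.2 := fun F => by
    simp [Fintype.sum_prod_type]
  rw [e4]
  simp only [sum2_eq_prod, Finset.sum_mul_sum, Matrix.transpose_apply]
  simp only [Finset.mul_sum]
  rw [Finset.sum_comm]
  refine Finset.sum_congr rfl fun x _ => ?_
  rw [Finset.sum_comm]
  exact Finset.sum_congr rfl fun y _ => Finset.sum_congr rfl fun z _ => by ring

theorem contr_phi0 : contr (coMat phi0) phi0 = fun i j a b =>
    del i a * del j b - del i b * del j a - psi0 i j a b := by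
  ext i j a b
  rw [← phi0_mul_phi0, contr, coMat_phi0]
  simp [Matrix.one_apply]

theorem tens2_del (A : Mat) (i j : Fin 7) : tens2 A del i j = ∑ a, A i a * A j a := by
  simp [tens2_apply, del]

/-- `c` is the pullback of the model form by an invertible linear map. -/
def IsModel (c : C3) : Prop := ∃ A : Mat, A.det ≠ 0 ∧ pull3 A phi0 = c

theorem tens4_del_del (A : Mat) (i j a b : Fin 7) :
    tens4 A (fun i j a b => del i a * del j b) i j a b = tens2 A del i a * tens2 A del j b := by
  have e : ∀ p q r s, A i p * A j q * A a r * A b s * (del p r * del q s) =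
      del p r * (del q s * (A i p * A j q * A a r * A b s)) := fun p q r s => by ring
  simp only [tens4_apply, tens2_del, Finset.sum_mul_sum, e, ← Finset.mul_sum, del_sum']
  simp only [Finset.mul_sum]
  exact Finset.sum_congr rfl fun p _ => Finset.sum_congr rfl fun q _ => by ring

theorem tens4_del_del' (A : Mat) (i j a b : Fin 7) :
    tens4 A (fun i j a b => del i b * del j a) i j a b = tens2 A del i b * tens2 A del j a := by
  have e : ∀ p q r s, A i p * A j q * A a r * A b s * (del p s * del q r) =
      del q r * (del p s * (A i p * A j q * A a r * A b s)) := fun p q r s => by ring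
  simp only [tens4_apply, tens2_del, Finset.sum_mul_sum, e, ← Finset.mul_sum, del_sum']
  simp only [Finset.mul_sum]
  exact Finset.sum_congr rfl fun p _ => Finset.sum_congr rfl fun q _ => by ring

/-- All terms are natural, so the identity is transported from `phi0`, where it is the definition of
`psi0`. -/
theorem IsModel.contr_eq {c : C3} (hc : IsModel c) (i j a b : Fin 7) :
    contr (coMat c) c i j a b =
      metric c i a * metric c j b - metric c i b * metric c j a - psi c i j a b := by
  obtain ⟨A, hA, rfl⟩ := hc
  have e : (fun i j a b => del i a * del j b - del i b * del j a - psi0 i j a b : C4) =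
    (fun i j a b => del i a * del j b) - (fun i j a b => del i b * del j a) - psi0 := rfl
  rw [contr_coMat_pull hA, contr_phi0, metric_pull hA, psi_pull hA, metric_phi0, psi_phi0, e,
    map_sub, map_sub]
  simp only [Pi.sub_apply, tens4_del_del, tens4_del_del']

theorem IsModel.isAlt3 {c : C3} (hc : IsModel c) : IsAlt3 c := by
  obtain ⟨A, -, rfl⟩ := hc
  exact isAlt3_phi0.pull3 A

theorem IsModel.det_ne_zero {c : C3} (hc : IsModel c) : (bMat c).det ≠ 0 := by
  obtain ⟨A, hA, rfl⟩ := hc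
  rw [bMat_pull, bMat_phi0]
  simp [Matrix.det_mul, hA]

theorem volCoeff_pow (c : C3) : volCoeff c ^ 9 = (bMat c).det := by
  rw [volCoeff_eq, pow_ninthRoot]

theorem volCoeff_ne_zero {c : C3} (hc : (bMat c).det ≠ 0) : volCoeff c ≠ 0 := by
  rw [← volCoeff_pow] at hc
  exact fun h => hc (by simp [h])

theorem bMat_eq_metric {c : C3} (hc : (bMat c).det ≠ 0) :
    bMat c = volCoeff c • Matrix.of (metric c) := by
  rw [of_metric, smul_smul, mul_inv_cancel₀ (volCoeff_ne_zero hc), one_smul]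

/-- Since `b = m g` and `det b = m⁹`, the adjugate `det b · b⁻¹` is `m⁸ g⁻¹`. It replaces the
cometric by something polynomial in `φ`. -/
theorem adjugate_bMat {c : C3} (hc : (bMat c).det ≠ 0) :
    (bMat c).adjugate = (volCoeff c) ^ 8 • coMat c := by
  have hm := volCoeff_ne_zero hc
  have h : coMat c = volCoeff c • (bMat c)⁻¹ := by
    rw [coMat, of_metric]
    refine Matrix.inv_eq_left_inv ?_
    rw [Matrix.smul_mul, Matrix.mul_smul, smul_smul, mul_inv_cancel₀ hm, one_smul,
      Matrix.nonsing_inv_mul _ hc.isUnit]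
  rw [h, smul_smul, ← pow_succ, volCoeff_pow, Matrix.inv_def, smul_smul, Ring.inverse_eq_inv',
    mul_inv_cancel₀ hc, one_smul]

/-- Twice the symmetrization of `c_{ijk} c_{abk}` in `i`, `a`, as a polynomial in `c`. -/
def symContr (c : C3) : C4 := fun i j a b =>
  contr (bMat c).adjugate c i j a b + contr (bMat c).adjugate c a j i b

def symProd (b : C2) : C4 := fun i j a d =>
  2 * (b i a * b j d) - b i j * b a d - b a j * b i d

theorem contr_smul (r : ℝ) (G : Mat) (c : C3) (i j a b : Fin 7) :
    contr (r • G) c i j a b = r * contr G c i j a b := by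
  simp only [contr, Finset.mul_sum, Matrix.smul_apply, smul_eq_mul, mul_assoc]

theorem contr_adjugate {c : C3} (hc : (bMat c).det ≠ 0) (i j a b : Fin 7) :
    contr (bMat c).adjugate c i j a b = volCoeff c ^ 8 * contr (coMat c) c i j a b := by
  rw [adjugate_bMat hc, contr_smul]

theorem symProd_bMat {c : C3} (hc : (bMat c).det ≠ 0) (i j a d : Fin 7) :
    symProd (bMat c) i j a d = volCoeff c ^ 2 * symProd (metric c) i j a d := by
  have h : ∀ i j, bMat c i j = volCoeff c * metric c i j := fun i j => by
    rw [bMat_eq_metric hc]; rfl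
  simp only [symProd, h]
  ring

theorem metric_symm {c : C3} (hc : IsModel c) (i j : Fin 7) : metric c j i = metric c i j := by
  obtain ⟨A, hA, rfl⟩ := hc
  rw [metric_pull hA, metric_phi0, tens2_del, tens2_del]
  exact Finset.sum_congr rfl fun a _ => mul_comm _ _

theorem isAlt4_psi_of_isModel {c : C3} (hc : IsModel c) : IsAlt4 (psi c) := by
  obtain ⟨A, hA, rfl⟩ := hc
  rw [psi_pull hA, psi_phi0]
  refine ⟨fun i => ?_, fun i j k l => ?_⟩
  · have : tens4 A.transpose psi0 i = ∑ a, A a i • pull3 A (psi0 a) := rfl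
    rw [this]
    exact IsAlt3.sum fun a _ => ((isAlt4_psi0.1 a).pull3 A).smul _
  · simp only [tens4_apply, ← Finset.sum_neg_distrib]
    rw [Finset.sum_comm]
    refine Finset.sum_congr rfl fun a _ => Finset.sum_congr rfl fun b _ =>
      Finset.sum_congr rfl fun d _ => Finset.sum_congr rfl fun e _ => ?_
    rw [isAlt4_psi0.2]; ring

/-- Symmetrizing in `i`, `a` removes `ψ` from the contraction identity and leaves `symContr = m⁸
symProd g = m⁶ symProd b`. The factor `m⁶` is not polynomial in `φ`, but its cube `m¹⁸ = (det b)²`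
is; this is why cubes are taken. -/
theorem IsModel.symContr_pow {c : C3} (hc : IsModel c) (i j a b : Fin 7) :
    symContr c i j a b ^ 3 = (bMat c).det ^ 2 * symProd (bMat c) i j a b ^ 3 := by
  have h : symContr c i j a b = volCoeff c ^ 8 * symProd (metric c) i j a b := by
    have h4 := isAlt4_psi_of_isModel hc
    have e : psi c a j i b = -psi c i j a b := by
      rw [h4.2 j a, (h4.1 j).1 i a, h4.2 i j]; ring
    rw [symContr, contr_adjugate hc.det_ne_zero, contr_adjugate hc.det_ne_zero, hc.contr_eq,
      hc.contr_eq, e, symProd, metric_symm hc i a, metric_symm hc j i, metric_symm hc a j]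
    ring
  rw [h, symProd_bMat hc.det_ne_zero, ← volCoeff_pow]
  ring

theorem contDiff_det {n : WithTop ℕ∞} {E : Type*} [NormedAddCommGroup E] [NormedSpace ℝ E]
    {B : E → Mat} (hB : ∀ i j, ContDiff ℝ n fun x => B x i j) : ContDiff ℝ n fun x => (B x).det := by
  simp only [Matrix.det_apply]
  fun_prop

/-- Along the segment from `phi0` to `c` both sides are polynomial in the parameter, and they agree
near the starting point because the forms there lie in the orbit of `phi0`. Analytic continuation
carries the identity to the endpoint `c`. -/
theorem IsAlt3.symContr_pow {c : C3} (hc : IsAlt3 c) (i j a b : Fin 7) :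
    symContr c i j a b ^ 3 = (bMat c).det ^ 2 * symProd (bMat c) i j a b ^ 3 := by
  set γ : ℝ → C3 := fun s => phi0 + s • (c - phi0) with hγ
  have h1 : ∀ i j k, ContDiff ℝ ω fun s => γ s i j k := by
    intro i j k
    simp only [hγ, Pi.add_apply, Pi.smul_apply]
    fun_prop
  have h2 : ∀ i j, ContDiff ℝ ω fun s => bMat (γ s) i j := by
    intro i j
    simp only [bMat, bForm, Matrix.of_apply]
    fun_prop
  have h3 : ∀ i j, ContDiff ℝ ω fun s => (bMat (γ s)).adjugate i j := by
    intro i j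
    simp only [Matrix.adjugate_apply]
    refine contDiff_det fun p q => ?_
    by_cases hp : p = j
    · subst hp
      simp only [Matrix.updateRow_self]
      fun_prop
    · simp only [Matrix.updateRow_ne hp]
      exact h2 p q
  have h4 : ContDiff ℝ ω fun s => symContr (γ s) i j a b ^ 3 := by
    simp only [symContr, contr]
    fun_prop
  have h5 : ContDiff ℝ ω fun s => (bMat (γ s)).det ^ 2 * symProd (bMat (γ s)) i j a b ^ 3 := by
    have := contDiff_det h2
    simp only [symProd]
    fun_prop
  have h6 := AnalyticOnNhd.eq_of_eventuallyEq (𝕜 := ℝ) (z₀ := 0)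
    (fun x _ => (contDiff_omega_iff_analyticOnNhd.1 h4) x (mem_univ x))
    (fun x _ => (contDiff_omega_iff_analyticOnNhd.1 h5) x (mem_univ x)) (by
      filter_upwards [nhds_phi0 hc] with s ⟨A, hA, h⟩
      exact IsModel.symContr_pow ⟨A, hA, h⟩ i j a b)
  have h7 : γ 1 = c := by simp [hγ]
  have := congrFun h6 1
  simpa only [h7] using this

/-- The fundamental identity. -/
theorem IsAlt3.contr_symm {c : C3} (hc : IsAlt3 c) (hd : (bMat c).det ≠ 0) (i j a b : Fin 7) :
    contr (coMat c) c i j a b + contr (coMat c) c a j i b = symProd (metric c) i j a b := by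
  have h := hc.symContr_pow i j a b
  rw [symContr, contr_adjugate hd, contr_adjugate hd, symProd_bMat hd, ← volCoeff_pow,
    ← mul_add] at h
  -- Cubing is injective on the reals and the power of the volume coefficient is non-zero, so
  -- nothing is lost by the passage to cubes.
  have h2 : (volCoeff c ^ 8 * (contr (coMat c) c i j a b + contr (coMat c) c a j i b)) ^ 3 =
      (volCoeff c ^ 8 * symProd (metric c) i j a b) ^ 3 := by
    rw [h]; ring
  exact mul_left_cancel₀ (pow_ne_zero 8 (volCoeff_ne_zero hd))
    ((Odd.strictMono_pow (by decide : Odd 3)).injective h2)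

/-! ### Adapted bases of cross product algebras -/

section Cross

variable {V : Type*} [AddCommGroup V] [Module ℝ V]

/-- `cr` is a cross product for the positive definite inner product `g`. -/
structure IsCross (g : V →ₗ[ℝ] V →ₗ[ℝ] ℝ) (cr : V →ₗ[ℝ] V →ₗ[ℝ] V) : Prop where
  symm : ∀ u v, g u v = g v u
  pos : ∀ u, u ≠ 0 → 0 < g u u
  skew : ∀ u v, cr u v = -cr v u
  cyc : ∀ u v w, g (cr u v) w = g u (cr v w)
  main : ∀ u v w z, g (cr u v) (cr w z) + g (cr w v) (cr u z) =
    2 * (g u w * g v z) - g u v * g w z - g w v * g u z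

namespace IsCross

variable {g : V →ₗ[ℝ] V →ₗ[ℝ] ℝ} {cr : V →ₗ[ℝ] V →ₗ[ℝ] V}

theorem ext (h : IsCross g cr) {x y : V} (hxy : ∀ v, g x v = g y v) : x = y := by
  by_contra hne
  have := h.pos (x - y) (sub_ne_zero.2 hne)
  rw [LinearMap.map_sub₂, hxy, sub_self] at this
  exact lt_irrefl _ this

theorem self (h : IsCross g cr) (u : V) : cr u u = 0 := by
  have h2 : (2 : ℝ) • cr u u = 0 := by
    rw [two_smul]
    nth_rw 1 [h.skew u u]
    rw [neg_add_cancel]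
  exact (smul_eq_zero.1 h2).resolve_left two_ne_zero

/-- Cyclicity moves the outer product to the other side of `g`, and positive definiteness allows the
vector identity to be tested against an arbitrary vector. -/
theorem assoc (h : IsCross g cr) (u w z : V) : cr (cr w z) u + cr (cr u z) w =
    (2 * g u w) • z - g w z • u - g u z • w := by
  refine h.ext fun v => ?_
  have := h.main u v w z
  have e1 : g (cr (cr w z) u) v = g (cr u v) (cr w z) := by rw [h.cyc, h.symm]
  have e2 : g (cr (cr u z) w) v = g (cr w v) (cr u z) := by rw [h.cyc, h.symm]
  simp only [map_add, map_sub, map_smul, LinearMap.add_apply, LinearMap.sub_apply,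
    LinearMap.smul_apply, smul_eq_mul, e1, e2, this]
  rw [h.symm v z, h.symm u v, h.symm w v]
  rw [h.symm z v]
  ring

theorem assoc_self (h : IsCross g cr) (w z : V) : cr (cr w z) w = g w w • z - g w z • w := by
  have := h.assoc w w z
  have h2 : (2 : ℝ) • cr (cr w z) w = (2 : ℝ) • (g w w • z - g w z • w) := by
    rw [two_smul, this]
    module
  exact smul_right_injective V two_ne_zero h2

theorem left_orth (h : IsCross g cr) (x y : V) : g x (cr x y) = 0 := by
  rw [← h.cyc, h.self]
  simp

theorem right_orth (h : IsCross g cr) (x y : V) : g y (cr x y) = 0 := by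
  rw [h.symm, h.cyc, h.self]
  simp

theorem norm_cross (h : IsCross g cr) {x y : V} (hx : g x x = 1) (hy : g y y = 1) (hxy : g x y = 0) :
    g (cr x y) (cr x y) = 1 := by
  have := h.main x y x y
  rw [hx, hy, hxy] at this
  linarith

theorem mul_right (h : IsCross g cr) {x y : V} (hx : g x x = 1) (hxy : g x y = 0) : cr (cr x y) x = y := by
  rw [h.assoc_self, hx, hxy]
  simp

theorem mul_left (h : IsCross g cr) {x y : V} (hy : g y y = 1) (hxy : g x y = 0) : cr y (cr x y) = x := by
  rw [h.skew x y, map_neg, h.skew y, neg_neg, h.mul_right hy (by rw [h.symm, hxy])]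

theorem cross_orth (h : IsCross g cr) {x y z : V} (hxy : g x y = 0) (hxz : g x z = 0) :
    g (cr x y) (cr y z) = 0 := by
  have := h.main y y x z
  rw [h.self, h.symm y x, hxy, hxz] at this
  simpa using this

/-- The orthogonality hypotheses make every inner product in the polarized identity `assoc` vanish,
so reassociating a product only changes its sign, as for orthogonal imaginary octonions. -/
theorem cross_cross (h : IsCross g cr) {x y z : V} (hy : g y y = 1) (hxy : g x y = 0) (hyz : g y z = 0)
    (hz : g (cr x y) z = 0) : cr (cr x y) (cr y z) = cr x z := by
  have h1 := h.assoc (cr y z) x y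
  have e1 : g (cr y z) x = 0 := by rw [h.symm, ← h.cyc, hz]
  have e2 : g (cr y z) y = 0 := by rw [h.symm, h.left_orth]
  rw [h.mul_right hy hyz, e1, hxy, e2] at h1
  simp only [mul_zero, zero_smul, sub_zero] at h1
  rw [eq_neg_of_add_eq_zero_left h1, h.skew z x, neg_neg]

end IsCross

/-- Three linear conditions have a non-zero common solution in dimension greater than three, which
is then normalized. -/
theorem exists_unit_orth {g : V →ₗ[ℝ] V →ₗ[ℝ] ℝ} (hpos : ∀ u, u ≠ 0 → 0 < g u u)
    [FiniteDimensional ℝ V] (hV : 3 < Module.finrank ℝ V) (a b c : V) :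
    ∃ u, g u u = 1 ∧ g a u = 0 ∧ g b u = 0 ∧ g c u = 0 := by
  have hlt : Module.finrank ℝ (Fin 3 → ℝ) < Module.finrank ℝ V := by simpa using hV
  obtain ⟨v, hv, hv0⟩ := (LinearMap.pi ![g a, g b, g c] : V →ₗ[ℝ] (Fin 3 → ℝ)).ker.ne_bot_iff.1
    (LinearMap.ker_ne_bot_of_finrank_lt hlt)
  rw [LinearMap.mem_ker] at hv
  have h0 : g a v = 0 := congrFun hv 0
  have h1 : g b v = 0 := congrFun hv 1
  have h2 : g c v = 0 := congrFun hv 2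
  have hp := hpos v hv0
  refine ⟨(Real.sqrt (g v v))⁻¹ • v, ?_, by simp [h0], by simp [h1], by simp [h2]⟩
  simp only [map_smul, LinearMap.smul_apply, smul_eq_mul]
  rw [← mul_assoc, ← mul_inv, Real.mul_self_sqrt hp.le, inv_mul_cancel₀ hp.ne']

theorem phi0_add (i k : Fin 7) : phi0 i i k = 0 ∧ phi0 i (i + 1) k = del (i + 3) k ∧
    phi0 (i + 1) (i + 3) k = del i k ∧ phi0 (i + 3) i k = del (i + 1) k := by
  have : ∀ i k : Fin 7, phiZ i i k = 0 ∧ phiZ i (i + 1) k = delZ (i + 3) k ∧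
      phiZ (i + 1) (i + 3) k = delZ i k ∧ phiZ (i + 3) i k = delZ (i + 1) k := by decide +kernel
  obtain ⟨h0, h1, h2, h3⟩ := this i k
  simp only [phi0, h0, h1, h2, h3, delZ_cast, Int.cast_zero, and_self]

theorem fin7_diff (i j : Fin 7) : j = i ∨ (∃ p, i = p ∧ j = p + 1 ∨ i = p + 1 ∧ j = p) ∨
    (∃ p, i = p + 1 ∧ j = p + 3 ∨ i = p + 3 ∧ j = p + 1) ∨
    ∃ p, i = p + 3 ∧ j = p ∨ i = p ∧ j = p + 3 := by
  revert i j
  decide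

/-- As for the octonions, a unit vector `a`, a unit vector `b` orthogonal to it, and a unit vector
`d` orthogonal to `a`, `b` and `a × b` generate everything. The remaining four vectors are their
products, listed so that the multiplication table is cyclic modulo 7. -/
theorem exists_adapted_basis {g : V →ₗ[ℝ] V →ₗ[ℝ] ℝ} {cr : V →ₗ[ℝ] V →ₗ[ℝ] V}
    (h : IsCross g cr) [FiniteDimensional ℝ V] (hV : 3 < Module.finrank ℝ V) :
    ∃ e : Fin 7 → V, (∀ i j, g (e i) (e j) = del i j) ∧
      ∀ i j k, g (cr (e i) (e j)) (e k) = phi0 i j k := by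
  obtain ⟨a, ha, -, -, -⟩ := exists_unit_orth h.pos hV 0 0 0
  obtain ⟨b, hb, hab, -, -⟩ := exists_unit_orth h.pos hV a a a
  obtain ⟨d, hd, had, hbd, habd⟩ := exists_unit_orth h.pos hV a b (cr a b)
  have u3 := h.norm_cross ha hb hab
  have u4 := h.norm_cross hb hd hbd
  have u5 := h.norm_cross hd u3 (by rw [h.symm]; exact habd)
  have u6 := h.norm_cross ha hd had
  have hdab : g d (cr a b) = 0 := by rw [h.symm]; exact habd
  set e : Fin 7 → V := ![a, b, d, cr a b, cr b d, cr d (cr a b), cr a d] with he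
  -- The seven relations `e_i × e_{i+1} = e_{i+3}`, one for each line of the Fano plane, determine
  -- the whole table: any two distinct indices lie on exactly one line.
  have p0 : cr (e 0) (e 1) = e 3 ∧ g (e 0) (e 1) = 0 := ⟨rfl, hab⟩
  have p1 : cr (e 1) (e 2) = e 4 ∧ g (e 1) (e 2) = 0 := ⟨rfl, hbd⟩
  have p2 : cr (e 2) (e 3) = e 5 ∧ g (e 2) (e 3) = 0 := ⟨rfl, hdab⟩
  have p3 : cr (e 3) (e 4) = e 6 ∧ g (e 3) (e 4) = 0 :=
    ⟨h.cross_cross hb hab hbd habd, h.cross_orth hab had⟩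
  have p4 : cr (e 4) (e 5) = e 0 ∧ g (e 4) (e 5) = 0 := by
    refine ⟨(h.cross_cross hd hbd hdab ?_).trans (h.mul_left hb hab),
      h.cross_orth hbd (h.right_orth a b)⟩
    rw [h.symm]
    exact h.cross_orth hab had
  have p5 : cr (e 5) (e 6) = e 1 ∧ g (e 5) (e 6) = 0 := by
    have e5 : e 5 = -cr (cr a b) d := h.skew _ _
    have e6 : e 6 = -cr d a := h.skew _ _
    have hda : g d a = 0 := by rw [h.symm]; exact had
    have haba : g (cr a b) a = 0 := by rw [h.symm]; exact h.left_orth a b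
    rw [e5, e6]
    simp only [map_neg, LinearMap.neg_apply, neg_neg]
    refine ⟨(h.cross_cross hd habd hda ?_).trans (h.mul_right ha hab), h.cross_orth habd haba⟩
    rw [h.symm, ← h.cyc, h.skew a, h.mul_right ha hab, map_neg, LinearMap.neg_apply, hbd, neg_zero]
  have p6 : cr (e 6) (e 0) = e 2 ∧ g (e 6) (e 0) = 0 :=
    ⟨h.mul_right ha had, by rw [h.symm]; exact h.left_orth a d⟩
  have hu : ∀ i, g (e i) (e i) = 1 := by
    intro i
    fin_cases i
    exacts [ha, hb, hd, u3, u4, u5, u6]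
  have hp : ∀ i, cr (e i) (e (i + 1)) = e (i + 3) ∧ g (e i) (e (i + 1)) = 0 := by
    intro i
    fin_cases i
    exacts [p0, p1, p2, p3, p4, p5, p6]
  have q1 : ∀ i, cr (e (i + 1)) (e (i + 3)) = e i := fun i => by
    rw [← (hp i).1, h.mul_left (hu _) (hp i).2]
  have q2 : ∀ i, cr (e (i + 3)) (e i) = e (i + 1) := fun i => by
    rw [← (hp i).1, h.mul_right (hu _) (hp i).2]
  have o1 : ∀ i, g (e (i + 1)) (e (i + 3)) = 0 := fun i => by
    rw [← (hp i).1, h.right_orth]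
  have o2 : ∀ i, g (e (i + 3)) (e i) = 0 := fun i => by
    rw [← (hp i).1, h.symm, h.left_orth]
  have horth : ∀ i j, g (e i) (e j) = del i j := by
    intro i j
    rcases eq_or_ne i j with rfl | hij
    · rw [hu, del, if_pos rfl]
    · rw [del, if_neg hij]
      rcases fin7_diff i j with h0 | ⟨p, ⟨rfl, rfl⟩ | ⟨rfl, rfl⟩⟩ | ⟨p, ⟨rfl, rfl⟩ | ⟨rfl, rfl⟩⟩ |
        ⟨p, ⟨rfl, rfl⟩ | ⟨rfl, rfl⟩⟩
      · exact absurd h0.symm hij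
      · exact (hp _).2
      · rw [h.symm]; exact (hp _).2
      · exact o1 _
      · rw [h.symm]; exact o1 _
      · exact o2 _
      · rw [h.symm]; exact o2 _
  refine ⟨e, horth, fun i j k => ?_⟩
  rcases fin7_diff i j with rfl | ⟨p, ⟨rfl, rfl⟩ | ⟨rfl, rfl⟩⟩ | ⟨p, ⟨rfl, rfl⟩ | ⟨rfl, rfl⟩⟩ |
    ⟨p, ⟨rfl, rfl⟩ | ⟨rfl, rfl⟩⟩
  · rw [h.self, (phi0_add _ k).1, map_zero, LinearMap.zero_apply]
  · rw [(hp _).1, horth, (phi0_add _ k).2.1]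
  · rw [h.skew, (hp _).1, map_neg, LinearMap.neg_apply, horth, isAlt3_phi0.1 j,
      (phi0_add _ k).2.1]
  · rw [q1, horth, (phi0_add _ k).2.2.1]
  · rw [h.skew, q1, map_neg, LinearMap.neg_apply, horth, isAlt3_phi0.1 (_ + 1),
      (phi0_add _ k).2.2.1]
  · rw [q2, horth, (phi0_add _ k).2.2.2]
  · rw [h.skew, q2, map_neg, LinearMap.neg_apply, horth, isAlt3_phi0.1 (_ + 3),
      (phi0_add _ k).2.2.2]

end Cross

/-! ### The normal form of a `G₂`-form -/

/-- 2-forms commute: exchanging the two pairs of slots is an even permutation of the seven slots. -/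
theorem bForm_symm (c : C3) (i j : Fin 7) : bForm c j i = bForm c i j := by
  set σ : Equiv.Perm (Fin 7) := Equiv.swap 0 2 * Equiv.swap 1 3 with hσ
  have h : Equiv.Perm.sign σ = 1 := by
    rw [hσ, map_mul, Equiv.Perm.sign_swap (by decide), Equiv.Perm.sign_swap (by decide)]
    rfl
  simp only [bForm]
  congr 1
  rw [← Equiv.sum_comp (Equiv.arrowCongr σ (Equiv.refl (Fin 7)))]
  refine Finset.sum_congr rfl fun s _ => ?_
  have e : ∀ k, Equiv.arrowCongr σ (Equiv.refl (Fin 7)) s k = s (σ.symm k) := fun k => rfl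
  have e2 : permSymbol (Equiv.arrowCongr σ (Equiv.refl (Fin 7)) s) = permSymbol s := by
    have := permSymbol_perm σ (fun k => s (σ.symm k))
    simp only [Equiv.symm_apply_apply, h] at this
    simp only [Units.val_one, Int.cast_one, one_mul] at this
    exact this.symm
  have f0 : σ.symm 0 = 2 := by decide
  have f1 : σ.symm 1 = 3 := by decide
  have f2 : σ.symm 2 = 0 := by decide
  have f3 : σ.symm 3 = 1 := by decide
  have f4 : σ.symm 4 = 4 := by decide
  have f5 : σ.symm 5 = 5 := by decide
  have f6 : σ.symm 6 = 6 := by decide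
  rw [e2, e, e, e, e, e, e, e, f0, f1, f2, f3, f4, f5, f6]
  ring

theorem bForm_quad (c : C3) (v : Fin 7 → ℝ) :
    ∑ i, ∑ j, bForm c i j * v i * v j = -6 * (v ⬝ᵥ (bMat c).mulVec v) := by
  simp only [dotProduct, Matrix.mulVec, bMat, Matrix.of_apply, Finset.mul_sum]
  exact Finset.sum_congr rfl fun a _ => Finset.sum_congr rfl fun b _ => by ring

theorem IsG2At.det_ne_zero {c : C3} (hc : IsG2At c) : (bMat c).det ≠ 0 := by
  intro h
  obtain ⟨v, hv, h0⟩ := Matrix.exists_mulVec_eq_zero_iff.2 h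
  exact hc v hv (by rw [bForm_quad, h0]; simp)

/-- The quadratic form `B(v, v)` has no zero on the connected set of non-zero vectors, hence is
definite. If `b` is negative definite then `det b < 0`, the dimension being odd, so `m < 0` and `g =
b / m` is positive definite in this case as well. -/
theorem IsG2At.posDef {c : C3} (hc : IsG2At c) : (Matrix.of (metric c) : Mat).PosDef := by
  have hsym : (bMat c).IsHermitian := by
    ext i j
    simp [bMat, bForm_symm c i j]
  set Q : (Fin 7 → ℝ) → ℝ := fun v => v ⬝ᵥ (bMat c).mulVec v with hQ
  have hne : ∀ v, v ≠ 0 → Q v ≠ 0 := fun v hv h0 => hc v hv (by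
    rw [bForm_quad]; exact mul_eq_zero_of_right _ h0)
  have hcont : Continuous Q := by
    simp only [hQ, dotProduct, Matrix.mulVec]
    fun_prop
  have hconn : IsPreconnected ({0}ᶜ : Set (Fin 7 → ℝ)) :=
    (isConnected_compl_singleton_of_one_lt_rank (by simp) 0).isPreconnected
  have himg := (hconn.image Q hcont.continuousOn).ordConnected
  have hsign : (∀ v, v ≠ 0 → 0 < Q v) ∨ ∀ v, v ≠ 0 → Q v < 0 := by
    by_contra hcon
    push Not at hcon
    obtain ⟨⟨u, hu, hu'⟩, v, hv, hv'⟩ := hcon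
    obtain ⟨w, hw, hw0⟩ := himg.out ⟨u, hu, rfl⟩ ⟨v, hv, rfl⟩ ⟨hu', hv'⟩
    exact hne w hw hw0
  rcases hsign with hs | hs
  · have hp : (bMat c).PosDef := Matrix.posDef_iff_dotProduct_mulVec.2
      ⟨hsym, fun x hx => by simpa [hQ] using hs x hx⟩
    have hm : 0 < volCoeff c := by
      have := hp.det_pos
      rw [← volCoeff_pow] at this
      exact (Odd.pow_pos_iff (by decide)).1 this
    rw [of_metric]
    exact hp.smul (inv_pos.2 hm)
  · have hp : (-bMat c).PosDef := Matrix.posDef_iff_dotProduct_mulVec.2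
      ⟨hsym.neg, fun x hx => by
        have := hs x hx
        simp only [hQ] at this
        simpa [Matrix.neg_mulVec] using this⟩
    have hm : volCoeff c < 0 := by
      have := hp.det_pos
      rw [Matrix.det_neg, ← volCoeff_pow] at this
      norm_num at this
      exact (Odd.pow_neg_iff (by decide)).1 this
    have e : (Matrix.of (metric c) : Mat) = (-volCoeff c)⁻¹ • -bMat c := by
      rw [of_metric, inv_neg, smul_neg, neg_smul, neg_neg]
    rw [e]
    exact hp.smul (inv_pos.2 (neg_pos.2 hm))

theorem sum2_mul_sum2_a (P Q : C2) : (∑ i, ∑ a, P i a) * ∑ j, ∑ b, Q j b =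
    ∑ i, ∑ j, ∑ a, ∑ b, P i a * Q j b := by
  rw [sum4_eq_prod, sum2_eq_prod, sum2_eq_prod, Finset.sum_mul_sum, ← Fintype.sum_prod_type']
  exact Fintype.sum_equiv ⟨fun x => (x.1.1, x.2.1, x.1.2, x.2.2),
    fun x => ((x.1, x.2.2.1), (x.2.1, x.2.2.2)), fun _ => rfl, fun _ => rfl⟩ _ _ fun _ => rfl

theorem sum2_mul_sum2_b (P Q : C2) : (∑ i, ∑ j, P i j) * ∑ a, ∑ b, Q a b =
    ∑ i, ∑ j, ∑ a, ∑ b, P i j * Q a b := by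
  rw [sum4_eq_prod, sum2_eq_prod, sum2_eq_prod, Finset.sum_mul_sum, ← Fintype.sum_prod_type']
  exact Fintype.sum_equiv ⟨fun x => (x.1.1, x.1.2, x.2.1, x.2.2),
    fun x => ((x.1, x.2.1), (x.2.2.1, x.2.2.2)), fun _ => rfl, fun _ => rfl⟩ _ _ fun _ => rfl

theorem sum2_mul_sum2_c (P Q : C2) : (∑ a, ∑ j, P a j) * ∑ i, ∑ b, Q i b =
    ∑ i, ∑ j, ∑ a, ∑ b, P a j * Q i b := by
  rw [sum4_eq_prod, sum2_eq_prod, sum2_eq_prod, Finset.sum_mul_sum, ← Fintype.sum_prod_type']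
  exact Fintype.sum_equiv ⟨fun x => (x.2.1, x.1.2, x.1.1, x.2.2),
    fun x => ((x.2.2.1, x.2.1), (x.1, x.2.2.2)), fun _ => rfl, fun _ => rfl⟩ _ _ fun _ => rfl

/-- Raising the last index of `φ` with the positive definite metric gives a bilinear product;
skewness and cyclicity are those of `φ`, and the norm identity is `IsAlt3.contr_symm`. An adapted
basis for this cross product is a basis in which `φ` has the components of the model form. -/
theorem IsG2At.isModel {c : C3} (hc : IsG2At c) (halt : IsAlt3 c) : IsModel c := by
  have hd := hc.det_ne_zero
  have hp := hc.posDef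
  set G : Mat := Matrix.of (metric c) with hG
  have hGd : IsUnit G.det := hp.det_pos.ne'.isUnit
  have hGs : ∀ i j, G j i = G i j := fun i j => by
    simpa using hp.isHermitian.apply i j
  have hco : ∀ w : C1, G.mulVec ((coMat c).mulVec w) = w := fun w => by
    rw [Matrix.mulVec_mulVec, coMat, ← hG, Matrix.mul_nonsing_inv _ hGd, Matrix.one_mulVec]
  set g : (Fin 7 → ℝ) →ₗ[ℝ] (Fin 7 → ℝ) →ₗ[ℝ] ℝ := Matrix.toLinearMap₂' ℝ G with hg
  have hgv : ∀ u v, g u v = u ⬝ᵥ G.mulVec v := fun u v => Matrix.toLinearMap₂'_apply' G u v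
  set low : (Fin 7 → ℝ) →ₗ[ℝ] (Fin 7 → ℝ) →ₗ[ℝ] (Fin 7 → ℝ) :=
    LinearMap.mk₂ ℝ (fun u v k => ∑ i, ∑ j, u i * v j * c i j k)
      (fun u u' v => by ext k; simp [add_mul, Finset.sum_add_distrib])
      (fun r u v => by ext k; simp [Finset.mul_sum, mul_assoc])
      (fun u v v' => by ext k; simp [add_mul, mul_add, Finset.sum_add_distrib])
      (fun r u v => by
        ext k
        simp only [Pi.smul_apply, smul_eq_mul, Finset.mul_sum]
        exact Finset.sum_congr rfl fun i _ => Finset.sum_congr rfl fun j _ => by ring) with hlow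
  set cr : (Fin 7 → ℝ) →ₗ[ℝ] (Fin 7 → ℝ) →ₗ[ℝ] (Fin 7 → ℝ) :=
    low.compr₂ (Matrix.mulVecLin (coMat c)) with hcr
  have hcrv : ∀ u v, cr u v = (coMat c).mulVec (low u v) := fun u v => rfl
  have hsymm : ∀ u v, g u v = g v u := fun u v => by
    simp only [hgv, dotProduct, Matrix.mulVec, Finset.mul_sum]
    rw [Finset.sum_comm]
    exact Finset.sum_congr rfl fun i _ => Finset.sum_congr rfl fun j _ => by rw [hGs i j]; ring
  have htri : ∀ u v w, g (cr u v) w = ∑ i, ∑ j, ∑ k, u i * v j * w k * c i j k := by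
    intro u v w
    rw [hsymm, hgv, hcrv, hco]
    simp only [hlow, LinearMap.mk₂_apply, dotProduct, Finset.mul_sum, sum3_eq_prod]
    exact Fintype.sum_equiv ⟨fun x => (x.2.1, x.2.2, x.1), fun x => (x.2.2, x.1, x.2.1),
      fun _ => rfl, fun _ => rfl⟩ _ _ fun x => by simp; ring
  have hcross : ∀ u v w z, g (cr u v) (cr w z) =
      ∑ i, ∑ j, ∑ a, ∑ b, u i * v j * w a * z b * contr (coMat c) c i j a b := by
    intro u v w z
    rw [hsymm, hgv, hcrv u v, hco]
    have hl : ∀ u v k, low u v k = ∑ x : Fin 7 × Fin 7, u x.1 * v x.2 * c x.1 x.2 k :=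
      fun u v k => by simp only [hlow, LinearMap.mk₂_apply, sum2_eq_prod]
    have e4 : ∀ F : Fin 7 → Fin 7 → Fin 7 → Fin 7 → ℝ, ∑ p, ∑ q, ∑ r, ∑ s, F p q r s =
        ∑ x : Fin 7 × Fin 7, ∑ y : Fin 7 × Fin 7, F x.1 x.2 y.1 y.2 := fun F => by
      simp [Fintype.sum_prod_type]
    rw [e4]
    simp only [hcrv, dotProduct, Matrix.mulVec, contr, Finset.sum_mul, mul_assoc]
    simp only [hl, sum2_eq_prod, Finset.sum_mul_sum]
    simp only [Finset.mul_sum]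
    conv_lhs =>
      enter [2, x]
      rw [Finset.sum_comm]
    rw [Finset.sum_comm]
    refine Finset.sum_congr rfl fun x _ => ?_
    rw [Finset.sum_comm]
    exact Finset.sum_congr rfl fun y _ => Finset.sum_congr rfl fun z _ => by ring
  have hC : IsCross g cr := by
    refine ⟨hsymm, fun u hu => ?_, fun u v => ?_, fun u v w => ?_, fun u v w z => ?_⟩
    · rw [hgv]
      simpa using hp.dotProduct_mulVec_pos hu
    · rw [hcrv, hcrv, ← Matrix.mulVec_neg]
      congr 1
      ext k
      simp only [hlow, LinearMap.mk₂_apply, Pi.neg_apply, ← Finset.sum_neg_distrib]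
      rw [Finset.sum_comm]
      exact Finset.sum_congr rfl fun i _ => Finset.sum_congr rfl fun j _ => by
        rw [halt.1 i j]; ring
    · rw [hsymm u, htri, htri]
      simp only [sum3_eq_prod]
      exact Fintype.sum_equiv ⟨fun x => (x.2.1, x.2.2, x.1), fun x => (x.2.2, x.1, x.2.1),
        fun _ => rfl, fun _ => rfl⟩ _ _ fun x => by
          simp only [Equiv.coe_fn_mk]
          rw [halt.cyc x.1]
          ring
    · have hgs : ∀ u v, g u v = ∑ i, ∑ j, u i * v j * G i j := fun u v => by
        simp only [hgv, dotProduct, Matrix.mulVec, Finset.mul_sum]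
        exact Finset.sum_congr rfl fun i _ => Finset.sum_congr rfl fun j _ => by ring
      have key := fun i j a b => halt.contr_symm hd i j a b
      have h2 : ∑ i, ∑ j, ∑ a, ∑ b, w i * v j * u a * z b * contr (coMat c) c i j a b =
          ∑ i, ∑ j, ∑ a, ∑ b, u i * v j * w a * z b * contr (coMat c) c a j i b := by
        rw [sum4_eq_prod, sum4_eq_prod]
        exact Fintype.sum_equiv ⟨fun x => (x.2.2.1, x.2.1, x.1, x.2.2.2),
          fun x => (x.2.2.1, x.2.1, x.1, x.2.2.2), fun _ => rfl, fun _ => rfl⟩ _ _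
          fun x => by simp only [Equiv.coe_fn_mk]; ring
      rw [hcross, hcross, h2]
      simp only [← Finset.sum_add_distrib, ← mul_add, key, symProd]
      rw [hgs u w, hgs v z, hgs u v, hgs w z, hgs w v, hgs u z, sum2_mul_sum2_a, sum2_mul_sum2_b,
        sum2_mul_sum2_c]
      simp only [Finset.mul_sum, ← Finset.sum_sub_distrib]
      refine Finset.sum_congr rfl fun i _ => Finset.sum_congr rfl fun j _ =>
        Finset.sum_congr rfl fun a _ => Finset.sum_congr rfl fun b _ => ?_
      change u i * v j * w a * z b * (2 * (G i a * G j b) - G i j * G a b - G a j * G i b) = _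
      ring
  -- The matrix with these columns pulls `c` back to `phi0`. Orthonormality makes it invertible, so
  -- its inverse exhibits `c` as a pullback of `phi0`.
  obtain ⟨e, he, hce⟩ := exists_adapted_basis hC (by simp)
  set E : Mat := Matrix.of fun a i => e i a with hE
  have hpull : pull3 E c = phi0 := by
    ext i j k
    rw [← hce, htri, tens3_apply]
    rfl
  have hEd : E.det ≠ 0 := by
    intro h0
    have : E.transpose * G * E = 1 := by
      ext i j
      have := he i j
      rw [hgv] at this
      rw [Matrix.mul_assoc, Matrix.one_apply, ← del, ← this]
      simp only [Matrix.mul_apply, Matrix.transpose_apply, dotProduct, Matrix.mulVec]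
      rfl
    have h1 := congrArg Matrix.det this
    rw [Matrix.det_mul, h0, mul_zero, Matrix.det_one] at h1
    exact zero_ne_one h1
  refine ⟨E⁻¹, ?_, ?_⟩
  · rw [Matrix.det_nonsing_inv]
    rw [Ring.inverse_eq_inv']
    exact inv_ne_zero hEd
  · rw [← hpull]
    change tens3 _ (tens3 _ c) = c
    rw [tens3_mul, ← Matrix.transpose_mul, Matrix.mul_nonsing_inv _ hEd.isUnit,
      Matrix.transpose_one, tens3_one]

/-! ### Model forms -/

theorem IsModel.pull3 {c : C3} (hc : IsModel c) {A : Mat} (hA : A.det ≠ 0) :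
    IsModel (pull3 A c) := by
  obtain ⟨B, hB, rfl⟩ := hc
  refine ⟨B * A, by rw [Matrix.det_mul]; exact mul_ne_zero hB hA, ?_⟩
  change _ = tens3 _ (tens3 _ _)
  rw [tens3_mul, ← Matrix.transpose_mul]

theorem pull3_inv {A : Mat} (hA : A.det ≠ 0) (c : C3) : pull3 A (pull3 A⁻¹ c) = c := by
  change tens3 _ (tens3 _ c) = c
  rw [tens3_mul, ← Matrix.transpose_mul, Matrix.nonsing_inv_mul _ hA.isUnit,
    Matrix.transpose_one, tens3_one]

theorem IsModel.cometric_symm {c : C3} (hc : IsModel c) (i j : Fin 7) :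
    cometric c j i = cometric c i j := by
  have h : (Matrix.of (metric c) : Mat).transpose = Matrix.of (metric c) := by
    ext i j
    exact metric_symm hc i j
  have h2 : (coMat c).transpose = coMat c := by
    rw [coMat, Matrix.transpose_nonsing_inv, h]
  exact congrFun (congrFun h2 i) j

theorem IsModel.isUnit_metric {c : C3} (hc : IsModel c) :
    IsUnit (Matrix.of (metric c) : Mat).det := by
  obtain ⟨A, hA, rfl⟩ := hc
  rw [of_metric_pull hA, of_metric_phi0]
  simp [Matrix.det_mul, hA]

theorem IsModel.metric_mul_coMat {c : C3} (hc : IsModel c) :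
    (Matrix.of (metric c) : Mat) * coMat c = 1 := Matrix.mul_nonsing_inv _ hc.isUnit_metric

theorem IsModel.coMat_mul_metric {c : C3} (hc : IsModel c) :
    coMat c * (Matrix.of (metric c) : Mat) = 1 := Matrix.nonsing_inv_mul _ hc.isUnit_metric

theorem IsModel.sum_cometric_metric {c : C3} (hc : IsModel c) (i j : Fin 7) :
    ∑ a, cometric c i a * metric c a j = del i j := by
  have := congrFun (congrFun hc.coMat_mul_metric i) j
  rwa [Matrix.mul_apply, Matrix.one_apply] at this

/-! ### Smooth dependence of the operations on the form -/

theorem contDiffAt_ninthRoot {n : WithTop ℕ∞} {x : ℝ} (hx : x ≠ 0) :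
    ContDiffAt ℝ n ninthRoot x := by
  rcases lt_or_gt_of_ne hx with h | h
  · have e : ninthRoot =ᶠ[nhds x] fun y => -(-y) ^ ((1 : ℝ) / 9) := by
      filter_upwards [eventually_lt_nhds h] with y hy
      rw [ninthRoot, sign_neg hy, abs_of_neg hy]
      simp
    refine ContDiffAt.congr_of_eventuallyEq ?_ e
    exact (contDiffAt_id.neg.rpow_const_of_ne (by simpa using hx)).neg
  · have e : ninthRoot =ᶠ[nhds x] fun y => y ^ ((1 : ℝ) / 9) := by
      filter_upwards [eventually_gt_nhds h] with y hy
      rw [ninthRoot, sign_pos hy, abs_of_pos hy]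
      simp
    exact ContDiffAt.congr_of_eventuallyEq (contDiffAt_id.rpow_const_of_ne hx) e

section Smooth

variable {E : Type*} [NormedAddCommGroup E] [NormedSpace ℝ E] {n : WithTop ℕ∞} {f : E → C3}
  {s : Set E}

theorem contDiffOn_bMat (hf : ∀ i j k, ContDiffOn ℝ n (fun x => f x i j k) s) (i j : Fin 7) :
    ContDiffOn ℝ n (fun x => bMat (f x) i j) s := by
  simp only [bMat, bForm, Matrix.of_apply]
  fun_prop

theorem contDiffOn_det {B : E → Mat} (hB : ∀ i j, ContDiffOn ℝ n (fun x => B x i j) s) :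
    ContDiffOn ℝ n (fun x => (B x).det) s := by
  simp only [Matrix.det_apply]
  fun_prop

theorem contDiffOn_inv {B : E → Mat} (hB : ∀ i j, ContDiffOn ℝ n (fun x => B x i j) s)
    (h0 : ∀ x ∈ s, (B x).det ≠ 0) (i j : Fin 7) : ContDiffOn ℝ n (fun x => (B x)⁻¹ i j) s := by
  have h : ContDiffOn ℝ n (fun x => (B x).adjugate i j) s := by
    simp only [Matrix.adjugate_apply]
    refine contDiffOn_det fun p q => ?_
    by_cases hp : p = j
    · subst hp
      simp only [Matrix.updateRow_self]
      fun_prop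
    · simp only [Matrix.updateRow_ne hp]
      exact hB p q
  simp only [Matrix.inv_def, Ring.inverse_eq_inv', Matrix.smul_apply, smul_eq_mul]
  exact ((contDiffOn_det hB).inv h0).mul h

theorem det_metric_ne_zero {c : C3} (hc : (bMat c).det ≠ 0) :
    (Matrix.of (metric c) : Mat).det ≠ 0 := by
  rw [of_metric, Matrix.det_smul]
  exact mul_ne_zero (pow_ne_zero _ (inv_ne_zero (volCoeff_ne_zero hc))) hc

theorem contDiffOn_volCoeff (hf : ∀ i j k, ContDiffOn ℝ n (fun x => f x i j k) s)
    (h0 : ∀ x ∈ s, (bMat (f x)).det ≠ 0) : ContDiffOn ℝ n (fun x => volCoeff (f x)) s := by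
  simp only [volCoeff_eq]
  intro x hx
  exact (contDiffAt_ninthRoot (h0 x hx)).comp_contDiffWithinAt x
    (contDiffOn_det (contDiffOn_bMat hf) x hx)

theorem contDiffOn_metric (hf : ∀ i j k, ContDiffOn ℝ n (fun x => f x i j k) s)
    (h0 : ∀ x ∈ s, (bMat (f x)).det ≠ 0) (i j : Fin 7) :
    ContDiffOn ℝ n (fun x => metric (f x) i j) s := by
  have h : ∀ x, metric (f x) i j = (volCoeff (f x))⁻¹ * bMat (f x) i j := fun x =>
    congrFun (congrFun (of_metric (f x)) i) j
  simp only [h]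
  exact ((contDiffOn_volCoeff hf h0).inv fun x hx => volCoeff_ne_zero (h0 x hx)).mul
    (contDiffOn_bMat hf i j)

theorem contDiffOn_cometric (hf : ∀ i j k, ContDiffOn ℝ n (fun x => f x i j k) s)
    (h0 : ∀ x ∈ s, (bMat (f x)).det ≠ 0) (i j : Fin 7) :
    ContDiffOn ℝ n (fun x => cometric (f x) i j) s :=
  contDiffOn_inv (B := fun x => Matrix.of (metric (f x))) (contDiffOn_metric hf h0)
    (fun x hx => det_metric_ne_zero (h0 x hx)) i j

theorem contDiffOn_psi (hf : ∀ i j k, ContDiffOn ℝ n (fun x => f x i j k) s)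
    (h0 : ∀ x ∈ s, (bMat (f x)).det ≠ 0) (i j k l : Fin 7) :
    ContDiffOn ℝ n (fun x => psi (f x) i j k l) s := by
  have h1 := contDiffOn_cometric hf h0
  have h2 := contDiffOn_volCoeff hf h0
  simp only [psi, raise3]
  fun_prop

/-- `X_q = (1/24) α_{ijk} ψ_{qijk}`, the coefficient of `ψ` in the decomposition of `α`. -/
def psiPart (c α : C3) : C1 := fun q =>
  (1 / 24) * ∑ i, ∑ j, ∑ k, raise3 c α i j k * psi c q i j k

theorem contDiffOn_psiPart {g : E → C3} (hf : ∀ i j k, ContDiffOn ℝ n (fun x => f x i j k) s)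
    (hg : ∀ i j k, ContDiffOn ℝ n (fun x => g x i j k) s)
    (h0 : ∀ x ∈ s, (bMat (f x)).det ≠ 0) (q : Fin 7) :
    ContDiffOn ℝ n (fun x => psiPart (f x) (g x) q) s := by
  have h1 := contDiffOn_cometric hf h0
  have h2 := contDiffOn_psi hf h0
  simp only [psiPart, raise3]
  fun_prop

end Smooth

theorem isOpen_det_bMat : IsOpen {c : C3 | (bMat c).det ≠ 0} := by
  have h : Continuous fun c : C3 => (bMat c).det := by
    have : ∀ i j, ContDiff ℝ 0 fun c : C3 => bMat c i j := fun i j =>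
      contDiffOn_univ.1 (contDiffOn_bMat (f := id) (fun i j k => by
        simp only [id]; fun_prop) i j)
    exact (contDiff_det this).continuous
  exact isOpen_ne.preimage h

theorem psiPart_pull {A : Mat} (hA : A.det ≠ 0) (c α : C3) :
    psiPart (pull3 A c) (pull3 A α) = mv A.transpose (psiPart c α) := by
  ext q
  have h : ∀ q, psi (pull3 A c) q = tens3 A.transpose (fun i j k => ∑ a, A a q * psi c a i j k) := by
    intro q
    rw [psi_pull hA]
    have e : (fun i j k => ∑ a, A a q * psi c a i j k) = ∑ a, A a q • psi c a := by
      ext i j k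
      simp
    rw [e, map_sum]
    simp only [map_smul]
    rfl
  simp only [psiPart, h, dual3, push_raise3 hA, mv_apply_real, Finset.mul_sum,
    Matrix.transpose_apply]
  have e : ∀ (F : Fin 7 → Fin 7 → Fin 7 → Fin 7 → ℝ), ∑ i, ∑ j, ∑ k, ∑ a, F i j k a =
      ∑ a, ∑ i, ∑ j, ∑ k, F i j k a := by
    intro F
    refine (Finset.sum_congr rfl fun i _ => ?_).trans Finset.sum_comm
    refine (Finset.sum_congr rfl fun j _ => Finset.sum_comm).trans Finset.sum_comm
  rw [e]
  refine Finset.sum_congr rfl fun a _ => Finset.sum_congr rfl fun i _ =>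
    Finset.sum_congr rfl fun j _ => Finset.sum_congr rfl fun k _ => by ring

/-! ### Operations at the model form -/

theorem raise1_phi0 (X : C1) : raise1 phi0 X = X := by rw [raise1_eq, coMat_phi0, mv_one]

theorem raise2_phi0 (X : C2) : raise2 phi0 X = X := by rw [raise2_eq, coMat_phi0, tens2_one]

theorem raise3_phi0 (X : C3) : raise3 phi0 X = X := by rw [raise3_eq, coMat_phi0, tens3_one]

theorem tr_phi0 (w : C2) : tr phi0 w = ∑ i, w i i := by
  simp [tr, cometric_phi0, del]

theorem hookPsi_phi0 (X : C1) (i j k : Fin 7) : hookPsi phi0 X i j k = ∑ l, X l * psi0 l i j k := by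
  rw [hookPsi, raise1_phi0, psi_phi0]

theorem psiPart_phi0 (α : C3) (q : Fin 7) :
    psiPart phi0 α q = (1 / 24) * ∑ i, ∑ j, ∑ k, α i j k * psi0 q i j k := by
  rw [psiPart, raise3_phi0, psi_phi0]

theorem psi0_swap (i j k l : Fin 7) : psi0 j i k l = -psi0 i j k l := isAlt4_psi0.2 i j k l
theorem psi0_swap2 (i j k l : Fin 7) : psi0 i k j l = -psi0 i j k l := (isAlt4_psi0.1 i).1 j k l
theorem psi0_swap3 (i j k l : Fin 7) : psi0 i j l k = -psi0 i j k l := (isAlt4_psi0.1 i).2 j k l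
theorem phi0_swap (i j k : Fin 7) : phi0 j i k = -phi0 i j k := isAlt3_phi0.1 i j k
theorem phi0_swap2 (i j k : Fin 7) : phi0 i k j = -phi0 i j k := isAlt3_phi0.2 i j k
theorem phi0_cyc (i j k : Fin 7) : phi0 j k i = phi0 i j k := isAlt3_phi0.cyc i j k

/-- By skewness of `φ` and `ψ` the three terms of the infinitesimal action contribute equally, and
each contraction of `φ` with `ψ` over two indices gives a factor 4, so the constant is `3 · 4 / 24 =
1 / 2`. -/
theorem psiPart_inf3 (M : Mat) (q : Fin 7) :
    psiPart phi0 (inf3 M phi0) q = (1 / 2) * ∑ a, ∑ i, M a i * phi0 a i q := by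
  have e : ∀ a i, ∑ j, ∑ k, phi0 a j k * psi0 q i j k = 4 * phi0 a i q := fun a i => by
    rw [phi0_mul_psi0_two, phi0_swap2 a i q]; ring
  set G : C3 := fun i j k => (∑ a, M a i * phi0 a j k) * psi0 q i j k with hG
  have e1 : ∑ i, ∑ j, ∑ k, G i j k = ∑ i, ∑ a, M a i * (4 * phi0 a i q) := by
    refine Finset.sum_congr rfl fun i _ => ?_
    simp only [hG, ← e, Finset.sum_mul, sum2_eq_prod, Finset.mul_sum]
    simp only [Fintype.sum_prod_type]
    simp only [Finset.sum_comm (t := (Finset.univ : Finset (Fin 7))) (s := Finset.univ)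
      (f := fun j k => ∑ a, M a i * phi0 a j k * psi0 q i j k)]
    rw [Finset.sum_congr rfl fun k _ => Finset.sum_comm, Finset.sum_comm]
    refine Finset.sum_congr rfl fun a _ => ?_
    rw [Finset.sum_comm]
    simp only [mul_assoc]
  have e2 : ∀ i j k, inf3 M phi0 i j k * psi0 q i j k = G i j k + G j i k + G k j i := by
    intro i j k
    simp only [hG, inf3, Finset.sum_add_distrib, psi0_swap2 q i j k,
      ((isAlt4_psi0.1 q).swap13 i j k), add_mul]
    have t1 : ∀ a, phi0 i a k = -phi0 a i k := fun a => phi0_swap a i k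
    have t2 : ∀ a, phi0 i j a = -phi0 a j i := fun a => isAlt3_phi0.swap13 a j i
    simp only [t1, t2, mul_neg, Finset.sum_neg_distrib, neg_mul]
  simp only [psiPart_phi0, e2, Finset.sum_add_distrib]
  rw [Finset.sum_comm (f := fun i j => ∑ k, G j i k)]
  have e3 : ∑ i, ∑ j, ∑ k, G k j i = ∑ i, ∑ j, ∑ k, G i j k := by
    rw [Finset.sum_congr rfl fun i _ => Finset.sum_comm, Finset.sum_comm]
    refine Finset.sum_congr rfl fun i _ => Finset.sum_comm
  rw [e3, e1, Finset.sum_comm]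
  simp only [Finset.mul_sum, ← Finset.sum_add_distrib]
  exact Finset.sum_congr rfl fun i _ => Finset.sum_congr rfl fun a _ => by ring

/-- The hypothesis intertwines the curves `1 + s N` and `1 + s M` through `A`; the claim is the
derivative of the resulting identity of pullbacks. -/
theorem inf3_pull {A M N : Mat} (h : A * N = M * A) (c : C3) :
    inf3 N (pull3 A c) = pull3 A (inf3 M c) := by
  have h1 := hasDerivAt_pull3 N (pull3 A c)
  have h2 := (LinearMap.toContinuousLinearMap (pull3 A)).hasFDerivAt.comp_hasDerivAt (0 : ℝ)
    (hasDerivAt_pull3 M c)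
  refine h1.unique (h2.congr_of_eventuallyEq (Filter.Eventually.of_forall fun s => ?_))
  change tens3 _ (tens3 _ c) = tens3 _ (tens3 _ c)
  rw [tens3_mul, tens3_mul, ← Matrix.transpose_mul, ← Matrix.transpose_mul]
  congr 2
  rw [mul_add, add_mul, mul_one, one_mul, Matrix.mul_smul, Matrix.smul_mul, h]

theorem diamond_eq (c : C3) (h : C2) :
    diamond c h = inf3 ((Matrix.of h : Mat) * coMat c).transpose c := by
  ext i j k
  simp only [diamond, inf3, Matrix.transpose_apply, Matrix.mul_apply, cometric_eq, Matrix.of_apply,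
    Finset.sum_mul, ← Finset.sum_add_distrib]
  rw [Finset.sum_comm]
  exact Finset.sum_congr rfl fun q _ => Finset.sum_congr rfl fun p _ => by ring

theorem diamond_pull {A : Mat} (hA : A.det ≠ 0) (c : C3) (h : C2) :
    diamond (pull3 A c) (tens2 A.transpose h) = pull3 A (diamond c h) := by
  rw [diamond_eq, diamond_eq]
  refine inf3_pull ?_ c
  rw [← Matrix.transpose_inj, Matrix.transpose_mul, Matrix.transpose_mul (Matrix.transpose _) A,
    Matrix.transpose_transpose, Matrix.transpose_transpose, of_tens2, ← coMat_pull hA c]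
  simp only [Matrix.mul_assoc, Matrix.transpose_transpose]

theorem diamond_phi0 (h : C2) : diamond phi0 h = inf3 (Matrix.of h).transpose phi0 := by
  rw [diamond_eq, coMat_phi0, mul_one]

/-- Expanding `φ_{abl} ψ_{lijk}` gives six terms `δ φ`, which for skew `S` combine in pairs to the
infinitesimal action. So a skew matrix acts on the model form only through its contraction with `φ`,
that is, through its 7-dimensional component. -/
theorem inf3_skew {S : Mat} (hS : ∀ a b, S b a = -S a b) :
    inf3 S phi0 = hookPsi phi0 (fun l => (1 / 2) * ∑ a, ∑ b, S a b * phi0 a b l) := by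
  ext i j k
  rw [hookPsi_phi0]
  have e : ∀ a b, ∑ l, phi0 a b l * psi0 l i j k = _ := fun a b => phi0_mul_psi0 a b i j k
  have e1 : ∑ l, (1 / 2) * (∑ a, ∑ b, S a b * phi0 a b l) * psi0 l i j k =
      (1 / 2) * ∑ a, ∑ b, S a b * ∑ l, phi0 a b l * psi0 l i j k := by
    simp only [Finset.mul_sum, Finset.sum_mul]
    rw [Finset.sum_comm]
    refine Finset.sum_congr rfl fun a _ => ?_
    rw [Finset.sum_comm]
    exact Finset.sum_congr rfl fun b _ => Finset.sum_congr rfl fun l _ => by ring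
  have f1 : ∀ (F : C2) i, ∑ a, ∑ b, S a b * (del b i * F a b) = ∑ a, S a i * F a i := by
    intro F i
    refine Finset.sum_congr rfl fun a _ => ?_
    simp only [mul_left_comm (S a _), del_sum]
  have f2 : ∀ (F : C2) i, ∑ a, ∑ b, S a b * (del a i * F a b) = ∑ b, S i b * F i b := by
    intro F i
    rw [Finset.sum_comm]
    refine Finset.sum_congr rfl fun b _ => ?_
    simp only [mul_left_comm (S _ b), del_sum]
  rw [e1]
  simp only [e, mul_sub, mul_add, Finset.sum_sub_distrib, Finset.sum_add_distrib]
  rw [f1 (fun a _ => phi0 a j k), f1 (fun a _ => phi0 i a k), f1 (fun a _ => phi0 i j a),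
    f2 (fun _ b => phi0 b j k), f2 (fun _ b => phi0 i b k), f2 (fun _ b => phi0 i j b), inf3]
  simp only [Finset.mul_sum, ← Finset.sum_add_distrib, ← Finset.sum_sub_distrib]
  refine Finset.sum_congr rfl fun a _ => ?_
  rw [hS a i, hS a j, hS a k]
  ring

/-- The factor `1 / 3` normalizes the skew matrix `X ⌟ φ`: contracting it with `φ` gives `6 X`, and
`inf3_skew` contributes `1 / 2`. -/
theorem hookPsi_eq_inf3_phi0 (X : C1) : hookPsi phi0 X =
    inf3 (Matrix.of fun a i => (1 / 3) * ∑ l, X l * phi0 l a i) phi0 := by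
  rw [inf3_skew]
  · congr 1
    ext l
    have e1 : ∑ a, ∑ b, (1 / 3) * (∑ m, X m * phi0 m a b) * phi0 a b l =
      (1 / 3) * ∑ m, X m * ∑ a, ∑ b, phi0 m a b * phi0 l a b := by
      simp only [Finset.mul_sum, Finset.sum_mul]
      rw [Finset.sum_congr rfl fun a _ => Finset.sum_comm, Finset.sum_comm]
      refine Finset.sum_congr rfl fun m _ => Finset.sum_congr rfl fun a _ =>
        Finset.sum_congr rfl fun b _ => ?_
      rw [phi0_cyc l a b]
      ring
    simp only [Matrix.of_apply]
    rw [e1]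
    simp only [phi0_mul_phi0_two, mul_left_comm (X _), ← Finset.mul_sum]
    simp only [mul_comm (X _), del_sum]
    ring
  · intro a b
    simp only [Matrix.of_apply, phi0_swap2 _ a b, mul_neg, Finset.sum_neg_distrib]

theorem psiPart_hookPsi_phi0 (X : C1) : psiPart phi0 (hookPsi phi0 X) = X := by
  ext q
  rw [hookPsi_eq_inf3_phi0, psiPart_inf3]
  have e1 : ∑ a, ∑ i, (Matrix.of fun a i => (1 / 3) * ∑ l, X l * phi0 l a i : Mat) a i * phi0 a i q
      = (1 / 3) * ∑ m, X m * ∑ a, ∑ b, phi0 m a b * phi0 q a b := by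
    simp only [Finset.mul_sum, Finset.sum_mul, Matrix.of_apply]
    rw [Finset.sum_congr rfl fun a _ => Finset.sum_comm, Finset.sum_comm]
    refine Finset.sum_congr rfl fun m _ => Finset.sum_congr rfl fun a _ =>
      Finset.sum_congr rfl fun b _ => ?_
    rw [phi0_cyc q a b]
    ring
  have e2 : ∑ m, del m q * X m = X q := del_sum X q
  rw [e1]
  simp only [phi0_mul_phi0_two, mul_left_comm (X _), ← Finset.mul_sum, mul_comm (X _), e2]
  ring

/-- By `psiPart_inf3` the `ψ`-part is a contraction of the acting matrix with the skew `φ`, so a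
symmetric matrix has none. -/
theorem psiPart_diamond_phi0 {h : C2} (hh : ∀ i j, h i j = h j i) :
    psiPart phi0 (diamond phi0 h) = 0 := by
  ext q
  rw [diamond_phi0, psiPart_inf3]
  have : ∑ a, ∑ i, (Matrix.of h : Mat).transpose a i * phi0 a i q =
      -∑ a, ∑ i, (Matrix.of h : Mat).transpose a i * phi0 a i q := by
    conv_lhs => rw [Finset.sum_comm]
    simp only [← Finset.sum_neg_distrib]
    refine Finset.sum_congr rfl fun a _ => Finset.sum_congr rfl fun i _ => ?_
    rw [phi0_swap a i, Matrix.transpose_apply, Matrix.transpose_apply, Matrix.of_apply,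
      Matrix.of_apply, hh]
    ring
  simp only [Pi.zero_apply]
  linarith

theorem psiPart_add (c α β : C3) : psiPart c (α + β) = psiPart c α + psiPart c β := by
  ext q
  simp only [psiPart, raise3_eq, map_add, Pi.add_apply, add_mul, Finset.sum_add_distrib, mul_add]

theorem psiPart_smul (c : C3) (r : ℝ) (α : C3) : psiPart c (r • α) = r • psiPart c α := by
  ext q
  simp only [psiPart, raise3_eq, map_smul, Pi.smul_apply, smul_eq_mul, Finset.mul_sum]
  refine Finset.sum_congr rfl fun a _ => Finset.sum_congr rfl fun i _ =>
    Finset.sum_congr rfl fun j _ => by ring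

/-! ### Derivatives of natural operations along curves of forms -/

/-- By the chain rule the derivative depends on the curve only through its velocity, so the curve
may be replaced by `pull3 (1 + s H) phi0`. Along the latter a natural operation is given by its
transformation law. -/
theorem hasDerivAt_natural {V : Type*} [NormedAddCommGroup V] [NormedSpace ℝ V] {Φ : C3 → V}
    {c : ℝ → C3} {H : Mat} {v : V} (hΦ : DifferentiableAt ℝ Φ phi0) (h0 : c 0 = phi0)
    (hc : HasDerivAt c (inf3 H phi0) 0)
    (hv : HasDerivAt (fun s : ℝ => Φ (pull3 (1 + s • H) phi0)) v 0) :
    HasDerivAt (fun s => Φ (c s)) v 0 := by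
  have e : pull3 (1 + (0 : ℝ) • H) phi0 = phi0 := by rw [one_add_zero_smul, pull3_one]
  have h1 : HasDerivAt (fun s => Φ (c s)) (fderiv ℝ Φ phi0 (inf3 H phi0)) 0 :=
    HasFDerivAt.comp_hasDerivAt (x := (0 : ℝ)) (by rw [h0]; exact hΦ.hasFDerivAt) hc
  have h2 : HasDerivAt (fun s : ℝ => Φ (pull3 (1 + s • H) phi0))
      (fderiv ℝ Φ phi0 (inf3 H phi0)) 0 :=
    HasFDerivAt.comp_hasDerivAt (x := (0 : ℝ)) (by rw [e]; exact hΦ.hasFDerivAt)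
      (hasDerivAt_pull3 H phi0)
  rwa [hv.unique h2]

theorem det_bMat_phi0 : (bMat phi0).det ≠ 0 := by rw [bMat_phi0, Matrix.det_one]; exact one_ne_zero

theorem contDiffOn_apply3 {n : WithTop ℕ∞} (s : Set C3) (i j k : Fin 7) :
    ContDiffOn ℝ n (fun c : C3 => c i j k) s := by fun_prop

theorem differentiableAt_metric {c : C3} (hc : (bMat c).det ≠ 0) (i j : Fin 7) :
    DifferentiableAt ℝ (fun c => metric c i j) c :=
  ((contDiffOn_metric (n := 1) (f := fun c => c) (contDiffOn_apply3 _) (fun _ h => h) i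
    j).contDiffAt (isOpen_det_bMat.mem_nhds hc)).differentiableAt one_ne_zero

theorem differentiableAt_cometric {c : C3} (hc : (bMat c).det ≠ 0) (i j : Fin 7) :
    DifferentiableAt ℝ (fun c => cometric c i j) c :=
  ((contDiffOn_cometric (n := 1) (f := fun c => c) (contDiffOn_apply3 _) (fun _ h => h) i
    j).contDiffAt (isOpen_det_bMat.mem_nhds hc)).differentiableAt one_ne_zero

theorem differentiableAt_volCoeff {c : C3} (hc : (bMat c).det ≠ 0) :
    DifferentiableAt ℝ volCoeff c :=
  ((contDiffOn_volCoeff (n := 1) (f := fun c => c) (contDiffOn_apply3 _)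
    (fun _ h => h)).contDiffAt (isOpen_det_bMat.mem_nhds hc)).differentiableAt one_ne_zero

theorem eventually_det_ne_zero (H : Mat) : ∀ᶠ s : ℝ in nhds 0, (1 + s • H).det ≠ 0 := by
  have h : Continuous fun s : ℝ => (1 + s • H).det := by fun_prop
  exact h.continuousAt.eventually_ne (by simp)

theorem hasDerivAt_metric_phi0 {c : ℝ → C3} {H : Mat} (h0 : c 0 = phi0)
    (hc : HasDerivAt c (inf3 H phi0) 0) (i j : Fin 7) :
    HasDerivAt (fun s => metric (c s) i j) (H j i + H i j) 0 := by
  refine hasDerivAt_natural (Φ := fun c => metric c i j) (differentiableAt_metric det_bMat_phi0 i j)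
    h0 hc ?_
  have e : (fun s : ℝ => metric (pull3 (1 + s • H) phi0) i j) =ᶠ[nhds 0] fun s =>
      ∑ a, (1 + s • H) a i * (1 + s • H) a j := by
    filter_upwards [eventually_det_ne_zero H] with s hs
    rw [metric_pull hs, metric_phi0, tens2_del]
    rfl
  refine HasDerivAt.congr_of_eventuallyEq ?_ e
  refine (HasDerivAt.fun_sum fun a _ => (hasDerivAt_one_add_smul H a i).mul
    (hasDerivAt_one_add_smul H a j)).congr_deriv ?_
  simp [Finset.sum_add_distrib, Matrix.one_apply]

theorem hasDerivAt_volCoeff_phi0 {c : ℝ → C3} {H : Mat} (h0 : c 0 = phi0)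
    (hc : HasDerivAt c (inf3 H phi0) 0) :
    HasDerivAt (fun s => volCoeff (c s)) (∑ i, H i i) 0 := by
  refine hasDerivAt_natural (Φ := volCoeff) (differentiableAt_volCoeff det_bMat_phi0) h0 hc ?_
  simp only [volCoeff_pull, volCoeff_phi0, mul_one]
  rw [funext fun s : ℝ => Matrix.det_one_add_smul s H]
  set p := (Matrix.det (1 + (Polynomial.X : Polynomial ℝ) • H.map Polynomial.C)).divX.divX
  have h1 : HasDerivAt (fun s : ℝ => 1 + H.trace * s) H.trace 0 := by
    simpa using ((hasDerivAt_id (0 : ℝ)).const_mul H.trace).const_add 1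
  have h2 : HasDerivAt (fun s : ℝ => p.eval s * s ^ 2) 0 0 := by
    simpa using (p.hasDerivAt 0).fun_mul ((hasDerivAt_id (0 : ℝ)).fun_pow 2)
  refine (h1.add h2).congr_deriv ?_
  rw [add_zero]
  rfl

/-- Differentiation of `g⁻¹ g = 1` at a point where both factors are the identity. -/
theorem hasDerivAt_cometric_of_metric {c : ℝ → C3} {m : C2} (h0 : c 0 = phi0)
    (hc : DifferentiableAt ℝ c 0)
    (hm : ∀ i j, HasDerivAt (fun s => metric (c s) i j) (m i j) 0) (i j : Fin 7) :
    HasDerivAt (fun s => cometric (c s) i j) (-m i j) 0 := by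
  have hd : ∀ i j, HasDerivAt (fun s => cometric (c s) i j)
      (deriv (fun s => cometric (c s) i j) 0) 0 := fun i j =>
    (DifferentiableAt.comp (x := (0 : ℝ)) (g := fun c => cometric c i j) (f := c)
      (by rw [h0]; exact differentiableAt_cometric det_bMat_phi0 i j) hc).hasDerivAt
  have h1 := HasDerivAt.fun_sum (u := Finset.univ) fun a _ => (hd i a).fun_mul (hm a j)
  have hev : ∀ᶠ s in nhds (0 : ℝ), (bMat (c s)).det ≠ 0 :=
    hc.continuousAt.eventually (isOpen_det_bMat.mem_nhds
      (show (bMat (c 0)).det ≠ 0 by rw [h0]; exact det_bMat_phi0))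
  have h2 : HasDerivAt (fun s => ∑ a, cometric (c s) i a * metric (c s) a j) 0 0 := by
    refine (hasDerivAt_const (0 : ℝ) (del i j)).congr_of_eventuallyEq ?_
    filter_upwards [hev] with s hs
    have := congrFun (congrFun (Matrix.nonsing_inv_mul _ (det_metric_ne_zero hs).isUnit) i) j
    rwa [Matrix.mul_apply, Matrix.one_apply] at this
  have h3 := h1.unique h2
  simp only [h0, metric_phi0, cometric_phi0, Finset.sum_add_distrib, del_sum'] at h3
  have h4 : ∑ a, deriv (fun s => cometric (c s) i a) 0 * del a j =
      deriv (fun s => cometric (c s) i j) 0 := by simp [del]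
  rw [h4] at h3
  have h5 := hd i j
  rwa [show deriv (fun s => cometric (c s) i j) 0 = -m i j by linarith] at h5

/-- The velocity of the pair of arguments is split in two: both arguments move by the same
infinitesimal change of basis, under which the result is covariant, and then the second argument
alone moves by the remainder, in which the operation is linear. -/
theorem hasDerivAt_psiPart_phi0 {c w : ℝ → C3} {H : Mat} {w' : C3} (h0 : c 0 = phi0)
    (hc : HasDerivAt c (inf3 H phi0) 0) (hw : HasDerivAt w w' 0) (q : Fin 7) :
    HasDerivAt (fun s => psiPart (c s) (w s) q)
      ((∑ a, H a q * psiPart phi0 (w 0) a) + psiPart phi0 (w' - inf3 H (w 0)) q) 0 := by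
  obtain ⟨Φ, hΦ⟩ : ∃ Φ : C3 × C3 → ℝ, ∀ p r, Φ (p, r) = psiPart p r q :=
    ⟨fun p => psiPart p.1 p.2 q, fun _ _ => rfl⟩
  have hd : DifferentiableAt ℝ Φ (phi0, w 0) := by
    have hs : IsOpen {p : C3 × C3 | (bMat p.1).det ≠ 0} := isOpen_det_bMat.preimage continuous_fst
    have h1 : ∀ i j k, ContDiff ℝ 1 fun p : C3 × C3 => p.1 i j k := fun i j k =>
      ContDiff.comp (g := fun c : C3 => c i j k) (by fun_prop) contDiff_fst
    have h2 : ∀ i j k, ContDiff ℝ 1 fun p : C3 × C3 => p.2 i j k := fun i j k =>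
      ContDiff.comp (g := fun c : C3 => c i j k) (by fun_prop) contDiff_snd
    have h3 : ∀ x ∈ {p : C3 × C3 | (bMat p.1).det ≠ 0}, (bMat x.1).det ≠ 0 := fun _ h => h
    have h4 : (phi0, w 0) ∈ {p : C3 × C3 | (bMat p.1).det ≠ 0} := det_bMat_phi0
    have := contDiffOn_psiPart (f := fun p : C3 × C3 => p.1) (g := fun p : C3 × C3 => p.2)
      (fun i j k => (h1 i j k).contDiffOn) (fun i j k => (h2 i j k).contDiffOn) h3 q
    rw [show Φ = fun p => psiPart p.1 p.2 q from funext fun p => hΦ p.1 p.2]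
    exact (this.contDiffAt (hs.mem_nhds h4)).differentiableAt one_ne_zero
  suffices hs : HasDerivAt (fun s => Φ (c s, w s))
      ((∑ a, H a q * psiPart phi0 (w 0) a) + psiPart phi0 (w' - inf3 H (w 0)) q) 0 by
    simpa only [hΦ] using hs
  set L := fderiv ℝ Φ (phi0, w 0) with hL
  have e : pull3 (1 + (0 : ℝ) • H) phi0 = phi0 := by rw [one_add_zero_smul, pull3_one]
  have e' : pull3 (1 + (0 : ℝ) • H) (w 0) = w 0 := by rw [one_add_zero_smul, pull3_one]
  have h1 : HasDerivAt (fun s => Φ (c s, w s)) (L (inf3 H phi0, w')) 0 :=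
    HasFDerivAt.comp_hasDerivAt (x := (0 : ℝ)) (by rw [h0]; exact hd.hasFDerivAt) (hc.prodMk hw)
  have h2 : HasDerivAt (fun s : ℝ => Φ (pull3 (1 + s • H) phi0, pull3 (1 + s • H) (w 0)))
      (L (inf3 H phi0, inf3 H (w 0))) 0 :=
    HasFDerivAt.comp_hasDerivAt (x := (0 : ℝ)) (by rw [e, e']; exact hd.hasFDerivAt)
      ((hasDerivAt_pull3 H phi0).prodMk (hasDerivAt_pull3 H (w 0)))
  have h3 : HasDerivAt (fun s : ℝ => Φ (phi0, w 0 + s • (w' - inf3 H (w 0))))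
      (L (0, w' - inf3 H (w 0))) 0 := by
    have hl : HasDerivAt (fun s : ℝ => w 0 + s • (w' - inf3 H (w 0))) (w' - inf3 H (w 0)) 0 := by
      simpa using ((hasDerivAt_id (0 : ℝ)).smul_const (w' - inf3 H (w 0))).const_add (w 0)
    exact HasFDerivAt.comp_hasDerivAt (x := (0 : ℝ)) (by rw [zero_smul, add_zero]; exact hd.hasFDerivAt)
      ((hasDerivAt_const (0 : ℝ) phi0).prodMk hl)
  have h2' : HasDerivAt (fun s : ℝ => Φ (pull3 (1 + s • H) phi0, pull3 (1 + s • H) (w 0)))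
      (∑ a, H a q * psiPart phi0 (w 0) a) 0 := by
    have e : (fun s : ℝ => Φ (pull3 (1 + s • H) phi0, pull3 (1 + s • H) (w 0))) =ᶠ[nhds 0]
        fun s => ∑ a, (1 + s • H) a q * psiPart phi0 (w 0) a := by
      filter_upwards [eventually_det_ne_zero H] with s hs
      simp only [hΦ, psiPart_pull hs]
      rfl
    exact (HasDerivAt.fun_sum fun a _ =>
      (hasDerivAt_one_add_smul H a q).mul_const _).congr_of_eventuallyEq e
  have h3' : HasDerivAt (fun s : ℝ => Φ (phi0, w 0 + s • (w' - inf3 H (w 0))))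
      (psiPart phi0 (w' - inf3 H (w 0)) q) 0 := by
    simp only [hΦ, psiPart_add, psiPart_smul, Pi.add_apply, Pi.smul_apply, smul_eq_mul]
    simpa using ((hasDerivAt_id (0 : ℝ)).mul_const
      (psiPart phi0 (w' - inf3 H (w 0)) q)).const_add (psiPart phi0 (w 0) q)
  refine h1.congr_deriv ?_
  rw [h2'.unique h2, h3'.unique h3, ← map_add]
  simp

/-! ### Variations `h ⋄ φ + X ⌟ ψ` -/

theorem tens2_inv {A : Mat} (hA : A.det ≠ 0) (h : C2) :
    tens2 A.transpose (tens2 A⁻¹.transpose h) = h := by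
  rw [tens2_mul, ← Matrix.transpose_mul, Matrix.nonsing_inv_mul _ hA.isUnit,
    Matrix.transpose_one, tens2_one]

theorem mv_inv {A : Mat} (hA : A.det ≠ 0) (X : C1) :
    mv A.transpose (mv A⁻¹.transpose X) = X := by
  rw [mv_mv, ← Matrix.transpose_mul, Matrix.nonsing_inv_mul _ hA.isUnit,
    Matrix.transpose_one, mv_one]

theorem det_inv_ne_zero {A : Mat} (hA : A.det ≠ 0) : A⁻¹.det ≠ 0 := by
  rw [Matrix.det_nonsing_inv, Ring.inverse_eq_inv']
  exact inv_ne_zero hA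

theorem tens2_symm (A : Mat) {h : C2} (hh : ∀ i j, h i j = h j i) (i j : Fin 7) :
    tens2 A h i j = tens2 A h j i := by
  rw [tens2_apply, tens2_apply, Finset.sum_comm]
  exact Finset.sum_congr rfl fun a _ => Finset.sum_congr rfl fun b _ => by rw [hh b a]; ring

/-- The endomorphism `h + (1/3) X ⌟ φ` at the model form. -/
def varMat (h : C2) (X : C1) : Mat :=
  Matrix.of fun a i => h i a + (1 / 3) * ∑ l, X l * phi0 l a i

theorem variation_eq (h : C2) (X : C1) :
    diamond phi0 h + hookPsi phi0 X = inf3 (varMat h X) phi0 := by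
  rw [diamond_phi0, hookPsi_eq_inf3_phi0, ← inf3_add]
  rfl

theorem sum_varMat_symm (h : C2) (hh : ∀ i j, h i j = h j i) (X : C1) (i j : Fin 7) :
    varMat h X j i + varMat h X i j = 2 * h i j := by
  have e : ∀ l, phi0 l j i = -phi0 l i j := fun l => phi0_swap2 l i j
  simp only [varMat, Matrix.of_apply, e, mul_neg, Finset.sum_neg_distrib, hh j i]
  ring

theorem variation_pull {A : Mat} (hA : A.det ≠ 0) (h : C2) (X : C1) :
    diamond (pull3 A phi0) h + hookPsi (pull3 A phi0) X =
      pull3 A (inf3 (varMat (tens2 A⁻¹.transpose h) (mv A⁻¹.transpose X)) phi0) := by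
  rw [← variation_eq, map_add, ← diamond_pull hA, ← hookPsi_pull hA, tens2_inv hA, mv_inv hA]

theorem hasDerivAt_pull3_comp {c : ℝ → C3} {c' : C3} (A : Mat) (hc : HasDerivAt c c' 0) :
    HasDerivAt (fun s => pull3 A (c s)) (pull3 A c') 0 :=
  (LinearMap.toContinuousLinearMap (pull3 A)).hasFDerivAt.comp_hasDerivAt (0 : ℝ) hc

theorem pull3_inv_pull3 {A : Mat} (hA : A.det ≠ 0) (c : C3) : pull3 A⁻¹ (pull3 A c) = c := by
  change tens3 _ (tens3 _ c) = c
  rw [tens3_mul, ← Matrix.transpose_mul, Matrix.mul_nonsing_inv _ hA.isUnit,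
    Matrix.transpose_one, tens3_one]

/-- After a change of basis the curve starts at `phi0` and its velocity is the action of `varMat`.
The metric sees only the symmetrization of that matrix, from which the skew contribution of `X`
drops out. -/
theorem hasDerivAt_metric {c : ℝ → C3} {h : C2} {X : C1} (h0 : IsModel (c 0))
    (hh : ∀ i j, h i j = h j i) (hc : HasDerivAt c (diamond (c 0) h + hookPsi (c 0) X) 0)
    (i j : Fin 7) : HasDerivAt (fun s => metric (c s) i j) (2 * h i j) 0 := by
  obtain ⟨A, hA, h0⟩ := h0
  rw [← h0, variation_pull hA] at hc
  have hc2 := hasDerivAt_pull3_comp A⁻¹ hc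
  rw [pull3_inv_pull3 hA] at hc2
  have hm := hasDerivAt_metric_phi0 (by rw [← h0, pull3_inv_pull3 hA]) hc2
  have e : ∀ s, metric (c s) i j = ∑ a, ∑ b, A.transpose i a * A.transpose j b *
      metric (pull3 A⁻¹ (c s)) a b := by
    intro s
    rw [← tens2_apply, ← metric_pull hA, pull3_inv hA]
  simp only [e]
  refine (HasDerivAt.fun_sum fun a _ => HasDerivAt.fun_sum fun b _ =>
    (hm a b).const_mul _).congr_deriv ?_
  have hh' := tens2_symm A⁻¹.transpose hh
  simp only [sum_varMat_symm _ hh', mul_left_comm _ (2 : ℝ), ← Finset.mul_sum]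
  rw [← tens2_apply, tens2_inv hA]

theorem hasDerivAt_volCoeff {c : ℝ → C3} {h : C2} {X : C1} (h0 : IsModel (c 0))
    (hc : HasDerivAt c (diamond (c 0) h + hookPsi (c 0) X) 0) :
    HasDerivAt (fun s => volCoeff (c s)) (volCoeff (c 0) * tr (c 0) h) 0 := by
  obtain ⟨A, hA, h0⟩ := h0
  rw [← h0, variation_pull hA] at hc
  have hc2 := hasDerivAt_pull3_comp A⁻¹ hc
  rw [pull3_inv_pull3 hA] at hc2
  have hm := hasDerivAt_volCoeff_phi0 (by rw [← h0, pull3_inv_pull3 hA]) hc2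
  have e : ∀ s, volCoeff (c s) = A.det * volCoeff (pull3 A⁻¹ (c s)) := by
    intro s
    rw [← volCoeff_pull, pull3_inv hA]
  simp only [e]
  refine (hm.const_mul _).congr_deriv ?_
  have e2 : tr (c 0) h = ∑ i, tens2 A⁻¹.transpose h i i := by
    conv_lhs => rw [← h0, ← tens2_inv hA h]
    rw [tr_pull hA, tr_phi0]
  have e3 : ∀ a, ∑ l, mv A⁻¹.transpose X l * phi0 l a a = 0 := fun a =>
    Finset.sum_eq_zero fun l _ => by
      have := phi0_swap2 l a a
      rw [show phi0 l a a = 0 by linarith, mul_zero]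
  rw [e2, ← h0, pull3_inv_pull3 hA, volCoeff_phi0, mul_one]
  simp only [varMat, Matrix.of_apply, e3, mul_zero, add_zero]

theorem psiPart_variation {c : C3} (hc : IsModel c) {h : C2} (hh : ∀ i j, h i j = h j i) (X : C1) :
    psiPart c (diamond c h + hookPsi c X) = X := by
  obtain ⟨A, hA, rfl⟩ := hc
  rw [variation_pull hA, psiPart_pull hA, ← variation_eq, psiPart_add, psiPart_hookPsi_phi0,
    psiPart_diamond_phi0 (tens2_symm _ hh), zero_add, mv_inv hA]

/-- The two summands are recovered separately: `h` as half the derivative of the metric along a line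
with this velocity, and `X` as the `ψ`-part. -/
theorem eq_of_variation_eq {c : C3} (hc : IsModel c) {h k : C2} (hh : ∀ i j, h i j = h j i)
    (hk : ∀ i j, k i j = k j i) {X Y : C1}
    (e : diamond c h + hookPsi c X = diamond c k + hookPsi c Y) : h = k ∧ X = Y := by
  refine ⟨?_, ?_⟩
  · have hd : HasDerivAt (fun s : ℝ => c + s • (diamond c h + hookPsi c X))
        (diamond c h + hookPsi c X) 0 := by
      simpa using ((hasDerivAt_id (0 : ℝ)).smul_const (diamond c h + hookPsi c X)).const_add c
    have h0 : c + (0 : ℝ) • (diamond c h + hookPsi c X) = c := by simp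
    ext i j
    have h1 := hasDerivAt_metric (c := fun s : ℝ => c + s • (diamond c h + hookPsi c X))
      (h := h) (X := X) (by rwa [h0]) hh (by rwa [h0]) i j
    have h2 := hasDerivAt_metric (c := fun s : ℝ => c + s • (diamond c h + hookPsi c X))
      (h := k) (X := Y) (by rwa [h0]) hk (by rw [h0, ← e]; exact hd) i j
    linarith [h1.unique h2]
  · rw [← psiPart_variation hc hh X, e, psiPart_variation hc hk]

/-- A 3-form is the action of some matrix on the model form; its symmetric part gives `h` and its
skew part, by `inf3_skew`, gives `X`. -/
theorem exists_variation {c α : C3} (hc : IsModel c) (hα : IsAlt3 α) :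
    ∃ (h : C2) (X : C1), (∀ i j, h i j = h j i) ∧ α = diamond c h + hookPsi c X := by
  obtain ⟨A, hA, rfl⟩ := hc
  obtain ⟨H, hH⟩ := exists_inf3_phi0 (hα.pull3 A⁻¹)
  set h : C2 := fun i j => (H i j + H j i) / 2 with hh
  have hs : ∀ i j, h i j = h j i := fun i j => by simp only [hh]; ring
  set S : Mat := Matrix.of fun i j => (H i j - H j i) / 2 with hS
  have hSS : ∀ a b, S b a = -S a b := fun a b => by simp only [hS, Matrix.of_apply]; ring
  have e : H = (Matrix.of h : Mat).transpose + S := by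
    ext i j
    simp only [hS, hh, Matrix.add_apply, Matrix.transpose_apply, Matrix.of_apply]
    ring
  rw [e, inf3_add, ← diamond_phi0, inf3_skew hSS] at hH
  refine ⟨tens2 A.transpose h,
    mv A.transpose (fun l => (1 / 2) * ∑ a, ∑ b, S a b * phi0 a b l), tens2_symm _ hs, ?_⟩
  rw [diamond_pull hA, hookPsi_pull hA, ← pull3_inv hA α, ← hH, map_add]

/-- A variation of the model form that does not change the metric. -/
theorem eq_hookPsi_of_metric {c : ℝ → C3} {c' : C3} (h0 : c 0 = phi0) (hc : HasDerivAt c c' 0)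
    (hc' : IsAlt3 c') (hm : ∀ i j, HasDerivAt (fun s => metric (c s) i j) 0 0) :
    c' = hookPsi phi0 (psiPart phi0 c') := by
  obtain ⟨H, rfl⟩ := exists_inf3_phi0 hc'
  have hS : ∀ a b, H b a = -H a b := fun a b => by
    linarith [(hasDerivAt_metric_phi0 h0 hc a b).unique (hm a b)]
  rw [inf3_skew hS, psiPart_hookPsi_phi0]

/-! ### Partial derivatives -/

theorem hasDerivAt_line {u : E7 → ℝ} {y : E7} (hu : DifferentiableAt ℝ u y) (i : Fin 7) :
    HasDerivAt (fun s : ℝ => u (y + s • EuclideanSpace.single i (1 : ℝ))) (pd i u y) 0 := by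
  have h1 : HasDerivAt (fun s : ℝ => y + s • EuclideanSpace.single i (1 : ℝ))
      (EuclideanSpace.single i (1 : ℝ)) 0 := by
    simpa using ((hasDerivAt_id (0 : ℝ)).smul_const
      (EuclideanSpace.single i (1 : ℝ))).const_add y
  exact HasFDerivAt.comp_hasDerivAt (x := (0 : ℝ)) (by
    rw [zero_smul, add_zero]; exact hu.hasFDerivAt) h1

theorem pd_eq_of_line {u : E7 → ℝ} {y : E7} {i : Fin 7} {d : ℝ} (hu : DifferentiableAt ℝ u y)
    (h : HasDerivAt (fun s : ℝ => u (y + s • EuclideanSpace.single i (1 : ℝ))) d 0) :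
    pd i u y = d := (hasDerivAt_line hu i).unique h

theorem pd_congr {U : Set E7} (hU : IsOpen U) {u v : E7 → ℝ} (h : ∀ z ∈ U, u z = v z) {y : E7}
    (hy : y ∈ U) (i : Fin 7) : pd i u y = pd i v y := by
  rw [pd, pd, Filter.EventuallyEq.fderiv_eq (Filter.eventuallyEq_of_mem (hU.mem_nhds hy) h)]

theorem pd_const (i : Fin 7) (r : ℝ) (y : E7) : pd i (fun _ => r) y = 0 := by
  simp [pd]

theorem pd_add {u v : E7 → ℝ} {y : E7} (hu : DifferentiableAt ℝ u y) (hv : DifferentiableAt ℝ v y)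
    (i : Fin 7) : pd i (fun z => u z + v z) y = pd i u y + pd i v y :=
  pd_eq_of_line (hu.add hv) ((hasDerivAt_line hu i).add (hasDerivAt_line hv i))

theorem pd_sub {u v : E7 → ℝ} {y : E7} (hu : DifferentiableAt ℝ u y) (hv : DifferentiableAt ℝ v y)
    (i : Fin 7) : pd i (fun z => u z - v z) y = pd i u y - pd i v y :=
  pd_eq_of_line (hu.sub hv) ((hasDerivAt_line hu i).sub (hasDerivAt_line hv i))

theorem pd_mul {u v : E7 → ℝ} {y : E7} (hu : DifferentiableAt ℝ u y) (hv : DifferentiableAt ℝ v y)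
    (i : Fin 7) : pd i (fun z => u z * v z) y = pd i u y * v y + u y * pd i v y :=
  pd_eq_of_line (hu.mul hv) (((hasDerivAt_line hu i).mul (hasDerivAt_line hv i)).congr_deriv
    (by simp))

theorem pd_const_mul {v : E7 → ℝ} {y : E7} (r : ℝ) (hv : DifferentiableAt ℝ v y)
    (i : Fin 7) : pd i (fun z => r * v z) y = r * pd i v y :=
  pd_eq_of_line (hv.const_mul r) ((hasDerivAt_line hv i).const_mul r)

theorem pd_sum {u : Fin 7 → E7 → ℝ} {y : E7} (hu : ∀ a, DifferentiableAt ℝ (u a) y)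
    (i : Fin 7) : pd i (fun z => ∑ a, u a z) y = ∑ a, pd i (u a) y :=
  pd_eq_of_line (DifferentiableAt.fun_sum fun a _ => hu a)
    (HasDerivAt.fun_sum fun a _ => hasDerivAt_line (hu a) i)

theorem pd_comm {u : E7 → ℝ} {y : E7} (hu : ContDiffAt ℝ ∞ u y) (i j : Fin 7) :
    pd i (pd j u) y = pd j (pd i u) y := by
  have hs := (hu.of_le (m := 2) ENat.LEInfty.out).isSymmSndFDerivAt (by simp)
  have hd : DifferentiableAt ℝ (fderiv ℝ u) y :=
    (hu.fderiv_right (m := 1) (by norm_num; exact ENat.LEInfty.out)).differentiableAt one_ne_zero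
  have e : ∀ i j, pd i (pd j u) y = fderiv ℝ (fderiv ℝ u) y (EuclideanSpace.single i 1)
      (EuclideanSpace.single j 1) := by
    intro i j
    change fderiv ℝ (fun z => fderiv ℝ u z (EuclideanSpace.single j 1)) y _ = _
    rw [fderiv_clm_apply hd (differentiableAt_const _)]
    simp
  rw [e, e]
  exact hs _ _

/-! ### Smooth families of forms, and smoothness of the operators applied to them -/

section Family

variable {W : Set (ℝ × E7)} {F : ℝ → E7 → C3}

theorem contDiffOn_pd (hW : IsOpen W) {u : ℝ → E7 → ℝ}
    (hu : ContDiffOn ℝ ∞ (fun q => u q.1 q.2) W) (i : Fin 7) :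
    ContDiffOn ℝ ∞ (fun q => pd i (u q.1) q.2) W := by
  have h1 : ContDiffOn ℝ ∞ (fun q => fderiv ℝ (fun q : ℝ × E7 => u q.1 q.2) q
      ((0 : ℝ), EuclideanSpace.single i (1 : ℝ))) W :=
    (hu.fderiv_of_isOpen hW (by simp)).clm_apply contDiffOn_const
  refine h1.congr fun q hq => ?_
  have hd := ((hu.contDiffAt (hW.mem_nhds hq)).differentiableAt (by simp)).hasFDerivAt
  have h2 := HasFDerivAt.comp (f := fun z : E7 => (q.1, z)) q.2 hd
    (hasFDerivAt_prodMk_right q.1 q.2)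
  have h3 : HasFDerivAt (u q.1) _ q.2 := h2
  rw [pd, h3.fderiv]
  rfl

/-- The components of a smooth family of 3-forms that are pullbacks of the model form. -/
structure SmoothFam (W : Set (ℝ × E7)) (F : ℝ → E7 → C3) : Prop where
  isOpen : IsOpen W
  smooth : ∀ i j k, ContDiffOn ℝ ∞ (fun q : ℝ × E7 => F q.1 q.2 i j k) W
  model : ∀ q ∈ W, IsModel (F q.1 q.2)

namespace SmoothFam

variable (hF : SmoothFam W F)

theorem metric (hF : SmoothFam W F) (i j : Fin 7) :
    ContDiffOn ℝ ∞ (fun q => metric (F q.1 q.2) i j) W :=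
  contDiffOn_metric hF.smooth (fun q hq => (hF.model q hq).det_ne_zero) i j

theorem cometric (hF : SmoothFam W F) (i j : Fin 7) :
    ContDiffOn ℝ ∞ (fun q => cometric (F q.1 q.2) i j) W :=
  contDiffOn_cometric hF.smooth (fun q hq => (hF.model q hq).det_ne_zero) i j

theorem volCoeff (hF : SmoothFam W F) : ContDiffOn ℝ ∞ (fun q => volCoeff (F q.1 q.2)) W :=
  contDiffOn_volCoeff hF.smooth (fun q hq => (hF.model q hq).det_ne_zero)

theorem psi (hF : SmoothFam W F) (i j k l : Fin 7) :
    ContDiffOn ℝ ∞ (fun q => psi (F q.1 q.2) i j k l) W :=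
  contDiffOn_psi hF.smooth (fun q hq => (hF.model q hq).det_ne_zero) i j k l

theorem christoffel (hF : SmoothFam W F) (k i j : Fin 7) :
    ContDiffOn ℝ ∞ (fun q => christoffel (F q.1) q.2 k i j) W := by
  have h1 := hF.cometric
  have h2 : ∀ i j l, ContDiffOn ℝ ∞ (fun q => pd i (fun z => G2Hilbert.metric (F q.1 z) j l) q.2) W :=
    fun i j l => contDiffOn_pd hF.isOpen (u := fun t z => G2Hilbert.metric (F t z) j l)
      (hF.metric j l) i
  simp only [G2Hilbert.christoffel]
  fun_prop

theorem raise1 (hF : SmoothFam W F) {X : ℝ → E7 → C1}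
    (hX : ∀ i, ContDiffOn ℝ ∞ (fun q => X q.1 q.2 i) W) (i : Fin 7) :
    ContDiffOn ℝ ∞ (fun q => raise1 (F q.1 q.2) (X q.1 q.2) i) W := by
  have h1 := hF.cometric
  simp only [G2Hilbert.raise1]
  fun_prop

theorem raise2 (hF : SmoothFam W F) {w : ℝ → E7 → C2}
    (hw : ∀ i j, ContDiffOn ℝ ∞ (fun q => w q.1 q.2 i j) W) (i j : Fin 7) :
    ContDiffOn ℝ ∞ (fun q => raise2 (F q.1 q.2) (w q.1 q.2) i j) W := by
  have h1 := hF.cometric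
  simp only [G2Hilbert.raise2]
  fun_prop

theorem tr (hF : SmoothFam W F) {w : ℝ → E7 → C2}
    (hw : ∀ i j, ContDiffOn ℝ ∞ (fun q => w q.1 q.2 i j) W) :
    ContDiffOn ℝ ∞ (fun q => tr (F q.1 q.2) (w q.1 q.2)) W := by
  have h1 := hF.cometric
  simp only [G2Hilbert.tr]
  fun_prop

theorem comp (hF : SmoothFam W F) {v w : ℝ → E7 → C2}
    (hv : ∀ i j, ContDiffOn ℝ ∞ (fun q => v q.1 q.2 i j) W)
    (hw : ∀ i j, ContDiffOn ℝ ∞ (fun q => w q.1 q.2 i j) W) (i j : Fin 7) :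
    ContDiffOn ℝ ∞ (fun q => comp (F q.1 q.2) (v q.1 q.2) (w q.1 q.2) i j) W := by
  have h1 := hF.cometric
  simp only [G2Hilbert.comp]
  fun_prop

theorem ip1 (hF : SmoothFam W F) {X Y : ℝ → E7 → C1}
    (hX : ∀ i, ContDiffOn ℝ ∞ (fun q => X q.1 q.2 i) W)
    (hY : ∀ i, ContDiffOn ℝ ∞ (fun q => Y q.1 q.2 i) W) :
    ContDiffOn ℝ ∞ (fun q => ip1 (F q.1 q.2) (X q.1 q.2) (Y q.1 q.2)) W := by
  have h1 := hF.raise1 hX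
  simp only [G2Hilbert.ip1]
  fun_prop

theorem ip2 (hF : SmoothFam W F) {v w : ℝ → E7 → C2}
    (hv : ∀ i j, ContDiffOn ℝ ∞ (fun q => v q.1 q.2 i j) W)
    (hw : ∀ i j, ContDiffOn ℝ ∞ (fun q => w q.1 q.2 i j) W) :
    ContDiffOn ℝ ∞ (fun q => ip2 (F q.1 q.2) (v q.1 q.2) (w q.1 q.2)) W := by
  have h1 := hF.raise2 hv
  simp only [G2Hilbert.ip2]
  fun_prop

theorem act (hF : SmoothFam W F) {w : ℝ → E7 → C2} {X : ℝ → E7 → C1}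
    (hw : ∀ i j, ContDiffOn ℝ ∞ (fun q => w q.1 q.2 i j) W)
    (hX : ∀ i, ContDiffOn ℝ ∞ (fun q => X q.1 q.2 i) W) (i : Fin 7) :
    ContDiffOn ℝ ∞ (fun q => act (F q.1 q.2) (w q.1 q.2) (X q.1 q.2) i) W := by
  have h1 := hF.raise1 hX
  simp only [G2Hilbert.act]
  fun_prop

theorem vop (hF : SmoothFam W F) {w : ℝ → E7 → C2}
    (hw : ∀ i j, ContDiffOn ℝ ∞ (fun q => w q.1 q.2 i j) W) (k : Fin 7) :
    ContDiffOn ℝ ∞ (fun q => vop (F q.1 q.2) (w q.1 q.2) k) W := by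
  have h1 := hF.raise2 hw
  have h2 := hF.smooth
  simp only [G2Hilbert.vop]
  fun_prop

theorem hookPhi (hF : SmoothFam W F) {X : ℝ → E7 → C1}
    (hX : ∀ i, ContDiffOn ℝ ∞ (fun q => X q.1 q.2 i) W) (i j : Fin 7) :
    ContDiffOn ℝ ∞ (fun q => hookPhi (F q.1 q.2) (X q.1 q.2) i j) W := by
  have h1 := hF.raise1 hX
  have h2 := hF.smooth
  simp only [G2Hilbert.hookPhi]
  fun_prop

theorem hookPsi (hF : SmoothFam W F) {X : ℝ → E7 → C1}
    (hX : ∀ i, ContDiffOn ℝ ∞ (fun q => X q.1 q.2 i) W) (i j k : Fin 7) :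
    ContDiffOn ℝ ∞ (fun q => hookPsi (F q.1 q.2) (X q.1 q.2) i j k) W := by
  have h1 := hF.raise1 hX
  have h2 := hF.psi
  simp only [G2Hilbert.hookPsi]
  fun_prop

theorem diamond (hF : SmoothFam W F) {h : ℝ → E7 → C2}
    (hh : ∀ i j, ContDiffOn ℝ ∞ (fun q => h q.1 q.2 i j) W) (i j k : Fin 7) :
    ContDiffOn ℝ ∞ (fun q => diamond (F q.1 q.2) (h q.1 q.2) i j k) W := by
  have h1 := hF.cometric
  have h2 := hF.smooth
  simp only [G2Hilbert.diamond]
  fun_prop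

theorem cov1 (hF : SmoothFam W F) {X : ℝ → E7 → C1}
    (hX : ∀ i, ContDiffOn ℝ ∞ (fun q => X q.1 q.2 i) W) (i j : Fin 7) :
    ContDiffOn ℝ ∞ (fun q => cov1 (F q.1) (X q.1) q.2 i j) W := by
  have h1 := hF.christoffel
  have h2 := contDiffOn_pd hF.isOpen (u := fun t z => X t z j) (hX j) i
  simp only [G2Hilbert.cov1]
  fun_prop

theorem cov2 (hF : SmoothFam W F) {w : ℝ → E7 → C2}
    (hw : ∀ i j, ContDiffOn ℝ ∞ (fun q => w q.1 q.2 i j) W) (i j k : Fin 7) :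
    ContDiffOn ℝ ∞ (fun q => cov2 (F q.1) (w q.1) q.2 i j k) W := by
  have h1 := hF.christoffel
  have h2 := contDiffOn_pd hF.isOpen (u := fun t z => w t z j k) (hw j k) i
  simp only [G2Hilbert.cov2]
  fun_prop

theorem cov3 (hF : SmoothFam W F) {w : ℝ → E7 → C3}
    (hw : ∀ i j k, ContDiffOn ℝ ∞ (fun q => w q.1 q.2 i j k) W) (i j k l : Fin 7) :
    ContDiffOn ℝ ∞ (fun q => cov3 (F q.1) (w q.1) q.2 i j k l) W := by
  have h1 := hF.christoffel
  have h2 := contDiffOn_pd hF.isOpen (u := fun t z => w t z j k l) (hw j k l) i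
  simp only [G2Hilbert.cov3]
  fun_prop

theorem ricci (hF : SmoothFam W F) (j k : Fin 7) :
    ContDiffOn ℝ ∞ (fun q => ricci (F q.1) q.2 j k) W := by
  have h1 := hF.christoffel
  have h2 : ∀ i l j k, ContDiffOn ℝ ∞ (fun q => pd i (fun z => G2Hilbert.christoffel (F q.1) z l j k) q.2) W :=
    fun i l j k => contDiffOn_pd hF.isOpen (u := fun t z => G2Hilbert.christoffel (F t) z l j k)
      (hF.christoffel l j k) i
  simp only [G2Hilbert.ricci, riemann]
  fun_prop

theorem scal (hF : SmoothFam W F) : ContDiffOn ℝ ∞ (fun q => scal (F q.1) q.2) W :=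
  hF.tr (w := fun t z => G2Hilbert.ricci (F t) z) hF.ricci

theorem torsion (hF : SmoothFam W F) (i j : Fin 7) :
    ContDiffOn ℝ ∞ (fun q => torsion (F q.1) q.2 i j) W := by
  have h := hF.cov3 (w := fun t z => F t z) hF.smooth i
  exact contDiffOn_psiPart (f := fun q : ℝ × E7 => F q.1 q.2)
    (g := fun q : ℝ × E7 => G2Hilbert.cov3 (F q.1) (F q.1) q.2 i) hF.smooth h
    (fun q hq => (hF.model q hq).det_ne_zero) j

theorem trT (hF : SmoothFam W F) : ContDiffOn ℝ ∞ (fun q => trT (F q.1) q.2) W :=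
  hF.tr (w := fun t z => G2Hilbert.torsion (F t) z) hF.torsion

theorem vT (hF : SmoothFam W F) (k : Fin 7) : ContDiffOn ℝ ∞ (fun q => vT (F q.1) q.2 k) W :=
  hF.vop (w := fun t z => G2Hilbert.torsion (F t) z) hF.torsion k

theorem lagr (hF : SmoothFam W F) : ContDiffOn ℝ ∞ (fun q => lagr (F q.1) q.2) W := by
  have h1 := hF.scal
  have h2 := hF.ip2 (v := fun t z => G2Hilbert.torsion (F t) z)
    (w := fun t z => G2Hilbert.torsion (F t) z) hF.torsion hF.torsion
  have h3 := hF.trT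
  simp only [G2Hilbert.lagr]
  fun_prop

theorem lieMetric (hF : SmoothFam W F) {V : ℝ → E7 → C1}
    (hV : ∀ i, ContDiffOn ℝ ∞ (fun q => V q.1 q.2 i) W) (i j : Fin 7) :
    ContDiffOn ℝ ∞ (fun q => lieMetric (F q.1) (V q.1) q.2 i j) W := by
  have h1 := hF.metric
  have h2 : ∀ k, ContDiffOn ℝ ∞ (fun q => pd k (fun z => G2Hilbert.metric (F q.1 z) i j) q.2) W :=
    fun k => contDiffOn_pd hF.isOpen (u := fun t z => G2Hilbert.metric (F t z) i j) (hF.metric i j) k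
  have h3 : ∀ i k, ContDiffOn ℝ ∞ (fun q => pd i (fun z => V q.1 z k) q.2) W :=
    fun i k => contDiffOn_pd hF.isOpen (u := fun t z => V t z k) (hV k) i
  simp only [G2Hilbert.lieMetric]
  fun_prop

theorem locP1hat (hF : SmoothFam W F) (i j : Fin 7) :
    ContDiffOn ℝ ∞ (fun q => locP1hat (F q.1) q.2 i j) W := by
  have h1 := hF.ricci
  have h2 := hF.lieMetric (V := fun t z => G2Hilbert.raise1 (F t z) (G2Hilbert.vT (F t) z))
    (hF.raise1 (X := fun t z => G2Hilbert.vT (F t) z) hF.vT)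
  have h3 := hF.comp (v := fun t z => G2Hilbert.torsion (F t) z)
    (w := fun t z => G2Hilbert.hookPhi (F t z) (G2Hilbert.vT (F t) z)) hF.torsion
    (hF.hookPhi (X := fun t z => G2Hilbert.vT (F t) z) hF.vT)
  have h4 := hF.trT
  have h5 := hF.torsion
  simp only [G2Hilbert.locP1hat, sym]
  fun_prop

theorem div2 (hF : SmoothFam W F) {w : ℝ → E7 → C2}
    (hw : ∀ i j, ContDiffOn ℝ ∞ (fun q => w q.1 q.2 i j) W) (k : Fin 7) :
    ContDiffOn ℝ ∞ (fun q => div2 (F q.1) (w q.1) q.2 k) W := by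
  have h1 := hF.cometric
  have h2 := hF.cov2 hw
  simp only [G2Hilbert.div2]
  fun_prop

theorem locP2 (hF : SmoothFam W F) (k : Fin 7) :
    ContDiffOn ℝ ∞ (fun q => locP2 (F q.1) q.2 k) W := by
  have h1 := hF.div2 (w := fun t z => G2Hilbert.torsion (F t) z) hF.torsion
  have h2 := contDiffOn_pd hF.isOpen (u := fun t => G2Hilbert.trT (F t)) hF.trT k
  have h3 := hF.trT
  have h4 := hF.vT
  simp only [G2Hilbert.locP2]
  fun_prop

theorem locA (hF : SmoothFam W F) {h : ℝ → E7 → C2} {X : ℝ → E7 → C1}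
    (hh : ∀ i j, ContDiffOn ℝ ∞ (fun q => h q.1 q.2 i j) W)
    (hX : ∀ i, ContDiffOn ℝ ∞ (fun q => X q.1 q.2 i) W) (a : Fin 7) :
    ContDiffOn ℝ ∞ (fun q => locA (F q.1) (h q.1) (X q.1) q.2 a) W := by
  have h1 := contDiffOn_pd hF.isOpen (u := fun t z => G2Hilbert.tr (F t z) (h t z)) (hF.tr hh) a
  have h2 := hF.div2 hh
  have h3 := hF.vop (w := fun t z => G2Hilbert.comp (F t z) (h t z) (G2Hilbert.torsion (F t) z))
    (hF.comp hh (w := fun t z => G2Hilbert.torsion (F t) z) hF.torsion)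
  have h4 := hF.act (w := fun t z => G2Hilbert.torsion (F t) z) hF.torsion hX
  have h5 := hF.trT
  simp only [G2Hilbert.locA]
  fun_prop

end SmoothFam

end Family

/-- The components of a smooth 3-form that is pointwise a pullback of the model form. -/
structure SmoothField (U : Set E7) (f : E7 → C3) : Prop where
  isOpen : IsOpen U
  smooth : ∀ i j k, ContDiffOn ℝ ∞ (fun y => f y i j k) U
  model : ∀ y ∈ U, IsModel (f y)

/-- A single field is treated as a constant family, so the smoothness statements for families need
not be repeated. -/
theorem contDiffOn_snd_iff {U : Set E7} {u : E7 → ℝ} :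
    ContDiffOn ℝ ∞ (fun q : ℝ × E7 => u q.2) (univ ×ˢ U) ↔ ContDiffOn ℝ ∞ u U := by
  refine ⟨fun h => ?_, fun h => h.comp contDiff_snd.contDiffOn fun q hq => hq.2⟩
  exact h.comp (f := fun z : E7 => ((0 : ℝ), z)) (by fun_prop) fun z hz => ⟨trivial, hz⟩

theorem SmoothField.fam {U : Set E7} {f : E7 → C3} (hf : SmoothField U f) :
    SmoothFam (univ ×ˢ U) fun _ => f :=
  ⟨isOpen_univ.prod hf.isOpen, fun i j k => contDiffOn_snd_iff.2 (hf.smooth i j k),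
    fun q hq => hf.model q.2 hq.2⟩

theorem SmoothFam.field {W : Set (ℝ × E7)} {F : ℝ → E7 → C3} (hF : SmoothFam W F) (t : ℝ) :
    SmoothField {y | (t, y) ∈ W} (F t) := by
  refine ⟨hF.isOpen.preimage (by fun_prop), fun i j k => ?_, fun y hy => hF.model _ hy⟩
  exact (hF.smooth i j k).comp (f := fun z : E7 => (t, z)) (by fun_prop) fun z hz => hz

/-! ### Changes of coordinates -/

def inf1 (H : Mat) (X : C1) : C1 := fun i => ∑ a, H a i * X a

def inf2 (H : Mat) (w : C2) : C2 := fun i j => ∑ a, (H a i * w a j + H a j * w i a)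

theorem inf1_add (H K : Mat) (X : C1) : inf1 (H + K) X = inf1 H X + inf1 K X := by
  ext i
  simp only [inf1, Pi.add_apply, ← Finset.sum_add_distrib, Matrix.add_apply]
  exact Finset.sum_congr rfl fun a _ => by ring

theorem inf2_add (H K : Mat) (X : C2) : inf2 (H + K) X = inf2 H X + inf2 K X := by
  ext i j
  simp only [inf2, Pi.add_apply, ← Finset.sum_add_distrib, Matrix.add_apply]
  exact Finset.sum_congr rfl fun a _ => by ring

theorem inf1_sum (r : Fin 7 → ℝ) (H : Fin 7 → Mat) (X : C1) :
    inf1 (∑ p, r p • H p) X = ∑ p, r p • inf1 (H p) X := by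
  ext i
  simp only [inf1, Finset.sum_apply, Pi.smul_apply, smul_eq_mul, Matrix.sum_apply,
    Matrix.smul_apply, Finset.mul_sum, Finset.sum_mul]
  rw [Finset.sum_comm]
  exact Finset.sum_congr rfl fun a _ => Finset.sum_congr rfl fun p _ => by ring

theorem inf2_sum (r : Fin 7 → ℝ) (H : Fin 7 → Mat) (X : C2) :
    inf2 (∑ p, r p • H p) X = ∑ p, r p • inf2 (H p) X := by
  ext i j
  simp only [inf2, Finset.sum_apply, Pi.smul_apply, smul_eq_mul, Matrix.sum_apply,
    Matrix.smul_apply, Finset.mul_sum, Finset.sum_mul, ← Finset.sum_add_distrib]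
  rw [Finset.sum_comm]
  exact Finset.sum_congr rfl fun a _ => Finset.sum_congr rfl fun p _ => by ring

theorem inf3_sum (r : Fin 7 → ℝ) (H : Fin 7 → Mat) (X : C3) :
    inf3 (∑ p, r p • H p) X = ∑ p, r p • inf3 (H p) X := by
  ext i j k
  simp only [inf3, Finset.sum_apply, Pi.smul_apply, smul_eq_mul, Matrix.sum_apply,
    Matrix.smul_apply, Finset.mul_sum, Finset.sum_mul, ← Finset.sum_add_distrib]
  rw [Finset.sum_comm]
  exact Finset.sum_congr rfl fun a _ => Finset.sum_congr rfl fun p _ => by ring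

section Curves

variable {B : ℝ → Mat} {N : Mat}

theorem hasDerivAt_mv (hB0 : B 0 = 1) (hB : ∀ a i, HasDerivAt (fun s => B s a i) (N a i) 0)
    {u : ℝ → C1} {u' : C1} (hu : ∀ i, HasDerivAt (fun s => u s i) (u' i) 0) (i : Fin 7) :
    HasDerivAt (fun s => mv (B s).transpose (u s) i) ((inf1 N (u 0) + u') i) 0 := by
  simp only [mv_apply_real, Matrix.transpose_apply]
  refine (HasDerivAt.fun_sum fun a _ => (hB a i).fun_mul (hu a)).congr_deriv ?_
  simp [hB0, inf1, Finset.sum_add_distrib, Matrix.one_apply]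

theorem hasDerivAt_tens2 (hB0 : B 0 = 1) (hB : ∀ a i, HasDerivAt (fun s => B s a i) (N a i) 0)
    {u : ℝ → C2} {u' : C2} (hu : ∀ i j, HasDerivAt (fun s => u s i j) (u' i j) 0) (i j : Fin 7) :
    HasDerivAt (fun s => tens2 (B s).transpose (u s) i j) ((inf2 N (u 0) + u') i j) 0 := by
  simp only [tens2_apply, Matrix.transpose_apply]
  refine (HasDerivAt.fun_sum fun a _ => HasDerivAt.fun_sum fun b _ =>
    ((hB a i).fun_mul (hB b j)).fun_mul (hu a b)).congr_deriv ?_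
  have e : ∀ a b, (N a i * B 0 b j + B 0 a i * N b j) * u 0 a b + B 0 a i * B 0 b j * u' a b =
      del b j * (N a i * u 0 a b) + del a i * (N b j * u 0 a b) + del a i * (del b j * u' a b) := by
    intro a b
    rw [hB0, Matrix.one_apply, Matrix.one_apply, del, del]
    ring
  simp only [e, Finset.sum_add_distrib, ← Finset.mul_sum, del_sum, inf2, Pi.add_apply]

theorem hasDerivAt_tens3 (hB0 : B 0 = 1) (hB : ∀ a i, HasDerivAt (fun s => B s a i) (N a i) 0)
    {u : ℝ → C3} {u' : C3} (hu : ∀ i j k, HasDerivAt (fun s => u s i j k) (u' i j k) 0)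
    (i j k : Fin 7) :
    HasDerivAt (fun s => tens3 (B s).transpose (u s) i j k) ((inf3 N (u 0) + u') i j k) 0 := by
  simp only [tens3_apply, Matrix.transpose_apply]
  refine (HasDerivAt.fun_sum fun a _ => HasDerivAt.fun_sum fun b _ => HasDerivAt.fun_sum fun d _ =>
    (((hB a i).fun_mul (hB b j)).fun_mul (hB d k)).fun_mul (hu a b d)).congr_deriv ?_
  have e : ∀ a b d, ((N a i * B 0 b j + B 0 a i * N b j) * B 0 d k + B 0 a i * B 0 b j * N d k) *
      u 0 a b d + B 0 a i * B 0 b j * B 0 d k * u' a b d =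
      del b j * (del d k * (N a i * u 0 a b d)) + del a i * (del d k * (N b j * u 0 a b d))
        + del a i * (del b j * (N d k * u 0 a b d))
        + del a i * (del b j * (del d k * u' a b d)) := by
    intro a b d
    simp only [hB0, Matrix.one_apply, del]
    ring
  simp only [e, Finset.sum_add_distrib, ← Finset.mul_sum, del_sum, inf3, Pi.add_apply]

end Curves

theorem mul_one_add_smul {A M N : Mat} (h : A * N = M * A) (s : ℝ) :
    A * (1 + s • N) = (1 + s • M) * A := by
  rw [mul_add, add_mul, mul_one, one_mul, Matrix.mul_smul, Matrix.smul_mul, h]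

theorem inf1_pull {A M N : Mat} (h : A * N = M * A) (X : C1) :
    inf1 N (mv A.transpose X) = mv A.transpose (inf1 M X) := by
  ext i
  simp only [inf1, mv_apply_real, Finset.mul_sum, Matrix.transpose_apply]
  have e : ∀ b, ∑ a, A b a * N a i = ∑ a, M b a * A a i := fun b => congrFun (congrFun h b) i
  have e1 : ∑ a, ∑ b, N a i * (A b a * X b) = ∑ b, (∑ a, A b a * N a i) * X b := by
    simp only [Finset.sum_mul]
    rw [Finset.sum_comm]
    exact Finset.sum_congr rfl fun a _ => Finset.sum_congr rfl fun b _ => by ring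
  rw [e1]
  simp only [e, Finset.sum_mul]
  rw [Finset.sum_comm]
  exact Finset.sum_congr rfl fun a _ => Finset.sum_congr rfl fun b _ => by ring

theorem inf2_pull {A M N : Mat} (h : A * N = M * A) (w : C2) :
    inf2 N (tens2 A.transpose w) = tens2 A.transpose (inf2 M w) := by
  ext i j
  have h1 := hasDerivAt_tens2 (one_add_zero_smul N) (hasDerivAt_one_add_smul N)
    (u := fun _ => tens2 A.transpose w) (u' := 0) (fun i j => hasDerivAt_const _ _) i j
  have h2 := fun a b => hasDerivAt_tens2 (one_add_zero_smul M) (hasDerivAt_one_add_smul M)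
    (u := fun _ => w) (u' := 0) (fun i j => hasDerivAt_const _ _) a b
  have h3 : HasDerivAt (fun s : ℝ => ∑ a, ∑ b, A.transpose i a * A.transpose j b *
      tens2 (1 + s • M).transpose w a b) (∑ a, ∑ b, A.transpose i a * A.transpose j b *
      (inf2 M w + 0) a b) 0 :=
    HasDerivAt.fun_sum fun a _ => HasDerivAt.fun_sum fun b _ => (h2 a b).const_mul _
  simp only [← tens2_apply, tens2_mul, ← Matrix.transpose_mul, mul_one_add_smul h, add_zero]
    at h1 h3
  exact h1.unique h3

/-! ### Christoffel symbols -/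

/-- The connection form `Γ_i` of the Levi-Civita connection. -/
def gam (f : E7 → C3) (y : E7) (i : Fin 7) : Mat := Matrix.of fun a j => christoffel f y a i j

theorem cov1_eq (f : E7 → C3) (X : E7 → C1) (y : E7) (i : Fin 7) :
    cov1 f X y i = (fun j => pd i (fun z => X z j) y) - inf1 (gam f y i) (X y) := rfl

theorem cov2_eq (f : E7 → C3) (w : E7 → C2) (y : E7) (i : Fin 7) :
    cov2 f w y i = (fun j k => pd i (fun z => w z j k) y) - inf2 (gam f y i) (w y) := rfl

theorem cov3_eq (f : E7 → C3) (w : E7 → C3) (y : E7) (i : Fin 7) :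
    cov3 f w y i = (fun j k l => pd i (fun z => w z j k l) y) - inf3 (gam f y i) (w y) := rfl

theorem christoffel_congr {U : Set E7} (hU : IsOpen U) {f g : E7 → C3}
    (h : ∀ z ∈ U, f z = g z) {y : E7} (hy : y ∈ U) : christoffel f y = christoffel g y := by
  ext k i j
  have e : ∀ i j l, pd i (fun z => metric (f z) j l) y = pd i (fun z => metric (g z) j l) y :=
    fun i j l => pd_congr hU (fun z hz => by rw [h z hz]) hy i
  simp only [christoffel, e, h y hy]

section Field

variable {U : Set E7} {f : E7 → C3}

namespace SmoothField

theorem contDiffAt_apply (hf : SmoothField U f) {y : E7} (hy : y ∈ U) (i j k : Fin 7) :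
    ContDiffAt ℝ ∞ (fun z => f z i j k) y := (hf.smooth i j k).contDiffAt (hf.isOpen.mem_nhds hy)

theorem diffAt {u : E7 → ℝ} (hf : SmoothField U f) (hu : ContDiffOn ℝ ∞ u U) {y : E7}
    (hy : y ∈ U) : DifferentiableAt ℝ u y :=
  (hu.contDiffAt (hf.isOpen.mem_nhds hy)).differentiableAt (by simp)

theorem metric (hf : SmoothField U f) (i j : Fin 7) :
    ContDiffOn ℝ ∞ (fun y => metric (f y) i j) U := contDiffOn_snd_iff.1 (hf.fam.metric i j)

theorem cometric (hf : SmoothField U f) (i j : Fin 7) :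
    ContDiffOn ℝ ∞ (fun y => cometric (f y) i j) U := contDiffOn_snd_iff.1 (hf.fam.cometric i j)

theorem christoffel (hf : SmoothField U f) (k i j : Fin 7) :
    ContDiffOn ℝ ∞ (fun y => christoffel f y k i j) U :=
  contDiffOn_snd_iff.1 (hf.fam.christoffel k i j)

theorem pd (hf : SmoothField U f) {u : E7 → ℝ} (hu : ContDiffOn ℝ ∞ u U) (i : Fin 7) :
    ContDiffOn ℝ ∞ (fun y => pd i u y) U :=
  contDiffOn_snd_iff.1 (contDiffOn_pd hf.fam.isOpen (u := fun _ => u) (contDiffOn_snd_iff.2 hu) i)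

theorem pd_metric_symm (hf : SmoothField U f) {y : E7} (hy : y ∈ U) (i j k : Fin 7) :
    G2Hilbert.pd i (fun z => G2Hilbert.metric (f z) k j) y =
      G2Hilbert.pd i (fun z => G2Hilbert.metric (f z) j k) y :=
  pd_congr hf.isOpen (fun z hz => metric_symm (hf.model z hz) j k) hy i

theorem christoffel_symm (hf : SmoothField U f) {y : E7} (hy : y ∈ U) (k i j : Fin 7) :
    G2Hilbert.christoffel f y k j i = G2Hilbert.christoffel f y k i j := by
  simp only [G2Hilbert.christoffel, hf.pd_metric_symm hy _ i j]
  congr 1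
  exact Finset.sum_congr rfl fun l _ => by ring

/-- The Christoffel symbols of the first kind. -/
theorem sum_christoffel_metric (hf : SmoothField U f) {y : E7} (hy : y ∈ U) (i j l : Fin 7) :
    ∑ a, G2Hilbert.christoffel f y a i j * G2Hilbert.metric (f y) a l =
      (1 / 2) * (G2Hilbert.pd i (fun z => G2Hilbert.metric (f z) j l) y
        + G2Hilbert.pd j (fun z => G2Hilbert.metric (f z) i l) y
        - G2Hilbert.pd l (fun z => G2Hilbert.metric (f z) i j) y) := by
  have hm := hf.model y hy
  simp only [G2Hilbert.christoffel, Finset.mul_sum, Finset.sum_mul]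
  rw [Finset.sum_comm]
  have e : ∀ b, ∑ a, 1 / 2 * (G2Hilbert.cometric (f y) a b *
      (G2Hilbert.pd i (fun z => G2Hilbert.metric (f z) j b) y
        + G2Hilbert.pd j (fun z => G2Hilbert.metric (f z) i b) y
        - G2Hilbert.pd b (fun z => G2Hilbert.metric (f z) i j) y)) * G2Hilbert.metric (f y) a l =
      del b l * ((1 / 2) * (G2Hilbert.pd i (fun z => G2Hilbert.metric (f z) j b) y
        + G2Hilbert.pd j (fun z => G2Hilbert.metric (f z) i b) y
        - G2Hilbert.pd b (fun z => G2Hilbert.metric (f z) i j) y)) := by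
    intro b
    rw [← hm.sum_cometric_metric, Finset.sum_mul]
    refine Finset.sum_congr rfl fun a _ => ?_
    rw [hm.cometric_symm a b]
    ring
  simp only [e, del_sum]

/-- The Levi-Civita connection is metric. -/
theorem pd_metric (hf : SmoothField U f) {y : E7} (hy : y ∈ U) (i j l : Fin 7) :
    G2Hilbert.pd i (fun z => G2Hilbert.metric (f z) j l) y =
      inf2 (gam f y i) (G2Hilbert.metric (f y)) j l := by
  simp only [inf2, gam, Matrix.of_apply, Finset.sum_add_distrib]
  rw [hf.sum_christoffel_metric hy i j l]
  simp only [metric_symm (hf.model y hy) _ j]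
  rw [hf.sum_christoffel_metric hy i l j, hf.pd_metric_symm hy i j l]
  ring

/-- The Levi-Civita connection is the only torsion free metric connection. -/
theorem christoffel_unique (hf : SmoothField U f) {y : E7} (hy : y ∈ U) {S : C3}
    (hS : ∀ k i j, S k j i = S k i j)
    (hg : ∀ i j l, G2Hilbert.pd i (fun z => G2Hilbert.metric (f z) j l) y =
      inf2 (Matrix.of fun a j => S a i j) (G2Hilbert.metric (f y)) j l) :
    G2Hilbert.christoffel f y = S := by
  have hm := hf.model y hy
  have h1 : ∀ i j l, ∑ a, S a i j * G2Hilbert.metric (f y) a l =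
      ∑ a, G2Hilbert.christoffel f y a i j * G2Hilbert.metric (f y) a l := by
    intro i j l
    rw [hf.sum_christoffel_metric hy, hg, hg, hg]
    simp only [inf2, Matrix.of_apply, Finset.sum_add_distrib, metric_symm hm _ i,
      metric_symm hm _ j, hS _ i j, hS _ l j, hS _ l i]
    ring
  ext k i j
  have h2 : ∀ T : C1, T k = ∑ l, (∑ a, T a * G2Hilbert.metric (f y) a l) *
      G2Hilbert.cometric (f y) l k := by
    intro T
    have e : ∀ a, ∑ l, G2Hilbert.metric (f y) a l * G2Hilbert.cometric (f y) l k = del a k := by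
      intro a
      have := congrFun (congrFun hm.metric_mul_coMat a) k
      rwa [Matrix.mul_apply, Matrix.one_apply] at this
    simp only [Finset.sum_mul]
    rw [Finset.sum_comm]
    simp only [mul_assoc, ← Finset.mul_sum, e]
    simp [del]
  rw [h2 (fun a => G2Hilbert.christoffel f y a i j), h2 (fun a => S a i j)]
  simp only [h1]

end SmoothField

end Field

/-! ### Transformation laws -/

/-- The Jacobi matrix. -/
def jac (κ : E7 → E7) (z : E7) : Mat := Matrix.of fun a b => pd b (fun z => κ z a) z

def pf1 (κ : E7 → E7) (X : E7 → C1) (z : E7) : C1 := mv (jac κ z).transpose (X (κ z))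

def pf2 (κ : E7 → E7) (w : E7 → C2) (z : E7) : C2 := tens2 (jac κ z).transpose (w (κ z))

def pf3 (κ : E7 → E7) (w : E7 → C3) (z : E7) : C3 := pull3 (jac κ z) (w (κ z))

theorem jac_eq_fderiv {κ : E7 → E7} {z : E7} (hκ : DifferentiableAt ℝ κ z) (r i : Fin 7) :
    jac κ z r i = fderiv ℝ κ z (EuclideanSpace.single i 1) r := by
  have : HasFDerivAt (fun z => κ z r) ((EuclideanSpace.proj r : E7 →L[ℝ] ℝ).comp (fderiv ℝ κ z)) z :=
    (EuclideanSpace.proj r : E7 →L[ℝ] ℝ).hasFDerivAt.comp z hκ.hasFDerivAt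
  rw [jac, Matrix.of_apply, pd, this.fderiv]
  rfl

theorem eq_sum_single (v : E7) : v = ∑ r, v r • EuclideanSpace.single r (1 : ℝ) := by
  ext r
  simp [Pi.single_apply]

theorem pd_comp_of_differentiableAt {u : E7 → ℝ} {κ : E7 → E7} {z : E7}
    (hu : DifferentiableAt ℝ u (κ z)) (hκ : DifferentiableAt ℝ κ z) (i : Fin 7) :
    pd i (fun z => u (κ z)) z = ∑ r, jac κ z r i * pd r u (κ z) := by
  have h3 : fderiv ℝ (fun z => u (κ z)) z = (fderiv ℝ u (κ z)).comp (fderiv ℝ κ z) :=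
    (hu.hasFDerivAt.comp z hκ.hasFDerivAt).fderiv
  rw [pd, h3, ContinuousLinearMap.comp_apply, eq_sum_single (fderiv ℝ κ z _), map_sum]
  simp only [map_smul, smul_eq_mul, jac_eq_fderiv hκ, pd]

/-- A smooth change of coordinates. -/
structure CoordChange (U V : Set E7) (κ : E7 → E7) : Prop where
  isOpen : IsOpen U
  isOpen_target : IsOpen V
  smooth : ∀ a, ContDiffOn ℝ ∞ (fun z => κ z a) U
  maps : ∀ z ∈ U, κ z ∈ V
  det : ∀ z ∈ U, (jac κ z).det ≠ 0

namespace CoordChange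

variable {U V : Set E7} {κ : E7 → E7} (hκ : CoordChange U V κ) {f : E7 → C3}

theorem contDiffOn (hκ : CoordChange U V κ) : ContDiffOn ℝ ∞ κ U :=
  contDiffOn_euclidean.2 hκ.smooth

theorem comp (hκ : CoordChange U V κ) {u : E7 → ℝ} (hu : ContDiffOn ℝ ∞ u V) :
    ContDiffOn ℝ ∞ (fun z => u (κ z)) U := hu.comp hκ.contDiffOn hκ.maps

theorem smooth_jac (hκ : CoordChange U V κ) (a b : Fin 7) :
    ContDiffOn ℝ ∞ (fun z => jac κ z a b) U :=
  contDiffOn_snd_iff.1 (contDiffOn_pd (isOpen_univ.prod hκ.isOpen) (u := fun _ z => κ z a)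
    (contDiffOn_snd_iff.2 (hκ.smooth a)) b)

theorem smooth_pf1 (hκ : CoordChange U V κ) {X : E7 → C1}
    (hX : ∀ i, ContDiffOn ℝ ∞ (fun y => X y i) V) (i : Fin 7) :
    ContDiffOn ℝ ∞ (fun z => pf1 κ X z i) U := by
  have h1 := hκ.smooth_jac
  have h2 := fun i => hκ.comp (hX i)
  simp only [pf1, mv_apply_real, Matrix.transpose_apply]
  exact ContDiffOn.sum fun a _ => (h1 a i).mul (h2 a)

theorem smooth_pf2 (hκ : CoordChange U V κ) {w : E7 → C2}
    (hw : ∀ i j, ContDiffOn ℝ ∞ (fun y => w y i j) V) (i j : Fin 7) :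
    ContDiffOn ℝ ∞ (fun z => pf2 κ w z i j) U := by
  have h1 := hκ.smooth_jac
  have h2 := fun i j => hκ.comp (hw i j)
  simp only [pf2, tens2_apply, Matrix.transpose_apply]
  exact ContDiffOn.sum fun a _ => ContDiffOn.sum fun b _ =>
    ((h1 a i).mul (h1 b j)).mul (h2 a b)

theorem smooth_pf3 (hκ : CoordChange U V κ) {w : E7 → C3}
    (hw : ∀ i j k, ContDiffOn ℝ ∞ (fun y => w y i j k) V) (i j k : Fin 7) :
    ContDiffOn ℝ ∞ (fun z => pf3 κ w z i j k) U := by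
  have h1 := hκ.smooth_jac
  have h2 := fun i j k => hκ.comp (hw i j k)
  simp only [pf3, tens3_apply, Matrix.transpose_apply]
  exact ContDiffOn.sum fun a _ => ContDiffOn.sum fun b _ => ContDiffOn.sum fun d _ =>
    (((h1 a i).mul (h1 b j)).mul (h1 d k)).mul (h2 a b d)

theorem field (hκ : CoordChange U V κ) (hf : SmoothField V f) : SmoothField U (pf3 κ f) :=
  ⟨hκ.isOpen, hκ.smooth_pf3 hf.smooth, fun z hz =>
    (hf.model _ (hκ.maps z hz)).pull3 (hκ.det z hz)⟩

theorem diffAt (hκ : CoordChange U V κ) {u : E7 → ℝ} (hu : ContDiffOn ℝ ∞ u U) {z : E7}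
    (hz : z ∈ U) : DifferentiableAt ℝ u z :=
  (hu.contDiffAt (hκ.isOpen.mem_nhds hz)).differentiableAt (by simp)

theorem diffAt_map (hκ : CoordChange U V κ) {z : E7} (hz : z ∈ U) : DifferentiableAt ℝ κ z :=
  (hκ.contDiffOn.contDiffAt (hκ.isOpen.mem_nhds hz)).differentiableAt (by simp)

theorem pd_comp (hκ : CoordChange U V κ) {u : E7 → ℝ} (hu : ContDiffOn ℝ ∞ u V) {z : E7}
    (hz : z ∈ U) (i : Fin 7) :
    pd i (fun z => u (κ z)) z = ∑ r, jac κ z r i * pd r u (κ z) :=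
  pd_comp_of_differentiableAt ((hu.contDiffAt
    (hκ.isOpen_target.mem_nhds (hκ.maps z hz))).differentiableAt (by simp)) (hκ.diffAt_map hz) i

/-- `J⁻¹ ∂_i J`. -/
def _root_.G2Hilbert.logJac (κ : E7 → E7) (z : E7) (i : Fin 7) : Mat :=
  (jac κ z)⁻¹ * Matrix.of fun a b => pd i (fun z => jac κ z a b) z

/-- Multiplication by the inverse Jacobi matrix at the base point produces a curve of matrices
through the identity, to which the derivative formulas for the tensor actions apply. Its velocity is
the inhomogeneous term in the transformation law of the connection. -/
theorem hasDerivAt_jac (hκ : CoordChange U V κ) {z : E7} (hz : z ∈ U) (i a b : Fin 7) :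
    HasDerivAt (fun s : ℝ => ((jac κ z)⁻¹ *
      jac κ (z + s • EuclideanSpace.single i (1 : ℝ))) a b) (logJac κ z i a b) 0 := by
  simp only [logJac, Matrix.mul_apply, Matrix.of_apply]
  exact HasDerivAt.fun_sum fun c _ =>
    (hasDerivAt_line (hκ.diffAt (hκ.smooth_jac c b) hz) i).const_mul _

theorem inv_mul_jac_zero (hκ : CoordChange U V κ) {z : E7} (hz : z ∈ U) (i : Fin 7) :
    (jac κ z)⁻¹ * jac κ (z + (0 : ℝ) • EuclideanSpace.single i (1 : ℝ)) = 1 := by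
  rw [zero_smul, add_zero, Matrix.nonsing_inv_mul _ (hκ.det z hz).isUnit]

theorem jac_mul (hκ : CoordChange U V κ) {z : E7} (hz : z ∈ U) (B : Mat) :
    (jac κ z) * ((jac κ z)⁻¹ * B) = B := by
  rw [← Matrix.mul_assoc, Matrix.mul_nonsing_inv _ (hκ.det z hz).isUnit, Matrix.one_mul]

theorem pd_pf1 (hκ : CoordChange U V κ) {X : E7 → C1}
    (hX : ∀ i, ContDiffOn ℝ ∞ (fun y => X y i) V) {z : E7} (hz : z ∈ U) (i : Fin 7) :
    (fun j => pd i (fun z => pf1 κ X z j) z) = inf1 (logJac κ z i) (pf1 κ X z) +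
      mv (jac κ z).transpose (∑ r, jac κ z r i • fun j => pd r (fun y => X y j) (κ z)) := by
  ext j
  refine pd_eq_of_line (hκ.diffAt (hκ.smooth_pf1 hX j) hz) ?_
  have hu : ∀ j, HasDerivAt (fun s : ℝ => mv (jac κ z).transpose
      (X (κ (z + s • EuclideanSpace.single i (1 : ℝ)))) j) _ 0 := fun j => by
    simp only [mv_apply_real]
    exact HasDerivAt.fun_sum fun a _ =>
      (hasDerivAt_line (hκ.diffAt (hκ.comp (hX a)) hz) i).const_mul _
  have h := hasDerivAt_mv (hκ.inv_mul_jac_zero hz i) (hκ.hasDerivAt_jac hz i) hu j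
  simp only [mv_mv, ← Matrix.transpose_mul, hκ.jac_mul hz] at h
  refine h.congr_deriv ?_
  simp only [hκ.pd_comp (hX _) hz, zero_smul, add_zero, Pi.add_apply, pf1]
  simp [mv_apply_real]

theorem pd_pf2 (hκ : CoordChange U V κ) {w : E7 → C2}
    (hw : ∀ i j, ContDiffOn ℝ ∞ (fun y => w y i j) V) {z : E7} (hz : z ∈ U) (i : Fin 7) :
    (fun j k => pd i (fun z => pf2 κ w z j k) z) = inf2 (logJac κ z i) (pf2 κ w z) +
      tens2 (jac κ z).transpose (∑ r, jac κ z r i • fun j k => pd r (fun y => w y j k) (κ z)) := by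
  ext j k
  refine pd_eq_of_line (hκ.diffAt (hκ.smooth_pf2 hw j k) hz) ?_
  have hu : ∀ j k, HasDerivAt (fun s : ℝ => tens2 (jac κ z).transpose
      (w (κ (z + s • EuclideanSpace.single i (1 : ℝ)))) j k) _ 0 := fun j k => by
    simp only [tens2_apply]
    exact HasDerivAt.fun_sum fun a _ => HasDerivAt.fun_sum fun b _ =>
      (hasDerivAt_line (hκ.diffAt (hκ.comp (hw a b)) hz) i).const_mul _
  have h := hasDerivAt_tens2 (hκ.inv_mul_jac_zero hz i) (hκ.hasDerivAt_jac hz i) hu j k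
  simp only [tens2_mul, ← Matrix.transpose_mul, hκ.jac_mul hz] at h
  refine h.congr_deriv ?_
  simp only [hκ.pd_comp (hw _ _) hz, zero_smul, add_zero, Pi.add_apply, pf2]
  simp [tens2_apply]

theorem pd_pf3 (hκ : CoordChange U V κ) {w : E7 → C3}
    (hw : ∀ i j k, ContDiffOn ℝ ∞ (fun y => w y i j k) V) {z : E7} (hz : z ∈ U) (i : Fin 7) :
    (fun j k l => pd i (fun z => pf3 κ w z j k l) z) = inf3 (logJac κ z i) (pf3 κ w z) +
      pull3 (jac κ z) (∑ r, jac κ z r i • fun j k l => pd r (fun y => w y j k l) (κ z)) := by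
  ext j k l
  refine pd_eq_of_line (hκ.diffAt (hκ.smooth_pf3 hw j k l) hz) ?_
  have hu : ∀ j k l, HasDerivAt (fun s : ℝ => tens3 (jac κ z).transpose
      (w (κ (z + s • EuclideanSpace.single i (1 : ℝ)))) j k l) _ 0 := fun j k l => by
    simp only [tens3_apply]
    exact HasDerivAt.fun_sum fun a _ => HasDerivAt.fun_sum fun b _ => HasDerivAt.fun_sum fun d _ =>
      (hasDerivAt_line (hκ.diffAt (hκ.comp (hw a b d)) hz) i).const_mul _
  have h := hasDerivAt_tens3 (hκ.inv_mul_jac_zero hz i) (hκ.hasDerivAt_jac hz i) hu j k l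
  simp only [tens3_mul, ← Matrix.transpose_mul, hκ.jac_mul hz] at h
  refine h.congr_deriv ?_
  simp only [hκ.pd_comp (hw _ _ _) hz, zero_smul, add_zero, Pi.add_apply, pf3]
  simp [tens3_apply]

theorem metric_pf3 (hκ : CoordChange U V κ) {z : E7} (hz : z ∈ U) :
    metric (pf3 κ f z) = pf2 κ (fun y => metric (f y)) z := metric_pull (hκ.det z hz) _

/-- `Σ_r J_{ri} Γ_r`. -/
def _root_.G2Hilbert.gamJ (κ : E7 → E7) (f : E7 → C3) (z : E7) (i : Fin 7) : Mat :=
  ∑ r, jac κ z r i • gam f (κ z) r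

theorem jac_mul_conj (hκ : CoordChange U V κ) {z : E7} (hz : z ∈ U) (M : Mat) :
    jac κ z * ((jac κ z)⁻¹ * M * jac κ z) = M * jac κ z := by
  rw [Matrix.mul_assoc, hκ.jac_mul hz]

theorem pd_jac_symm (hκ : CoordChange U V κ) {z : E7} (hz : z ∈ U) (a i j : Fin 7) :
    pd i (fun z => jac κ z a j) z = pd j (fun z => jac κ z a i) z :=
  pd_comm ((hκ.smooth a).contDiffAt (hκ.isOpen.mem_nhds hz)) i j

/-- The right hand side is symmetric in its lower indices, because the Christoffel symbols are and
second derivatives of `κ` commute, and it is metric, by differentiating the law for `g`. Uniqueness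
of the Levi-Civita connection identifies it without expanding the definition. -/
theorem gam_pf3 (hκ : CoordChange U V κ) (hf : SmoothField V f) {z : E7} (hz : z ∈ U) (i : Fin 7) :
    gam (pf3 κ f) z i = (jac κ z)⁻¹ * gamJ κ f z i * jac κ z + logJac κ z i := by
  set S : C3 := fun k i j => ((jac κ z)⁻¹ * gamJ κ f z i * jac κ z + logJac κ z i) k j with hS
  suffices h : christoffel (pf3 κ f) z = S by
    ext k j
    simp only [gam, Matrix.of_apply, h, hS]
  refine (hκ.field hf).christoffel_unique hz ?_ ?_
  · intro k i j
    simp only [hS, Matrix.add_apply, logJac, Matrix.mul_assoc]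
    rw [Matrix.mul_apply, Matrix.mul_apply, Matrix.mul_apply, Matrix.mul_apply]
    simp only [Matrix.of_apply, hκ.pd_jac_symm hz _ j i]
    congr 1
    refine Finset.sum_congr rfl fun c _ => ?_
    congr 1
    simp only [gamJ, Matrix.mul_apply, Matrix.sum_apply, Matrix.smul_apply, smul_eq_mul,
      Finset.sum_mul]
    rw [Finset.sum_comm]
    refine Finset.sum_congr rfl fun a _ => Finset.sum_congr rfl fun b _ => ?_
    rw [gam, gam, Matrix.of_apply, Matrix.of_apply, hf.christoffel_symm (hκ.maps z hz) c a b]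
    ring
  · intro i j l
    have e : (Matrix.of fun a j => S a i j : Mat) =
        (jac κ z)⁻¹ * gamJ κ f z i * jac κ z + logJac κ z i := rfl
    have e2 : ∀ r, (fun j k => pd r (fun y => metric (f y) j k) (κ z)) =
        inf2 (gam f (κ z) r) (metric (f (κ z))) := fun r => by
      ext a b
      exact hf.pd_metric (hκ.maps z hz) r a b
    have h1 := congrFun (congrFun (hκ.pd_pf2 hf.metric hz i) j) l
    simp only [e2] at h1
    rw [pd_congr hκ.isOpen (fun z hz => by rw [hκ.metric_pf3 hz]) hz i, h1, e, hκ.metric_pf3 hz,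
      inf2_add, add_comm, pf2, inf2_pull (hκ.jac_mul_conj hz _), gamJ, inf2_sum]

/-- Differentiating the pulled back components and transforming the connection form produce the same
inhomogeneous term `logJac`, which cancels. -/
theorem cov1_pf (hκ : CoordChange U V κ) (hf : SmoothField V f) {X : E7 → C1}
    (hX : ∀ i, ContDiffOn ℝ ∞ (fun y => X y i) V) {z : E7} (hz : z ∈ U) :
    cov1 (pf3 κ f) (pf1 κ X) z = pf2 κ (cov1 f X) z := by
  have h : ∀ i, cov1 (pf3 κ f) (pf1 κ X) z i =
      ∑ r, jac κ z r i • mv (jac κ z).transpose (cov1 f X (κ z) r) := by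
    intro i
    rw [cov1_eq, hκ.pd_pf1 hX hz, hκ.gam_pf3 hf hz, inf1_add, pf1,
      inf1_pull (hκ.jac_mul_conj hz _), gamJ, inf1_sum]
    simp only [cov1_eq, map_sum, map_sub, map_smul, smul_sub, Finset.sum_sub_distrib]
    abel
  ext i : 1
  rw [h]
  rfl

theorem cov2_pf (hκ : CoordChange U V κ) (hf : SmoothField V f) {w : E7 → C2}
    (hw : ∀ i j, ContDiffOn ℝ ∞ (fun y => w y i j) V) {z : E7} (hz : z ∈ U) :
    cov2 (pf3 κ f) (pf2 κ w) z = pf3 κ (cov2 f w) z := by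
  have h : ∀ i, cov2 (pf3 κ f) (pf2 κ w) z i =
      ∑ r, jac κ z r i • tens2 (jac κ z).transpose (cov2 f w (κ z) r) := by
    intro i
    rw [cov2_eq, hκ.pd_pf2 hw hz, hκ.gam_pf3 hf hz, inf2_add, pf2,
      inf2_pull (hκ.jac_mul_conj hz _), gamJ, inf2_sum]
    simp only [cov2_eq, map_sum, map_sub, map_smul, smul_sub, Finset.sum_sub_distrib]
    abel
  ext i : 1
  rw [h]
  rfl

theorem cov3_pf (hκ : CoordChange U V κ) (hf : SmoothField V f) {w : E7 → C3}
    (hw : ∀ i j k, ContDiffOn ℝ ∞ (fun y => w y i j k) V) {z : E7} (hz : z ∈ U) :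
    cov3 (pf3 κ f) (pf3 κ w) z = tens4 (jac κ z).transpose (cov3 f w (κ z)) := by
  have h : ∀ i, cov3 (pf3 κ f) (pf3 κ w) z i =
      ∑ r, jac κ z r i • pull3 (jac κ z) (cov3 f w (κ z) r) := by
    intro i
    rw [cov3_eq, hκ.pd_pf3 hw hz, hκ.gam_pf3 hf hz, inf3_add, pf3,
      inf3_pull (hκ.jac_mul_conj hz _), gamJ, inf3_sum]
    simp only [cov3_eq, map_sum, map_sub, map_smul, smul_sub, Finset.sum_sub_distrib]
    abel
  ext i : 1
  rw [h]
  rfl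

end CoordChange

/-! ### Curvature, torsion and the operators of the variational formula under changes of coordinates -/

section Field

variable {U : Set E7} {f : E7 → C3}

theorem cov1_congr (hU : IsOpen U) {X Y : E7 → C1} (h : ∀ z ∈ U, X z = Y z) {y : E7} (hy : y ∈ U) :
    cov1 f X y = cov1 f Y y := by
  ext i j
  rw [cov1, cov1, h y hy, pd_congr hU (fun z hz => by rw [h z hz]) hy i]

theorem cov2_congr (hU : IsOpen U) {X Y : E7 → C2} (h : ∀ z ∈ U, X z = Y z) {y : E7} (hy : y ∈ U) :
    cov2 f X y = cov2 f Y y := by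
  ext i j k
  rw [cov2, cov2, h y hy, pd_congr hU (fun z hz => by rw [h z hz]) hy i]

namespace SmoothField

theorem cov1 (hf : SmoothField U f) {X : E7 → C1} (hX : ∀ i, ContDiffOn ℝ ∞ (fun y => X y i) U)
    (i j : Fin 7) : ContDiffOn ℝ ∞ (fun y => cov1 f X y i j) U :=
  contDiffOn_snd_iff.1 (hf.fam.cov1 (X := fun _ => X) (fun i => contDiffOn_snd_iff.2 (hX i)) i j)

theorem torsion (hf : SmoothField U f) (i j : Fin 7) :
    ContDiffOn ℝ ∞ (fun y => torsion f y i j) U := contDiffOn_snd_iff.1 (hf.fam.torsion i j)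

theorem trT (hf : SmoothField U f) : ContDiffOn ℝ ∞ (fun y => trT f y) U :=
  contDiffOn_snd_iff.1 hf.fam.trT

theorem vT (hf : SmoothField U f) (i : Fin 7) : ContDiffOn ℝ ∞ (fun y => vT f y i) U :=
  contDiffOn_snd_iff.1 (hf.fam.vT i)

theorem tr (hf : SmoothField U f) {w : E7 → C2}
    (hw : ∀ i j, ContDiffOn ℝ ∞ (fun y => w y i j) U) :
    ContDiffOn ℝ ∞ (fun y => tr (f y) (w y)) U :=
  contDiffOn_snd_iff.1 (hf.fam.tr (w := fun _ => w) fun i j => contDiffOn_snd_iff.2 (hw i j))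

/-- The Ricci identity. -/
theorem ricci_identity (hf : SmoothField U f) {X : E7 → C1}
    (hX : ∀ i, ContDiffOn ℝ ∞ (fun y => X y i) U) {y : E7} (hy : y ∈ U) (i j k : Fin 7) :
    cov2 f (G2Hilbert.cov1 f X) y i j k - cov2 f (G2Hilbert.cov1 f X) y j i k =
      -∑ l, riemann f y i j k l * X y l := by
  have h1 : ∀ i j, G2Hilbert.pd i (fun z => G2Hilbert.cov1 f X z j k) y =
      G2Hilbert.pd i (G2Hilbert.pd j fun z => X z k) y
      - ∑ a, (G2Hilbert.pd i (fun z => G2Hilbert.christoffel f z a j k) y * X y a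
        + G2Hilbert.christoffel f y a j k * G2Hilbert.pd i (fun z => X z a) y) := by
    intro i j
    refine pd_eq_of_line (hf.diffAt (hf.cov1 hX j k) hy) ?_
    have := (hasDerivAt_line (hf.diffAt (hf.pd (hX k) j) hy) i).fun_sub
      (HasDerivAt.fun_sum (u := Finset.univ) fun a _ =>
        (hasDerivAt_line (hf.diffAt (hf.christoffel a j k) hy) i).fun_mul
          (hasDerivAt_line (hf.diffAt (hX a) hy) i))
    simp only [zero_smul, add_zero] at this
    exact this
  have h2 : G2Hilbert.pd i (G2Hilbert.pd j fun z => X z k) y =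
      G2Hilbert.pd j (G2Hilbert.pd i fun z => X z k) y :=
    pd_comm ((hX k).contDiffAt (hf.isOpen.mem_nhds hy)) i j
  simp only [cov2, h1, h2, riemann, hf.christoffel_symm hy _ i j]
  simp only [G2Hilbert.cov1, mul_sub, add_mul, sub_mul, Finset.sum_add_distrib,
    Finset.sum_sub_distrib, Finset.mul_sum, Finset.sum_mul]
  have e : ∀ i j, ∑ l, ∑ p, G2Hilbert.christoffel f y l i p * G2Hilbert.christoffel f y p j k *
      X y l = ∑ p, ∑ l, G2Hilbert.christoffel f y p j k *
        (G2Hilbert.christoffel f y l i p * X y l) := by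
    intro i j
    rw [Finset.sum_comm]
    exact Finset.sum_congr rfl fun a _ => Finset.sum_congr rfl fun p _ => by ring
  rw [e, e]
  ring

theorem sum_metric_raise1 (hf : SmoothField U f) {y : E7} (hy : y ∈ U) (X : C1) (j : Fin 7) :
    ∑ k, G2Hilbert.metric (f y) j k * raise1 (f y) X k = X j := by
  have h := congrArg (fun M => mv M X j) (hf.model y hy).metric_mul_coMat
  simp only [← mv_mv, mv_one] at h
  exact h

theorem raise1 (hf : SmoothField U f) {X : E7 → C1}
    (hX : ∀ i, ContDiffOn ℝ ∞ (fun y => X y i) U) (i : Fin 7) :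
    ContDiffOn ℝ ∞ (fun y => raise1 (f y) (X y) i) U :=
  contDiffOn_snd_iff.1 (hf.fam.raise1 (X := fun _ => X) (fun i => contDiffOn_snd_iff.2 (hX i)) i)

/-- Differentiating `X_j = g_{jk} X^k` and using the Christoffel symbols of the first kind gives
`(L_X g)_{ij} = ∇_i X_j + ∇_j X_i`, which is visibly covariant. -/
theorem lieMetric_eq (hf : SmoothField U f) {X : E7 → C1}
    (hX : ∀ i, ContDiffOn ℝ ∞ (fun y => X y i) U) {y : E7} (hy : y ∈ U) :
    lieMetric f (fun z => G2Hilbert.raise1 (f z) (X z)) y = (2 : ℝ) • sym (G2Hilbert.cov1 f X y) := by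
  have h1 : ∀ i j, G2Hilbert.pd i (fun z => X z j) y = ∑ k,
      (G2Hilbert.pd i (fun z => G2Hilbert.metric (f z) j k) y * G2Hilbert.raise1 (f y) (X y) k
      + G2Hilbert.metric (f y) j k *
        G2Hilbert.pd i (fun z => G2Hilbert.raise1 (f z) (X z) k) y) := by
    intro i j
    refine pd_eq_of_line (hf.diffAt (hX j) hy) ?_
    have := HasDerivAt.fun_sum (u := Finset.univ) fun k _ =>
      (hasDerivAt_line (hf.diffAt (hf.metric j k) hy) i).fun_mul
          (hasDerivAt_line (hf.diffAt (hf.raise1 hX k) hy) i)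
    simp only [zero_smul, add_zero] at this
    refine this.congr_of_eventuallyEq ?_
    have hc : Filter.Tendsto (fun s : ℝ => y + s • EuclideanSpace.single i (1 : ℝ)) (nhds 0)
        (nhds y) := by
      have : Continuous fun s : ℝ => y + s • EuclideanSpace.single i (1 : ℝ) := by fun_prop
      simpa using this.tendsto 0
    filter_upwards [hc (hf.isOpen.mem_nhds hy)] with s hs
    exact (hf.sum_metric_raise1 hs _ j).symm
  have h2 : ∀ i j, ∑ a, G2Hilbert.christoffel f y a i j * X y a = ∑ k, (1 / 2) *
      (G2Hilbert.pd i (fun z => G2Hilbert.metric (f z) j k) y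
        + G2Hilbert.pd j (fun z => G2Hilbert.metric (f z) i k) y
        - G2Hilbert.pd k (fun z => G2Hilbert.metric (f z) i j) y) *
          G2Hilbert.raise1 (f y) (X y) k := by
    intro i j
    simp only [← hf.sum_christoffel_metric hy, ← hf.sum_metric_raise1 hy (X y), Finset.mul_sum,
      Finset.sum_mul]
    rw [Finset.sum_comm]
    refine Finset.sum_congr rfl fun a _ => Finset.sum_congr rfl fun k _ => ?_
    ring
  ext i j
  simp only [lieMetric, sym, G2Hilbert.cov1, Pi.smul_apply, smul_eq_mul, h1, h2]
  rw [mul_div_cancel₀ _ two_ne_zero]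
  simp only [← Finset.sum_sub_distrib, ← Finset.sum_add_distrib]
  refine Finset.sum_congr rfl fun k _ => ?_
  rw [hf.pd_metric_symm hy k i j, metric_symm (hf.model y hy) k j]
  ring

theorem locP1hat_eq (hf : SmoothField U f) {y : E7} (hy : y ∈ U) :
    locP1hat f y = -ricci f y - (2 / 3 : ℝ) • sym (G2Hilbert.cov1 f (G2Hilbert.vT f) y)
      - (2 / 3 : ℝ) • sym (comp (f y) (G2Hilbert.torsion f y) (hookPhi (f y) (G2Hilbert.vT f y)))
      + G2Hilbert.trT f y • sym (G2Hilbert.torsion f y) := by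
  ext i j
  simp only [locP1hat, hf.lieMetric_eq hf.vT hy, Pi.add_apply, Pi.sub_apply, Pi.smul_apply,
    Pi.neg_apply, smul_eq_mul]
  ring

end SmoothField

end Field

def psiPartL (c : C3) : C3 →ₗ[ℝ] C1 where
  toFun := psiPart c
  map_add' := psiPart_add c
  map_smul' := psiPart_smul c

/-- The contraction of the first two indices. -/
def contr12 (c : C3) (t : C3) : C1 := fun k => ∑ a, ∑ b, cometric c a b * t a b k

theorem contr12_pull {A : Mat} (hA : A.det ≠ 0) (c t : C3) :
    contr12 (pull3 A c) (pull3 A t) = mv A.transpose (contr12 c t) := by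
  ext k
  have h : ∀ a b, pull3 A t a b k =
      tens2 A.transpose (fun a b => ∑ d, A d k * t a b d) a b := by
    intro a b
    simp only [tens3_apply, tens2_apply, Finset.mul_sum, Matrix.transpose_apply]
    exact Finset.sum_congr rfl fun _ _ => Finset.sum_congr rfl fun _ _ =>
      Finset.sum_congr rfl fun _ _ => by ring
  have h2 : contr12 (pull3 A c) (pull3 A t) k =
      tr (pull3 A c) (tens2 A.transpose fun a b => ∑ d, A d k * t a b d) := by
    simp only [contr12, h, tr]
  rw [h2, tr_pull hA, tr]
  simp only [mv_apply_real, contr12, Finset.mul_sum, Matrix.transpose_apply]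
  rw [Finset.sum_congr rfl fun a _ => Finset.sum_comm, Finset.sum_comm]
  exact Finset.sum_congr rfl fun _ _ => Finset.sum_congr rfl fun _ _ =>
      Finset.sum_congr rfl fun _ _ => by ring

namespace CoordChange

variable {U V : Set E7} {κ : E7 → E7} {f : E7 → C3}

/-- Curvature is the commutator of covariant derivatives of a covector field. Its transformation law
thus follows from those of `cov1` and `cov2`, without second derivatives of the Jacobi matrix. -/
theorem ricci_pf (hκ : CoordChange U V κ) (hf : SmoothField V f) {z : E7} (hz : z ∈ U) :
    ricci (pf3 κ f) z = pf2 κ (ricci f) z := by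
  have h1 : ∀ s i j k, ∑ l, riemann (pf3 κ f) z i j k l * jac κ z s l =
      pf3 κ (fun y i j k => riemann f y i j k s) z i j k := by
    intro s i j k
    -- A covector field with constant components isolates the curvature components with last index
    -- `s`; its pullback is a row of the Jacobi matrix.
    set X : E7 → C1 := fun _ => Pi.single s 1 with hX
    have hXs : ∀ i, ContDiffOn ℝ ∞ (fun y => X y i) V := fun i => contDiffOn_const
    have e1 := (hκ.field hf).ricci_identity (hκ.smooth_pf1 hXs) hz i j k
    have e2 : ∀ l, pf1 κ X z l = jac κ z s l := by
      intro l
      simp [pf1, mv_apply_real, hX, Pi.single_apply]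
    simp only [e2] at e1
    rw [cov2_congr (Y := pf2 κ (cov1 f X)) hκ.isOpen (fun z hz => hκ.cov1_pf hf hXs hz) hz,
      hκ.cov2_pf hf (hf.cov1 hXs) hz] at e1
    have e3 : ∀ i j k, riemann f (κ z) i j k s =
        cov2 f (cov1 f X) (κ z) j i k - cov2 f (cov1 f X) (κ z) i j k := by
      intro i j k
      have := hf.ricci_identity hXs (hκ.maps z hz) i j k
      simp only [hX, Pi.single_apply, mul_ite, mul_one, mul_zero, Finset.sum_ite_eq',
        Finset.mem_univ, if_true] at this
      rw [← hX] at this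
      linarith
    have e4 : pf3 κ (fun y i j k => riemann f y i j k s) z i j k =
        pf3 κ (cov2 f (cov1 f X)) z j i k - pf3 κ (cov2 f (cov1 f X)) z i j k := by
      simp only [pf3, tens3_apply, e3, mul_sub, Finset.sum_sub_distrib]
      congr 1
      rw [Finset.sum_comm]
      exact Finset.sum_congr rfl fun _ _ => Finset.sum_congr rfl fun _ _ =>
        Finset.sum_congr rfl fun _ _ => by ring
    rw [e4]
    linarith
  have hJ := Matrix.nonsing_inv_mul _ (hκ.det z hz).isUnit
  have hJ' := Matrix.mul_nonsing_inv _ (hκ.det z hz).isUnit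
  have h2 : ∀ i j k, riemann (pf3 κ f) z i j k i =
      ∑ s, (jac κ z)⁻¹ i s * pf3 κ (fun y i j k => riemann f y i j k s) z i j k := by
    intro i j k
    simp only [← h1, Finset.mul_sum]
    rw [Finset.sum_comm]
    have e : ∀ l, ∑ s, (jac κ z)⁻¹ i s * (riemann (pf3 κ f) z i j k l * jac κ z s l) =
        del i l * riemann (pf3 κ f) z i j k l := by
      intro l
      have := congrFun (congrFun hJ i) l
      rw [Matrix.mul_apply, Matrix.one_apply] at this
      rw [del, ← this, Finset.sum_mul]
      exact Finset.sum_congr rfl fun _ _ => by ring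
    simp only [e, del_sum']
  ext j k
  simp only [ricci, h2, pf3, pf2, tens3_apply, tens2_apply, Finset.mul_sum,
    Matrix.transpose_apply]
  have e5 : ∀ p s, ∑ i, jac κ z p i * (jac κ z)⁻¹ i s = del p s := fun p s => by
    have := congrFun (congrFun hJ' p) s
    rwa [Matrix.mul_apply, Matrix.one_apply] at this
  rw [Finset.sum_comm]
  have e6 : ∀ s, ∑ i, ∑ p, ∑ q, ∑ r, (jac κ z)⁻¹ i s * (jac κ z p i * jac κ z q j * jac κ z r k *
      riemann f (κ z) p q r s) = ∑ q, ∑ r, jac κ z q j * jac κ z r k * riemann f (κ z) s q r s := by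
    intro s
    rw [Finset.sum_comm]
    have e7 : ∀ p, ∑ i, ∑ q, ∑ r, (jac κ z)⁻¹ i s * (jac κ z p i * jac κ z q j * jac κ z r k *
      riemann f (κ z) p q r s) = del p s *
        ∑ q, ∑ r, jac κ z q j * jac κ z r k * riemann f (κ z) p q r s := by
      intro p
      rw [← e5, Finset.sum_mul]
      simp only [Finset.mul_sum]
      exact Finset.sum_congr rfl fun _ _ => Finset.sum_congr rfl fun _ _ =>
        Finset.sum_congr rfl fun _ _ => by ring
    simp only [e7, del_sum]
  simp only [e6]
  rw [Finset.sum_comm]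
  exact Finset.sum_congr rfl fun _ _ => Finset.sum_comm

theorem torsion_pf (hκ : CoordChange U V κ) (hf : SmoothField V f) {z : E7} (hz : z ∈ U) :
    torsion (pf3 κ f) z = pf2 κ (torsion f) z := by
  ext p : 1
  have h1 : cov3 (pf3 κ f) (pf3 κ f) z p =
      ∑ r, jac κ z r p • pull3 (jac κ z) (cov3 f f (κ z) r) := by
    rw [hκ.cov3_pf hf hf.smooth hz]
    rfl
  have h2 : torsion (pf3 κ f) z p = psiPart (pf3 κ f z) (cov3 (pf3 κ f) (pf3 κ f) z p) := rfl
  have h3 : psiPart (pf3 κ f z) (cov3 (pf3 κ f) (pf3 κ f) z p) =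
      psiPartL (pf3 κ f z) (cov3 (pf3 κ f) (pf3 κ f) z p) := rfl
  rw [h2, h3, h1, map_sum]
  simp only [map_smul]
  have h4 : ∀ r, psiPartL (pf3 κ f z) (pull3 (jac κ z) (cov3 f f (κ z) r)) =
    mv (jac κ z).transpose (torsion f (κ z) r) := fun r => psiPart_pull (hκ.det z hz) _ _
  simp only [h4]
  rfl

theorem trT_pf (hκ : CoordChange U V κ) (hf : SmoothField V f) {z : E7} (hz : z ∈ U) :
    trT (pf3 κ f) z = trT f (κ z) := by
  rw [trT, hκ.torsion_pf hf hz]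
  exact tr_pull (hκ.det z hz) _ _

theorem vT_pf (hκ : CoordChange U V κ) (hf : SmoothField V f) {z : E7} (hz : z ∈ U) :
    vT (pf3 κ f) z = pf1 κ (vT f) z := by
  rw [vT, hκ.torsion_pf hf hz]
  exact vop_pull (hκ.det z hz) _ _

theorem lagr_pf (hκ : CoordChange U V κ) (hf : SmoothField V f) {z : E7} (hz : z ∈ U) :
    lagr (pf3 κ f) z = lagr f (κ z) := by
  have h1 : scal (pf3 κ f) z = scal f (κ z) := by
    rw [scal, hκ.ricci_pf hf hz]
    exact tr_pull (hκ.det z hz) (f (κ z)) (ricci f (κ z))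
  have h2 : ip2 (pf3 κ f z) (torsion (pf3 κ f) z) (torsion (pf3 κ f) z) =
      ip2 (f (κ z)) (torsion f (κ z)) (torsion f (κ z)) := by
    rw [hκ.torsion_pf hf hz]
    exact ip2_pull (hκ.det z hz) (f (κ z)) (torsion f (κ z)) (torsion f (κ z))
  rw [lagr, lagr, h1, h2, hκ.trT_pf hf hz]

theorem locP1hat_pf (hκ : CoordChange U V κ) (hf : SmoothField V f) {z : E7} (hz : z ∈ U) :
    locP1hat (pf3 κ f) z = pf2 κ (locP1hat f) z := by
  rw [(hκ.field hf).locP1hat_eq hz, pf2, hf.locP1hat_eq (hκ.maps z hz), hκ.ricci_pf hf hz,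
    cov1_congr (Y := pf1 κ (vT f)) hκ.isOpen (fun z hz => hκ.vT_pf hf hz) hz,
    hκ.cov1_pf hf hf.vT hz, hκ.torsion_pf hf hz, hκ.vT_pf hf hz, hκ.trT_pf hf hz]
  have h1 := hookPhi_pull (hκ.det z hz) (f (κ z)) (vT f (κ z))
  have h2 := comp_pull (hκ.det z hz) (f (κ z)) (torsion f (κ z)) (hookPhi (f (κ z)) (vT f (κ z)))
  simp only [pf2, pf1, pf3, map_add, map_sub, map_smul, map_neg, h1, h2, sym_pull]

theorem div1_pf (hκ : CoordChange U V κ) (hf : SmoothField V f) {X : E7 → C1}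
    (hX : ∀ i, ContDiffOn ℝ ∞ (fun y => X y i) V) {z : E7} (hz : z ∈ U) :
    div1 (pf3 κ f) (pf1 κ X) z = div1 f X (κ z) := by
  rw [div1, hκ.cov1_pf hf hX hz]
  exact tr_pull (hκ.det z hz) _ _

theorem div2_pf (hκ : CoordChange U V κ) (hf : SmoothField V f) {w : E7 → C2}
    (hw : ∀ i j, ContDiffOn ℝ ∞ (fun y => w y i j) V) {z : E7} (hz : z ∈ U) :
    div2 (pf3 κ f) (pf2 κ w) z = pf1 κ (div2 f w) z := by
  have h : ∀ (f : E7 → C3) w y, div2 f w y = contr12 (f y) (cov2 f w y) := fun _ _ _ => rfl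
  rw [h, hκ.cov2_pf hf hw hz]
  exact contr12_pull (hκ.det z hz) _ _

theorem grad_pf (hκ : CoordChange U V κ) {u v : E7 → ℝ} (hu : ContDiffOn ℝ ∞ u V)
    (h : ∀ z ∈ U, v z = u (κ z)) {z : E7} (hz : z ∈ U) :
    (fun k => pd k v z) = pf1 κ (fun y k => pd k u y) z := by
  ext k
  rw [pd_congr hκ.isOpen h hz, hκ.pd_comp hu hz]
  rfl

theorem locP2_pf (hκ : CoordChange U V κ) (hf : SmoothField V f) {z : E7} (hz : z ∈ U) :
    locP2 (pf3 κ f) z = pf1 κ (locP2 f) z := by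
  have h : ∀ (f : E7 → C3) y, locP2 f y = (2 / 3 : ℝ) • div2 f (torsion f) y
      + (1 / 3 : ℝ) • (fun k => pd k (trT f) y) + (1 / 3 : ℝ) • (trT f y • vT f y) :=
    fun _ _ => rfl
  have h1 : div2 (pf3 κ f) (torsion (pf3 κ f)) z = div2 (pf3 κ f) (pf2 κ (torsion f)) z := by
    ext k
    rw [div2, cov2_congr hκ.isOpen (fun z hz => hκ.torsion_pf hf hz) hz, div2]
  rw [h, h1, hκ.div2_pf hf hf.torsion hz, hκ.grad_pf hf.trT (fun z hz => hκ.trT_pf hf hz) hz,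
    hκ.trT_pf hf hz, hκ.vT_pf hf hz]
  simp only [pf1, h, map_add, map_smul]

theorem locA_pf (hκ : CoordChange U V κ) (hf : SmoothField V f) {w : E7 → C2} {X : E7 → C1}
    (hw : ∀ i j, ContDiffOn ℝ ∞ (fun y => w y i j) V) {z : E7} (hz : z ∈ U) :
    locA (pf3 κ f) (pf2 κ w) (pf1 κ X) z = pf1 κ (locA f w X) z := by
  have h : ∀ (f : E7 → C3) w X y, locA f w X y =
      (-(1 / 3) : ℝ) • (fun k => pd k (fun z => tr (f z) (w z)) y) + (1 / 3 : ℝ) • div2 f w y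
      - (2 / 3 : ℝ) • vop (f y) (G2Hilbert.comp (f y) (w y) (torsion f y))
      - (2 / 3 : ℝ) • act (f y) (torsion f y) (X y) - (1 / 3 : ℝ) • (trT f y • X y) :=
    fun _ _ _ _ => rfl
  have hd := hκ.det z hz
  have h1 : vop (pf3 κ f z) (G2Hilbert.comp (pf3 κ f z) (pf2 κ w z) (torsion (pf3 κ f) z)) =
      mv (jac κ z).transpose
        (vop (f (κ z)) (G2Hilbert.comp (f (κ z)) (w (κ z)) (torsion f (κ z)))) := by
    rw [hκ.torsion_pf hf hz, pf3, pf2, pf2, comp_pull hd, vop_pull hd]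
  have h2 : act (pf3 κ f z) (torsion (pf3 κ f) z) (pf1 κ X z) =
      mv (jac κ z).transpose (act (f (κ z)) (torsion f (κ z)) (X (κ z))) := by
    rw [hκ.torsion_pf hf hz, pf3, pf2, pf1, act_pull hd]
  have h3 : ∀ z ∈ U, tr (pf3 κ f z) (pf2 κ w z) = tr (f (κ z)) (w (κ z)) := fun z hz =>
    tr_pull (hκ.det z hz) (f (κ z)) (w (κ z))
  rw [h, hκ.div2_pf hf hw hz, hκ.grad_pf (hf.tr hw) h3 hz, hκ.trT_pf hf hz, h1, h2]
  simp only [pf1, h, map_add, map_sub, map_smul]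

end CoordChange

/-! ### Derivatives with respect to the parameter -/

/-- The derivative with respect to the parameter at `0`. -/
def dt (u : ℝ → E7 → ℝ) (y : E7) : ℝ := deriv (fun t => u t y) 0

/-- The domain at parameter `0`. -/
def slice (W : Set (ℝ × E7)) : Set E7 := {y | ((0 : ℝ), y) ∈ W}

section Parameter

variable {W : Set (ℝ × E7)} {u : ℝ → E7 → ℝ}

theorem hasDerivAt_slice (hW : IsOpen W) (hu : ContDiffOn ℝ ∞ (fun q => u q.1 q.2) W) {t : ℝ}
    {y : E7} (hy : (t, y) ∈ W) :
    HasDerivAt (fun t => u t y) (fderiv ℝ (fun q : ℝ × E7 => u q.1 q.2) (t, y) (1, 0)) t := by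
  have hd := ((hu.contDiffAt (hW.mem_nhds hy)).differentiableAt (by simp)).hasFDerivAt
  exact (HasFDerivAt.comp (f := fun t : ℝ => (t, y)) t hd
    (hasFDerivAt_prodMk_left t y)).hasDerivAt

theorem hasDerivAt_dt (hW : IsOpen W) (hu : ContDiffOn ℝ ∞ (fun q => u q.1 q.2) W) {y : E7}
    (hy : y ∈ slice W) : HasDerivAt (fun t => u t y) (dt u y) 0 := by
  have := hasDerivAt_slice hW hu hy
  rwa [dt, this.deriv]

theorem isOpen_slice (hW : IsOpen W) : IsOpen (slice W) := hW.preimage (by fun_prop)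

theorem contDiffOn_dt (hW : IsOpen W) (hu : ContDiffOn ℝ ∞ (fun q => u q.1 q.2) W) :
    ContDiffOn ℝ ∞ (dt u) (slice W) := by
  have h1 : ContDiffOn ℝ ∞ (fun q => fderiv ℝ (fun q : ℝ × E7 => u q.1 q.2) q
      ((1 : ℝ), (0 : E7))) W :=
    (hu.fderiv_of_isOpen hW (by simp)).clm_apply contDiffOn_const
  have h2 := h1.comp (f := fun z : E7 => ((0 : ℝ), z)) (s := slice W) (by fun_prop)
    fun z hz => hz
  exact h2.congr fun y hy => (hasDerivAt_slice hW hu hy).deriv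

/-- The parameter derivative and the space derivative commute, by symmetry of the second derivative
on the product. -/
theorem hasDerivAt_pd (hW : IsOpen W) (hu : ContDiffOn ℝ ∞ (fun q => u q.1 q.2) W) {y : E7}
    (hy : y ∈ slice W) (i : Fin 7) :
    HasDerivAt (fun t => pd i (u t) y) (pd i (dt u) y) 0 := by
  set û : ℝ × E7 → ℝ := fun q => u q.1 q.2 with hû
  have hat : ContDiffAt ℝ ∞ û (0, y) := hu.contDiffAt (hW.mem_nhds hy)
  have hs := (hat.of_le (m := 2) ENat.LEInfty.out).isSymmSndFDerivAt (by simp)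
  have hd : DifferentiableAt ℝ (fderiv ℝ û) (0, y) :=
    (hat.fderiv_right (m := 1) (by norm_num; exact ENat.LEInfty.out)).differentiableAt one_ne_zero
  have e : ∀ v w : ℝ × E7, HasFDerivAt (fun q => fderiv ℝ û q w)
      ((ContinuousLinearMap.apply ℝ ℝ w).comp (fderiv ℝ (fderiv ℝ û) (0, y))) (0, y) := fun v w =>
    (ContinuousLinearMap.apply ℝ ℝ w).hasFDerivAt.comp (0, y) hd.hasFDerivAt
  have h1 : HasDerivAt (fun t : ℝ => fderiv ℝ û (t, y) (0, EuclideanSpace.single i 1))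
      (fderiv ℝ (fderiv ℝ û) (0, y) (1, 0) (0, EuclideanSpace.single i 1)) 0 :=
    (HasFDerivAt.comp (f := fun t : ℝ => (t, y)) (0 : ℝ)
      (e (1, 0) (0, EuclideanSpace.single i 1)) (hasFDerivAt_prodMk_left 0 y)).hasDerivAt
  have h2 : pd i (dt u) y =
      fderiv ℝ (fderiv ℝ û) (0, y) (0, EuclideanSpace.single i 1) (1, 0) := by
    have h5 : pd i (dt u) y = pd i (fun z => fderiv ℝ û (0, z) (1, 0)) y :=
      pd_congr (isOpen_slice hW) (fun z hz => (hasDerivAt_slice hW hu hz).deriv) hy i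
    rw [h5]
    have h3 := HasFDerivAt.comp (f := fun z : E7 => ((0 : ℝ), z)) y
      (e (0, EuclideanSpace.single i 1) (1, 0)) (hasFDerivAt_prodMk_right 0 y)
    have h4 : HasFDerivAt (fun z => fderiv ℝ û (0, z) (1, 0)) _ y := h3
    rw [pd, h4.fderiv]
    rfl
  rw [h2, ← hs]
  refine h1.congr_of_eventuallyEq ?_
  have hc : Filter.Tendsto (fun t : ℝ => (t, y)) (nhds 0) (nhds ((0 : ℝ), y)) :=
    Continuous.tendsto (by fun_prop) 0
  filter_upwards [hc (hW.mem_nhds hy)] with t ht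
  have hd := ((hu.contDiffAt (hW.mem_nhds ht)).differentiableAt (by simp)).hasFDerivAt
  have h3 : HasFDerivAt (u t) _ y := HasFDerivAt.comp (f := fun z : E7 => (t, z)) y hd
    (hasFDerivAt_prodMk_right t y)
  rw [pd, h3.fderiv]
  rfl

end Parameter

/-- A smooth family of forms, with velocity `h ⋄ φ + X ⌟ ψ` at parameter `0`. -/
structure Variation (W : Set (ℝ × E7)) (F : ℝ → E7 → C3) (h : E7 → C2) (X : E7 → C1) : Prop where
  fam : SmoothFam W F
  symm : ∀ y ∈ slice W, ∀ i j, h y i j = h y j i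
  deriv : ∀ y ∈ slice W,
    HasDerivAt (fun t => F t y) (diamond (F 0 y) (h y) + hookPsi (F 0 y) (X y)) 0

namespace Variation

variable {W : Set (ℝ × E7)} {F : ℝ → E7 → C3} {h : E7 → C2} {X : E7 → C1}

theorem field (hV : Variation W F h X) : SmoothField (slice W) (F 0) := hV.fam.field 0

theorem dt_metric (hV : Variation W F h X) {y : E7} (hy : y ∈ slice W) (i j : Fin 7) :
    dt (fun t z => metric (F t z) i j) y = 2 * h y i j :=
  (hasDerivAt_metric (hV.fam.model _ hy) (hV.symm y hy) (hV.deriv y hy) i j).deriv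

/-- No smoothness of `h` is assumed. It follows because `2 h` is the parameter derivative of the
smooth family of metrics; in the same way `X` is the `ψ`-part of the velocity. -/
theorem smooth_h (hV : Variation W F h X) (i j : Fin 7) :
    ContDiffOn ℝ ∞ (fun y => h y i j) (slice W) := by
  have h1 := (contDiffOn_dt hV.fam.isOpen (u := fun t z => metric (F t z) i j)
    (hV.fam.metric i j)).const_smul (1 / 2 : ℝ)
  refine h1.congr fun y hy => ?_
  simp only [smul_eq_mul, hV.dt_metric hy]
  ring

theorem dt_apply (hV : Variation W F h X) {y : E7} (hy : y ∈ slice W) (i j k : Fin 7) :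
    dt (fun t z => F t z i j k) y = (diamond (F 0 y) (h y) + hookPsi (F 0 y) (X y)) i j k :=
  (hasDerivAt_pi.1 (hasDerivAt_pi.1 (hasDerivAt_pi.1 (hV.deriv y hy) i) j) k).deriv

theorem smooth_X (hV : Variation W F h X) (i : Fin 7) :
    ContDiffOn ℝ ∞ (fun y => X y i) (slice W) := by
  have h1 := contDiffOn_psiPart (f := F 0) (g := fun y i j k => dt (fun t z => F t z i j k) y)
    hV.field.smooth (fun i j k => contDiffOn_dt hV.fam.isOpen (u := fun t z => F t z i j k)
      (hV.fam.smooth i j k)) (fun y hy => (hV.field.model y hy).det_ne_zero) i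
  refine h1.congr fun y hy => ?_
  have e : (fun i j k => dt (fun t z => F t z i j k) y) =
      diamond (F 0 y) (h y) + hookPsi (F 0 y) (X y) := by
    ext i j k
    exact hV.dt_apply hy i j k
  simp only [e, psiPart_variation (hV.field.model y hy) (hV.symm y hy)]

/-- A change of coordinates. -/
theorem pf (hV : Variation W F h X) {U : Set E7} {κ : E7 → E7}
    (hκ : CoordChange U (slice W) κ) :
    Variation {q | q.2 ∈ U ∧ (q.1, κ q.2) ∈ W} (fun t => pf3 κ (F t)) (pf2 κ h) (pf1 κ X) := by
  have hc : ContDiffOn ℝ ∞ (fun q : ℝ × E7 => (q.1, κ q.2)) (univ ×ˢ U) :=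
    contDiffOn_fst.prodMk (hκ.contDiffOn.comp contDiffOn_snd fun q hq => hq.2)
  have ho : IsOpen {q : ℝ × E7 | q.2 ∈ U ∧ (q.1, κ q.2) ∈ W} := by
    have := hc.continuousOn.isOpen_inter_preimage (isOpen_univ.prod hκ.isOpen) hV.fam.isOpen
    have e : {q : ℝ × E7 | q.2 ∈ U ∧ (q.1, κ q.2) ∈ W} =
        univ ×ˢ U ∩ (fun q => (q.1, κ q.2)) ⁻¹' W := by
      ext q
      simp
    rwa [e]
  refine ⟨⟨ho, fun i j k => ?_, fun q hq => (hV.fam.model _ hq.2).pull3 (hκ.det _ hq.1)⟩,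
    fun y hy => tens2_symm _ (hV.symm _ hy.2), fun y hy => ?_⟩
  · have h1 : ∀ a b, ContDiffOn ℝ ∞ (fun q : ℝ × E7 => jac κ q.2 a b)
        {q | q.2 ∈ U ∧ (q.1, κ q.2) ∈ W} := fun a b =>
      (hκ.smooth_jac a b).comp contDiffOn_snd fun q hq => hq.1
    have h2 : ∀ a b d, ContDiffOn ℝ ∞ (fun q : ℝ × E7 => F q.1 (κ q.2) a b d)
        {q | q.2 ∈ U ∧ (q.1, κ q.2) ∈ W} := fun a b d =>
      (hV.fam.smooth a b d).comp (f := fun q : ℝ × E7 => (q.1, κ q.2))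
        (hc.mono fun q hq => ⟨trivial, hq.1⟩) fun q hq => hq.2
    simp only [pf3, tens3_apply, Matrix.transpose_apply]
    exact ContDiffOn.sum fun a _ => ContDiffOn.sum fun b _ => ContDiffOn.sum fun d _ =>
      (((h1 a i).mul (h1 b j)).mul (h1 d k)).mul (h2 a b d)
  · have h1 := hasDerivAt_pull3_comp (jac κ y) (hV.deriv _ hy.2)
    have hd := hκ.det y hy.1
    rw [map_add, ← diamond_pull hd, ← hookPsi_pull hd] at h1
    exact h1

end Variation

/-! ### Normal coordinates -/

theorem IsModel.exists_pull3_eq {c : C3} (hc : IsModel c) : ∃ A : Mat, A.det ≠ 0 ∧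
    G2Hilbert.pull3 A c = phi0 := by
  obtain ⟨A, hA, rfl⟩ := hc
  exact ⟨A⁻¹, det_inv_ne_zero hA, pull3_inv_pull3 hA _⟩

theorem pd_coord (i j : Fin 7) (y : E7) : pd i (fun z => z j) y = del i j := by
  have : HasFDerivAt (fun z : E7 => z j) (EuclideanSpace.proj j : E7 →L[ℝ] ℝ) y :=
    (EuclideanSpace.proj j : E7 →L[ℝ] ℝ).hasFDerivAt
  rw [pd, this.fderiv]
  simp [del, eq_comm]

/-- A quadratic map with prescribed value, Jacobi matrix and second derivatives at the origin.
Symmetry of `Q` is what makes the Jacobi matrix exactly affine with coefficients `Q`. -/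
theorem exists_quadratic (y : E7) (A : Mat) (Q : C3) (hQ : ∀ a i j, Q a j i = Q a i j) :
    ∃ κ : E7 → E7, (∀ a, ContDiff ℝ ∞ fun z => κ z a) ∧ κ 0 = y ∧
      ∀ z a j, jac κ z a j = A a j + ∑ i, Q a i j * z i := by
  set κ : E7 → E7 := fun z => WithLp.toLp 2 fun a =>
    y a + (∑ i, A a i * z i + (1 / 2) * ∑ i, ∑ j, Q a i j * (z i * z j)) with hκ
  refine ⟨κ, fun a => ?_, ?_, fun z a j => ?_⟩
  · simp only [hκ]
    fun_prop
  · ext a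
    simp [hκ]
  · have hd : ∀ (i : Fin 7) (z : E7), DifferentiableAt ℝ (fun z : E7 => z i) z := fun i z => by
      fun_prop
    have hl := fun i => hasDerivAt_line (hd i z) j
    simp only [pd_coord] at hl
    rw [jac, Matrix.of_apply]
    refine pd_eq_of_line (by simp only [hκ]; fun_prop) ?_
    simp only [hκ]
    refine (((HasDerivAt.fun_sum (u := Finset.univ) fun i _ => (hl i).const_mul (A a i)).fun_add
      ((HasDerivAt.fun_sum (u := Finset.univ) fun i _ => HasDerivAt.fun_sum (u := Finset.univ)
        fun k _ => ((hl i).fun_mul (hl k)).const_mul (Q a i k)).const_mul (1 / 2))).const_add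
          (y a)).congr_deriv ?_
    simp only [zero_smul, add_zero, mul_add, Finset.sum_add_distrib]
    have e1 : ∑ i, A a i * del j i = A a j := by simp [del]
    have e2 : ∑ i, ∑ k, Q a i k * (del j i * z k) = ∑ k, Q a j k * z k := by
      rw [Finset.sum_comm]
      refine Finset.sum_congr rfl fun k _ => ?_
      simp only [mul_left_comm (Q a _ k), del_sum']
    have e3 : ∑ i, ∑ k, Q a i k * (z i * del j k) = ∑ k, Q a j k * z k := by
      refine Finset.sum_congr rfl fun i _ => ?_
      have e4 : ∀ k, Q a i k * (z i * del j k) = del j k * (Q a i k * z i) := fun k => by ring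
      simp only [e4, del_sum', hQ a j i]
    rw [e1, e2, e3]
    simp only [hQ a j]
    ring

/-- Coordinates that are normal at `0` up to second order, in which the form is the model form
at `0`. -/
theorem SmoothField.exists_normal {V : Set E7} {f : E7 → C3} (hf : SmoothField V f) {y : E7}
    (hy : y ∈ V) : ∃ (U : Set E7) (κ : E7 → E7), CoordChange U V κ ∧ (0 : E7) ∈ U ∧ κ 0 = y ∧
      pf3 κ f 0 = phi0 ∧ ∀ k i j, G2Hilbert.christoffel (pf3 κ f) 0 k i j = 0 := by
  obtain ⟨A, hA, hA'⟩ := (hf.model y hy).exists_pull3_eq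
  -- With Jacobi matrix `A` at the origin, this choice gives `∂_i J = -Γ(J_i) J` there, which
  -- cancels the homogeneous term in `gam_pf3`.
  set Q : C3 := fun a i j => -∑ r, A r i * ∑ s, A s j * G2Hilbert.christoffel f y a r s with hQ
  have hQs : ∀ a i j, Q a j i = Q a i j := by
    intro a i j
    simp only [hQ, Finset.mul_sum]
    rw [Finset.sum_comm]
    congr 1
    refine Finset.sum_congr rfl fun r _ => Finset.sum_congr rfl fun s _ => ?_
    rw [hf.christoffel_symm hy a r s]
    ring
  obtain ⟨κ, hκs, hκ0, hκ⟩ := exists_quadratic y A Q hQs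
  have hJ0 : jac κ 0 = A := by
    ext a j
    simp [hκ]
  have hκc : Continuous κ := (contDiff_euclidean.2 hκs).continuous
  have hJc : Continuous fun z => (jac κ z).det := by
    refine (contDiff_det (n := 0) fun a j => ?_).continuous
    simp only [hκ]
    fun_prop
  have hC : CoordChange (κ ⁻¹' V ∩ {z | (jac κ z).det ≠ 0}) V κ :=
    ⟨(hf.isOpen.preimage hκc).inter (isOpen_ne.preimage hJc), hf.isOpen,
      fun a => (hκs a).contDiffOn, fun z hz => hz.1, fun z hz => hz.2⟩
  have h0 : (0 : E7) ∈ κ ⁻¹' V ∩ {z | (jac κ z).det ≠ 0} :=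
    ⟨by rwa [mem_preimage, hκ0], by simpa [hJ0] using hA⟩
  refine ⟨_, κ, hC, h0, hκ0, by rw [pf3, hJ0, hκ0, hA'], fun k i j => ?_⟩
  have h1 := hC.gam_pf3 hf h0 i
  have hdJ : (Matrix.of fun a b => G2Hilbert.pd i (fun z => jac κ z a b) 0 : Mat) =
      -(gamJ κ f 0 i * jac κ 0) := by
    ext a b
    have e : G2Hilbert.pd i (fun z => jac κ z a b) 0 = Q a i b := by
      simp only [hκ]
      have hd : ∀ (i : Fin 7), DifferentiableAt ℝ (fun z : E7 => z i) 0 := fun i => by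
        fun_prop
      have hl := fun i' => hasDerivAt_line (hd i') i
      simp only [pd_coord] at hl
      refine pd_eq_of_line (by fun_prop) (((HasDerivAt.fun_sum (u := Finset.univ) fun i' _ =>
        (hl i').const_mul (Q a i' b)).const_add (A a b)).congr_deriv ?_)
      simp [del]
    rw [Matrix.of_apply, e, hJ0]
    simp only [hQ, Matrix.neg_apply, Matrix.mul_apply, gamJ, Matrix.sum_apply, Matrix.smul_apply,
      smul_eq_mul, Finset.sum_mul, hJ0, hκ0, gam, Matrix.of_apply, Finset.mul_sum]
    congr 1
    exact Finset.sum_congr rfl fun r _ => Finset.sum_congr rfl fun s _ => by ring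
  have h2 : gam (pf3 κ f) 0 i = 0 := by
    rw [h1, logJac, hdJ, Matrix.mul_neg, Matrix.mul_assoc, add_neg_cancel]
  exact congrFun (congrFun h2 k) j

/-! ### Geometry at the centre of normal coordinates -/

def hookPsiL (c : C3) : C1 →ₗ[ℝ] C3 where
  toFun := hookPsi c
  map_add' X Y := by
    ext i j k
    simp [hookPsi, raise1_eq, add_mul, Finset.sum_add_distrib]
  map_smul' r X := by
    ext i j k
    simp [hookPsi, raise1_eq, Finset.mul_sum, mul_assoc]

theorem inf3_zero (c : C3) : inf3 0 c = 0 := by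
  ext i j k
  simp [inf3]

theorem inf2_zero (c : C2) : inf2 0 c = 0 := by
  ext i j
  simp [inf2]

/-- `f` is a field of forms in coordinates that are normal at `0` up to second order. -/
structure NormalField (U : Set E7) (f : E7 → C3) : Prop where
  field : SmoothField U f
  mem : (0 : E7) ∈ U
  phi : f 0 = phi0
  chr : ∀ k i j, christoffel f 0 k i j = 0

namespace NormalField

variable {U : Set E7} {f : E7 → C3}

theorem gam_zero (hN : NormalField U f) (i : Fin 7) : gam f 0 i = 0 := by
  ext k j
  exact hN.chr k i j

theorem line (hN : NormalField U f) {u : E7 → ℝ} (hu : ContDiffOn ℝ ∞ u U) (i : Fin 7) :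
    HasDerivAt (fun s : ℝ => u (0 + s • EuclideanSpace.single i (1 : ℝ))) (pd i u 0) 0 :=
  hasDerivAt_line (hN.field.diffAt hu hN.mem) i

theorem pd_metric (hN : NormalField U f) (i j l : Fin 7) : pd i (fun z => metric (f z) j l) 0 = 0 := by
  rw [hN.field.pd_metric hN.mem, hN.gam_zero, inf2_zero]
  rfl

theorem hasDerivAt_form (hN : NormalField U f) (i : Fin 7) :
    HasDerivAt (fun s : ℝ => f (0 + s • EuclideanSpace.single i (1 : ℝ)))
      (fun j k l => pd i (fun z => f z j k l) 0) 0 :=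
  hasDerivAt_pi.2 fun j => hasDerivAt_pi.2 fun k => hasDerivAt_pi.2 fun l =>
    hN.line (hN.field.smooth j k l) i

theorem pd_cometric (hN : NormalField U f) (i j l : Fin 7) :
    pd i (fun z => cometric (f z) j l) 0 = 0 := by
  refine pd_eq_of_line (hN.field.diffAt (hN.field.cometric j l) hN.mem) ?_
  have := hasDerivAt_cometric_of_metric (m := fun _ _ => 0)
    (by rw [zero_smul, add_zero, hN.phi]) (hN.hasDerivAt_form i).differentiableAt
    (fun j l => by simpa only [hN.pd_metric] using hN.line (hN.field.metric j l) i) j l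
  simpa using this

theorem cov3_zero (hN : NormalField U f) {w : E7 → C3} (i : Fin 7) :
    cov3 f w 0 i = fun j k l => pd i (fun z => w z j k l) 0 := by
  rw [cov3_eq, hN.gam_zero, inf3_zero, sub_zero]

/-- At the centre the derivatives of the metric vanish, so `∂_i φ` is a variation of the model form
that fixes the metric; such a variation is of the form `X ⌟ ψ`, and the torsion is by definition its
`ψ`-part. -/
theorem cov3_eq_hookPsi (hN : NormalField U f) (i : Fin 7) :
    cov3 f f 0 i = hookPsi phi0 (torsion f 0 i) := by
  have e : torsion f 0 i = psiPart (f 0) (cov3 f f 0 i) := rfl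
  rw [e, hN.phi, hN.cov3_zero]
  refine eq_hookPsi_of_metric (by rw [zero_smul, add_zero, hN.phi]) (hN.hasDerivAt_form i)
    ⟨fun j k l => ?_, fun j k l => ?_⟩
    (fun j l => by simpa only [hN.pd_metric] using hN.line (hN.field.metric j l) i)
  · change pd i (fun z => f z k j l) 0 = -pd i (fun z => f z j k l) 0
    rw [pd_congr hN.field.isOpen (v := fun z => -1 * f z j k l)
      (fun z hz => by rw [(hN.field.model z hz).isAlt3.1 j k l]; ring) hN.mem,
      pd_const_mul _ (hN.field.diffAt (hN.field.smooth j k l) hN.mem)]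
    ring
  · change pd i (fun z => f z j l k) 0 = -pd i (fun z => f z j k l) 0
    rw [pd_congr hN.field.isOpen (v := fun z => -1 * f z j k l)
      (fun z hz => by rw [(hN.field.model z hz).isAlt3.2 j k l]; ring) hN.mem,
      pd_const_mul _ (hN.field.diffAt (hN.field.smooth j k l) hN.mem)]
    ring

theorem pd_form (hN : NormalField U f) (i j k l : Fin 7) :
    pd i (fun z => f z j k l) 0 = ∑ m, torsion f 0 i m * psi0 m j k l := by
  rw [← hookPsi_phi0, ← hN.cov3_eq_hookPsi, hN.cov3_zero]

end NormalField

/-- `∇_i φ = T_i ⌟ ψ`. -/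
theorem SmoothField.cov3_eq_hookPsi {U : Set E7} {f : E7 → C3} (hf : SmoothField U f) {y : E7}
    (hy : y ∈ U) (i : Fin 7) : cov3 f f y i = hookPsi (f y) (G2Hilbert.torsion f y i) := by
  obtain ⟨U', κ, hκ, h0, hκ0, hφ, hchr⟩ := hf.exists_normal hy
  have hN : NormalField U' (pf3 κ f) := ⟨hκ.field hf, h0, hφ, hchr⟩
  have hd := hκ.det 0 h0
  have h1 : tens4 (jac κ 0).transpose (cov3 f f (κ 0)) =
      tens4 (jac κ 0).transpose fun i => hookPsi (f (κ 0)) (G2Hilbert.torsion f (κ 0) i) := by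
    rw [← hκ.cov3_pf hf hf.smooth h0]
    ext i : 1
    have e : pf2 κ (G2Hilbert.torsion f) 0 i = ∑ r, jac κ 0 r i •
      mv (jac κ 0).transpose (G2Hilbert.torsion f (κ 0) r) := rfl
    have e2 : ∀ X, hookPsiL (pf3 κ f 0) (mv (jac κ 0).transpose X) =
      pull3 (jac κ 0) (hookPsi (f (κ 0)) X) := hookPsi_pull hd (f (κ 0))
    rw [hN.cov3_eq_hookPsi, hκ.torsion_pf hf h0, ← hφ, e]
    change hookPsiL (pf3 κ f 0) _ = _
    simp only [map_sum, map_smul, e2]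
    rfl
  have h2 := congrArg (tens4 (jac κ 0)⁻¹.transpose) h1
  rw [tens4_mul, tens4_mul, ← Matrix.transpose_mul, Matrix.mul_nonsing_inv _ hd.isUnit,
    Matrix.transpose_one, tens4_one, tens4_one, hκ0] at h2
  exact congrFun h2 i

theorem sum_cyc (F : C3) : ∑ i, ∑ j, ∑ k, F j k i = ∑ i, ∑ j, ∑ k, F i j k := by
  rw [Finset.sum_comm]
  exact Finset.sum_congr rfl fun _ _ => Finset.sum_comm

theorem sum_swap13 (F : C3) : ∑ i, ∑ j, ∑ k, F k j i = ∑ i, ∑ j, ∑ k, F i j k := by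
  rw [Finset.sum_comm, ← sum_cyc]

/-- A contraction of an algebraic curvature tensor with the model form. -/
theorem curvature_contraction {R : C4} (h1 : ∀ i j a b, R j i a b = -R i j a b)
    (h2 : ∀ i j a b, R i j b a = -R i j a b)
    (h3 : ∀ i j b a, R i j a b + R j b a i + R b i a j = 0) (j k : Fin 7) :
    ∑ i, ∑ q, (∑ a, ∑ b, R i j a b * phi0 a b q) * phi0 i k q = 2 * ∑ i, R i j i k := by
  -- Here `ψ` is invariant under cyclic permutations of `x`, `y`, `z`, so the first Bianchi identity
  -- `h3` makes the total sum vanish.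
  set C : C3 := fun x y z => R x y j z * psi0 z x y k with hC
  have hC0 : ∑ x, ∑ y, ∑ z, C x y z = 0 := by
    have e1 : ∑ x, ∑ y, ∑ z, C y z x = ∑ x, ∑ y, ∑ z, C x y z := sum_cyc C
    have e2 : ∑ x, ∑ y, ∑ z, C z x y = ∑ x, ∑ y, ∑ z, C y z x := (sum_cyc fun x y z => C z x y).symm.trans e1.symm
    have e3 : ∑ x, ∑ y, ∑ z, (C x y z + C y z x + C z x y) = 0 := by
      refine Finset.sum_eq_zero fun x _ => Finset.sum_eq_zero fun y _ =>
        Finset.sum_eq_zero fun z _ => ?_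
      have e4 : psi0 x y z k = psi0 z x y k := by rw [psi0_swap2 x z y, psi0_swap z x y]; ring
      have e5 : psi0 y z x k = psi0 x y z k := by rw [psi0_swap2 y x z, psi0_swap x y z]; ring
      simp only [hC, e5, e4]
      linear_combination psi0 z x y k * h3 x y z j
    simp only [Finset.sum_add_distrib] at e3
    linarith
  -- Two relabelled copies of this sum add up, again by the Bianchi identity, to the vanishing sum
  -- of `C`. Hence only the `δ δ` terms of `φ φ` contribute to the contraction.
  have hS : ∑ i, ∑ a, ∑ b, R i j a b * psi0 a b i k = 0 := by
    have e1 : ∑ i, ∑ a, ∑ b, R i j a b * psi0 a b i k = ∑ i, ∑ a, ∑ b, R j b a i * psi0 a b i k := by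
      rw [← sum_swap13]
      refine Finset.sum_congr rfl fun i _ => Finset.sum_congr rfl fun a _ =>
        Finset.sum_congr rfl fun b _ => ?_
      rw [h1 j b a i, psi0_swap2 a b i k]
      ring
    have e2 : ∑ i, ∑ a, ∑ b, (R i j a b * psi0 a b i k + R j b a i * psi0 a b i k) =
        ∑ i, ∑ a, ∑ b, C b i a := by
      refine Finset.sum_congr rfl fun i _ => Finset.sum_congr rfl fun a _ =>
        Finset.sum_congr rfl fun b _ => ?_
      simp only [hC]
      linear_combination psi0 a b i k * h3 i j b a - psi0 a b i k * h2 b i a j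
    rw [← sum_cyc fun i a b => C b i a, hC0] at e2
    simp only [Finset.sum_add_distrib] at e2
    linarith
  have e1 : ∀ i, ∑ q, (∑ a, ∑ b, R i j a b * phi0 a b q) * phi0 i k q =
      ∑ a, ∑ b, R i j a b * ∑ q, phi0 a b q * phi0 i k q := by
    intro i
    simp only [Finset.sum_mul, Finset.mul_sum]
    rw [Finset.sum_comm]
    refine Finset.sum_congr rfl fun a _ => ?_
    rw [Finset.sum_comm]
    exact Finset.sum_congr rfl fun b _ => Finset.sum_congr rfl fun q _ => by ring
  have e2 : ∀ i, ∑ a, ∑ b, R i j a b * (del a i * del b k - del a k * del b i - psi0 a b i k) =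
      R i j i k - R i j k i - ∑ a, ∑ b, R i j a b * psi0 a b i k := by
    intro i
    simp only [mul_sub, Finset.sum_sub_distrib]
    simp [del]
  simp only [e1, phi0_mul_phi0, e2, Finset.sum_sub_distrib, hS, h2 _ j k]
  rw [Finset.mul_sum]
  simp only [h2 _ j _ k, ← Finset.sum_sub_distrib, sub_zero]
  exact Finset.sum_congr rfl fun i _ => by ring

namespace NormalField

variable {U : Set E7} {f : E7 → C3}

/-- The derivative of `ψ`. -/
theorem pd_psi (hN : NormalField U f) (i m a b d : Fin 7) :
    pd i (fun z => psi (f z) m a b d) 0 =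
      -(torsion f 0 i m * phi0 a b d - torsion f 0 i a * phi0 m b d
        + torsion f 0 i b * phi0 m a d - torsion f 0 i d * phi0 m a b) := by
  set T := torsion f 0 i with hT
  have hm := fun j l => hN.line (hN.field.metric j l) i
  have hc := fun j l => hN.line (hN.field.cometric j l) i
  have hf := fun j k l => hN.line (hN.field.smooth j k l) i
  simp only [hN.pd_metric] at hm
  simp only [hN.pd_cometric] at hc
  simp only [hN.pd_form] at hf
  -- The identity `ψ = g g - g g - φ φ` is differentiated. At the centre the metric and the cometric
  -- are stationary, so only the derivatives `T ⌟ ψ` of the two factors `φ` contribute.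
  have h1 := ((hm m b).fun_mul (hm a d)).fun_sub ((hm m d).fun_mul (hm a b)) |>.fun_sub
    (HasDerivAt.fun_sum (u := Finset.univ) fun k _ => HasDerivAt.fun_sum (u := Finset.univ)
      fun l _ => (hc k l).fun_mul ((hf m a k).fun_mul (hf b d l)))
  have hs : ContDiffOn ℝ ∞ (fun z => psi (f z) m a b d) U :=
    contDiffOn_snd_iff.1 (hN.field.fam.psi m a b d)
  refine (pd_eq_of_line (hN.field.diffAt hs hN.mem) (h1.congr_of_eventuallyEq ?_)).trans ?_
  · change ∀ᶠ s : ℝ in nhds 0, psi (f (0 + s • EuclideanSpace.single i (1 : ℝ))) m a b d = _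
    have hc : Filter.Tendsto (fun s : ℝ => (0 : E7) + s • EuclideanSpace.single i (1 : ℝ)) (nhds 0)
        (nhds 0) := by
      have : Continuous fun s : ℝ => (0 : E7) + s • EuclideanSpace.single i (1 : ℝ) := by fun_prop
      simpa using this.tendsto 0
    filter_upwards [hc (hN.field.isOpen.mem_nhds hN.mem)] with s hs
    have := (hN.field.model _ hs).contr_eq m a b d
    rw [contr] at this
    simp only [cometric_eq]
    linarith
  simp only [zero_smul, add_zero, hN.phi, cometric_phi0, zero_mul, mul_zero, sub_zero, zero_add,
    del_sum', ← hT]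
  have e1 : ∀ k, (∑ n, T n * psi0 n m a k) * phi0 b d k
      + phi0 m a k * ∑ n, T n * psi0 n b d k = ∑ n, T n * (-(phi0 b d k * psi0 k n m a)
        - phi0 m a k * psi0 k n b d) := by
    intro k
    simp only [Finset.sum_mul, Finset.mul_sum, ← Finset.sum_add_distrib]
    refine Finset.sum_congr rfl fun n _ => ?_
    rw [psi0_swap3 n m k a, psi0_swap2 n k m a, psi0_swap k n m a, psi0_swap3 n b k d,
      psi0_swap2 n k b d, psi0_swap k n b d]
    ring
  simp only [e1]
  rw [Finset.sum_comm]
  have e2 : ∀ n, ∑ k, T n * (-(phi0 b d k * psi0 k n m a) - phi0 m a k * psi0 k n b d) =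
      T n * (-(∑ k, phi0 b d k * psi0 k n m a) - ∑ k, phi0 m a k * psi0 k n b d) := by
    intro n
    rw [← Finset.mul_sum, Finset.sum_sub_distrib, Finset.sum_neg_distrib]
  simp only [e2, phi0_mul_psi0]
  have e3 : ∀ n, T n * (-(del d n * phi0 b m a + del d m * phi0 n b a + del d a * phi0 n m b
        - del b n * phi0 d m a - del b m * phi0 n d a - del b a * phi0 n m d)
      - (del a n * phi0 m b d + del a b * phi0 n m d + del a d * phi0 n b m
        - del m n * phi0 a b d - del m b * phi0 n a d - del m d * phi0 n b a)) =
      del m n * (T n * phi0 a b d) - del a n * (T n * phi0 m b d) + del b n * (T n * phi0 m a d)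
        - del d n * (T n * phi0 m a b) := by
    intro n
    have s1 : ∀ i j, del i j = del j i := fun i j => by simp [del, eq_comm]
    rw [s1 d m, s1 d a, s1 b m, s1 b a, ← phi0_cyc b m a, ← phi0_cyc d m a,
      phi0_swap2 n b m, phi0_swap2 n a d]
    ring
  simp only [e3, Finset.sum_add_distrib, Finset.sum_sub_distrib, del_sum']
  ring

end NormalField

/-- `∂_i Γ_j` at the origin. -/
def dGam (f : E7 → C3) (i j : Fin 7) : Mat :=
  Matrix.of fun a b => pd i (fun z => christoffel f z a j b) 0

/-- `∂_i T_j` at the origin. -/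
def dTor (f : E7 → C3) (i j : Fin 7) : C1 := fun q => pd i (fun z => torsion f z j q) 0

theorem psi0_cyc (i j k l : Fin 7) : psi0 j k i l = psi0 i j k l := by
  rw [psi0_swap2 j i k, psi0_swap i j k]
  ring

/-- A consequence of the identity for `φ_{abl} φ_{jml}` alone, valid for any 2-tensor. It accounts
for all terms quadratic in the torsion in `NormalField.defect_skew`. -/
theorem sum_torsion_psi (T : C2) (j m : Fin 7) :
    T m j - T j m + ∑ a, ∑ b, T a b * psi0 j a b m
      + ∑ l, (∑ a, ∑ b, T a b * phi0 a b l) * phi0 l j m = 0 := by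
  have e1 : ∑ l, (∑ a, ∑ b, T a b * phi0 a b l) * phi0 l j m =
      ∑ a, ∑ b, T a b * ∑ l, phi0 a b l * phi0 j m l := by
    simp only [Finset.sum_mul, Finset.mul_sum]
    rw [Finset.sum_comm]
    refine Finset.sum_congr rfl fun a _ => ?_
    rw [Finset.sum_comm]
    refine Finset.sum_congr rfl fun b _ => Finset.sum_congr rfl fun l _ => ?_
    rw [phi0_cyc l j m]
    ring
  have e2 : ∀ a b, T a b * (del a j * del b m - del a m * del b j - psi0 a b j m) =
      del a j * (del b m * T a b) - del a m * (del b j * T a b) - T a b * psi0 a b j m :=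
    fun a b => by ring
  have e3 : ∀ a b, psi0 a b j m = psi0 j a b m := fun a b => psi0_cyc j a b m
  rw [e1]
  simp only [phi0_mul_phi0, e2]
  simp only [e3, Finset.sum_sub_distrib, ← Finset.mul_sum, del_sum]
  ring

namespace NormalField

variable {U : Set E7} {f : E7 → C3}

theorem tendsto_line (i : Fin 7) :
    Filter.Tendsto (fun s : ℝ => (0 : E7) + s • EuclideanSpace.single i (1 : ℝ)) (nhds 0)
      (nhds 0) := by
  have : Continuous fun s : ℝ => (0 : E7) + s • EuclideanSpace.single i (1 : ℝ) := by fun_prop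
  simpa using this.tendsto 0

/-- The relation `∂_j φ = Γ_j · φ + T_j ⌟ ψ` holds near the centre, so it can be differentiated once
more; terms with an undifferentiated Christoffel symbol or a derivative of the cometric vanish at
the centre. -/
theorem pd_pd_form (hN : NormalField U f) (i j a b d : Fin 7) :
    pd i (pd j fun z => f z a b d) 0 = inf3 (dGam f i j) phi0 a b d
      + hookPsi phi0 (dTor f i j) a b d
      + ∑ m, torsion f 0 j m * pd i (fun z => psi (f z) m a b d) 0 := by
  have hG := fun a b => hN.line (hN.field.christoffel a j b) i
  have hf := fun a b d => hN.line (hN.field.smooth a b d) i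
  have hT := fun m => hN.line (hN.field.torsion j m) i
  have hc := fun k l => hN.line (hN.field.cometric k l) i
  simp only [hN.pd_cometric] at hc
  have hp := fun m => hN.line (u := fun z => psi (f z) m a b d)
    (contDiffOn_snd_iff.1 (hN.field.fam.psi m a b d)) i
  have h1 := (HasDerivAt.fun_sum (u := Finset.univ) fun e _ =>
    (((hG e a).fun_mul (hf e b d)).fun_add ((hG e b).fun_mul (hf a e d))).fun_add
      ((hG e d).fun_mul (hf a b e))).fun_add
    (HasDerivAt.fun_sum (u := Finset.univ) fun m _ => (HasDerivAt.fun_sum (u := Finset.univ)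
      fun n _ => (hc m n).fun_mul (hT n)).fun_mul (hp m))
  refine (pd_eq_of_line (hN.field.diffAt (hN.field.pd (hN.field.smooth a b d) j) hN.mem)
    (h1.congr_of_eventuallyEq ?_)).trans ?_
  · filter_upwards [tendsto_line i (hN.field.isOpen.mem_nhds hN.mem)] with s hs
    have h2 := congrFun (congrFun (congrFun (hN.field.cov3_eq_hookPsi hs j) a) b) d
    rw [cov3_eq] at h2
    simp only [Pi.sub_apply, inf3, gam, Matrix.of_apply, hookPsi, raise1] at h2
    linarith
  · simp only [zero_smul, add_zero, hN.phi, hN.chr, zero_mul, cometric_phi0, zero_add, psi_phi0,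
      del_sum']
    rw [hookPsi_phi0, inf3]
    simp only [dGam, dTor, Matrix.of_apply, Finset.sum_add_distrib]
    ring

/-- The contraction of the torsion with the derivative of `ψ`. -/
theorem sum_torsion_pd_psi (hN : NormalField U f) (i j : Fin 7) :
    (fun a b d => ∑ m, torsion f 0 j m * pd i (fun z => psi (f z) m a b d) 0 : C3) =
      inf3 (Matrix.of fun m a => torsion f 0 j m * torsion f 0 i a) phi0
        - (∑ m, torsion f 0 i m * torsion f 0 j m) • phi0 := by
  ext a b d
  simp only [hN.pd_psi, inf3, Matrix.of_apply, Pi.sub_apply, Pi.smul_apply, smul_eq_mul,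
    Finset.sum_mul, ← Finset.sum_sub_distrib]
  refine Finset.sum_congr rfl fun m _ => ?_
  rw [phi0_swap m a d, phi0_cyc m a b]
  ring

/-- The `G₂`-Bianchi identity. -/
theorem bianchi (hN : NormalField U f) (i j q : Fin 7) :
    ∑ a, ∑ b, (dGam f i j - dGam f j i) a b * phi0 a b q =
      -2 * (dTor f i j q - dTor f j i q)
        - 2 * ∑ m, ∑ a, torsion f 0 j m * torsion f 0 i a * phi0 m a q := by
  set T := torsion f 0 with hT
  set N : Fin 7 → Fin 7 → Mat := fun i j => Matrix.of fun m a => T j m * T i a with hNN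
  have h1 : ∀ i j, (fun a b d => pd i (pd j fun z => f z a b d) 0 : C3) =
      inf3 (dGam f i j) phi0 + hookPsiL phi0 (dTor f i j) + (inf3 (N i j) phi0
        - (∑ m, T i m * T j m) • phi0) := by
    intro i j
    rw [← hN.sum_torsion_pd_psi]
    ext a b d
    exact hN.pd_pd_form i j a b d
  -- Second partial derivatives of `φ` commute. The multiple of `φ` in the quadratic terms is
  -- symmetric in `i`, `j` and drops out, leaving a relation between curvature, the derivative of
  -- the torsion and its square.
  have h2 : (fun a b d => pd i (pd j fun z => f z a b d) 0 : C3) =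
      fun a b d => pd j (pd i fun z => f z a b d) 0 := by
    ext a b d
    exact pd_comm (hN.field.contDiffAt_apply hN.mem a b d) i j
  rw [h1, h1] at h2
  have h3 : inf3 (dGam f i j - dGam f j i + (N i j - N j i)) phi0 +
      hookPsi phi0 (dTor f i j - dTor f j i) = 0 := by
    have e : hookPsi phi0 (dTor f i j - dTor f j i) =
      hookPsiL phi0 (dTor f i j) - hookPsiL phi0 (dTor f j i) := map_sub (hookPsiL phi0) _ _
    have e2 : ∑ m, T j m * T i m = ∑ m, T i m * T j m := Finset.sum_congr rfl fun m _ => mul_comm _ _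
    rw [e2] at h2
    rw [inf3_add, inf3_sub, inf3_sub, e]
    linear_combination (exp := 1) h2
  -- Only the component of the 3-form relation in the 7-dimensional part is needed; the `ψ`-part
  -- extracts it.
  have h4 := congrFun (congrArg (psiPart phi0) h3) q
  have h5 : psiPart phi0 0 q = 0 := congrFun (map_zero (psiPartL phi0)) q
  rw [h5, psiPart_add, Pi.add_apply, psiPart_hookPsi_phi0, psiPart_inf3] at h4
  simp only [Matrix.add_apply, add_mul, Finset.sum_add_distrib, Pi.sub_apply] at h4
  have h6 : ∑ a, ∑ b, (N i j - N j i) a b * phi0 a b q =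
      2 * ∑ m, ∑ a, T j m * T i a * phi0 m a q := by
    have e : ∑ m, ∑ a, T i m * T j a * phi0 m a q = -∑ m, ∑ a, T j m * T i a * phi0 m a q := by
      rw [Finset.sum_comm]
      simp only [← Finset.sum_neg_distrib]
      refine Finset.sum_congr rfl fun a _ => Finset.sum_congr rfl fun b _ => ?_
      rw [phi0_swap a b]
      ring
    simp only [hNN, Matrix.sub_apply, Matrix.of_apply, sub_mul, Finset.sum_sub_distrib, e]
    ring
  rw [h6] at h4
  linarith

theorem dGam_symm (hN : NormalField U f) (i j a b : Fin 7) : dGam f i j a b = dGam f i b a j :=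
  pd_congr hN.field.isOpen (fun _ hz => hN.field.christoffel_symm hz a b j) hN.mem i

theorem pd_pd_metric (hN : NormalField U f) (i j a b : Fin 7) :
    pd i (pd j fun z => metric (f z) a b) 0 = dGam f i j b a + dGam f i j a b := by
  have hG := fun a b => hN.line (hN.field.christoffel a j b) i
  have hm := fun a b => hN.line (hN.field.metric a b) i
  simp only [hN.pd_metric] at hm
  have h1 := HasDerivAt.fun_sum (u := Finset.univ) fun e _ =>
    ((hG e a).fun_mul (hm e b)).fun_add ((hG e b).fun_mul (hm a e))
  refine (pd_eq_of_line (hN.field.diffAt (hN.field.pd (hN.field.metric a b) j) hN.mem)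
    (h1.congr_of_eventuallyEq ?_)).trans ?_
  · filter_upwards [tendsto_line i (hN.field.isOpen.mem_nhds hN.mem)] with s hs
    exact hN.field.pd_metric hs j a b
  · simp only [zero_smul, add_zero, hN.phi, mul_zero, metric_phi0, Finset.sum_add_distrib]
    simp [del, dGam]

theorem riemann_eq (hN : NormalField U f) (i j k l : Fin 7) :
    riemann f 0 i j k l = (dGam f i j - dGam f j i) l k := by
  simp [riemann, hN.chr, dGam]

/-- The Ricci curvature in terms of the torsion. -/
theorem ricci_eq (hN : NormalField U f) (m i : Fin 7) :
    ricci f 0 m i = -(∑ a, ∑ j, dTor f a m j * phi0 i j a) - (∑ a, ∑ b, dTor f m a b * phi0 a b i)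
      - ∑ a, torsion f 0 m a * torsion f 0 a i + (∑ a, torsion f 0 a a) * torsion f 0 m i
      + ∑ p, torsion f 0 m p * ∑ a, ∑ b, torsion f 0 a b * psi0 p b a i := by
  set T := torsion f 0 with hT
  set R : C4 := fun i j => dGam f i j - dGam f j i with hR
  have hRic : ricci f 0 m i = ∑ a, R a m a i := by
    rw [ricci]
    exact Finset.sum_congr rfl fun a _ => hN.riemann_eq a m i a
  have h1 : ∀ i j a b, R j i a b = -R i j a b := fun i j a b => by
    simp only [hR, Matrix.sub_apply]; ring
  have h2 : ∀ i j a b, R i j b a = -R i j a b := fun i j a b => by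
    have := pd_comm ((hN.field.metric a b).contDiffAt (hN.field.isOpen.mem_nhds hN.mem)) i j
    rw [hN.pd_pd_metric, hN.pd_pd_metric] at this
    simp only [hR, Matrix.sub_apply]
    linarith
  have h3 : ∀ i j b a, R i j a b + R j b a i + R b i a j = 0 := fun i j b a => by
    simp only [hR, Matrix.sub_apply]
    rw [hN.dGam_symm i b, hN.dGam_symm j i, hN.dGam_symm b j]
    ring
  -- The contraction of curvature with two factors `φ` equals twice the Ricci curvature, and the
  -- inner contraction is what the `G₂`-Bianchi identity expresses through the torsion.
  have h4 := curvature_contraction h1 h2 h3 m i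
  rw [← hRic] at h4
  have h5 : ∀ a q, ∑ x, ∑ y, R a m x y * phi0 x y q = -2 * (dTor f a m q - dTor f m a q)
        - 2 * ∑ p, ∑ b, T m p * T a b * phi0 p b q := fun a q => hN.bianchi a m q
  simp only [h5] at h4
  have e1 : ∀ a, ∑ q, (∑ p, ∑ b, T m p * T a b * phi0 p b q) * phi0 a i q =
      ∑ p, ∑ b, T m p * T a b * ∑ q, phi0 p b q * phi0 a i q := by
    intro a
    simp only [Finset.sum_mul, Finset.mul_sum]
    rw [Finset.sum_comm]
    refine Finset.sum_congr rfl fun p _ => ?_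
    rw [Finset.sum_comm]
    exact Finset.sum_congr rfl fun _ _ => Finset.sum_congr rfl fun _ _ => by ring
  have e2 : ∀ a p b, T m p * T a b * (del p a * del b i - del p i * del b a - psi0 p b a i) =
      del p a * (del b i * (T m p * T a b)) - del p i * (del b a * (T m p * T a b))
        - T m p * (T a b * psi0 p b a i) := fun a p b => by ring
  have e3 : ∑ a, ∑ q, (∑ p, ∑ b, T m p * T a b * phi0 p b q) * phi0 a i q =
      ∑ a, T m a * T a i - (∑ a, T a a) * T m i - ∑ p, T m p * ∑ a, ∑ b, T a b * psi0 p b a i := by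
    simp only [e1, phi0_mul_phi0, e2, Finset.sum_sub_distrib, ← Finset.mul_sum, del_sum]
    congr 1
    · congr 1
      ring
    · rw [Finset.sum_comm]
      simp only [← Finset.mul_sum]
  have e4 : ∀ a q, (-2 * (dTor f a m q - dTor f m a q)
      - 2 * ∑ p, ∑ b, T m p * T a b * phi0 p b q) * phi0 a i q =
      -2 * (dTor f a m q * phi0 i q a) - 2 * (dTor f m a q * phi0 a q i)
        - 2 * ((∑ p, ∑ b, T m p * T a b * phi0 p b q) * phi0 a i q) := by
    intro a q
    rw [phi0_swap2 a i q, phi0_cyc a i q]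
    ring
  simp only [e4, Finset.sum_sub_distrib, ← Finset.mul_sum, e3] at h4
  linarith

theorem pd_vT (hN : NormalField U f) (i m : Fin 7) :
    pd i (fun z => vT f z m) 0 = ∑ a, ∑ b, dTor f i a b * phi0 a b m
      + ∑ s, torsion f 0 i s * ∑ a, ∑ b, torsion f 0 a b * psi0 s a b m := by
  have hT := fun a b => hN.line (hN.field.torsion a b) i
  have hf := fun a b d => hN.line (hN.field.smooth a b d) i
  have hc := fun k l => hN.line (hN.field.cometric k l) i
  simp only [hN.pd_cometric] at hc
  simp only [hN.pd_form] at hf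
  have h1 := HasDerivAt.fun_sum (u := Finset.univ) fun a _ => HasDerivAt.fun_sum (u := Finset.univ)
    fun b _ => (HasDerivAt.fun_sum (u := Finset.univ) fun p _ =>
      HasDerivAt.fun_sum (u := Finset.univ) fun q _ =>
        ((hc a p).fun_mul (hc b q)).fun_mul (hT p q)).fun_mul (hf a b m)
  refine (pd_eq_of_line (hN.field.diffAt (hN.field.vT m) hN.mem) h1).trans ?_
  simp only [zero_smul, add_zero, hN.phi, cometric_phi0, zero_mul, mul_zero, zero_add, mul_assoc,
    del_sum', ← Finset.mul_sum, Finset.sum_add_distrib]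
  congr 1
  simp only [Finset.mul_sum]
  rw [Finset.sum_congr rfl fun a _ => Finset.sum_comm, Finset.sum_comm]
  exact Finset.sum_congr rfl fun _ _ => Finset.sum_congr rfl fun _ _ =>
    Finset.sum_congr rfl fun _ _ => by ring

/-- The tensor that has to vanish for the formula for the variation of `𝖥`. -/
def defect (f : E7 → C3) (i m : Fin 7) : ℝ :=
  ricci f 0 i m + ∑ j, torsion f 0 i j * torsion f 0 m j
    - (∑ a, torsion f 0 a a) * torsion f 0 i m + pd i (fun z => vT f z m) 0
    + ∑ j, torsion f 0 i j * ∑ l, (∑ a, ∑ b, torsion f 0 a b * phi0 a b l) * phi0 l j m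
    + ∑ a, ∑ j, dTor f a m j * phi0 i j a
    + ∑ j, torsion f 0 m j * ∑ a, ∑ s, torsion f 0 a s * psi0 s i j a

/-- After `ricci_eq` and `pd_vT` are substituted, the terms with `∂_i T` cancel, the other
derivative terms change sign under the exchange of `i` and `m`, and the symmetrized quadratic terms
are contractions of `T` with the identity `sum_torsion_psi`. -/
theorem defect_skew (hN : NormalField U f) (i m : Fin 7) : defect f i m + defect f m i = 0 := by
  set T := torsion f 0 with hT
  have key : ∀ i m, ∑ j, T i j * (-T j m + ∑ a, ∑ b, T a b * psi0 j b a m + T m j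
      + ∑ a, ∑ b, T a b * psi0 j a b m + ∑ l, (∑ a, ∑ b, T a b * phi0 a b l) * phi0 l j m
      + ∑ a, ∑ s, T a s * psi0 s m j a) = 0 := by
    intro i m
    refine Finset.sum_eq_zero fun j _ => ?_
    have e1 : ∑ a, ∑ b, T a b * psi0 j b a m = -∑ a, ∑ b, T a b * psi0 j a b m := by
      simp only [← Finset.sum_neg_distrib]
      refine Finset.sum_congr rfl fun a _ => Finset.sum_congr rfl fun b _ => ?_
      rw [psi0_swap2 j a b]
      ring
    have e2 : ∑ a, ∑ s, T a s * psi0 s m j a = ∑ a, ∑ b, T a b * psi0 j a b m := by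
      refine Finset.sum_congr rfl fun a _ => Finset.sum_congr rfl fun s _ => ?_
      have : psi0 s m j a = psi0 j a s m := by
        rw [psi0_swap3 s m a j, psi0_swap2 s a m j, psi0_swap a s m j, psi0_swap3 a s j m,
          psi0_swap2 a j s m, psi0_swap j a s m]
        ring
      rw [this]
    have h := sum_torsion_psi T j m
    rw [e1, e2]
    linear_combination T i j * h
  have k1 := key i m
  have k2 := key m i
  simp only [mul_add, Finset.sum_add_distrib, mul_neg, Finset.sum_neg_distrib] at k1 k2
  simp only [defect, hN.pd_vT, ← hT]
  rw [hN.ricci_eq i m, hN.ricci_eq m i]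
  linear_combination k1 + k2

end NormalField

/-! ### First variation at the centre of normal coordinates -/

/-- The matrix field `H` with `h ⋄ φ + X ⌟ ψ = inf3 H φ`. -/
def varMatAt (c : C3) (h : C2) (X : C1) : Mat :=
  ((Matrix.of h : Mat) * coMat c).transpose + (1 / 3 : ℝ) • (coMat c * Matrix.of (hookPhi c X))

theorem hookPsi_eq_inf3 {c : C3} (hc : IsModel c) (X : C1) :
    hookPsi c X = inf3 ((1 / 3 : ℝ) • (coMat c * Matrix.of (hookPhi c X))) c := by
  obtain ⟨A, hA, rfl⟩ := hc
  set Y := mv A⁻¹.transpose X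
  have hX : X = mv A.transpose Y := (mv_inv hA X).symm
  rw [hX, hookPsi_pull hA, hookPsi_eq_inf3_phi0, hookPhi_pull hA]
  refine (inf3_pull ?_ phi0).symm
  have e : (Matrix.of fun a i => (1 / 3) * ∑ l, Y l * phi0 l a i : Mat) =
      (1 / 3 : ℝ) • Matrix.of (hookPhi phi0 Y) := by
    ext a i
    simp [hookPhi, raise1_phi0]
  rw [e, of_tens2, Matrix.transpose_transpose, Matrix.mul_smul, Matrix.smul_mul,
    ← Matrix.mul_assoc, ← Matrix.mul_assoc, ← Matrix.mul_assoc, coMat_pull hA, coMat_phi0,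
    Matrix.one_mul]

theorem variation_eq_inf3 {c : C3} (hc : IsModel c) (h : C2) (X : C1) :
    diamond c h + hookPsi c X = inf3 (varMatAt c h X) c := by
  rw [varMatAt, inf3_add, ← diamond_eq, ← hookPsi_eq_inf3 hc]

theorem varMatAt_phi0 (h : C2) (X : C1) : varMatAt phi0 h X = varMat h X := by
  ext a i
  simp [varMatAt, varMat, coMat_phi0, hookPhi, raise1_phi0]

theorem pd_pd_mul {U : Set E7} (hU : IsOpen U) {u v : E7 → ℝ} (hu : ContDiffOn ℝ ∞ u U)
    (hv : ContDiffOn ℝ ∞ v U) {y : E7} (hy : y ∈ U) (m k : Fin 7) :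
    pd m (pd k fun z => u z * v z) y = pd m (pd k u) y * v y + pd k u y * pd m v y
      + (pd m u y * pd k v y + u y * pd m (pd k v) y) := by
  have d : ∀ {w : E7 → ℝ}, ContDiffOn ℝ ∞ w U → ∀ z ∈ U, DifferentiableAt ℝ w z := fun hw z hz =>
    (hw.contDiffAt (hU.mem_nhds hz)).differentiableAt (by simp)
  have s : ∀ {w : E7 → ℝ}, ContDiffOn ℝ ∞ w U → ContDiffOn ℝ ∞ (pd k w) U := fun hw =>
    (hw.fderiv_of_isOpen hU (by simp)).clm_apply contDiffOn_const
  rw [pd_congr hU (fun z hz => pd_mul (d hu z hz) (d hv z hz) k) hy]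
  refine (pd_add ((d (s hu) y hy).mul (d hv y hy)) ((d hu y hy).mul (d (s hv) y hy)) m).trans ?_
  exact congrArg₂ (· + ·) (pd_mul (d (s hu) y hy) (d hv y hy) m)
    (pd_mul (d hu y hy) (d (s hv) y hy) m)

structure Center (W : Set (ℝ × E7)) (F : ℝ → E7 → C3) (h : E7 → C2) (X : E7 → C1) : Prop where
  var : Variation W F h X
  normal : NormalField (slice W) (F 0)

namespace Center

variable {W : Set (ℝ × E7)} {F : ℝ → E7 → C3} {h : E7 → C2} {X : E7 → C1}

theorem hasDerivAt_form (hC : Center W F h X) :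
    HasDerivAt (fun t => F t 0) (inf3 (varMat (h 0) (X 0)) phi0) 0 := by
  have := hC.var.deriv 0 hC.normal.mem
  rwa [hC.normal.phi, variation_eq] at this

theorem hasDerivAt_cometric (hC : Center W F h X) (i j : Fin 7) :
    HasDerivAt (fun t => cometric (F t 0) i j) (-(2 * h 0 i j)) 0 :=
  hasDerivAt_cometric_of_metric (c := fun t => F t 0) (m := fun i j => 2 * h 0 i j) hC.normal.phi
    hC.hasDerivAt_form.differentiableAt
    (fun i j => hasDerivAt_metric (hC.var.fam.model _ hC.normal.mem)
      (hC.var.symm 0 hC.normal.mem) (hC.var.deriv 0 hC.normal.mem) i j) i j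

theorem symm (hC : Center W F h X) (i j : Fin 7) : h 0 i j = h 0 j i :=
  hC.var.symm 0 hC.normal.mem i j

theorem line_h (hC : Center W F h X) (p i j : Fin 7) :
    HasDerivAt (fun s : ℝ => h (0 + s • EuclideanSpace.single p (1 : ℝ)) i j)
      (pd p (fun z => h z i j) 0) 0 :=
  hC.normal.line (hC.var.smooth_h i j) p

theorem line_X (hC : Center W F h X) (p i : Fin 7) :
    HasDerivAt (fun s : ℝ => X (0 + s • EuclideanSpace.single p (1 : ℝ)) i)
      (pd p (fun z => X z i) 0) 0 :=
  hC.normal.line (hC.var.smooth_X i) p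

theorem pd_h_symm (hC : Center W F h X) {y : E7} (hy : y ∈ slice W) (p i j : Fin 7) :
    pd p (fun z => h z i j) y = pd p (fun z => h z j i) y :=
  pd_congr hC.normal.field.isOpen (fun z hz => hC.var.symm z hz i j) hy p

/-- Twice the variation of the Christoffel symbols of the first kind, up to lower order terms. -/
def velChr (h : E7 → C2) (y : E7) : C3 := fun l i j =>
  pd i (fun z => h z j l) y + pd j (fun z => h z i l) y - pd l (fun z => h z i j) y

theorem pd_dt_metric (hC : Center W F h X) {y : E7} (hy : y ∈ slice W) (i j l : Fin 7) :
    pd i (dt fun t z => metric (F t z) j l) y = 2 * pd i (fun z => h z j l) y := by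
  rw [pd_congr hC.normal.field.isOpen (fun z hz => hC.var.dt_metric hz j l) hy,
    pd_const_mul _ (hC.normal.field.diffAt (hC.var.smooth_h j l) hy)]

theorem hasDerivAt_pd_metric (hC : Center W F h X) {y : E7} (hy : y ∈ slice W) (i j l : Fin 7) :
    HasDerivAt (fun t => pd i (fun z => metric (F t z) j l) y)
      (2 * pd i (fun z => h z j l) y) 0 := by
  rw [← hC.pd_dt_metric hy]
  exact hasDerivAt_pd hC.var.fam.isOpen (u := fun t z => metric (F t z) j l)
    (hC.var.fam.metric j l) hy i

theorem hasDerivAt_dt_christoffel (hC : Center W F h X) {y : E7} (hy : y ∈ slice W)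
    (k i j : Fin 7) : HasDerivAt (fun t => christoffel (F t) y k i j)
      (dt (fun t z => christoffel (F t) z k i j) y) 0 :=
  hasDerivAt_dt hC.var.fam.isOpen (u := fun t z => christoffel (F t) z k i j)
    (hC.var.fam.christoffel k i j) hy

/-- Obtained by differentiating the Christoffel symbols of the first kind, which avoids the
derivative of the cometric. It is stated at all points of the slice because it has to be
differentiated again in space. -/
theorem sum_dt_christoffel (hC : Center W F h X) {y : E7} (hy : y ∈ slice W) (i j l : Fin 7) :
    ∑ a, (dt (fun t z => christoffel (F t) z a i j) y * metric (F 0 y) a l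
      + christoffel (F 0) y a i j * (2 * h y a l)) = velChr h y l i j := by
  have hm : ∀ a l, HasDerivAt (fun t => metric (F t y) a l) (2 * h y a l) 0 := fun a l =>
    hasDerivAt_metric (hC.var.fam.model _ hy) (hC.var.symm y hy) (hC.var.deriv y hy) a l
  have h1 := HasDerivAt.fun_sum (u := Finset.univ) fun a _ =>
    (hC.hasDerivAt_dt_christoffel hy a i j).fun_mul (hm a l)
  have h2 := (((hC.hasDerivAt_pd_metric hy i j l).fun_add
    (hC.hasDerivAt_pd_metric hy j i l)).fun_sub
    (hC.hasDerivAt_pd_metric hy l i j)).const_mul (1 / 2)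
  have hc : Filter.Tendsto (fun t : ℝ => (t, y)) (nhds 0) (nhds ((0 : ℝ), y)) :=
    Continuous.tendsto (by fun_prop) 0
  rw [h1.unique (h2.congr_of_eventuallyEq ?_), velChr]
  · ring
  · filter_upwards [hc (hC.var.fam.isOpen.mem_nhds hy)] with t ht
    exact (hC.var.fam.field t).sum_christoffel_metric ht i j l

theorem dt_christoffel (hC : Center W F h X) (k i j : Fin 7) :
    dt (fun t z => christoffel (F t) z k i j) 0 = velChr h 0 k i j := by
  rw [← hC.sum_dt_christoffel hC.normal.mem]
  simp only [hC.normal.phi, hC.normal.chr, zero_mul, add_zero, metric_phi0]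
  simp [del]

theorem hasDerivAt_christoffel (hC : Center W F h X) (k i j : Fin 7) :
    HasDerivAt (fun t => christoffel (F t) 0 k i j) (velChr h 0 k i j) 0 := by
  rw [← hC.dt_christoffel]
  exact hC.hasDerivAt_dt_christoffel hC.normal.mem k i j

theorem smooth_pd_h (hC : Center W F h X) (p i j : Fin 7) :
    ContDiffOn ℝ ∞ (fun y => pd p (fun z => h z i j) y) (slice W) :=
  hC.normal.field.pd (hC.var.smooth_h i j) p

theorem pd_velChr (hC : Center W F h X) (m l i j : Fin 7) :
    pd m (fun z => velChr h z l i j) 0 = pd m (pd i fun z => h z j l) 0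
      + pd m (pd j fun z => h z i l) 0 - pd m (pd l fun z => h z i j) 0 := by
  have d := fun p i j => hC.normal.field.diffAt (hC.smooth_pd_h p i j) hC.normal.mem
  simp only [velChr]
  refine (pd_sub ((d i j l).add (d j i l)) (d l i j) m).trans ?_
  exact congrArg (· - _) (pd_add (d i j l) (d j i l) m)

/-- The correction appears because the Christoffel symbols vanish at the centre while their
derivatives do not: it is the space derivative of the term `Γ · 2 h`. -/
theorem pd_dt_christoffel (hC : Center W F h X) (m l i j : Fin 7) :
    pd m (dt fun t z => christoffel (F t) z l i j) 0 =
      pd m (fun z => velChr h z l i j) 0 - 2 * ∑ a, dGam (F 0) m i a j * h 0 a l := by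
  have hm := fun a b => hC.normal.line (hC.normal.field.metric a b) m
  simp only [hC.normal.pd_metric] at hm
  have hG := fun a => hC.normal.line (hC.normal.field.christoffel a i j) m
  have hd := fun a => hC.normal.line (contDiffOn_dt hC.var.fam.isOpen
    (u := fun t z => christoffel (F t) z a i j) (hC.var.fam.christoffel a i j)) m
  have h1 := HasDerivAt.fun_sum (u := Finset.univ) fun a _ =>
    ((hd a).fun_mul (hm a l)).fun_add ((hG a).fun_mul ((hC.line_h m a l).const_mul 2))
  have hv : ContDiffOn ℝ ∞ (fun z => velChr h z l i j) (slice W) :=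
    ((hC.smooth_pd_h _ _ _).add (hC.smooth_pd_h _ _ _)).sub (hC.smooth_pd_h _ _ _)
  have h2 := hC.normal.line hv m
  have h3 := h2.unique (h1.congr_of_eventuallyEq ?_)
  · rw [h3]
    simp only [zero_smul, add_zero, hC.normal.phi, hC.normal.chr, zero_mul, mul_zero, metric_phi0,
      Finset.sum_add_distrib, dGam, Matrix.of_apply, Finset.mul_sum, mul_left_comm (2 : ℝ)]
    simp [del]
  · filter_upwards [NormalField.tendsto_line m
      (hC.normal.field.isOpen.mem_nhds hC.normal.mem)] with s hs
    exact (hC.sum_dt_christoffel hs i j l).symm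

/-- The quadratic terms of the curvature do not contribute, since the Christoffel symbols vanish at
the centre. -/
theorem hasDerivAt_ricci (hC : Center W F h X) (j k : Fin 7) :
    HasDerivAt (fun t => ricci (F t) 0 j k)
      (∑ i, (pd i (dt fun t z => christoffel (F t) z i j k) 0
        - pd j (dt fun t z => christoffel (F t) z i i k) 0)) 0 := by
  have hp : ∀ m k i j, HasDerivAt (fun t => pd m (fun z => christoffel (F t) z k i j) 0)
      (pd m (dt fun t z => christoffel (F t) z k i j) 0) 0 := fun m k i j =>
    hasDerivAt_pd hC.var.fam.isOpen (u := fun t z => christoffel (F t) z k i j)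
      (hC.var.fam.christoffel k i j) hC.normal.mem m
  have h1 := HasDerivAt.fun_sum (u := Finset.univ) fun i _ =>
    ((hp i i j k).fun_sub (hp j i i k)).fun_add (HasDerivAt.fun_sum (u := Finset.univ) fun p _ =>
      ((hC.hasDerivAt_christoffel i i p).fun_mul (hC.hasDerivAt_christoffel p j k)).fun_sub
      ((hC.hasDerivAt_christoffel i j p).fun_mul (hC.hasDerivAt_christoffel p i k)))
  refine h1.congr_deriv ?_
  simp [hC.normal.chr]

theorem hasDerivAt_scal (hC : Center W F h X) :
    HasDerivAt (fun t => scal (F t) 0) (-2 * (∑ i, ∑ j, h 0 i j * ricci (F 0) 0 i j)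
      + ∑ j, ∑ i, (pd i (dt fun t z => christoffel (F t) z i j j) 0
        - pd j (dt fun t z => christoffel (F t) z i i j) 0)) 0 := by
  have h1 := HasDerivAt.fun_sum (u := Finset.univ) fun i _ => HasDerivAt.fun_sum
    (u := Finset.univ) fun j _ => (hC.hasDerivAt_cometric i j).fun_mul (hC.hasDerivAt_ricci i j)
  refine h1.congr_deriv ?_
  simp only [hC.normal.phi, cometric_phi0, Finset.sum_add_distrib, Finset.mul_sum]
  congr 1
  · exact Finset.sum_congr rfl fun _ _ => Finset.sum_congr rfl fun _ _ => by ring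
  · simp [del]

/-- Second derivatives of the cometric. -/
theorem _root_.G2Hilbert.NormalField.pd_pd_cometric {U : Set E7} {f : E7 → C3}
    (hN : NormalField U f) (m k i j : Fin 7) :
    pd m (pd k fun z => cometric (f z) i j) 0 = -(dGam f m k j i + dGam f m k i j) := by
  have h1 : ∀ a, pd m (pd k fun z => cometric (f z) i a * metric (f z) a j) 0 =
      pd m (pd k fun z => cometric (f z) i a) 0 * del a j
        + del i a * (dGam f m k j a + dGam f m k a j) := by
    intro a
    rw [pd_pd_mul hN.field.isOpen (hN.field.cometric i a) (hN.field.metric a j) hN.mem,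
      hN.pd_pd_metric, hN.pd_metric, hN.pd_metric, hN.phi, metric_phi0, cometric_phi0]
    ring
  have d : ∀ (k : Fin 7) {w : E7 → ℝ}, ContDiffOn ℝ ∞ w U → ∀ z ∈ U, DifferentiableAt ℝ w z :=
    fun _ _ hw z hz => hN.field.diffAt hw hz
  have s := fun a => (hN.field.cometric i a).mul (hN.field.metric a j)
  have h2 : pd m (pd k fun z => ∑ a, cometric (f z) i a * metric (f z) a j) 0 = 0 := by
    have h3 : ∀ z ∈ U, pd k (fun z => ∑ a, cometric (f z) i a * metric (f z) a j) z = 0 :=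
      fun z hz => by
        rw [pd_congr hN.field.isOpen (fun z hz => (hN.field.model z hz).sum_cometric_metric i j) hz,
          pd_const]
    rw [pd_congr hN.field.isOpen h3 hN.mem, pd_const]
  rw [pd_congr hN.field.isOpen (fun z hz => pd_sum (fun a => hN.field.diffAt (s a) hz) k) hN.mem,
    pd_sum (fun a => hN.field.diffAt (hN.field.pd (s a) k) hN.mem)] at h2
  have h3 : ∑ a, pd m (pd k fun z => cometric (f z) i a * metric (f z) a j) 0 = 0 := h2
  simp only [h1, Finset.sum_add_distrib] at h3
  simp only [del, mul_ite, ite_mul, mul_one, mul_zero, one_mul, zero_mul, Finset.sum_ite_eq,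
    Finset.sum_ite_eq', Finset.mem_univ, if_true] at h3
  linarith

theorem pd_pd_tr (hC : Center W F h X) (m k : Fin 7) :
    pd m (pd k fun z => tr (F 0 z) (h z)) 0 =
      -2 * (∑ i, ∑ j, dGam (F 0) m k i j * h 0 i j) + ∑ i, pd m (pd k fun z => h z i i) 0 := by
  have hN := hC.normal
  have s := fun i j => (hN.field.cometric i j).mul (hC.var.smooth_h i j)
  have s2 := fun i => ContDiffOn.sum (s := Finset.univ) fun j _ => s i j
  have e : ∀ z ∈ slice W, pd k (fun z => tr (F 0 z) (h z)) z =
      ∑ i, ∑ j, pd k (fun z => cometric (F 0 z) i j * h z i j) z := fun z hz => by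
    refine (pd_sum (fun i => hN.field.diffAt (s2 i) hz) k).trans ?_
    exact Finset.sum_congr rfl fun i _ => pd_sum (fun j => hN.field.diffAt (s i j) hz) k
  have s3 := fun i j => hN.field.pd (s i j) k
  have s4 := fun i => ContDiffOn.sum (s := Finset.univ) fun j _ => s3 i j
  have h1 : ∀ i j, pd m (pd k fun z => cometric (F 0 z) i j * h z i j) 0 =
      -(dGam (F 0) m k j i + dGam (F 0) m k i j) * h 0 i j + del i j * pd m (pd k fun z => h z i j) 0 := by
    intro i j
    rw [pd_pd_mul hN.field.isOpen (hN.field.cometric i j) (hC.var.smooth_h i j) hN.mem,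
      hN.pd_pd_cometric, hN.pd_cometric, hN.pd_cometric, hN.phi, cometric_phi0]
    ring
  rw [pd_congr hN.field.isOpen e hN.mem]
  refine (pd_sum (fun i => hN.field.diffAt (s4 i) hN.mem) m).trans ?_
  have h2 : ∀ i, pd m (fun z => ∑ j, pd k (fun z => cometric (F 0 z) i j * h z i j) z) 0 =
      ∑ j, pd m (pd k fun z => cometric (F 0 z) i j * h z i j) 0 := fun i =>
    pd_sum (fun j => hN.field.diffAt (s3 i j) hN.mem) m
  rw [Finset.sum_congr rfl fun i _ => h2 i]
  simp only [h1, Finset.sum_add_distrib, neg_mul, add_mul, Finset.sum_neg_distrib]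
  have e2 : ∑ i, ∑ j, dGam (F 0) m k j i * h 0 i j = ∑ i, ∑ j, dGam (F 0) m k i j * h 0 i j := by
    rw [Finset.sum_comm]
    exact Finset.sum_congr rfl fun i _ => Finset.sum_congr rfl fun j _ => by rw [hC.symm]
  rw [e2]
  simp only [del, ite_mul, one_mul, zero_mul, Finset.sum_ite_eq, Finset.mem_univ, if_true]
  ring

theorem pd_div2 (hC : Center W F h X) (m k : Fin 7) :
    pd m (fun z => div2 (F 0) h z k) 0 = ∑ a, (pd m (pd a fun z => h z a k) 0
      - ∑ c, (dGam (F 0) m a c a * h 0 c k + dGam (F 0) m a c k * h 0 a c)) := by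
  have hN := hC.normal
  have hc := fun a b => hN.line (hN.field.cometric a b) m
  simp only [hN.pd_cometric] at hc
  have hp := fun a b => hN.line (hC.smooth_pd_h a b k) m
  have hG := fun c a b => hN.line (hN.field.christoffel c a b) m
  have hh := hC.line_h m
  have h1 := HasDerivAt.fun_sum (u := Finset.univ) fun a _ => HasDerivAt.fun_sum
    (u := Finset.univ) fun b _ => (hc a b).fun_mul ((hp a b).fun_sub
      (HasDerivAt.fun_sum (u := Finset.univ) fun c _ =>
        ((hG c a b).fun_mul (hh c k)).fun_add ((hG c a k).fun_mul (hh b c))))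
  refine (pd_eq_of_line (hN.field.diffAt (u := fun z => div2 (F 0) h z k) (contDiffOn_snd_iff.1
    (hN.field.fam.div2 (w := fun _ => h)
      (fun i j => contDiffOn_snd_iff.2 (hC.var.smooth_h i j)) k)) hN.mem) h1).trans ?_
  simp only [zero_smul, add_zero, hN.phi, hN.chr, cometric_phi0, zero_mul, zero_add, del_sum']
  rfl

/-- The first variation of the scalar curvature. -/
theorem scal_deriv (hC : Center W F h X) :
    ∑ j, ∑ i, (pd i (dt fun t z => christoffel (F t) z i j j) 0
        - pd j (dt fun t z => christoffel (F t) z i i j) 0) =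
      2 * (∑ k, pd k (fun z => div2 (F 0) h z k) 0)
        - 2 * ∑ k, pd k (pd k fun z => tr (F 0 z) (h z)) 0 := by
  have hN := hC.normal
  -- At the centre second covariant derivatives differ from second partial derivatives by terms `∂Γ
  -- · h`. These have to be carried along and match between the two sides after relabelling.
  set D : C4 := fun m k i j => pd m (pd k fun z => h z i j) 0 with hD
  have s1 : ∀ m k i j, D m k i j = D k m i j := fun m k i j =>
    pd_comm ((hC.var.smooth_h i j).contDiffAt (hN.field.isOpen.mem_nhds hN.mem)) m k
  have s2 : ∀ m k i j, D m k i j = D m k j i := fun m k i j =>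
    pd_congr hN.field.isOpen (fun z hz => hC.pd_h_symm hz k i j) hN.mem m
  have e1 : ∀ m l i j, pd m (fun z => velChr h z l i j) 0 = D m i j l + D m j i l - D m l i j :=
    hC.pd_velChr
  have e2 : ∀ m k, pd m (fun z => div2 (F 0) h z k) 0 = ∑ a, (D m a a k
      - ∑ c, (dGam (F 0) m a c a * h 0 c k + dGam (F 0) m a c k * h 0 a c)) := hC.pd_div2
  have e3 : ∀ m k, pd m (pd k fun z => tr (F 0 z) (h z)) 0 =
      -2 * (∑ i, ∑ j, dGam (F 0) m k i j * h 0 i j) + ∑ i, D m k i i := hC.pd_pd_tr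
  simp only [hC.pd_dt_christoffel, e1, e2, e3]
  have f1 : ∀ j i, D i j j i + D i j j i - D i i j j - 2 * ∑ a, dGam (F 0) i j a j * h 0 a i
      - (D j i j i + D j j i i - D j i i j - 2 * ∑ a, dGam (F 0) j i a j * h 0 a i) =
      2 * D i j j i - 2 * (∑ a, dGam (F 0) i j a j * h 0 a i)
      + 2 * (∑ a, dGam (F 0) j j a i * h 0 a i) - D i i j j - D j j i i := by
    intro j i
    rw [s2 j i i j]
    simp only [fun a => hN.dGam_symm j i a j]
    ring
  have f2 : ∑ k, ∑ a, ∑ c, dGam (F 0) k a c k * h 0 a c =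
      ∑ k, ∑ i, ∑ j, dGam (F 0) k k i j * h 0 i j := by
    refine Finset.sum_congr rfl fun k _ => ?_
    rw [Finset.sum_comm]
    refine Finset.sum_congr rfl fun a _ => Finset.sum_congr rfl fun c _ => ?_
    rw [hN.dGam_symm k k a c, hC.symm]
  have f3 : ∑ j, ∑ i, ∑ a, dGam (F 0) j j a i * h 0 a i =
      ∑ k, ∑ i, ∑ j, dGam (F 0) k k i j * h 0 i j :=
    Finset.sum_congr rfl fun k _ => Finset.sum_comm
  have f4 : ∑ j, ∑ i, D i i j j = ∑ j, ∑ i, D j j i i := Finset.sum_comm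
  have f5 : ∑ j, ∑ i, D i j j i = ∑ k, ∑ a, D k a a k := Finset.sum_comm
  have f6 : ∑ j, ∑ i, ∑ a, dGam (F 0) i j a j * h 0 a i =
      ∑ k, ∑ a, ∑ c, dGam (F 0) k a c a * h 0 c k := Finset.sum_comm
  simp only [f1, Finset.sum_add_distrib, Finset.sum_sub_distrib, ← Finset.mul_sum]
  rw [f2, f3, f4, f5, f6]
  ring

end Center

theorem psi0_mul_phi0_two (m l q : Fin 7) :
    ∑ a, ∑ i, psi0 m l a i * phi0 a i q = -4 * phi0 m l q := by
  rw [← phi0_cyc m l q, ← phi0_cyc l q m, ← phi0_mul_psi0_two q m l]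
  refine Finset.sum_congr rfl fun a _ => Finset.sum_congr rfl fun i _ => ?_
  rw [phi0_cyc q a i]
  ring

namespace Center

variable {W : Set (ℝ × E7)} {F : ℝ → E7 → C3} {h : E7 → C2} {X : E7 → C1}

/-- The derivative of `varMatAt` at the centre. -/
def dVar (F : ℝ → E7 → C3) (h : E7 → C2) (X : E7 → C1) (p : Fin 7) : Mat :=
  Matrix.of fun a i => pd p (fun z => h z i a) 0 + (1 / 3) * ∑ l,
    (pd p (fun z => X z l) 0 * phi0 l a i + X 0 l * ∑ m, torsion (F 0) 0 p m * psi0 m l a i)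

theorem line_varMatAt (hC : Center W F h X) (p a i : Fin 7) :
    HasDerivAt (fun s : ℝ => varMatAt (F 0 (0 + s • EuclideanSpace.single p (1 : ℝ)))
      (h (0 + s • EuclideanSpace.single p (1 : ℝ))) (X (0 + s • EuclideanSpace.single p (1 : ℝ)))
        a i) (dVar F h X p a i) 0 := by
  have hN := hC.normal
  have hc := fun a b => hN.line (hN.field.cometric a b) p
  have hf := fun a b d => hN.line (hN.field.smooth a b d) p
  simp only [hN.pd_cometric] at hc
  simp only [hN.pd_form] at hf
  have h1 := (HasDerivAt.fun_sum (u := Finset.univ) fun b _ =>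
    (hC.line_h p i b).fun_mul (hc b a)).fun_add ((HasDerivAt.fun_sum (u := Finset.univ) fun b _ =>
      (hc a b).fun_mul (HasDerivAt.fun_sum (u := Finset.univ) fun l _ =>
        (HasDerivAt.fun_sum (u := Finset.univ) fun e _ =>
          (hc l e).fun_mul (hC.line_X p e)).fun_mul (hf l b i))).const_mul (1 / 3))
  refine h1.congr_deriv ?_
  simp only [zero_smul, add_zero, hN.phi, cometric_phi0, zero_mul, mul_zero, zero_add, del_sum']
  simp [dVar, del]

theorem pd_dt_form (hC : Center W F h X) (p i j k : Fin 7) :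
    pd p (dt fun t z => F t z i j k) 0 = (inf3 (dVar F h X p) phi0
      + inf3 (varMat (h 0) (X 0)) (fun i j k => pd p (fun z => F 0 z i j k) 0)) i j k := by
  have hN := hC.normal
  have hf := fun a b d => hN.line (hN.field.smooth a b d) p
  have hv := hC.line_varMatAt p
  have h1 := HasDerivAt.fun_sum (u := Finset.univ) fun e _ =>
    (((hv e i).fun_mul (hf e j k)).fun_add ((hv e j).fun_mul (hf i e k))).fun_add
      ((hv e k).fun_mul (hf i j e))
  refine (pd_eq_of_line (hN.field.diffAt (contDiffOn_dt hC.var.fam.isOpen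
    (u := fun t z => F t z i j k) (hC.var.fam.smooth i j k)) hN.mem)
    (h1.congr_of_eventuallyEq ?_)).trans ?_
  · filter_upwards [NormalField.tendsto_line p (hN.field.isOpen.mem_nhds hN.mem)] with s hs
    rw [hC.var.dt_apply hs, variation_eq_inf3 (hN.field.model _ hs)]
    rfl
  · simp only [zero_smul, add_zero, hN.phi, varMatAt_phi0]
    simp only [inf3, Pi.add_apply, ← Finset.sum_add_distrib]
    exact Finset.sum_congr rfl fun _ _ => by ring

/-- The part of the velocity of the torsion that involves derivatives. -/
def velTor (F : ℝ → E7 → C3) (h : E7 → C2) (X : E7 → C1) : C2 := fun p q =>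
  -(∑ a, ∑ i, pd i (fun z => h z p a) 0 * phi0 a i q) + pd p (fun z => X z q) 0
    - (2 / 3) * ∑ s, torsion (F 0) 0 p s * ∑ l, X 0 l * phi0 s l q

theorem hasDerivAt_cov3 (hC : Center W F h X) (p : Fin 7) :
    HasDerivAt (fun t => cov3 (F t) (F t) 0 p)
      (inf3 (dVar F h X p - Matrix.of fun a i => velChr h 0 a p i) phi0
      + inf3 (varMat (h 0) (X 0)) (fun i j k => pd p (fun z => F 0 z i j k) 0)) 0 := by
  have hN := hC.normal
  refine hasDerivAt_pi.2 fun i => hasDerivAt_pi.2 fun j => hasDerivAt_pi.2 fun k => ?_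
  have hd : ∀ i j k, HasDerivAt (fun t => F t 0 i j k) (inf3 (varMat (h 0) (X 0)) phi0 i j k) 0 :=
    fun i j k => hasDerivAt_pi.1 (hasDerivAt_pi.1 (hasDerivAt_pi.1 hC.hasDerivAt_form i) j) k
  have hp := hasDerivAt_pd hC.var.fam.isOpen (u := fun t z => F t z i j k)
    (hC.var.fam.smooth i j k) hN.mem p
  have hG := hC.hasDerivAt_christoffel
  refine (hp.fun_sub (HasDerivAt.fun_sum (u := Finset.univ) fun a _ =>
    (((hG a p i).fun_mul (hd a j k)).fun_add ((hG a p j).fun_mul (hd i a k))).fun_add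
      ((hG a p k).fun_mul (hd i j a)))).congr_deriv ?_
  simp only [hC.pd_dt_form, hN.chr, hN.phi, zero_mul, add_zero, inf3_sub]
  simp only [Pi.add_apply, Pi.sub_apply, inf3, Matrix.of_apply]
  ring

/-- The matrix of the variation rotates the second index of the torsion; the rest is the `ψ`-part of
the velocity of `∇φ` corrected by this rotation. -/
theorem hasDerivAt_torsion (hC : Center W F h X) (p q : Fin 7) :
    HasDerivAt (fun t => torsion (F t) 0 p q)
      ((∑ a, varMat (h 0) (X 0) a q * torsion (F 0) 0 p a) + velTor F h X p q) 0 := by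
  have hN := hC.normal
  have h1 := hasDerivAt_psiPart_phi0 hN.phi hC.hasDerivAt_form (hC.hasDerivAt_cov3 p) q
  refine h1.congr_deriv ?_
  have e1 : cov3 (F 0) (F 0) 0 p = fun i j k => pd p (fun z => F 0 z i j k) 0 := hN.cov3_zero p
  have e2 : psiPart phi0 (cov3 (F 0) (F 0) 0 p) = torsion (F 0) 0 p := by
    rw [← hN.phi]
    rfl
  -- The action of the variation on `∇φ` occurs both in the velocity and in the correction, and
  -- cancels. What is left is an infinitesimal action on the model form itself.
  rw [e2, e1, add_sub_cancel_right, psiPart_inf3]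
  congr 1
  have s : ∀ a i, pd a (fun z => h z p i) 0 = pd a (fun z => h z i p) 0 := fun a i =>
    hC.pd_h_symm hN.mem a p i
  have e3 : ∀ a i, (dVar F h X p - Matrix.of fun a i => velChr h 0 a p i) a i * phi0 a i q =
      pd a (fun z => h z p i) 0 * phi0 a i q - pd i (fun z => h z p a) 0 * phi0 a i q
      + (1 / 3) * ((∑ l, pd p (fun z => X z l) 0 * (phi0 l a i * phi0 q a i))
        + ∑ l, ∑ m, X 0 l * torsion (F 0) 0 p m * (psi0 m l a i * phi0 a i q)) := by
    intro a i
    have e4 : (∑ l, pd p (fun z => X z l) 0 * (phi0 l a i * phi0 q a i)) =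
        (∑ l, pd p (fun z => X z l) 0 * phi0 l a i) * phi0 a i q := by
      rw [Finset.sum_mul]
      exact Finset.sum_congr rfl fun l _ => by rw [← phi0_cyc q a i]; ring
    have e5 : ∑ l, ∑ m, X 0 l * torsion (F 0) 0 p m * (psi0 m l a i * phi0 a i q) =
        (∑ l, X 0 l * ∑ m, torsion (F 0) 0 p m * psi0 m l a i) * phi0 a i q := by
      simp only [Finset.sum_mul, Finset.mul_sum]
      exact Finset.sum_congr rfl fun l _ => Finset.sum_congr rfl fun m _ => by ring
    rw [e4, e5]
    simp only [dVar, velChr, Matrix.sub_apply, Matrix.of_apply, Finset.sum_add_distrib]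
    rw [s i a, s a i]
    ring
  have e6 : ∑ a, ∑ i, pd a (fun z => h z p i) 0 * phi0 a i q =
      -∑ a, ∑ i, pd i (fun z => h z p a) 0 * phi0 a i q := by
    rw [Finset.sum_comm]
    simp only [← Finset.sum_neg_distrib]
    refine Finset.sum_congr rfl fun a _ => Finset.sum_congr rfl fun i _ => ?_
    rw [phi0_swap a i]
    ring
  have e7 : ∑ a, ∑ i, ∑ l, pd p (fun z => X z l) 0 * (phi0 l a i * phi0 q a i) =
      6 * pd p (fun z => X z q) 0 := by
    rw [← sum_cyc]
    have : ∀ l, ∑ a, ∑ i, pd p (fun z => X z l) 0 * (phi0 l a i * phi0 q a i) =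
        del l q * (6 * pd p (fun z => X z l) 0) := fun l => by
      simp only [← Finset.mul_sum, phi0_mul_phi0_two]
      ring
    simp only [this, del_sum]
  have e8 : ∑ a, ∑ i, ∑ l, ∑ m, X 0 l * torsion (F 0) 0 p m * (psi0 m l a i * phi0 a i q) =
      -4 * ∑ s, torsion (F 0) 0 p s * ∑ l, X 0 l * phi0 s l q := by
    have e9 : ∀ l m, ∑ a, ∑ i, X 0 l * torsion (F 0) 0 p m * (psi0 m l a i * phi0 a i q) =
        -4 * (torsion (F 0) 0 p m * (X 0 l * phi0 m l q)) := fun l m => by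
      simp only [← Finset.mul_sum, psi0_mul_phi0_two]
      ring
    calc _ = ∑ l, ∑ m, ∑ a, ∑ i,
          X 0 l * torsion (F 0) 0 p m * (psi0 m l a i * phi0 a i q) := by
          rw [Finset.sum_congr rfl fun a _ => Finset.sum_comm, Finset.sum_comm]
          refine Finset.sum_congr rfl fun l _ => ?_
          rw [Finset.sum_congr rfl fun a _ => Finset.sum_comm, Finset.sum_comm]
      _ = _ := by
          rw [Finset.sum_congr rfl fun l _ => Finset.sum_congr rfl fun m _ => e9 l m,
            Finset.sum_comm]
          simp only [← Finset.mul_sum]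
  simp only [e3, Finset.sum_add_distrib, Finset.sum_sub_distrib, ← Finset.mul_sum, e6, e7, e8,
    velTor]
  ring

end Center

namespace Center

variable {W : Set (ℝ × E7)} {F : ℝ → E7 → C3} {h : E7 → C2} {X : E7 → C1}

/-- The variation of the cometric on the second index cancels against the action of `h` on the
second index of `T`, so only the first index contributes. The action of `X` is skew and preserves
the norm. -/
theorem hasDerivAt_normSq_torsion (hC : Center W F h X) :
    HasDerivAt (fun t => ip2 (F t 0) (torsion (F t) 0) (torsion (F t) 0))
      (-2 * (∑ i, ∑ a, h 0 i a * ∑ j, torsion (F 0) 0 i j * torsion (F 0) 0 a j)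
        + 2 * ∑ p, ∑ q, torsion (F 0) 0 p q * velTor F h X p q) 0 := by
  set T := torsion (F 0) 0 with hT
  set T' : C2 := fun p q => (∑ a, varMat (h 0) (X 0) a q * T p a) + velTor F h X p q with hT'
  have ht : ∀ p q, HasDerivAt (fun t => torsion (F t) 0 p q) (T' p q) 0 := hC.hasDerivAt_torsion
  have hc := hC.hasDerivAt_cometric
  have h1 := HasDerivAt.fun_sum (u := Finset.univ) fun i _ => HasDerivAt.fun_sum
    (u := Finset.univ) fun j _ => (HasDerivAt.fun_sum (u := Finset.univ) fun a _ =>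
      HasDerivAt.fun_sum (u := Finset.univ) fun b _ =>
        ((hc i a).fun_mul (hc j b)).fun_mul (ht a b)).fun_mul (ht i j)
  refine h1.congr_deriv ?_
  simp only [hC.normal.phi, cometric_phi0, ← hT]
  have e1 : ∀ i j, ∑ a, ∑ b, ((-(2 * h 0 i a) * del j b + del i a * -(2 * h 0 j b)) * T a b
      + del i a * del j b * T' a b) = -2 * (∑ a, h 0 i a * T a j) - 2 * (∑ b, h 0 j b * T i b)
        + T' i j := by
    intro i j
    simp only [add_mul, Finset.sum_add_distrib, del, mul_ite, ite_mul, mul_one, mul_zero, one_mul,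
      zero_mul, Finset.sum_ite_eq, Finset.mem_univ, if_true, Finset.mul_sum]
    simp [mul_assoc, Finset.sum_neg_distrib]
    ring
  have e2 : ∀ i j, ∑ a, ∑ b, del i a * del j b * T a b = T i j := by
    intro i j
    simp [del]
  simp only [e1, e2]
  have e3 : ∀ i j, (-2 * (∑ a, h 0 i a * T a j) - 2 * (∑ b, h 0 j b * T i b) + T' i j) * T i j
      + T i j * T' i j = -2 * ((∑ a, h 0 i a * T a j) * T i j)
        + (2 / 3) * (∑ a, (∑ l, X 0 l * phi0 l a j) * (T i a * T i j))
        + 2 * (T i j * velTor F h X i j) := by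
    intro i j
    have : (∑ a, varMat (h 0) (X 0) a j * T i a) = (∑ b, h 0 j b * T i b)
        + (1 / 3) * ∑ a, (∑ l, X 0 l * phi0 l a j) * T i a := by
      simp only [varMat, Matrix.of_apply, add_mul, Finset.sum_add_distrib, Finset.mul_sum,
        mul_assoc, Finset.sum_mul]
    have e4 : ∑ a, (∑ l, X 0 l * phi0 l a j) * (T i a * T i j) =
        (∑ a, (∑ l, X 0 l * phi0 l a j) * T i a) * T i j := by
      rw [Finset.sum_mul]
      exact Finset.sum_congr rfl fun _ _ => by ring
    rw [e4]
    simp only [hT']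
    rw [this]
    ring
  have e5 : ∀ i, ∑ j, ∑ a, (∑ l, X 0 l * phi0 l a j) * (T i a * T i j) = 0 := by
    intro i
    have : ∑ j, ∑ a, (∑ l, X 0 l * phi0 l a j) * (T i a * T i j) =
        -∑ j, ∑ a, (∑ l, X 0 l * phi0 l a j) * (T i a * T i j) := by
      conv_lhs => rw [Finset.sum_comm]
      simp only [← Finset.sum_neg_distrib]
      refine Finset.sum_congr rfl fun a _ => Finset.sum_congr rfl fun j _ => ?_
      rw [show (∑ l, X 0 l * phi0 l a j) = -∑ l, X 0 l * phi0 l j a by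
        rw [← Finset.sum_neg_distrib]
        exact Finset.sum_congr rfl fun l _ => by rw [phi0_swap2 l j a]; ring]
      ring
    linarith
  simp only [e3, Finset.sum_add_distrib, ← Finset.mul_sum, e5, mul_zero,
    add_zero]
  congr 2
  refine Finset.sum_congr rfl fun i _ => ?_
  simp only [Finset.sum_mul, Finset.mul_sum]
  rw [Finset.sum_comm]
  exact Finset.sum_congr rfl fun _ _ => Finset.sum_congr rfl fun _ _ => by ring

/-- The cometric contributes `-2 ⟨h, T⟩` and the action on the second index gives back `⟨h, T⟩ -
(1/3) ⟨X, 𝖵T⟩`; the rest is the trace of `velTor`. -/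
theorem hasDerivAt_trT (hC : Center W F h X) :
    HasDerivAt (fun t => trT (F t) 0) (-(∑ i, ∑ j, h 0 i j * torsion (F 0) 0 i j)
      - (1 / 3) * (∑ l, X 0 l * vT (F 0) 0 l) + ∑ p, velTor F h X p p) 0 := by
  have h1 := HasDerivAt.fun_sum (u := Finset.univ) fun i _ => HasDerivAt.fun_sum
    (u := Finset.univ) fun j _ => (hC.hasDerivAt_cometric i j).fun_mul (hC.hasDerivAt_torsion i j)
  refine h1.congr_deriv ?_
  have hv : ∀ l, vT (F 0) 0 l = ∑ i, ∑ j, torsion (F 0) 0 i j * phi0 i j l := fun l => by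
    rw [vT, vop, hC.normal.phi, raise2_phi0]
  simp only [hv, hC.normal.phi, cometric_phi0, Finset.sum_add_distrib, del_sum', mul_add,
    varMat, Matrix.of_apply, add_mul]
  have e1 : ∑ i, ∑ j, -(2 * h 0 i j) * torsion (F 0) 0 i j =
      -2 * ∑ i, ∑ j, h 0 i j * torsion (F 0) 0 i j := by
    simp only [Finset.mul_sum]
    exact Finset.sum_congr rfl fun _ _ => Finset.sum_congr rfl fun _ _ => by ring
  have e2 : ∑ i, ∑ a, 1 / 3 * (∑ l, X 0 l * phi0 l a i) * torsion (F 0) 0 i a =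
      -(1 / 3) * ∑ l, X 0 l * ∑ i, ∑ j, torsion (F 0) 0 i j * phi0 i j l := by
    simp only [Finset.mul_sum, Finset.sum_mul]
    rw [Finset.sum_congr rfl fun i _ => Finset.sum_comm, Finset.sum_comm]
    refine Finset.sum_congr rfl fun l _ => Finset.sum_congr rfl fun i _ =>
      Finset.sum_congr rfl fun a _ => ?_
    rw [phi0_cyc l i a, phi0_swap2 l i a]
    ring
  rw [e1, e2]
  ring

end Center

theorem sum_pairs (f : C4) : ∑ a, ∑ b, ∑ c, ∑ d, f a b c d = ∑ c, ∑ d, ∑ a, ∑ b, f a b c d := by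
  rw [Finset.sum_congr rfl fun a _ => Finset.sum_comm, Finset.sum_comm]
  refine Finset.sum_congr rfl fun c _ => ?_
  rw [Finset.sum_congr rfl fun a _ => Finset.sum_comm, Finset.sum_comm]

/-! ### Comparison with the asserted formula at the centre -/

namespace Center

variable {W : Set (ℝ × E7)} {F : ℝ → E7 → C3} {h : E7 → C2} {X : E7 → C1}

/-- Against the symmetric `h` every symmetrization may be dropped, and at the centre covariant
derivatives are partial derivatives. -/
theorem ip2_locP1hat (hC : Center W F h X) :
    ip2 (F 0 0) (h 0) (locP1hat (F 0) 0) = ∑ i, ∑ j, h 0 i j * (-ricci (F 0) 0 i j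
      - (2 / 3) * pd i (fun z => vT (F 0) z j) 0
      - (2 / 3) * (∑ m, torsion (F 0) 0 i m * ∑ l, vT (F 0) 0 l * phi0 l m j)
      + trT (F 0) 0 * torsion (F 0) 0 i j) := by
  have hN := hC.normal
  have hs : ∀ w : C2, ∑ i, ∑ j, h 0 i j * sym w i j = ∑ i, ∑ j, h 0 i j * w i j := by
    intro w
    have e : ∑ i, ∑ j, h 0 i j * w j i = ∑ i, ∑ j, h 0 i j * w i j := by
      rw [Finset.sum_comm]
      exact Finset.sum_congr rfl fun i _ => Finset.sum_congr rfl fun j _ => by rw [hC.symm]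
    have e2 : ∀ i j, h 0 i j * sym w i j = (1 / 2) * (h 0 i j * w i j)
        + (1 / 2) * (h 0 i j * w j i) := fun i j => by simp only [sym]; ring
    simp only [e2, Finset.sum_add_distrib, ← Finset.mul_sum, e]
    ring
  have e1 : ∀ i j, cov1 (F 0) (vT (F 0)) 0 i j = pd i (fun z => vT (F 0) z j) 0 := fun i j => by
    simp [cov1, hN.chr]
  have e2 : ∀ i j, comp phi0 (torsion (F 0) 0) (hookPhi phi0 (vT (F 0) 0)) i j =
      ∑ m, torsion (F 0) 0 i m * ∑ l, vT (F 0) 0 l * phi0 l m j := fun i j => by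
    have e : ∀ m n, torsion (F 0) 0 i m * del m n * (∑ l, vT (F 0) 0 l * phi0 l n j) =
      del m n * (torsion (F 0) 0 i m * ∑ l, vT (F 0) 0 l * phi0 l n j) := fun m n => by ring
    simp only [comp, hookPhi, raise1_phi0, cometric_phi0, e, del_sum']
  rw [hN.field.locP1hat_eq hN.mem, hN.phi, ip2, raise2_phi0]
  have e3 : ∀ i j (R S S' S'' : C2), h 0 i j * ((-R - (2 / 3 : ℝ) • S - (2 / 3 : ℝ) • S'
      + trT (F 0) 0 • S'') i j) = -(h 0 i j * R i j) - (2 / 3) * (h 0 i j * S i j)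
      - (2 / 3) * (h 0 i j * S' i j) + trT (F 0) 0 * (h 0 i j * S'' i j) := fun i j R S S' S'' => by
    simp only [Pi.add_apply, Pi.sub_apply, Pi.neg_apply, Pi.smul_apply, smul_eq_mul]
    ring
  have e4 : ∀ i j (R S S' S'' : ℝ), h 0 i j * (-R - (2 / 3 : ℝ) * S - (2 / 3 : ℝ) * S'
      + trT (F 0) 0 * S'') = -(h 0 i j * R) - (2 / 3) * (h 0 i j * S)
      - (2 / 3) * (h 0 i j * S') + trT (F 0) 0 * (h 0 i j * S'') := fun i j R S S' S'' => by ring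
  simp only [e3, e4, Finset.sum_add_distrib, Finset.sum_sub_distrib, Finset.sum_neg_distrib,
    ← Finset.mul_sum, hs, e1, e2]

theorem ip1_locP2 (hC : Center W F h X) :
    ip1 (F 0 0) (X 0) (locP2 (F 0) 0) = ∑ k, X 0 k * ((2 / 3) * (∑ a, dTor (F 0) a a k)
      + (1 / 3) * pd k (trT (F 0)) 0 + (1 / 3) * (trT (F 0) 0 * vT (F 0) 0 k)) := by
  have hN := hC.normal
  have e : ∀ k, div2 (F 0) (torsion (F 0)) 0 k = ∑ a, dTor (F 0) a a k := fun k => by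
    simp only [div2, hN.phi, cometric_phi0, del_sum', cov2, hN.chr, zero_mul, add_zero,
      Finset.sum_const_zero, sub_zero]
    rfl
  simp only [ip1, hN.phi, raise1_phi0, locP2, e]

theorem pd_vop (hC : Center W F h X) (k : Fin 7) :
    pd k (fun z => vop (F 0 z) (comp (F 0 z) (h z) (torsion (F 0) z)) k) 0 =
      ∑ i, ∑ j, ∑ m, (pd k (fun z => h z i m) 0 * torsion (F 0) 0 m j * phi0 i j k
        + h 0 i m * (dTor (F 0) k m j * phi0 i j k)
        + h 0 i m * (torsion (F 0) 0 m j * ∑ s, torsion (F 0) 0 k s * psi0 s i j k)) := by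
  have hN := hC.normal
  have hT := fun a b => hN.line (hN.field.torsion a b) k
  have hf := fun a b d => hN.line (hN.field.smooth a b d) k
  have hc := fun a b => hN.line (hN.field.cometric a b) k
  simp only [hN.pd_cometric] at hc
  simp only [hN.pd_form] at hf
  have h1 := HasDerivAt.fun_sum (u := Finset.univ) fun i _ => HasDerivAt.fun_sum
    (u := Finset.univ) fun j _ => (HasDerivAt.fun_sum (u := Finset.univ) fun a _ =>
      HasDerivAt.fun_sum (u := Finset.univ) fun b _ =>
        ((hc i a).fun_mul (hc j b)).fun_mul (HasDerivAt.fun_sum (u := Finset.univ) fun m _ =>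
          HasDerivAt.fun_sum (u := Finset.univ) fun n _ =>
            ((hC.line_h k a m).fun_mul (hc m n)).fun_mul (hT n b))).fun_mul (hf i j k)
  have hs : ContDiffOn ℝ ∞ (fun z => vop (F 0 z) (comp (F 0 z) (h z) (torsion (F 0) z)) k)
      (slice W) := contDiffOn_snd_iff.1 (hN.field.fam.vop
        (w := fun _ z => comp (F 0 z) (h z) (torsion (F 0) z)) (fun i j => hN.field.fam.comp
        (v := fun _ => h) (w := fun _ => torsion (F 0))
        (fun i j => contDiffOn_snd_iff.2 (hC.var.smooth_h i j))
        (fun i j => contDiffOn_snd_iff.2 (hN.field.torsion i j)) i j) k)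
  refine (pd_eq_of_line (hN.field.diffAt hs hN.mem) h1).trans ?_
  refine Finset.sum_congr rfl fun i _ => Finset.sum_congr rfl fun j _ => ?_
  simp only [zero_smul, add_zero, hN.phi, cometric_phi0, zero_mul, mul_zero, zero_add, mul_assoc,
    del_sum', ← Finset.mul_sum, Finset.sum_add_distrib]
  have e : ∀ (u : ℝ) (a b : Fin 7 → ℝ), ∑ m, a m * (b m * u) = (∑ m, a m * b m) * u :=
    fun u a b => by
      rw [Finset.sum_mul]
      exact Finset.sum_congr rfl fun m _ => by ring
  simp only [e, dTor]
  ring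

theorem pd_act (hC : Center W F h X) (k : Fin 7) :
    pd k (fun z => act (F 0 z) (torsion (F 0) z) (X z) k) 0 =
      ∑ b, (dTor (F 0) k k b * X 0 b + torsion (F 0) 0 k b * pd k (fun z => X z b) 0) := by
  have hN := hC.normal
  have hT := fun a b => hN.line (hN.field.torsion a b) k
  have hc := fun a b => hN.line (hN.field.cometric a b) k
  simp only [hN.pd_cometric] at hc
  have h1 := HasDerivAt.fun_sum (u := Finset.univ) fun b _ => (hT k b).fun_mul
    (HasDerivAt.fun_sum (u := Finset.univ) fun c _ => (hc b c).fun_mul (hC.line_X k c))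
  have hs : ContDiffOn ℝ ∞ (fun z => act (F 0 z) (torsion (F 0) z) (X z) k)
      (slice W) := contDiffOn_snd_iff.1 (hN.field.fam.act
        (w := fun _ => torsion (F 0)) (X := fun _ => X)
        (fun i j => contDiffOn_snd_iff.2 (hN.field.torsion i j))
        (fun i => contDiffOn_snd_iff.2 (hC.var.smooth_X i)) k)
  refine (pd_eq_of_line (hN.field.diffAt hs hN.mem) h1).trans ?_
  simp only [zero_smul, add_zero, hN.phi, cometric_phi0, zero_mul, zero_add, del_sum']
  rfl

theorem div1_locA (hC : Center W F h X) : div1 (F 0) (locA (F 0) h X) 0 =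
    -(1 / 3) * (∑ k, pd k (pd k fun z => tr (F 0 z) (h z)) 0)
      + (1 / 3) * (∑ k, pd k (fun z => div2 (F 0) h z k) 0)
      - (2 / 3) * (∑ k, ∑ i, ∑ j, ∑ m, (pd k (fun z => h z i m) 0 * torsion (F 0) 0 m j * phi0 i j k
        + h 0 i m * (dTor (F 0) k m j * phi0 i j k)
        + h 0 i m * (torsion (F 0) 0 m j * ∑ s, torsion (F 0) 0 k s * psi0 s i j k)))
      - (2 / 3) * (∑ k, ∑ b, (dTor (F 0) k k b * X 0 b
        + torsion (F 0) 0 k b * pd k (fun z => X z b) 0))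
      - (1 / 3) * ∑ k, (pd k (trT (F 0)) 0 * X 0 k + trT (F 0) 0 * pd k (fun z => X z k) 0) := by
  have hN := hC.normal
  have hfam := hN.field.fam
  have sh : ∀ i j, ContDiffOn ℝ ∞ (fun q : ℝ × E7 => h q.2 i j) (univ ×ˢ slice W) := fun i j =>
    contDiffOn_snd_iff.2 (hC.var.smooth_h i j)
  have sX : ∀ i, ContDiffOn ℝ ∞ (fun q : ℝ × E7 => X q.2 i) (univ ×ˢ slice W) := fun i =>
    contDiffOn_snd_iff.2 (hC.var.smooth_X i)
  have sT : ∀ i j, ContDiffOn ℝ ∞ (fun q : ℝ × E7 => torsion (F 0) q.2 i j) (univ ×ˢ slice W) :=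
    hfam.torsion
  have d : ∀ {u : E7 → ℝ}, ContDiffOn ℝ ∞ u (slice W) → DifferentiableAt ℝ u 0 := fun hu =>
    hN.field.diffAt hu hN.mem
  have d1 := fun k => d (hN.field.pd (hN.field.tr hC.var.smooth_h) k)
  have d2 := fun k => d (u := fun z => div2 (F 0) h z k)
    (contDiffOn_snd_iff.1 (hfam.div2 (w := fun _ => h) sh k))
  have d3 := fun k => d (u := fun z => vop (F 0 z) (comp (F 0 z) (h z) (torsion (F 0) z)) k)
    (contDiffOn_snd_iff.1 (hfam.vop (w := fun _ z => comp (F 0 z) (h z) (torsion (F 0) z))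
      (fun i j => hfam.comp (v := fun _ => h) (w := fun _ => torsion (F 0)) sh sT i j) k))
  have d4 := fun k => d (u := fun z => act (F 0 z) (torsion (F 0) z) (X z) k)
    (contDiffOn_snd_iff.1 (hfam.act (w := fun _ => torsion (F 0)) (X := fun _ => X) sT sX k))
  have d5 := fun k => (hN.line hN.field.trT k).fun_mul (hC.line_X k k)
  have l1 := fun k => ((((hasDerivAt_line (d1 k) k).const_mul (-(1 / 3))).fun_add
    ((hasDerivAt_line (d2 k) k).const_mul (1 / 3))).fun_sub
    ((hasDerivAt_line (d3 k) k).const_mul (2 / 3))).fun_sub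
    ((hasDerivAt_line (d4 k) k).const_mul (2 / 3)) |>.fun_sub ((d5 k).const_mul (1 / 3))
  have sA := fun k => d (u := fun z => locA (F 0) h X z k)
    (contDiffOn_snd_iff.1 (hfam.locA (h := fun _ => h) (X := fun _ => X) sh sX k))
  have e : ∀ k, cov1 (F 0) (locA (F 0) h X) 0 k k = _ := fun k => by
    have e1 : cov1 (F 0) (locA (F 0) h X) 0 k k = pd k (fun z => locA (F 0) h X z k) 0 := by
      simp [cov1, hN.chr]
    exact e1.trans (pd_eq_of_line (sA k) (l1 k))
  rw [div1, hN.phi, tr_phi0]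
  simp only [e, hC.pd_vop, hC.pd_act, zero_smul, add_zero, Finset.sum_add_distrib,
    Finset.sum_sub_distrib, ← Finset.mul_sum]

/-- The first variation of `𝖥` at the centre of normal coordinates. -/
theorem hasDerivAt_lagr (hC : Center W F h X) : HasDerivAt (fun t => lagr (F t) 0)
    (ip2 (F 0 0) (h 0) (locP1hat (F 0) 0) + ip1 (F 0 0) (X 0) (locP2 (F 0) 0)
      + div1 (F 0) (locA (F 0) h X) 0) 0 := by
  have hN := hC.normal
  have h1 := ((hC.hasDerivAt_scal.const_mul (1 / 6)).fun_sub
    (hC.hasDerivAt_normSq_torsion.const_mul (1 / 3))).fun_sub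
    ((hC.hasDerivAt_trT.fun_pow 2).const_mul (1 / 6))
  refine h1.congr_deriv ?_
  rw [hC.scal_deriv, hC.ip2_locP1hat, hC.ip1_locP2, hC.div1_locA]
  set T := torsion (F 0) 0 with hT
  set V := vT (F 0) 0 with hV
  set τ := trT (F 0) 0 with hτ
  have vV : ∀ l, V l = ∑ a, ∑ b, T a b * phi0 a b l := fun l => by
    rw [hV, vT, vop, hN.phi, raise2_phi0]
  have vτ : τ = ∑ a, T a a := by rw [hτ, trT, hN.phi, tr_phi0]
  -- A symmetric tensor is orthogonal to the skew `defect`.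
  have hdef : ∑ i, ∑ m, h 0 i m * NormalField.defect (F 0) i m = 0 := by
    have : ∑ i, ∑ m, h 0 i m * NormalField.defect (F 0) i m = -∑ i, ∑ m, h 0 i m * NormalField.defect (F 0) i m := by
      conv_lhs => rw [Finset.sum_comm]
      simp only [← Finset.sum_neg_distrib]
      refine Finset.sum_congr rfl fun i _ => Finset.sum_congr rfl fun m _ => ?_
      rw [hC.symm m i, eq_neg_of_add_eq_zero_left (hN.defect_skew m i)]
      ring
    linarith
  simp only [NormalField.defect, ← hT, ← vV, ← vτ] at hdef
  have r1 : ∑ k, ∑ i, ∑ j, ∑ m, pd k (fun z => h z i m) 0 * T m j * phi0 i j k =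
      -∑ p, ∑ q, T p q * ∑ a, ∑ i, pd i (fun z => h z p a) 0 * phi0 a i q := by
    have e : ∀ k i m j, pd k (fun z => h z i m) 0 * T m j * phi0 i j k =
        -(T m j * (pd k (fun z => h z m i) 0 * phi0 i k j)) := fun k i m j => by
      rw [hC.pd_h_symm hN.mem k i m, phi0_swap2 i k j]
      ring
    simp only [e, Finset.sum_neg_distrib, Finset.mul_sum]
    refine congrArg Neg.neg ?_
    calc _ = ∑ k, ∑ i, ∑ p, ∑ q, T p q * (pd k (fun z => h z p i) 0 * phi0 i k q) :=
          Finset.sum_congr rfl fun _ _ => Finset.sum_congr rfl fun _ _ => Finset.sum_comm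
      _ = ∑ p, ∑ q, ∑ k, ∑ i, T p q * (pd k (fun z => h z p i) 0 * phi0 i k q) :=
          sum_pairs fun k i p q => T p q * (pd k (fun z => h z p i) 0 * phi0 i k q)
      _ = _ := Finset.sum_congr rfl fun _ _ => Finset.sum_congr rfl fun _ _ => Finset.sum_comm
  have r2 : ∑ k, ∑ i, ∑ j, ∑ m, h 0 i m * (dTor (F 0) k m j * phi0 i j k) =
      ∑ i, ∑ m, h 0 i m * ∑ a, ∑ j, dTor (F 0) a m j * phi0 i j a := by
    simp only [Finset.mul_sum]
    calc _ = ∑ k, ∑ j, ∑ i, ∑ m, h 0 i m * (dTor (F 0) k m j * phi0 i j k) :=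
          Finset.sum_congr rfl fun _ _ => Finset.sum_comm
      _ = _ := sum_pairs fun k j i m => h 0 i m * (dTor (F 0) k m j * phi0 i j k)
  have r3 : ∑ k, ∑ i, ∑ j, ∑ m, h 0 i m * (T m j * ∑ s, T k s * psi0 s i j k) =
      ∑ i, ∑ m, h 0 i m * ∑ j, T m j * ∑ a, ∑ s, T a s * psi0 s i j a := by
    have e : ∀ i m, h 0 i m * ∑ j, T m j * ∑ a, ∑ s, T a s * psi0 s i j a =
        ∑ k, ∑ j, h 0 i m * (T m j * ∑ s, T k s * psi0 s i j k) := fun i m => by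
      rw [Finset.sum_comm]
      simp only [Finset.mul_sum]
    simp only [e]
    calc _ = ∑ k, ∑ j, ∑ i, ∑ m, h 0 i m * (T m j * ∑ s, T k s * psi0 s i j k) :=
          Finset.sum_congr rfl fun _ _ => Finset.sum_comm
      _ = _ := sum_pairs fun k j i m => h 0 i m * (T m j * ∑ s, T k s * psi0 s i j k)
  have r4 : ∑ p, velTor F h X p p = (∑ p, pd p (fun z => X z p) 0)
      - (2 / 3) * ∑ l, X 0 l * V l := by
    have e1 : ∑ p, ∑ a, ∑ i, pd i (fun z => h z p a) 0 * phi0 a i p = 0 := by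
      have : ∑ p, ∑ a, ∑ i, pd i (fun z => h z p a) 0 * phi0 a i p =
          -∑ p, ∑ a, ∑ i, pd i (fun z => h z p a) 0 * phi0 a i p := by
        conv_lhs => rw [Finset.sum_comm]
        simp only [← Finset.sum_neg_distrib]
        refine Finset.sum_congr rfl fun p _ => Finset.sum_congr rfl fun a _ =>
          Finset.sum_congr rfl fun i _ => ?_
        rw [hC.pd_h_symm hN.mem i a p, phi0_cyc a p i, phi0_swap2 a i p]
        ring
      linarith
    have e2 : ∑ p, ∑ s, T p s * ∑ l, X 0 l * phi0 s l p = ∑ l, X 0 l * V l := by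
      simp only [vV, Finset.mul_sum]
      rw [Finset.sum_congr rfl fun p _ => Finset.sum_comm, Finset.sum_comm]
      refine Finset.sum_congr rfl fun l _ => Finset.sum_congr rfl fun p _ =>
        Finset.sum_congr rfl fun s _ => ?_
      rw [phi0_cyc p s l]
      ring
    simp only [velTor, Finset.sum_add_distrib, Finset.sum_sub_distrib, Finset.sum_neg_distrib,
      ← Finset.mul_sum, ← hT, e1, e2]
    ring
  have r5 : ∑ p, ∑ q, T p q * velTor F h X p q =
      -(∑ p, ∑ q, T p q * ∑ a, ∑ i, pd i (fun z => h z p a) 0 * phi0 a i q)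
        + ∑ k, ∑ b, T k b * pd k (fun z => X z b) 0 := by
    have e1 : ∀ p, ∑ q, T p q * ∑ s, T p s * ∑ l, X 0 l * phi0 s l q = 0 := by
      intro p
      have : ∑ q, T p q * ∑ s, T p s * ∑ l, X 0 l * phi0 s l q =
          -∑ q, T p q * ∑ s, T p s * ∑ l, X 0 l * phi0 s l q := by
        simp only [Finset.mul_sum]
        conv_lhs => rw [Finset.sum_comm]
        simp only [← Finset.sum_neg_distrib]
        refine Finset.sum_congr rfl fun q _ => Finset.sum_congr rfl fun s _ =>
          Finset.sum_congr rfl fun l _ => ?_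
        rw [phi0_cyc s q l, phi0_swap2 s l q]
        ring
      linarith
    have e2 : ∀ p q, T p q * velTor F h X p q =
        -(T p q * ∑ a, ∑ i, pd i (fun z => h z p a) 0 * phi0 a i q)
        + T p q * pd p (fun z => X z q) 0
        - (2 / 3) * (T p q * ∑ s, T p s * ∑ l, X 0 l * phi0 s l q) := fun p q => by
      rw [velTor]
      ring
    simp only [e2, Finset.sum_add_distrib, Finset.sum_sub_distrib, Finset.sum_neg_distrib,
      ← Finset.mul_sum, e1]
    simp
  have r6 : ∑ k, ∑ b, dTor (F 0) k k b * X 0 b = ∑ k, X 0 k * ∑ a, dTor (F 0) a a k := by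
    rw [Finset.sum_comm]
    refine Finset.sum_congr rfl fun k _ => ?_
    rw [Finset.mul_sum]
    exact Finset.sum_congr rfl fun _ _ => mul_comm _ _
  have r7 : ∑ k, pd k (trT (F 0)) 0 * X 0 k = ∑ k, X 0 k * pd k (trT (F 0)) 0 :=
    Finset.sum_congr rfl fun _ _ => mul_comm _ _
  have d1 : ∀ i j, h 0 i j * (-ricci (F 0) 0 i j - 2 / 3 * pd i (fun z => vT (F 0) z j) 0
      - 2 / 3 * (∑ m, T i m * ∑ l, V l * phi0 l m j) + τ * T i j) =
      -(h 0 i j * ricci (F 0) 0 i j) - 2 / 3 * (h 0 i j * pd i (fun z => vT (F 0) z j) 0)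
      - 2 / 3 * (h 0 i j * ∑ m, T i m * ∑ l, V l * phi0 l m j) + τ * (h 0 i j * T i j) :=
    fun i j => by ring
  have d2 : ∀ k, X 0 k * (2 / 3 * (∑ a, dTor (F 0) a a k) + 1 / 3 * pd k (trT (F 0)) 0
      + 1 / 3 * (τ * V k)) = 2 / 3 * (X 0 k * ∑ a, dTor (F 0) a a k)
      + 1 / 3 * (X 0 k * pd k (trT (F 0)) 0) + 1 / 3 * τ * (X 0 k * V k) := fun k => by ring
  have d3 : ∀ i m, h 0 i m * (ricci (F 0) 0 i m + ∑ j, T i j * T m j - τ * T i m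
      + pd i (fun z => vT (F 0) z m) 0 + ∑ j, T i j * ∑ l, V l * phi0 l j m
      + ∑ a, ∑ j, dTor (F 0) a m j * phi0 i j a
      + ∑ j, T m j * ∑ a, ∑ s, T a s * psi0 s i j a) =
      h 0 i m * ricci (F 0) 0 i m + h 0 i m * (∑ j, T i j * T m j) - τ * (h 0 i m * T i m)
      + h 0 i m * pd i (fun z => vT (F 0) z m) 0 + h 0 i m * (∑ j, T i j * ∑ l, V l * phi0 l j m)
      + h 0 i m * (∑ a, ∑ j, dTor (F 0) a m j * phi0 i j a)
      + h 0 i m * ∑ j, T m j * ∑ a, ∑ s, T a s * psi0 s i j a := fun i m => by ring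
  simp only [d3, Finset.sum_add_distrib, Finset.sum_sub_distrib, ← Finset.mul_sum] at hdef
  simp only [d1, d2, Finset.sum_add_distrib, Finset.sum_sub_distrib, Finset.sum_neg_distrib,
    ← Finset.mul_sum]
  rw [r5, r1, r2, r3, r4, r6, r7]
  norm_num
  -- Once the divergence terms and the terms in `X` are matched, the two sides differ by `2 / 3` of
  -- the pairing of `h` with the defect.
  linear_combination (2 / 3) * hdef

end Center

/-- The first variation of `𝖥` in coordinates. -/
theorem Variation.hasDerivAt_lagr {W : Set (ℝ × E7)} {F : ℝ → E7 → C3} {h : E7 → C2} {X : E7 → C1}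
    (hV : Variation W F h X) {y : E7} (hy : y ∈ slice W) :
    HasDerivAt (fun t => lagr (F t) y) (ip2 (F 0 y) (h y) (locP1hat (F 0) y)
      + ip1 (F 0 y) (X y) (locP2 (F 0) y) + div1 (F 0) (locA (F 0) h X) y) 0 := by
  obtain ⟨U, κ, hκ, h0, hκ0, hφ, hchr⟩ := hV.field.exists_normal hy
  have hf := hV.field
  have hs : slice {q : ℝ × E7 | q.2 ∈ U ∧ (q.1, κ q.2) ∈ W} = U := by
    ext z
    exact ⟨fun hz => hz.1, fun hz => ⟨hz, hκ.maps z hz⟩⟩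
  have hC : Center {q | q.2 ∈ U ∧ (q.1, κ q.2) ∈ W} (fun t => pf3 κ (F t)) (pf2 κ h) (pf1 κ X) := by
    refine ⟨hV.pf hκ, ?_⟩
    rw [hs]
    exact ⟨hκ.field hf, h0, hφ, hchr⟩
  have h1 := hC.hasDerivAt_lagr
  have hd := hκ.det 0 h0
  have eA : div1 (pf3 κ (F 0)) (locA (pf3 κ (F 0)) (pf2 κ h) (pf1 κ X)) 0 =
      div1 (F 0) (locA (F 0) h X) y := by
    have e1 : div1 (pf3 κ (F 0)) (locA (pf3 κ (F 0)) (pf2 κ h) (pf1 κ X)) 0 =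
        div1 (pf3 κ (F 0)) (pf1 κ (locA (F 0) h X)) 0 := by
      rw [div1, div1, cov1_congr hκ.isOpen (fun z hz => hκ.locA_pf hf hV.smooth_h hz) h0]
    rw [e1, hκ.div1_pf hf _ h0, hκ0]
    exact fun i => contDiffOn_snd_iff.1 (hf.fam.locA (h := fun _ => h) (X := fun _ => X)
      (fun i j => contDiffOn_snd_iff.2 (hV.smooth_h i j))
      (fun i => contDiffOn_snd_iff.2 (hV.smooth_X i)) i)
  have e2 : ip2 (pf3 κ (F 0) 0) (pf2 κ h 0) (locP1hat (pf3 κ (F 0)) 0) =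
      ip2 (F 0 y) (h y) (locP1hat (F 0) y) := by
    rw [hκ.locP1hat_pf hf h0, ← hκ0]
    exact ip2_pull hd _ _ _
  have e3 : ip1 (pf3 κ (F 0) 0) (pf1 κ X 0) (locP2 (pf3 κ (F 0)) 0) =
      ip1 (F 0 y) (X y) (locP2 (F 0) y) := by
    rw [hκ.locP2_pf hf h0, ← hκ0]
    exact ip1_pull hd _ _ _
  rw [eA, e2, e3] at h1
  refine h1.congr_of_eventuallyEq ?_
  have hc : Filter.Tendsto (fun t : ℝ => (t, y)) (nhds 0) (nhds ((0 : ℝ), y)) :=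
    Continuous.tendsto (by fun_prop) 0
  filter_upwards [hc (hV.fam.isOpen.mem_nhds hy)] with t ht
  -- Normal coordinates are chosen for parameter 0 only. For small `t` the same map is still a
  -- change of coordinates, on the part of its domain where the form at parameter `t` is defined,
  -- and `lagr` is invariant under it.
  have hft := hV.fam.field t
  have hκt : CoordChange (U ∩ κ ⁻¹' {z | (t, z) ∈ W}) {z | (t, z) ∈ W} κ :=
    ⟨hκ.contDiffOn.continuousOn.isOpen_inter_preimage hκ.isOpen hft.isOpen, hft.isOpen,
      fun a => (hκ.smooth a).mono inter_subset_left, fun z hz => hz.2, fun z hz => hκ.det z hz.1⟩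
  have h0t : (0 : E7) ∈ U ∩ κ ⁻¹' {z | (t, z) ∈ W} := ⟨h0, by
    change (t, κ 0) ∈ W
    rwa [hκ0]⟩
  rw [hκt.lagr_pf hft h0t, hκ0]

/-- The Ricci tensor is symmetric. -/
theorem NormalField.ricci_symm {U : Set E7} {f : E7 → C3} (hN : NormalField U f) (j k : Fin 7) :
    ricci f 0 j k = ricci f 0 k j := by
  have h1 : ∀ i j k l, riemann f 0 i j k l = (dGam f i j - dGam f j i) l k := hN.riemann_eq
  have hm : ∀ i j a b, dGam f i j b a + dGam f i j a b = dGam f j i b a + dGam f j i a b := by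
    intro i j a b
    have := pd_comm ((hN.field.metric a b).contDiffAt (hN.field.isOpen.mem_nhds hN.mem)) i j
    rwa [hN.pd_pd_metric, hN.pd_pd_metric] at this
  have hg := hN.dGam_symm
  simp only [ricci, h1, Matrix.sub_apply]
  refine Finset.sum_congr rfl fun i _ => ?_
  rw [hg i j i k, hg j i i k, hg k i i j]
  linarith [hm j k i i]

theorem SmoothField.ricci_symm {U : Set E7} {f : E7 → C3} (hf : SmoothField U f) {y : E7}
    (hy : y ∈ U) (j k : Fin 7) : ricci f y j k = ricci f y k j := by
  obtain ⟨U', κ, hκ, h0, hκ0, hφ, hchr⟩ := hf.exists_normal hy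
  have hN : NormalField U' (pf3 κ f) := ⟨hκ.field hf, h0, hφ, hchr⟩
  have h1 := hκ.ricci_pf hf h0
  have hd := hκ.det 0 h0
  have h2 : tens2 (jac κ 0)⁻¹.transpose (ricci (pf3 κ f) 0) = ricci f y := by
    rw [h1, pf2, tens2_mul, ← Matrix.transpose_mul, Matrix.mul_nonsing_inv _ hd.isUnit,
      Matrix.transpose_one, tens2_one, hκ0]
  rw [← h2]
  exact tens2_symm _ hN.ricci_symm j k

theorem SmoothField.locP1hat_symm {U : Set E7} {f : E7 → C3} (hf : SmoothField U f) {y : E7}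
    (hy : y ∈ U) (j k : Fin 7) : locP1hat f y j k = locP1hat f y k j := by
  rw [hf.locP1hat_eq hy]
  simp only [Pi.add_apply, Pi.sub_apply, Pi.neg_apply, Pi.smul_apply, sym, hf.ricci_symm hy j k,
    smul_eq_mul]
  ring

/-! ### Tensors on a manifold and their components -/

theorem map_sum_basis {α : E7 [⋀^Fin 3]→L[ℝ] ℝ} (B : Mat) (v w : Fin 7 → E7)
    (hv : ∀ i, v i = ∑ a, B i a • w a) :
    (fun i j k => α ![v i, v j, v k] : C3) = tens3 B fun i j k => α ![w i, w j, w k] := by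
  ext i j k
  have e : (![v i, v j, v k] : Fin 3 → E7) = fun m => ∑ a, B (![i, j, k] m) a • w a := by
    ext1 m
    fin_cases m <;> exact hv _
  rw [e]
  have h1 := α.toMultilinearMap.map_sum fun m a => B (![i, j, k] m) a • w a
  have h2 : α (fun m => ∑ a, B (![i, j, k] m) a • w a) =
      ∑ r : Fin 3 → Fin 7, α fun m => B (![i, j, k] m) (r m) • w (r m) := h1
  have h3 : ∀ r : Fin 3 → Fin 7, (α fun m => B (![i, j, k] m) (r m) • w (r m)) =
      (∏ m, B (![i, j, k] m) (r m)) * α fun m => w (r m) := fun r =>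
    α.toMultilinearMap.map_smul_univ (fun m => B (![i, j, k] m) (r m)) fun m => w (r m)
  rw [h2, sum_fun3, tens3_apply]
  refine Finset.sum_congr rfl fun a _ => Finset.sum_congr rfl fun b _ =>
    Finset.sum_congr rfl fun d _ => ?_
  rw [h3, Fin.prod_univ_three]
  congr 1
  refine congrArg α ?_
  ext1 m
  fin_cases m <;> rfl

theorem isAlt3_apply (α : E7 [⋀^Fin 3]→L[ℝ] ℝ) (v : Fin 7 → E7) :
    IsAlt3 fun i j k => α ![v i, v j, v k] := by
  refine ⟨fun i j k => ?_, fun i j k => ?_⟩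
  · have := α.toAlternatingMap.map_swap ![v i, v j, v k] (i := 0) (j := 1) (by decide)
    rw [show (![v i, v j, v k] ∘ Equiv.swap (0 : Fin 3) 1) = ![v j, v i, v k] by
      ext1 m; fin_cases m <;> rfl] at this
    exact this
  · have := α.toAlternatingMap.map_swap ![v i, v j, v k] (i := 1) (j := 2) (by decide)
    rw [show (![v i, v j, v k] ∘ Equiv.swap (1 : Fin 3) 2) = ![v i, v k, v j] by
      ext1 m; fin_cases m <;> rfl] at this
    exact this

/-! ### Transition maps and coordinate frames -/

section Charts

variable {M : Type*} [TopologicalSpace M] {e e' : OpenPartialHomeomorph M E7}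

/-- The change of coordinates from `e` to `e'`. -/
def transition (e e' : OpenPartialHomeomorph M E7) (y : E7) : E7 := e' (e.symm y)

/-- The domain of the change of coordinates from `e` to `e'`. -/
def overlap (e e' : OpenPartialHomeomorph M E7) : Set E7 := (e.symm.trans e').source

theorem mem_overlap {y : E7} : y ∈ overlap e e' ↔ y ∈ e.target ∧ e.symm y ∈ e'.source := by
  simp [overlap]

theorem isOpen_overlap : IsOpen (overlap e e') := (e.symm.trans e').open_source

theorem transition_mem_overlap {y : E7} (hy : y ∈ overlap e e') :
    transition e e' y ∈ overlap e' e ∧ transition e' e (transition e e' y) = y := by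
  rw [mem_overlap] at hy ⊢
  simp only [transition]
  rw [e'.left_inv hy.2]
  exact ⟨⟨e'.map_source hy.2, e.map_target hy.1⟩, e.right_inv hy.1⟩

variable [ChartedSpace E7 M] [IsManifold 𝓘(ℝ, E7) ∞ M]

theorem contDiffOn_transition (he : e ∈ atlas E7 M) (he' : e' ∈ atlas E7 M) :
    ContDiffOn ℝ ∞ (transition e e') (overlap e e') := by
  have h := HasGroupoid.compatible (G := contDiffGroupoid ∞ 𝓘(ℝ, E7)) he he'
  rw [contDiffGroupoid, mem_groupoid_of_pregroupoid] at h
  change ContDiffOn ℝ ∞ (e' ∘ e.symm) _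
  simpa [contDiffPregroupoid, overlap] using h.1

theorem differentiableAt_transition (he : e ∈ atlas E7 M) (he' : e' ∈ atlas E7 M) {y : E7}
    (hy : y ∈ overlap e e') : DifferentiableAt ℝ (transition e e') y :=
  ((contDiffOn_transition he he').contDiffAt (isOpen_overlap.mem_nhds hy)).differentiableAt
    (by simp)

/-- The Jacobi matrices of the two inverse transition maps multiply to the identity by the chain
rule, whence invertibility. -/
theorem coordChange (he : e ∈ atlas E7 M) (he' : e' ∈ atlas E7 M) :
    CoordChange (overlap e e') e'.target (transition e e') := by
  refine ⟨isOpen_overlap, e'.open_target, contDiffOn_euclidean.1 (contDiffOn_transition he he'),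
    fun z hz => e'.map_source (mem_overlap.1 hz).2, fun z hz => ?_⟩
  obtain ⟨hz', -⟩ := transition_mem_overlap hz
  have h1 : jac (transition e' e) (transition e e' z) * jac (transition e e') z = 1 := by
    ext a b
    have h2 := pd_comp_of_differentiableAt (u := fun w => transition e' e w a)
      (((EuclideanSpace.proj a : E7 →L[ℝ] ℝ).differentiableAt).comp _
        (differentiableAt_transition he' he hz')) (differentiableAt_transition he he' hz) b
    have h3 : pd b (fun z => transition e' e (transition e e' z) a) z = pd b (fun z => z a) z :=
      pd_congr isOpen_overlap (fun w hw => by rw [(transition_mem_overlap hw).2]) hz b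
    rw [h3, pd_coord] at h2
    rw [Matrix.mul_apply, Matrix.one_apply]
    have h4 : (if a = b then (1 : ℝ) else 0) = del b a := by simp [del, eq_comm]
    rw [h4, h2]
    exact Finset.sum_congr rfl fun r _ => mul_comm _ _
  intro h0
  have := congrArg Matrix.det h1
  rw [Matrix.det_mul, h0, mul_zero, Matrix.det_one] at this
  exact zero_ne_one this

/-- The derivative of `e.symm`, as a map of the model space. -/
def dsymm (e : OpenPartialHomeomorph M E7) (y : E7) : E7 →L[ℝ] E7 :=
  mfderiv 𝓘(ℝ, E7) 𝓘(ℝ, E7) e.symm y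

/-- `frame` with values in the model space. -/
def frameE (e : OpenPartialHomeomorph M E7) (y : E7) (i : Fin 7) : E7 :=
  dsymm e y (EuclideanSpace.single i 1)

theorem mdiff (he : e ∈ atlas E7 M) : e.MDifferentiable 𝓘(ℝ, E7) 𝓘(ℝ, E7) :=
  haveI : IsManifold 𝓘(ℝ, E7) 1 M := IsManifold.of_le (n := ∞) (by simp)
  mdifferentiable_of_mem_atlas he

theorem frameE_eq (he : e ∈ atlas E7 M) (he' : e' ∈ atlas E7 M) {y : E7} (hy : y ∈ overlap e e')
    (i : Fin 7) :
    frameE e y i = ∑ a, (jac (transition e e') y).transpose i a •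
      frameE e' (transition e e' y) a := by
  have hd := differentiableAt_transition he he' hy
  have h0 : e.symm =ᶠ[nhds y] e'.symm ∘ transition e e' := by
    filter_upwards [isOpen_overlap.mem_nhds hy] with z hz
    exact (e'.left_inv (mem_overlap.1 hz).2).symm
  have h1 : dsymm e y = (dsymm e' (transition e e' y)).comp (fderiv ℝ (transition e e') y) := by
    have h2 := h0.mfderiv_eq (I := 𝓘(ℝ, E7)) (I' := 𝓘(ℝ, E7))
    have h3 := mfderiv_comp y ((mdiff he').mdifferentiableAt_symm
      (transition_mem_overlap hy).1.1) hd.mdifferentiableAt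
    rw [mfderiv_eq_fderiv] at h3
    exact h2.trans h3
  rw [frameE, h1, ContinuousLinearMap.comp_apply, eq_sum_single (fderiv ℝ (transition e e') y _),
    map_sum]
  refine Finset.sum_congr rfl fun a _ => ?_
  rw [map_smul, ← jac_eq_fderiv hd]
  rfl

end Charts

/-! ### Components of tensor fields in different charts -/

section Components

variable {M : Type*} [TopologicalSpace M] [ChartedSpace E7 M]
  {e e' : OpenPartialHomeomorph M E7}

/-- A form at a point, as a form on the model space. -/
def formE (φ : ThreeForm M) (p : M) : E7 [⋀^Fin 3]→L[ℝ] ℝ := φ p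

def tensorE (w : TwoTensor M) (p : M) : E7 →L[ℝ] E7 →L[ℝ] ℝ := w p

def covecE (X : OneForm M) (p : M) : E7 →L[ℝ] ℝ := X p

theorem chart_symm_apply (p : M) : (chartAt E7 p).symm (chartAt E7 p p) = p :=
  (chartAt E7 p).left_inv (mem_chart_source E7 p)

/-- The points `p` and `e.symm (e p)` are equal, but their tangent spaces are distinct types that
are both copies of the model space. The base point can be rewritten once values are read in `E7`. -/
theorem at3_eq (φ : ThreeForm M) (p : M) :
    at3 p (φ p) = comps3 (chartAt E7 p) φ (chartAt E7 p p) := by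
  change (fun i j k => formE φ p ![frameE _ _ i, frameE _ _ j, frameE _ _ k] : C3) =
    fun i j k => formE φ ((chartAt E7 p).symm (chartAt E7 p p)) ![frameE _ _ i, frameE _ _ j,
      frameE _ _ k]
  rw [chart_symm_apply]

theorem at2_eq (w : TwoTensor M) (p : M) :
    at2 p (w p) = comps2 (chartAt E7 p) w (chartAt E7 p p) := by
  change (fun i j => tensorE w p (frameE _ _ i) (frameE _ _ j) : C2) =
    fun i j => tensorE w ((chartAt E7 p).symm (chartAt E7 p p)) (frameE _ _ i) (frameE _ _ j)
  rw [chart_symm_apply]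

theorem at1_eq (X : OneForm M) (p : M) :
    at1 p (X p) = comps1 (chartAt E7 p) X (chartAt E7 p p) := by
  change (fun i => covecE X p (frameE _ _ i) : C1) =
    fun i => covecE X ((chartAt E7 p).symm (chartAt E7 p p)) (frameE _ _ i)
  rw [chart_symm_apply]

/-- The transition matrix from `e` to the preferred chart at the point. -/
def toChart (e : OpenPartialHomeomorph M E7) (y : E7) : Mat :=
  jac (transition e (chartAt E7 (e.symm y))) y

theorem mem_overlap_chart {y : E7} (hy : y ∈ e.target) : y ∈ overlap e (chartAt E7 (e.symm y)) :=
  mem_overlap.2 ⟨hy, mem_chart_source E7 _⟩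

variable [IsManifold 𝓘(ℝ, E7) ∞ M]

theorem comps3_pf (he : e ∈ atlas E7 M) (he' : e' ∈ atlas E7 M) (φ : ThreeForm M) {y : E7}
    (hy : y ∈ overlap e e') : comps3 e φ y = pf3 (transition e e') (comps3 e' φ) y := by
  have h1 : e'.symm (transition e e' y) = e.symm y := e'.left_inv (mem_overlap.1 hy).2
  change (fun i j k => formE φ (e.symm y) ![frameE e y i, frameE e y j, frameE e y k] : C3) =
    tens3 _ fun i j k => formE φ (e'.symm (transition e e' y)) ![frameE e' _ i, frameE e' _ j,
      frameE e' _ k]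
  rw [h1, ← map_sum_basis _ _ _ (frameE_eq he he' hy)]

theorem comps2_pf (he : e ∈ atlas E7 M) (he' : e' ∈ atlas E7 M) (w : TwoTensor M) {y : E7}
    (hy : y ∈ overlap e e') : comps2 e w y = pf2 (transition e e') (comps2 e' w) y := by
  have h1 : e'.symm (transition e e' y) = e.symm y := e'.left_inv (mem_overlap.1 hy).2
  change (fun i j => tensorE w (e.symm y) (frameE e y i) (frameE e y j) : C2) =
    tens2 _ fun i j => tensorE w (e'.symm (transition e e' y)) (frameE e' _ i) (frameE e' _ j)
  ext i j
  rw [h1, tens2_apply, frameE_eq he he' hy i, frameE_eq he he' hy j]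
  simp only [map_sum, map_smul, sum_apply, smul_apply,
    smul_eq_mul, Finset.mul_sum]
  rw [Finset.sum_comm]
  exact Finset.sum_congr rfl fun _ _ => Finset.sum_congr rfl fun _ _ => by ring

theorem comps1_pf (he : e ∈ atlas E7 M) (he' : e' ∈ atlas E7 M) (X : OneForm M) {y : E7}
    (hy : y ∈ overlap e e') : comps1 e X y = pf1 (transition e e') (comps1 e' X) y := by
  have h1 : e'.symm (transition e e' y) = e.symm y := e'.left_inv (mem_overlap.1 hy).2
  change (fun i => covecE X (e.symm y) (frameE e y i) : C1) =
    mv _ fun i => covecE X (e'.symm (transition e e' y)) (frameE e' _ i)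
  ext i
  rw [h1, mv_apply_real, frameE_eq he he' hy i]
  simp only [map_sum, map_smul, smul_eq_mul]

theorem det_toChart (he : e ∈ atlas E7 M) {y : E7} (hy : y ∈ e.target) : (toChart e y).det ≠ 0 :=
  (coordChange he (chart_mem_atlas E7 _)).det y (mem_overlap_chart hy)

theorem comps3_eq_at3 (he : e ∈ atlas E7 M) (φ : ThreeForm M) {y : E7} (hy : y ∈ e.target) :
    comps3 e φ y = pull3 (toChart e y) (at3 (e.symm y) (φ (e.symm y))) := by
  rw [at3_eq]
  exact comps3_pf he (chart_mem_atlas E7 _) φ (mem_overlap_chart hy)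

theorem comps2_eq_at2 (he : e ∈ atlas E7 M) (w : TwoTensor M) {y : E7} (hy : y ∈ e.target) :
    comps2 e w y = tens2 (toChart e y).transpose (at2 (e.symm y) (w (e.symm y))) := by
  rw [at2_eq]
  exact comps2_pf he (chart_mem_atlas E7 _) w (mem_overlap_chart hy)

theorem comps1_eq_at1 (he : e ∈ atlas E7 M) (X : OneForm M) {y : E7} (hy : y ∈ e.target) :
    comps1 e X y = mv (toChart e y).transpose (at1 (e.symm y) (X (e.symm y))) := by
  rw [at1_eq]
  exact comps1_pf he (chart_mem_atlas E7 _) X (mem_overlap_chart hy)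

/-! ### Tensors with given components -/

def dchart (p : M) : E7 →L[ℝ] E7 := mfderiv 𝓘(ℝ, E7) 𝓘(ℝ, E7) (chartAt E7 p) p

def vecE (p : M) (i : Fin 7) : E7 := vec p i

def dxE (p : M) (i : Fin 7) : E7 →L[ℝ] ℝ := dx p i

theorem sum_dx_vec (p : M) (v : E7) : ∑ i, dxE p i v • vecE p i = v := by
  have h : (dsymm (chartAt E7 p) (chartAt E7 p p)).comp (dchart p) = ContinuousLinearMap.id ℝ E7 :=
    (mdiff (chart_mem_atlas E7 p)).symm_comp_deriv (mem_chart_source E7 p)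
  have h2 := congrArg (fun L : E7 →L[ℝ] E7 => L v) h
  simp only [ContinuousLinearMap.comp_apply, ContinuousLinearMap.id_apply] at h2
  rw [eq_sum_single (dchart p v), map_sum] at h2
  simp only [map_smul] at h2
  exact h2

theorem dx_vec (p : M) (i j : Fin 7) : dxE p i (vecE p j) = del i j := by
  have h0 : ∀ q, q = p → (mfderiv 𝓘(ℝ, E7) 𝓘(ℝ, E7) (chartAt E7 p) q : E7 →L[ℝ] E7) = dchart p := by
    rintro _ rfl
    rfl
  have h1 : (mfderiv 𝓘(ℝ, E7) 𝓘(ℝ, E7) (chartAt E7 p)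
      ((chartAt E7 p).symm (chartAt E7 p p)) : E7 →L[ℝ] E7).comp
        (dsymm (chartAt E7 p) (chartAt E7 p p)) = ContinuousLinearMap.id ℝ E7 :=
    (mdiff (chart_mem_atlas E7 p)).comp_symm_deriv (mem_chart_target E7 p)
  rw [h0 _ (chart_symm_apply p)] at h1
  have h2 := congrArg (fun L : E7 →L[ℝ] E7 => L (EuclideanSpace.single j 1) i) h1
  refine Eq.trans ?_ (h2.trans ?_)
  · rfl
  · simp [del]

end Components

set_option linter.unusedSectionVars false

/-! ### Tensors at a point are determined by their components in the preferred chart -/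

section Components

variable {M : Type*} [TopologicalSpace M] [ChartedSpace E7 M]

theorem tensor2Of_apply (p : M) (w : C2) (u v : Tan p) :
    tensor2Of p w u v = ∑ i, ∑ j, w i j * (dx p i u * dx p j v) := by
  simp [tensor2Of, sum_apply, smul_apply]

theorem form1Of_apply (p : M) (X : C1) (u : Tan p) : form1Of p X u = ∑ i, X i * dx p i u := by
  simp [form1Of, sum_apply, smul_apply]

theorem dx3_apply (p : M) (i j k : Fin 7) (v : Fin 3 → Tan p) : dx3 p i j k v =
    (Matrix.of fun r m : Fin 3 => dx p (![i, j, k] m) (v r)).det := by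
  rw [dx3, ContinuousMultilinearMap.alternatization_apply_apply, Matrix.det_apply]
  exact Finset.sum_congr rfl fun σ _ => rfl

theorem form3Of_apply (p : M) (α : C3) (v : Fin 3 → Tan p) : form3Of p α v =
    (1 / 6) * ∑ i, ∑ j, ∑ k, α i j k * dx3 p i j k v := by
  simp [form3Of, ContinuousAlternatingMap.sum_apply, ContinuousAlternatingMap.smul_apply]

theorem isAlt3_at3 (p : M) (α : Tan p [⋀^Fin 3]→L[ℝ] ℝ) : IsAlt3 (at3 p α) :=
  isAlt3_apply (α : E7 [⋀^Fin 3]→L[ℝ] ℝ) (vecE p)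

variable [IsManifold 𝓘(ℝ, E7) ∞ M]

theorem dx_apply_vec (p : M) (i j : Fin 7) : dx p i (vec p j) = del i j := dx_vec p i j

theorem at2_tensor2Of (p : M) (w : C2) : at2 p (tensor2Of p w) = w := by
  ext i j
  simp only [at2, tensor2Of_apply, dx_apply_vec]
  simp [del]

theorem at1_form1Of (p : M) (X : C1) : at1 p (form1Of p X) = X := by
  ext i
  simp only [at1, form1Of_apply, dx_apply_vec]
  simp [del]

/-- The six permutations in the determinant contribute `α_{abc}` each, by skewness, which cancels
the factor `1 / 6`. -/
theorem at3_form3Of (p : M) {α : C3} (hα : IsAlt3 α) : at3 p (form3Of p α) = α := by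
  ext a b c
  simp only [at3, form3Of_apply, dx3_apply, Matrix.det_fin_three, Matrix.of_apply]
  have e : ∀ i j k : Fin 7,
      α i j k * (dx p (![i, j, k] 0) (![vec p a, vec p b, vec p c] 0)
        * dx p (![i, j, k] 1) (![vec p a, vec p b, vec p c] 1)
        * dx p (![i, j, k] 2) (![vec p a, vec p b, vec p c] 2)
      - dx p (![i, j, k] 0) (![vec p a, vec p b, vec p c] 0)
        * dx p (![i, j, k] 2) (![vec p a, vec p b, vec p c] 1)
        * dx p (![i, j, k] 1) (![vec p a, vec p b, vec p c] 2)
      - dx p (![i, j, k] 1) (![vec p a, vec p b, vec p c] 0)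
        * dx p (![i, j, k] 0) (![vec p a, vec p b, vec p c] 1)
        * dx p (![i, j, k] 2) (![vec p a, vec p b, vec p c] 2)
      + dx p (![i, j, k] 1) (![vec p a, vec p b, vec p c] 0)
        * dx p (![i, j, k] 2) (![vec p a, vec p b, vec p c] 1)
        * dx p (![i, j, k] 0) (![vec p a, vec p b, vec p c] 2)
      + dx p (![i, j, k] 2) (![vec p a, vec p b, vec p c] 0)
        * dx p (![i, j, k] 0) (![vec p a, vec p b, vec p c] 1)
        * dx p (![i, j, k] 1) (![vec p a, vec p b, vec p c] 2)
      - dx p (![i, j, k] 2) (![vec p a, vec p b, vec p c] 0)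
        * dx p (![i, j, k] 1) (![vec p a, vec p b, vec p c] 1)
        * dx p (![i, j, k] 0) (![vec p a, vec p b, vec p c] 2)) =
      α i j k * (del i a * del j b * del k c) - α i j k * (del i a * del k b * del j c)
        - α i j k * (del j a * del i b * del k c) + α i j k * (del j a * del k b * del i c)
        + α i j k * (del k a * del i b * del j c) - α i j k * (del k a * del j b * del i c) := by
    intro i j k
    simp only [← dx_apply_vec p]
    simp
    ring
  simp only [e, Finset.sum_add_distrib, Finset.sum_sub_distrib]
  simp only [del, mul_ite, mul_one, mul_zero, Finset.sum_ite_eq',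
    Finset.sum_ite_irrel, Finset.sum_const_zero, Finset.mem_univ, if_true]
  linarith [hα.1 a b c, hα.2 a b c, hα.swap13 a b c, hα.cyc a b c, hα.cyc b c a]

theorem ext_at2 {p : M} {v w : Tan p →L[ℝ] Tan p →L[ℝ] ℝ} (h : at2 p v = at2 p w) : v = w := by
  have key : ∀ (w : E7 →L[ℝ] E7 →L[ℝ] ℝ) (x y : E7), w x y =
      ∑ i, ∑ j, dxE p j y * (dxE p i x * w (vecE p i) (vecE p j)) := by
    intro w x y
    conv_lhs => rw [← sum_dx_vec p x, ← sum_dx_vec p y]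
    simp only [map_sum, map_smul, sum_apply, smul_apply, smul_eq_mul, Finset.mul_sum]
    exact Finset.sum_comm
  refine ContinuousLinearMap.ext fun x => ContinuousLinearMap.ext fun y => ?_
  refine (key v x y).trans (Eq.trans ?_ (key w x y).symm)
  refine Finset.sum_congr rfl fun i _ => Finset.sum_congr rfl fun j _ => congrArg _ (congrArg _ ?_)
  exact congrFun (congrFun h i) j

theorem ext_at1 {p : M} {v w : Tan p →L[ℝ] ℝ} (h : at1 p v = at1 p w) : v = w := by
  have key : ∀ (w : E7 →L[ℝ] ℝ) (x : E7), w x = ∑ i, dxE p i x * w (vecE p i) := by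
    intro w x
    conv_lhs => rw [← sum_dx_vec p x]
    simp only [map_sum, map_smul, smul_eq_mul]
  refine ContinuousLinearMap.ext fun x => (key v x).trans (Eq.trans ?_ (key w x).symm)
  exact Finset.sum_congr rfl fun i _ => congrArg _ (congrFun h i)

theorem ext_at3 {p : M} {α β : Tan p [⋀^Fin 3]→L[ℝ] ℝ} (h : at3 p α = at3 p β) : α = β := by
  have key : ∀ (α : E7 [⋀^Fin 3]→L[ℝ] ℝ) (v : Fin 3 → E7), α v = ∑ i, ∑ j, ∑ k,
      dxE p i (v 0) * dxE p j (v 1) * dxE p k (v 2) * α ![vecE p i, vecE p j, vecE p k] := by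
    intro α v
    have h1 := map_sum_basis (α := α) (Matrix.of fun m i => if h : m.1 < 3 then dxE p i (v ⟨m, h⟩)
      else 0) (fun m => if h : m.1 < 3 then v ⟨m, h⟩ else 0) (vecE p) fun m => by
        by_cases h : m.1 < 3
        · simp only [h, dif_pos, Matrix.of_apply, sum_dx_vec]
        · simp [h]
    have h2 := congrFun (congrFun (congrFun h1 0) 1) 2
    rw [tens3_apply] at h2
    refine Eq.trans (congrArg α ?_) h2
    ext1 m
    fin_cases m <;> rfl
  refine ContinuousAlternatingMap.ext fun v => ?_
  refine (key α v).trans (Eq.trans ?_ (key β v).symm)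
  refine Finset.sum_congr rfl fun i _ => Finset.sum_congr rfl fun j _ =>
    Finset.sum_congr rfl fun k _ => congrArg _ ?_
  exact congrFun (congrFun (congrFun h i) j) k

end Components

/-! ### `G₂`-structures and their variations in charts; the pointwise formula -/

section Fields

variable {M : Type*} [TopologicalSpace M] [ChartedSpace E7 M] [IsManifold 𝓘(ℝ, E7) ∞ M]
  {e : OpenPartialHomeomorph M E7}

theorem isModel_at3 {φ : ThreeForm M} {p : M} (h : IsG2At (at3 p (φ p))) :
    IsModel (at3 p (φ p)) := h.isModel (isAlt3_at3 p (φ p))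

theorem isModel_comps3 (he : e ∈ atlas E7 M) {φ : ThreeForm M} (h : ∀ p, IsG2At (at3 p (φ p)))
    {y : E7} (hy : y ∈ e.target) : IsModel (comps3 e φ y) := by
  rw [comps3_eq_at3 he φ hy]
  exact (isModel_at3 (h _)).pull3 (det_toChart he hy)

theorem IsG2Structure.field {φ : ThreeForm M} (hφ : IsG2Structure φ) (he : e ∈ atlas E7 M) :
    SmoothField e.target (comps3 e φ) :=
  ⟨e.open_target, hφ.1 e he, fun _ hy => isModel_comps3 he hφ.2 hy⟩

theorem IsG2Family.fam {ε : ℝ} {φ : ℝ → ThreeForm M} (hφ : IsG2Family ε φ)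
    (he : e ∈ atlas E7 M) : SmoothFam (Ioo (-ε) ε ×ˢ e.target) fun t => comps3 e (φ t) :=
  ⟨isOpen_Ioo.prod e.open_target, hφ.2.1 e he,
    fun q hq => isModel_comps3 he (hφ.2.2 q.1 hq.1) hq.2⟩

theorem IsG2Family.structure {ε : ℝ} {φ : ℝ → ThreeForm M} (hφ : IsG2Family ε φ) {t : ℝ}
    (ht : t ∈ Ioo (-ε) ε) : IsG2Structure (φ t) := by
  refine ⟨fun e he i j k => ?_, hφ.2.2 t ht⟩
  exact (hφ.2.1 e he i j k).comp (f := fun y : E7 => (t, y)) (by fun_prop) fun y hy => ⟨ht, hy⟩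

theorem IsG2Family.zero_mem {ε : ℝ} {φ : ℝ → ThreeForm M} (hφ : IsG2Family ε φ) :
    (0 : ℝ) ∈ Ioo (-ε) ε := ⟨neg_lt_zero.2 hφ.1, hφ.1⟩

theorem isAlt3_diamond {c : C3} (hc : IsAlt3 c) (h : C2) : IsAlt3 (diamond c h) := by
  rw [diamond_eq]
  exact hc.inf3 _

theorem isAlt3_hookPsi {c : C3} (hc : IsModel c) (X : C1) : IsAlt3 (hookPsi c X) := by
  rw [hookPsi_eq_inf3 hc]
  exact hc.isAlt3.inf3 _

theorem at3_variation {φ : ThreeForm M} {p : M} (hc : IsModel (at3 p (φ p)))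
    (h : Tan p →L[ℝ] Tan p →L[ℝ] ℝ) (X : Tan p →L[ℝ] ℝ) :
    at3 p (diamondAt φ p h + hookPsiAt φ p X) =
      diamond (at3 p (φ p)) (at2 p h) + hookPsi (at3 p (φ p)) (at1 p X) := by
  have e : ∀ α β : Tan p [⋀^Fin 3]→L[ℝ] ℝ, at3 p (α + β) = at3 p α + at3 p β := fun α β => rfl
  rw [e, diamondAt, hookPsiAt, at3_form3Of p (isAlt3_diamond hc.isAlt3 _),
    at3_form3Of p (isAlt3_hookPsi hc _)]

theorem comps3_variation (he : e ∈ atlas E7 M) {φ : ThreeForm M} (hφ : ∀ p, IsG2At (at3 p (φ p)))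
    (h : TwoTensor M) (X : OneForm M) {y : E7} (hy : y ∈ e.target) :
    comps3 e (fun p => diamondAt φ p (h p) + hookPsiAt φ p (X p)) y =
      diamond (comps3 e φ y) (comps2 e h y) + hookPsi (comps3 e φ y) (comps1 e X y) := by
  have hd := det_toChart he hy
  rw [comps3_eq_at3 he _ hy, at3_variation (isModel_at3 (hφ _)), map_add, comps3_eq_at3 he _ hy,
    comps2_eq_at2 he _ hy, comps1_eq_at1 he _ hy, diamond_pull hd, hookPsi_pull hd]

theorem symm_comps2 {h : TwoTensor M} (hh : ∀ p u v, h p u v = h p v u) (y : E7) (i j : Fin 7) :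
    comps2 e h y i j = comps2 e h y j i := hh _ _ _

theorem variation_comps {ε : ℝ} {φ : ℝ → ThreeForm M} (hφ : IsG2Family ε φ) {h : TwoTensor M}
    {X : OneForm M} (hV : HasVariation φ h X) (he : e ∈ atlas E7 M) :
    Variation (Ioo (-ε) ε ×ˢ e.target) (fun t => comps3 e (φ t)) (comps2 e h) (comps1 e X) := by
  refine ⟨hφ.fam he, fun y _ => symm_comps2 hV.1 y, fun y hy => ?_⟩
  have h1 : HasDerivAt (fun t => comps3 e (φ t) y)
      (comps3 e (fun p => diamondAt (φ 0) p (h p) + hookPsiAt (φ 0) p (X p)) y) 0 :=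
    hasDerivAt_pi.2 fun i => hasDerivAt_pi.2 fun j => hasDerivAt_pi.2 fun k =>
    hV.2 (e.symm y) ![frame e y i, frame e y j, frame e y k]
  rwa [comps3_variation he (hφ.2.2 0 hφ.zero_mem) h X hy.2] at h1

theorem mem_slice {ε : ℝ} (hε : 0 < ε) {y : E7} (hy : y ∈ e.target) :
    y ∈ slice (Ioo (-ε) ε ×ˢ e.target) := ⟨⟨neg_lt_zero.2 hε, hε⟩, hy⟩

/-- The first variation of `𝖥` on a manifold. -/
theorem hasDerivAt_lagrangian {ε : ℝ} {φ : ℝ → ThreeForm M} (hφ : IsG2Family ε φ)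
    {h : TwoTensor M} {X : OneForm M} (hV : HasVariation φ h X) (p : M) :
    HasDerivAt (fun t => lagrangian (φ t) p) (innerAt2 (φ 0) p (h p) (P1hat (φ 0) p)
      + innerAt1 (φ 0) p (X p) (P2 (φ 0) p) + divA (φ 0) h X p) 0 := by
  have h1 := (variation_comps hφ hV (chart_mem_atlas E7 p)).hasDerivAt_lagr
    (mem_slice hφ.1 (mem_chart_target E7 p))
  rw [innerAt2, innerAt1, P1hat, P2, at2_tensor2Of, at1_form1Of, at3_eq, at2_eq, at1_eq]
  exact h1

end Fields

/-! ### The divergence theorem in a chart -/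

/-- The Riemannian density is `|m|`, since charts need not be compatible with the orientation given
by `φ`. As `m` does not vanish, its sign is locally constant and the logarithmic derivative is still
`tr h`. -/
theorem hasDerivAt_abs_volCoeff {c : ℝ → C3} {h : C2} {X : C1} (h0 : IsModel (c 0))
    (hc : HasDerivAt c (diamond (c 0) h + hookPsi (c 0) X) 0) :
    HasDerivAt (fun s => |volCoeff (c s)|) (|volCoeff (c 0)| * tr (c 0) h) 0 := by
  have h := (hasDerivAt_abs (volCoeff_ne_zero h0.det_ne_zero)).comp (0 : ℝ)
    (hasDerivAt_volCoeff h0 hc)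
  refine h.congr_deriv ?_
  rw [← mul_assoc, sign_mul_self]

theorem SmoothFam.abs_volCoeff {W : Set (ℝ × E7)} {F : ℝ → E7 → C3} (hF : SmoothFam W F) :
    ContDiffOn ℝ ∞ (fun q => |G2Hilbert.volCoeff (F q.1 q.2)|) W :=
  hF.volCoeff.abs fun q hq => volCoeff_ne_zero (hF.model q hq).det_ne_zero

namespace SmoothField

variable {U : Set E7} {f : E7 → C3}

theorem abs_volCoeff (hf : SmoothField U f) :
    ContDiffOn ℝ ∞ (fun y => |G2Hilbert.volCoeff (f y)|) U :=
  contDiffOn_snd_iff.1 hf.fam.abs_volCoeff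

/-- Differentiate `g⁻¹ g = 1`, insert the metric property of the connection, and multiply by the
inverse. -/
theorem pd_cometric (hf : SmoothField U f) {y : E7} (hy : y ∈ U) (m i j : Fin 7) :
    G2Hilbert.pd m (fun z => G2Hilbert.cometric (f z) i j) y =
      -∑ a, (G2Hilbert.christoffel f y i m a * G2Hilbert.cometric (f y) a j
        + G2Hilbert.christoffel f y j m a * G2Hilbert.cometric (f y) i a) := by
  have hm := hf.model y hy
  have e : ∀ i b, ∑ a, G2Hilbert.pd m (fun z => G2Hilbert.cometric (f z) i a) y *
      G2Hilbert.metric (f y) a b = -∑ a, G2Hilbert.cometric (f y) i a *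
        G2Hilbert.pd m (fun z => G2Hilbert.metric (f z) a b) y := by
    intro i b
    have h1 : G2Hilbert.pd m (fun z => ∑ a, G2Hilbert.cometric (f z) i a *
        G2Hilbert.metric (f z) a b) y = 0 :=
      (pd_congr hf.isOpen (fun z hz => (hf.model z hz).sum_cometric_metric i b) hy m).trans
        (pd_const m _ y)
    have h2 := pd_sum (u := fun a z => G2Hilbert.cometric (f z) i a * G2Hilbert.metric (f z) a b)
      (fun a => (hf.diffAt (hf.cometric i a) hy).mul (hf.diffAt (hf.metric a b) hy)) m
    rw [h1] at h2
    simp only [fun a => pd_mul (hf.diffAt (hf.cometric i a) hy) (hf.diffAt (hf.metric a b) hy) m,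
      Finset.sum_add_distrib] at h2
    linarith
  set G : Mat := Matrix.of (G2Hilbert.metric (f y))
  set K : Mat := coMat (f y)
  set N : Mat := gam f y m
  set K' : Mat := Matrix.of fun i j => G2Hilbert.pd m (fun z => G2Hilbert.cometric (f z) i j) y
  have hKG : K * G = 1 := hm.coMat_mul_metric
  have hGK : G * K = 1 := mul_eq_one_comm.1 hKG
  have h1 : K' * G = -(K * (N.transpose * G + G * N)) := by
    ext i b
    have h2 := e i b
    simp only [hf.pd_metric hy] at h2
    simp only [Matrix.mul_apply, Matrix.neg_apply, Matrix.add_apply, Matrix.transpose_apply]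
    refine h2.trans (congrArg Neg.neg (Finset.sum_congr rfl fun a _ => congrArg _ ?_))
    rw [inf2, ← Finset.sum_add_distrib]
    exact Finset.sum_congr rfl fun c _ => congrArg _ (mul_comm _ _)
  have h2 : K' = -(N * K + K * N.transpose) := by
    have h3 := congrArg (· * K) h1
    simp only [Matrix.mul_assoc, hGK, Matrix.mul_one, Matrix.mul_add, Matrix.add_mul,
      Matrix.neg_mul] at h3
    rw [← Matrix.mul_assoc K G, hKG, Matrix.one_mul] at h3
    rw [h3, add_comm]
  have h3 := congrFun (congrFun h2 i) j
  simp only [Matrix.neg_apply, Matrix.add_apply, Matrix.mul_apply, Matrix.transpose_apply,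
    ← Finset.sum_add_distrib] at h3
  refine h3.trans (congrArg Neg.neg (Finset.sum_congr rfl fun a _ => congrArg _ (mul_comm _ _)))

/-- The space derivative of `φ` is a 3-form and decomposes as `h ⋄ φ + X ⌟ ψ`, so the variation
formulas apply along a coordinate line: `|m|` changes by `|m| tr h`, while `2 h` is the derivative
of the metric, whose trace is twice that of the connection form. -/
theorem pd_abs_volCoeff (hf : SmoothField U f) (halt : ∀ z, IsAlt3 (f z)) {y : E7} (hy : y ∈ U)
    (m : Fin 7) : G2Hilbert.pd m (fun z => |G2Hilbert.volCoeff (f z)|) y =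
      |G2Hilbert.volCoeff (f y)| * ∑ a, G2Hilbert.christoffel f y a m a := by
  have hm := hf.model y hy
  set α : C3 := fun i j k => G2Hilbert.pd m (fun z => f z i j k) y
  have hα : IsAlt3 α := by
    refine ⟨fun i j k => ?_, fun i j k => ?_⟩
    · have h := pd_const_mul (-1) (hf.diffAt (hf.smooth i j k) hy) m
      simp only [neg_one_mul, ← (halt _).1 i j k] at h
      exact h
    · have h := pd_const_mul (-1) (hf.diffAt (hf.smooth i j k) hy) m
      simp only [neg_one_mul, ← (halt _).2 i j k] at h
      exact h
  obtain ⟨h, X, hh, e⟩ := exists_variation hm hα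
  have hl : ∀ {u : E7 → ℝ}, ContDiffOn ℝ ∞ u U → HasDerivAt (fun s : ℝ => u (y + s •
      EuclideanSpace.single m (1 : ℝ))) (G2Hilbert.pd m u y) 0 := fun hu =>
    hasDerivAt_line (hf.diffAt hu hy) m
  set c : ℝ → C3 := fun s => f (y + s • EuclideanSpace.single m (1 : ℝ)) with hc
  have hc0 : c 0 = f y := by simp [hc]
  have hd : HasDerivAt c (diamond (c 0) h + hookPsi (c 0) X) 0 := by
    rw [hc0, ← e]
    exact hasDerivAt_pi.2 fun i => hasDerivAt_pi.2 fun j => hasDerivAt_pi.2 fun k =>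
      hl (hf.smooth i j k)
  have h0 : IsModel (c 0) := hc0 ▸ hm
  have h1 := (hl hf.abs_volCoeff).unique (hasDerivAt_abs_volCoeff h0 hd)
  have h2 : ∀ i j, 2 * h i j = inf2 (gam f y m) (G2Hilbert.metric (f y)) i j := fun i j => by
    rw [← hf.pd_metric hy]
    exact ((hl (hf.metric i j)).unique (hasDerivAt_metric h0 hh hd i j)).symm
  have h3 : 2 * G2Hilbert.tr (f y) h = 2 * ∑ a, G2Hilbert.christoffel f y a m a := by
    have e1 : ∀ i a, ∑ j, G2Hilbert.cometric (f y) i j * G2Hilbert.metric (f y) a j = del i a :=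
      fun i a => by
        rw [← hm.sum_cometric_metric]
        exact Finset.sum_congr rfl fun j _ => by rw [metric_symm hm]
    have e2 : ∑ i, ∑ j, G2Hilbert.cometric (f y) i j * ∑ a, G2Hilbert.christoffel f y a m i *
        G2Hilbert.metric (f y) a j = ∑ a, G2Hilbert.christoffel f y a m a := by
      refine Finset.sum_congr rfl fun i _ => ?_
      simp only [Finset.mul_sum]
      rw [Finset.sum_comm]
      have e3 : ∀ a, ∑ j, G2Hilbert.cometric (f y) i j * (G2Hilbert.christoffel f y a m i *
          G2Hilbert.metric (f y) a j) = G2Hilbert.christoffel f y a m i * del i a := fun a => by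
        rw [← e1, Finset.mul_sum]
        exact Finset.sum_congr rfl fun j _ => by ring
      simp [e3, del]
    have e3 : 2 * G2Hilbert.tr (f y) h = ∑ i, ∑ j, G2Hilbert.cometric (f y) i j * (2 * h i j) := by
      simp only [G2Hilbert.tr, Finset.mul_sum]
      exact Finset.sum_congr rfl fun i _ => Finset.sum_congr rfl fun j _ => by ring
    rw [e3]
    simp only [h2, inf2, gam, Matrix.of_apply, Finset.sum_add_distrib, mul_add]
    rw [e2, two_mul]
    congr 1
    rw [Finset.sum_comm, ← e2]
    exact Finset.sum_congr rfl fun i _ => Finset.sum_congr rfl fun j _ => by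
      rw [hm.cometric_symm]
      exact congrArg _ (Finset.sum_congr rfl fun a _ => by rw [metric_symm hm])
  rw [zero_smul, add_zero] at h1
  rw [h1, mul_left_cancel₀ two_ne_zero h3]

/-- `div X dμ = d (X ⌟ dμ)`. -/
theorem div1_mul_abs_volCoeff (hf : SmoothField U f) (halt : ∀ z, IsAlt3 (f z)) {X : E7 → C1}
    (hX : ∀ i, ContDiffOn ℝ ∞ (fun y => X y i) U) {y : E7} (hy : y ∈ U) :
    div1 f X y * |G2Hilbert.volCoeff (f y)| = ∑ k, G2Hilbert.pd k
      (fun z => (∑ l, G2Hilbert.cometric (f z) k l * X z l) * |G2Hilbert.volCoeff (f z)|) y := by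
  have hd := fun k l => hf.diffAt (hf.cometric k l) hy
  have hdX := fun l => hf.diffAt (hX l) hy
  have hdv := hf.diffAt hf.abs_volCoeff hy
  have e1 : ∀ k, G2Hilbert.pd k
      (fun z => (∑ l, G2Hilbert.cometric (f z) k l * X z l) * |G2Hilbert.volCoeff (f z)|) y =
      (∑ l, (G2Hilbert.pd k (fun z => G2Hilbert.cometric (f z) k l) y * X y l +
        G2Hilbert.cometric (f y) k l * G2Hilbert.pd k (fun z => X z l) y)) *
          |G2Hilbert.volCoeff (f y)| + (∑ l, G2Hilbert.cometric (f y) k l * X y l) *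
          (|G2Hilbert.volCoeff (f y)| * ∑ a, G2Hilbert.christoffel f y a k a) := by
    intro k
    rw [pd_mul (u := fun z => ∑ l, G2Hilbert.cometric (f z) k l * X z l)
      (DifferentiableAt.fun_sum fun l _ => (hd k l).mul (hdX l)) hdv, hf.pd_abs_volCoeff halt hy,
      pd_sum (u := fun l z => G2Hilbert.cometric (f z) k l * X z l)
        fun l => (hd k l).mul (hdX l)]
    simp only [fun l => pd_mul (hd k l) (hdX l) k]
  simp only [e1, hf.pd_cometric hy, div1, G2Hilbert.tr, G2Hilbert.cov1]
  set g := G2Hilbert.cometric (f y)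
  set Γ := G2Hilbert.christoffel f y
  have hΓ : ∀ a b d, Γ a d b = Γ a b d := hf.christoffel_symm hy
  set v := |G2Hilbert.volCoeff (f y)|
  have e2 : ∑ k, ∑ l, (∑ a, Γ k k a * g a l) * X y l =
      ∑ k, (∑ l, g k l * X y l) * ∑ a, Γ a k a := by
    simp only [Finset.sum_mul, Finset.mul_sum]
    have : ∀ k, ∑ l, ∑ a, Γ k k a * g a l * X y l = ∑ a, ∑ l, Γ k k a * g a l * X y l :=
      fun k => Finset.sum_comm
    simp only [this]
    rw [Finset.sum_comm]
    exact Finset.sum_congr rfl fun a _ => Finset.sum_congr rfl fun k _ =>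
      Finset.sum_congr rfl fun l _ => by rw [hΓ]; ring
  have e3 : ∑ k, ∑ l, (∑ a, Γ l k a * g k a) * X y l = ∑ i, ∑ j, g i j * ∑ a, Γ a i j * X y a := by
    simp only [Finset.sum_mul, Finset.mul_sum]
    refine Finset.sum_congr rfl fun k _ => ?_
    rw [Finset.sum_comm]
    exact Finset.sum_congr rfl fun l _ => Finset.sum_congr rfl fun a _ => by ring
  simp only [Finset.sum_add_distrib, mul_sub, Finset.sum_sub_distrib, add_mul, neg_mul,
    Finset.sum_neg_distrib, ← Finset.sum_mul, neg_add]
  rw [e3, e2]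
  have e4 : ∑ k, (∑ l, g k l * X y l) * (v * ∑ a, Γ a k a) =
      (∑ k, (∑ l, g k l * X y l) * ∑ a, Γ a k a) * v := by
    rw [Finset.sum_mul]
    exact Finset.sum_congr rfl fun k _ => by ring
  rw [e4]
  ring

end SmoothField

/-- Integration by parts against the constant function 1. -/
theorem integral_pd_eq_zero {u : E7 → ℝ} (hu : ContDiff ℝ ∞ u) (hc : HasCompactSupport u)
    (k : Fin 7) : ∫ y, pd k u y = 0 := by
  have hd : Continuous (pd k u) := (hu.continuous_fderiv (by simp)).clm_apply continuous_const
  have hi : Integrable (pd k u) :=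
    hd.integrable_of_hasCompactSupport (hc.fderiv_apply (𝕜 := ℝ) (EuclideanSpace.single k 1))
  have h := integral_mul_fderiv_eq_neg_fderiv_mul_of_integrable (μ := (volume : Measure E7))
    (f := fun _ : E7 => (1 : ℝ)) (g := u) (v := EuclideanSpace.single k 1) (by simp)
    (by simpa using! hi) (by simpa using hu.continuous.integrable_of_hasCompactSupport hc)
    (fun _ _ => differentiableAt_const _) (fun _ _ => hu.differentiable (by simp) _)
  simpa using! h

/-- The divergence theorem for a compactly supported field in a chart. -/
theorem SmoothField.integral_div1 {U : Set E7} {f : E7 → C3} (hf : SmoothField U f)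
    (halt : ∀ z, IsAlt3 (f z)) {X : E7 → C1} (hX : ∀ i, ContDiffOn ℝ ∞ (fun y => X y i) U)
    {K : Set E7} (hK : IsCompact K) (hKU : K ⊆ U) (h0 : ∀ y ∈ U, y ∉ K → X y = 0) :
    ∫ y in U, div1 f X y * |G2Hilbert.volCoeff (f y)| = 0 := by
  set v : Fin 7 → E7 → ℝ := fun k z =>
    (∑ l, G2Hilbert.cometric (f z) k l * X z l) * |G2Hilbert.volCoeff (f z)|
  -- The components vanish off the compact set `K` contained in the open set `U`, so their extension
  -- by zero is smooth on the whole space and compactly supported.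
  set G : Fin 7 → E7 → ℝ := fun k => U.indicator (v k)
  have hv : ∀ k, ContDiffOn ℝ ∞ (v k) U := fun k =>
    (ContDiffOn.sum fun l _ => (hf.cometric k l).mul (hX l)).mul hf.abs_volCoeff
  have hG0 : ∀ k, ∀ z ∈ Kᶜ, G k z = 0 := by
    intro k z hz
    by_cases hzU : z ∈ U
    · simp [G, hzU, v, h0 z hzU hz]
    · simp [G, hzU]
  have hG : ∀ k, ContDiff ℝ ∞ (G k) := by
    refine fun k => contDiff_iff_contDiffAt.2 fun z => ?_
    by_cases hz : z ∈ U
    · refine ((hv k).contDiffAt (hf.isOpen.mem_nhds hz)).congr_of_eventuallyEq ?_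
      exact Filter.eventuallyEq_of_mem (hf.isOpen.mem_nhds hz) fun w hw => indicator_of_mem hw _
    · exact contDiffAt_const.congr_of_eventuallyEq (Filter.eventuallyEq_of_mem
        (hK.isClosed.isOpen_compl.mem_nhds fun h => hz (hKU h)) (hG0 k))
  have hs : ∀ k, HasCompactSupport (G k) := fun k => HasCompactSupport.intro hK (hG0 k)
  have e1 : ∫ y in U, div1 f X y * |G2Hilbert.volCoeff (f y)| =
      ∫ y in U, ∑ k, G2Hilbert.pd k (G k) y := by
    refine setIntegral_congr_fun hf.isOpen.measurableSet fun y hy => ?_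
    rw [hf.div1_mul_abs_volCoeff halt hX hy]
    exact Finset.sum_congr rfl fun k _ =>
      pd_congr hf.isOpen (fun z hz => (indicator_of_mem hz (v k)).symm) hy k
  rw [e1, setIntegral_eq_integral_of_forall_compl_eq_zero fun y hy => Finset.sum_eq_zero fun k _ =>
    (pd_congr hK.isClosed.isOpen_compl (hG0 k) (fun h => hy (hKU h)) k).trans (pd_const k 0 y),
    integral_finsetSum]
  · exact Finset.sum_eq_zero fun k _ => integral_pd_eq_zero (hG k) (hs k) k
  · intro k _
    have hd : Continuous (G2Hilbert.pd k (G k)) :=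
      ((hG k).continuous_fderiv (by simp)).clm_apply continuous_const
    exact hd.integrable_of_hasCompactSupport
      ((hs k).fderiv_apply (𝕜 := ℝ) (EuclideanSpace.single k 1))

/-- Differentiation under the integral sign. -/
theorem hasDerivAt_setIntegral {ε : ℝ} (hε : 0 < ε) {U K : Set E7} (hU : IsOpen U)
    (hK : IsCompact K) (hKU : K ⊆ U) {r : E7 → ℝ} (hr : ContinuousOn r K) {u : ℝ → E7 → ℝ}
    (hu : ContDiffOn ℝ ∞ (fun q : ℝ × E7 => u q.1 q.2) (Ioo (-ε) ε ×ˢ U)) :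
    HasDerivAt (fun t => ∫ y in K, r y * u t y) (∫ y in K, r y * dt u y) 0 := by
  have hW : IsOpen (Ioo (-ε) ε ×ˢ U) := isOpen_Ioo.prod hU
  set D : ℝ → E7 → ℝ := fun t y =>
    r y * fderiv ℝ (fun q : ℝ × E7 => u q.1 q.2) (t, y) (1, 0) with hD
  have hsub : Icc (-(ε / 2)) (ε / 2) ⊆ Ioo (-ε) ε := fun t ht =>
    ⟨by linarith [ht.1], by linarith [ht.2]⟩
  have h0 : (0 : ℝ) ∈ Ioo (-ε) ε := ⟨by linarith, hε⟩
  have hDc : ContinuousOn (fun q : ℝ × E7 => D q.1 q.2) (Icc (-(ε / 2)) (ε / 2) ×ˢ K) := by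
    refine (hr.comp continuousOn_snd fun q hq => hq.2).mul ?_
    have h1 := (hu.fderiv_of_isOpen (m := ∞) hW (by simp)).continuousOn
    exact (h1.clm_apply continuousOn_const).mono (prod_mono hsub hKU)
  -- Halving the parameter interval makes it compact, and a bound on the compact product is a
  -- constant dominating function.
  obtain ⟨C, hC⟩ := (isCompact_Icc.prod hK).exists_bound_of_continuousOn hDc
  have hcont : ∀ t ∈ Ioo (-ε) ε, ContinuousOn (fun y => r y * u t y) K := fun t ht =>
    hr.mul (hu.continuousOn.comp (f := fun y : E7 => (t, y)) (by fun_prop) fun y hy => ⟨ht, hKU hy⟩)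
  have hm := hK.measurableSet
  have h := hasDerivAt_integral_of_dominated_loc_of_deriv_le (μ := volume.restrict K)
    (F := fun t y => r y * u t y) (F' := D) (x₀ := (0 : ℝ)) (bound := fun _ => C)
    (s := Ioo (-(ε / 2)) (ε / 2)) (Ioo_mem_nhds (by linarith) (by linarith))
    (Filter.eventually_of_mem (Ioo_mem_nhds h0.1 h0.2)
      fun t ht => (hcont t ht).aestronglyMeasurable hm)
    ((hcont 0 h0).integrableOn_compact hK)
    (ContinuousOn.aestronglyMeasurable (hDc.comp (f := fun y : E7 => ((0 : ℝ), y)) (by fun_prop)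
      fun y hy => ⟨⟨by linarith, by linarith⟩, hy⟩) hm)
    ((ae_restrict_iff' hm).2 (.of_forall fun y hy t ht => hC (t, y) ⟨Ioo_subset_Icc_self ht, hy⟩))
    (integrableOn_const hK.measure_lt_top.ne)
    ((ae_restrict_iff' hm).2 (.of_forall fun y hy t ht =>
      (hasDerivAt_slice hW hu ⟨hsub (Ioo_subset_Icc_self ht), hKU hy⟩).const_mul _))
  refine h.2.congr_deriv (setIntegral_congr_fun hm fun y hy => ?_)
  simp only [hD, dt, (hasDerivAt_slice hW hu (t := 0) ⟨h0, hKU hy⟩).deriv]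

/-! ### The Riemannian volume measure -/

set_option linter.unusedSectionVars false

section Volume

variable {M : Type*} [TopologicalSpace M] [ChartedSpace E7 M] [IsManifold 𝓘(ℝ, E7) ∞ M]
  [MeasurableSpace M] [BorelSpace M] {e e' : OpenPartialHomeomorph M E7} {φ : ThreeForm M}

/-- The volume measure over the domain of a chart. -/
def chartMeasure (φ : ThreeForm M) (e : OpenPartialHomeomorph M E7) : Measure M :=
  Measure.map e.symm
    ((volume.restrict e.target).withDensity fun y => ENNReal.ofReal |volCoeff (comps3 e φ y)|)

theorem volMeasure_eq (φ : ThreeForm M) : volMeasure φ = ⨆ e ∈ atlas E7 M, chartMeasure φ e := rfl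

theorem measurableSet_chart_preimage (e : OpenPartialHomeomorph M E7) {s : Set M}
    (hs : MeasurableSet s) : MeasurableSet (e.target ∩ e.symm ⁻¹' s) := by
  have hc : Continuous (e.target.domRestrict e.symm) := e.continuousOn_symm.domRestrict
  have h := MeasurableSet.subtype_image e.open_target.measurableSet (hc.measurable hs)
  convert h using 1
  ext y
  simp [and_comm]

theorem aemeasurable_symm (e : OpenPartialHomeomorph M E7) : AEMeasurable e.symm
    ((volume.restrict e.target).withDensity fun y => ENNReal.ofReal |volCoeff (comps3 e φ y)|) :=
  (e.continuousOn_symm.aemeasurable e.open_target.measurableSet).mono_ac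
    (withDensity_absolutelyContinuous _ _)

theorem chartMeasure_apply (e : OpenPartialHomeomorph M E7) {s : Set M} (hs : MeasurableSet s) :
    chartMeasure φ e s =
      ∫⁻ y in e.target ∩ e.symm ⁻¹' s, ENNReal.ofReal |volCoeff (comps3 e φ y)| := by
  rw [chartMeasure, Measure.map_apply_of_aemeasurable (aemeasurable_symm e) hs,
    withDensity_apply', Measure.restrict_restrict' e.open_target.measurableSet, inter_comm]

theorem chartMeasure_source_compl (e : OpenPartialHomeomorph M E7) :
    chartMeasure φ e e.sourceᶜ = 0 := by
  rw [chartMeasure_apply e e.open_source.measurableSet.compl]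
  have : e.target ∩ e.symm ⁻¹' e.sourceᶜ = ∅ := by
    ext y
    simp only [mem_inter_iff, mem_preimage, mem_compl_iff, mem_empty_iff_false, iff_false, not_and,
      not_not]
    exact fun hy => e.map_target hy
  rw [this, Measure.restrict_empty, lintegral_zero_measure]

theorem fderiv_det_eq_jac {κ : E7 → E7} {y : E7} (hκ : DifferentiableAt ℝ κ y) :
    (fderiv ℝ κ y).det = (jac κ y).det := by
  rw [ContinuousLinearMap.det, ← LinearMap.det_toMatrix (EuclideanSpace.basisFun (Fin 7) ℝ).toBasis]
  congr 1
  ext i j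
  rw [LinearMap.toMatrix_apply, jac_eq_fderiv hκ]
  simp

/-- Change of variables: `volCoeff_pull` provides exactly the absolute value of the Jacobian
determinant. -/
theorem chartMeasure_inter (he : e ∈ atlas E7 M) (he' : e' ∈ atlas E7 M) {s : Set M}
    (hs : MeasurableSet s) :
    chartMeasure φ e' (s ∩ e.source) = chartMeasure φ e (s ∩ e'.source) := by
  rw [chartMeasure_apply e' (hs.inter e.open_source.measurableSet),
    chartMeasure_apply e (hs.inter e'.open_source.measurableSet)]
  set A := e.target ∩ e.symm ⁻¹' (s ∩ e'.source)
  have hA : A ⊆ overlap e e' := fun y hy => mem_overlap.2 ⟨hy.1, hy.2.2⟩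
  have hi : e'.target ∩ e'.symm ⁻¹' (s ∩ e.source) = transition e e' '' A := by
    ext y
    constructor
    · intro hy
      have hy' : y ∈ overlap e' e := mem_overlap.2 ⟨hy.1, hy.2.2⟩
      obtain ⟨h1, h2⟩ := transition_mem_overlap hy'
      refine ⟨transition e' e y, ⟨(mem_overlap.1 h1).1, ?_, (mem_overlap.1 h1).2⟩, h2⟩
      rw [transition, e.left_inv hy.2.2]
      exact hy.2.1
    · rintro ⟨z, hz, rfl⟩
      obtain ⟨h1, h2⟩ := transition_mem_overlap (hA hz)
      refine ⟨(mem_overlap.1 h1).1, ?_, (mem_overlap.1 h1).2⟩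
      rw [transition, e'.left_inv hz.2.2]
      exact hz.2.1
  rw [hi, lintegral_image_eq_lintegral_abs_det_fderiv_mul volume
    (measurableSet_chart_preimage e (hs.inter e'.open_source.measurableSet))
    (fun y hy => (differentiableAt_transition he he' (hA hy)).hasFDerivAt.hasFDerivWithinAt)
    fun y hy z hz h => by
      rw [← (transition_mem_overlap (hA hy)).2, h, (transition_mem_overlap (hA hz)).2]]
  refine setLIntegral_congr_fun (measurableSet_chart_preimage e
    (hs.inter e'.open_source.measurableSet)) fun y hy => ?_
  rw [fderiv_det_eq_jac (differentiableAt_transition he he' (hA hy)), comps3_pf he he' φ (hA hy),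
    pf3, ← ENNReal.ofReal_mul (abs_nonneg _), ← abs_mul, ← volCoeff_pull]

/-- Over the domain of `e` all chart measures are dominated by that of `e`, because they agree on
overlaps; so the supremum restricts to it. This makes integration against the supremum computable in
charts. -/
theorem volMeasure_restrict (he : e ∈ atlas E7 M) :
    (volMeasure φ).restrict e.source = chartMeasure φ e := by
  have hm := e.open_source.measurableSet
  have hs : (chartMeasure φ e).restrict e.source = chartMeasure φ e :=
    Measure.restrict_eq_self_of_ae_mem (by
      rw [ae_iff]
      exact chartMeasure_source_compl e)
  -- To bound the supremum on one chart domain, the largest measure is allowed off that domain,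
  -- which gives a common upper bound for all chart measures.
  have h1 : volMeasure φ ≤ chartMeasure φ e + (⊤ : Measure M).restrict e.sourceᶜ := by
    rw [volMeasure_eq]
    refine iSup₂_le fun e' he' => ?_
    rw [← Measure.restrict_add_restrict_compl hm (μ := chartMeasure φ e')]
    refine add_le_add ?_ (Measure.restrict_mono_measure le_top _)
    refine Measure.le_iff.2 fun s hs => ?_
    rw [Measure.restrict_apply hs, chartMeasure_inter he he' hs]
    exact measure_mono inter_subset_left
  refine le_antisymm ?_ ?_
  · refine (Measure.restrict_mono_measure h1 _).trans (le_of_eq ?_)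
    rw [Measure.restrict_add, hs, Measure.restrict_restrict hm]
    simp
  · conv_lhs => rw [← hs]
    refine Measure.restrict_mono_measure ?_ _
    rw [volMeasure_eq]
    exact le_iSup₂ (f := fun e (_ : e ∈ atlas E7 M) => chartMeasure φ e) e he

theorem continuousOn_of_chart (e : OpenPartialHomeomorph M E7) {g : M → ℝ}
    (hg : ContinuousOn (fun y => g (e.symm y)) e.target) : ContinuousOn g e.source := by
  refine (hg.comp e.continuousOn fun p hp => e.map_source hp).congr fun p hp => ?_
  simp [e.left_inv hp]

/-- The integral of a function that is supported in a compact subset of the domain of a chart. -/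
theorem integral_volMeasure (hφ : IsG2Structure φ) (he : e ∈ atlas E7 M) {K : Set M}
    (hK : IsCompact K) (hKe : K ⊆ e.source) {g : M → ℝ}
    (hg : ContinuousOn (fun y => g (e.symm y)) e.target) (h0 : ∀ p ∉ K, g p = 0) :
    Integrable g (volMeasure φ) ∧ ∫ p, g p ∂volMeasure φ =
      ∫ y in e.target, g (e.symm y) * |volCoeff (comps3 e φ y)| := by
  have hv := (hφ.field he).abs_volCoeff.continuousOn
  have hm : AEMeasurable (fun y => ENNReal.ofReal |volCoeff (comps3 e φ y)|)
      (volume.restrict e.target) :=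
    (hv.aemeasurable e.open_target.measurableSet).ennreal_ofReal
  have ht : ∀ᵐ y ∂volume.restrict e.target, ENNReal.ofReal |volCoeff (comps3 e φ y)| < ⊤ :=
    .of_forall fun _ => ENNReal.ofReal_lt_top
  have hgm : AEStronglyMeasurable g (Measure.map e.symm ((volume.restrict e.target).withDensity
      fun y => ENNReal.ofReal |volCoeff (comps3 e φ y)|)) := by
    change AEStronglyMeasurable g (chartMeasure φ e)
    rw [← volMeasure_restrict he]
    exact (continuousOn_of_chart e hg).aestronglyMeasurable e.open_source.measurableSet
  have hsm : ∀ y, (ENNReal.ofReal |volCoeff (comps3 e φ y)|).toReal • g (e.symm y) =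
      g (e.symm y) * |volCoeff (comps3 e φ y)| := fun y => by
    rw [ENNReal.toReal_ofReal (abs_nonneg _), smul_eq_mul, mul_comm]
  constructor
  · rw [← integrableOn_iff_integrable_of_support_subset (s := e.source) fun p hp =>
      by_contra fun h => hp (h0 p fun h' => h (hKe h')), IntegrableOn, volMeasure_restrict he,
      chartMeasure, integrable_map_measure hgm (aemeasurable_symm e),
      integrable_withDensity_iff_integrable_smul₀' hm ht]
    simp only [Function.comp_apply, hsm]
    have h1 : IntegrableOn (fun y => g (e.symm y) * |volCoeff (comps3 e φ y)|) (e '' K) :=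
      ((hg.mul hv).mono (image_subset_iff.2 fun p hp => e.map_source (hKe hp))).integrableOn_compact
        (hK.image_of_continuousOn (e.continuousOn.mono hKe))
    refine h1.of_forall_sdiff_eq_zero e.open_target.measurableSet fun y hy => ?_
    rw [h0, zero_mul]
    exact fun h => hy.2 ⟨_, h, e.right_inv hy.1⟩
  · rw [← setIntegral_eq_integral_of_forall_compl_eq_zero (s := e.source) fun p hp =>
      h0 p fun h => hp (hKe h), volMeasure_restrict he, chartMeasure,
      integral_map (aemeasurable_symm e) hgm, integral_withDensity_eq_integral_toReal_smul₀ hm ht]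
    simp only [hsm]

end Volume

/-! ### Locality -/

section Locality

variable {U : Set E7} {f g : E7 → C3}

theorem cov1_congr' {X Y : E7 → C1} (hU : IsOpen U) (h : ∀ z ∈ U, f z = g z)
    (hX : ∀ z ∈ U, X z = Y z) {y : E7} (hy : y ∈ U) : cov1 f X y = cov1 g Y y := by
  rw [← cov1_congr hU hX hy]
  ext i j
  rw [cov1, cov1, christoffel_congr hU h hy]

theorem div1_congr {X Y : E7 → C1} (hU : IsOpen U) (h : ∀ z ∈ U, f z = g z)
    (hX : ∀ z ∈ U, X z = Y z) {y : E7} (hy : y ∈ U) : div1 f X y = div1 g Y y := by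
  rw [div1, div1, cov1_congr' hU h hX hy, h y hy]

theorem div2_congr {v w : E7 → C2} (hU : IsOpen U) (h : ∀ z ∈ U, f z = g z)
    (hv : ∀ z ∈ U, v z = w z) {y : E7} (hy : y ∈ U) : div2 f v y = div2 g w y := by
  have e : ∀ i j k, pd i (fun z => v z j k) y = pd i (fun z => w z j k) y := fun i j k =>
    pd_congr hU (fun z hz => by rw [hv z hz]) hy i
  ext k
  simp only [div2, cov2, e, h y hy, hv y hy, christoffel_congr hU h hy]

theorem torsion_congr (hU : IsOpen U) (h : ∀ z ∈ U, f z = g z) {y : E7} (hy : y ∈ U) :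
    torsion f y = torsion g y := by
  have e : cov3 f f y = cov3 g g y := by
    ext i j k l
    simp only [cov3, h y hy, christoffel_congr hU h hy,
      pd_congr hU (u := fun z => f z j k l) (v := fun z => g z j k l)
        (fun z hz => by rw [h z hz]) hy i]
  ext p q
  simp only [torsion, e, h y hy]

theorem ricci_congr (hU : IsOpen U) (h : ∀ z ∈ U, f z = g z) {y : E7} (hy : y ∈ U) :
    ricci f y = ricci g y := by
  have e : ∀ i l j k, pd i (fun z => christoffel f z l j k) y =
      pd i (fun z => christoffel g z l j k) y := fun i l j k =>
    pd_congr hU (fun z hz => by rw [christoffel_congr hU h hz]) hy i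
  ext j k
  simp only [ricci, riemann, e, christoffel_congr hU h hy]

theorem trT_congr (hU : IsOpen U) (h : ∀ z ∈ U, f z = g z) {y : E7} (hy : y ∈ U) :
    trT f y = trT g y := by
  rw [trT, trT, torsion_congr hU h hy, h y hy]

theorem vT_congr (hU : IsOpen U) (h : ∀ z ∈ U, f z = g z) {y : E7} (hy : y ∈ U) :
    vT f y = vT g y := by
  rw [vT, vT, torsion_congr hU h hy, h y hy]

theorem lagr_congr (hU : IsOpen U) (h : ∀ z ∈ U, f z = g z) {y : E7} (hy : y ∈ U) :
    lagr f y = lagr g y := by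
  simp only [lagr, scal, ricci_congr hU h hy, torsion_congr hU h hy, trT_congr hU h hy, h y hy]

theorem locP1hat_congr (hU : IsOpen U) (h : ∀ z ∈ U, f z = g z) {y : E7} (hy : y ∈ U) :
    locP1hat f y = locP1hat g y := by
  have e1 : ∀ i j k, pd k (fun z => metric (f z) i j) y = pd k (fun z => metric (g z) i j) y :=
    fun i j k => pd_congr hU (fun z hz => by rw [h z hz]) hy k
  have e2 : ∀ i k, pd i (fun z => raise1 (f z) (vT f z) k) y =
      pd i (fun z => raise1 (g z) (vT g z) k) y := fun i k =>
    pd_congr hU (fun z hz => by rw [h z hz, vT_congr hU h hz]) hy i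
  ext i j
  simp only [locP1hat, lieMetric, e1, e2, ricci_congr hU h hy, torsion_congr hU h hy,
    trT_congr hU h hy, vT_congr hU h hy, h y hy]

theorem locP2_congr (hU : IsOpen U) (h : ∀ z ∈ U, f z = g z) {y : E7} (hy : y ∈ U) :
    locP2 f y = locP2 g y := by
  ext k
  simp only [locP2, div2_congr hU h (fun z hz => torsion_congr hU h hz) hy, trT_congr hU h hy,
    vT_congr hU h hy, pd_congr hU (fun z hz => trT_congr hU h hz) hy]

theorem locA_congr {v w : E7 → C2} {X Y : E7 → C1} (hU : IsOpen U) (h : ∀ z ∈ U, f z = g z)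
    (hv : ∀ z ∈ U, v z = w z) (hX : ∀ z ∈ U, X z = Y z) {y : E7} (hy : y ∈ U) :
    locA f v X y = locA g w Y y := by
  have e : ∀ k, pd k (fun z => tr (f z) (v z)) y = pd k (fun z => tr (g z) (w z)) y := fun k =>
    pd_congr hU (fun z hz => by rw [h z hz, hv z hz]) hy k
  ext k
  simp only [locA, e, div2_congr hU h hv hy, torsion_congr hU h hy, trT_congr hU h hy, h y hy,
    hv y hy, hX y hy]

end Locality

/-! ### Independence of the chart -/

section Scalars

variable {M : Type*} [TopologicalSpace M] [ChartedSpace E7 M] [IsManifold 𝓘(ℝ, E7) ∞ M]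
  {e : OpenPartialHomeomorph M E7} {φ : ThreeForm M}

/-- The definition uses the preferred chart of each point, which may jump from point to point.
Covariance and locality show that any fixed chart of the atlas gives the same value, and this is how
continuity is obtained. -/
theorem lagrangian_symm (hφ : IsG2Structure φ) (he : e ∈ atlas E7 M) {y : E7} (hy : y ∈ e.target) :
    lagrangian φ (e.symm y) = lagr (comps3 e φ) y := by
  have he' := chart_mem_atlas E7 (e.symm y)
  rw [lagr_congr isOpen_overlap (fun z hz => comps3_pf he he' φ hz) (mem_overlap_chart hy),
    (coordChange he he').lagr_pf (hφ.field he') (mem_overlap_chart hy)]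
  rfl

theorem comps2_P1hat (hφ : IsG2Structure φ) (he : e ∈ atlas E7 M) {y : E7} (hy : y ∈ e.target) :
    comps2 e (P1hat φ) y = locP1hat (comps3 e φ) y := by
  have he' := chart_mem_atlas E7 (e.symm y)
  rw [locP1hat_congr isOpen_overlap (fun z hz => comps3_pf he he' φ hz) (mem_overlap_chart hy),
    (coordChange he he').locP1hat_pf (hφ.field he') (mem_overlap_chart hy), comps2_eq_at2 he _ hy,
    P1hat, at2_tensor2Of]
  rfl

theorem comps2_P1 (hφ : IsG2Structure φ) (he : e ∈ atlas E7 M) {y : E7} (hy : y ∈ e.target) :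
    comps2 e (P1 φ) y = locP1hat (comps3 e φ) y + lagr (comps3 e φ) y • metric (comps3 e φ y) := by
  have h1 : comps2 e (P1 φ) y = comps2 e (P1hat φ) y
    + lagrangian φ (e.symm y) • comps2 e (metricAt φ) y := rfl
  rw [h1, comps2_P1hat hφ he hy, lagrangian_symm hφ he hy, comps2_eq_at2 he _ hy, metricAt,
    at2_tensor2Of, comps3_eq_at3 he φ hy, metric_pull (det_toChart he hy)]

theorem comps1_P2 (hφ : IsG2Structure φ) (he : e ∈ atlas E7 M) {y : E7} (hy : y ∈ e.target) :
    comps1 e (P2 φ) y = locP2 (comps3 e φ) y := by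
  have he' := chart_mem_atlas E7 (e.symm y)
  rw [locP2_congr isOpen_overlap (fun z hz => comps3_pf he he' φ hz) (mem_overlap_chart hy),
    (coordChange he he').locP2_pf (hφ.field he') (mem_overlap_chart hy), comps1_eq_at1 he _ hy,
    P2, at1_form1Of]
  rfl

/-- The 1-form `A`. -/
def formA (φ : ThreeForm M) (h : TwoTensor M) (X : OneForm M) : OneForm M := fun p =>
  form1Of p (locA (comps3 (chartAt E7 p) φ) (comps2 (chartAt E7 p) h) (comps1 (chartAt E7 p) X)
    (chartAt E7 p p))

/-- `div B` for a 1-form `B`. -/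
def divForm (φ : ThreeForm M) (B : OneForm M) (p : M) : ℝ :=
  div1 (comps3 (chartAt E7 p) φ) (comps1 (chartAt E7 p) B) (chartAt E7 p p)

theorem comps1_formA (hφ : IsG2Structure φ) (he : e ∈ atlas E7 M) {h : TwoTensor M} {X : OneForm M}
    (hh : ∀ e ∈ atlas E7 M, ∀ i j, ContDiffOn ℝ ∞ (fun y => comps2 e h y i j) e.target)
    {y : E7} (hy : y ∈ e.target) :
    comps1 e (formA φ h X) y = locA (comps3 e φ) (comps2 e h) (comps1 e X) y := by
  have he' := chart_mem_atlas E7 (e.symm y)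
  rw [locA_congr isOpen_overlap (fun z hz => comps3_pf he he' φ hz)
    (fun z hz => comps2_pf he he' h hz) (fun z hz => comps1_pf he he' X hz) (mem_overlap_chart hy),
    (coordChange he he').locA_pf (hφ.field he') (hh _ he') (mem_overlap_chart hy),
    comps1_eq_at1 he _ hy, formA, at1_form1Of]
  rfl

theorem divForm_symm (hφ : IsG2Structure φ) (he : e ∈ atlas E7 M) {B : OneForm M}
    (hB : ∀ e ∈ atlas E7 M, ∀ i, ContDiffOn ℝ ∞ (fun y => comps1 e B y i) e.target)
    {y : E7} (hy : y ∈ e.target) :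
    divForm φ B (e.symm y) = div1 (comps3 e φ) (comps1 e B) y := by
  have he' := chart_mem_atlas E7 (e.symm y)
  rw [div1_congr isOpen_overlap (fun z hz => comps3_pf he he' φ hz)
    (fun z hz => comps1_pf he he' B hz) (mem_overlap_chart hy),
    (coordChange he he').div1_pf (hφ.field he') (hB _ he') (mem_overlap_chart hy)]
  rfl

theorem innerAt2_symm (he : e ∈ atlas E7 M) (v w : TwoTensor M) {y : E7}
    (hy : y ∈ e.target) : innerAt2 φ (e.symm y) (v (e.symm y)) (w (e.symm y)) =
      ip2 (comps3 e φ y) (comps2 e v y) (comps2 e w y) := by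
  rw [comps3_eq_at3 he φ hy, comps2_eq_at2 he _ hy, comps2_eq_at2 he _ hy,
    ip2_pull (det_toChart he hy)]
  rfl

theorem innerAt1_symm (he : e ∈ atlas E7 M) (v w : OneForm M) {y : E7}
    (hy : y ∈ e.target) : innerAt1 φ (e.symm y) (v (e.symm y)) (w (e.symm y)) =
      ip1 (comps3 e φ y) (comps1 e v y) (comps1 e w y) := by
  rw [comps3_eq_at3 he φ hy, comps1_eq_at1 he _ hy, comps1_eq_at1 he _ hy,
    ip1_pull (det_toChart he hy)]
  rfl

end Scalars

set_option linter.unusedSectionVars false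

theorem div1_finset_sum {ι : Type*} (s : Finset ι) (f : E7 → C3) {X : ι → E7 → C1} {y : E7}
    (hX : ∀ i j, DifferentiableAt ℝ (fun z => X i z j) y) :
    div1 f (fun z j => ∑ i ∈ s, X i z j) y = ∑ i ∈ s, div1 f (X i) y := by
  have e1 : ∀ k j, pd k (fun z => ∑ i ∈ s, X i z j) y = ∑ i ∈ s, pd k (fun z => X i z j) y := by
    intro k j
    simp only [pd]
    rw [fderiv_fun_sum fun i _ => hX i j, sum_apply]
  simp only [div1, tr, cov1, e1]
  refine Eq.trans (Finset.sum_congr rfl fun k _ => Eq.trans (Finset.sum_congr rfl fun j _ => ?_)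
    Finset.sum_comm) Finset.sum_comm
  rw [← Finset.mul_sum, Finset.sum_sub_distrib]
  simp only [Finset.mul_sum]
  rw [Finset.sum_comm (s := s)]

/-! ### Partitions of unity and the divergence theorem on a compact manifold -/

section Compact

variable {M : Type*} [TopologicalSpace M] [ChartedSpace E7 M] [IsManifold 𝓘(ℝ, E7) ∞ M]
  {e : OpenPartialHomeomorph M E7} {φ : ThreeForm M}

/-- A finite smooth partition of unity, subordinate to the preferred charts. -/
structure ChartPartition (s : Finset M) (ρ : M → M → ℝ) : Prop where
  smooth : ∀ i, ∀ e ∈ atlas E7 M, ContDiffOn ℝ ∞ (fun y => ρ i (e.symm y)) e.target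
  compact : ∀ i, IsCompact (tsupport (ρ i))
  subset : ∀ i, tsupport (ρ i) ⊆ (chartAt E7 i).source
  sum : ∀ p, ∑ i ∈ s, ρ i p = 1

theorem exists_chartPartition [T2Space M] [CompactSpace M] :
    ∃ (s : Finset M) (ρ : M → M → ℝ), ChartPartition s ρ := by
  obtain ⟨ρ, hρ⟩ := SmoothPartitionOfUnity.exists_isSubordinate_chartAt_source 𝓘(ℝ, E7) M
  have hf := ρ.locallyFinite.finite_nonempty_of_compact
  refine ⟨hf.toFinset, fun i p => ρ i p, fun i e he => ?_,
    fun i => (isClosed_tsupport _).isCompact, hρ, fun p => ?_⟩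
  · have h1 := (ρ i).contMDiff.comp_contMDiffOn
      (contMDiffOn_symm_of_mem_maximalAtlas (I := 𝓘(ℝ, E7)) (n := ∞)
        (IsManifold.subset_maximalAtlas he))
    exact contMDiffOn_iff_contDiffOn.1 h1
  · rw [← ρ.sum_eq_one (mem_univ p), finsum_eq_sum_of_support_subset]
    intro i hi
    simp only [Finite.coe_toFinset, mem_ofPred_eq]
    exact ⟨p, hi⟩

variable [MeasurableSpace M] [BorelSpace M]

/-- The divergence theorem for a 1-form that is supported in the domain of a chart. -/
theorem integral_divForm_chart (hφ : IsG2Structure φ) (he : e ∈ atlas E7 M) {B : OneForm M}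
    (hB : ∀ e ∈ atlas E7 M, ∀ i, ContDiffOn ℝ ∞ (fun y => comps1 e B y i) e.target)
    {K : Set M} (hK : IsCompact K) (hKc : IsClosed K) (hKe : K ⊆ e.source) (h0 : ∀ p ∉ K, B p = 0) :
    Integrable (divForm φ B) (volMeasure φ) ∧ ∫ p, divForm φ B p ∂volMeasure φ = 0 := by
  have h0' : ∀ e ∈ atlas E7 M, ∀ y ∈ e.target, e.symm y ∉ K → comps1 e B y = 0 := by
    intro e _ y _ hy
    ext i
    rw [comps1, h0 _ hy]
    rfl
  have hf := hφ.field he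
  have hc : ContDiffOn ℝ ∞ (fun y => divForm φ B (e.symm y)) e.target :=
    (contDiffOn_snd_iff.1 (hf.fam.tr (w := fun _ => cov1 (comps3 e φ) (comps1 e B))
      (hf.fam.cov1 (X := fun _ => comps1 e B) fun i => contDiffOn_snd_iff.2 (hB e he i)))).congr
      fun y hy => divForm_symm hφ he hB hy
  have h1 := integral_volMeasure hφ he hK hKe hc.continuousOn fun p hp => ?_
  · refine ⟨h1.1, ?_⟩
    rw [h1.2, ← hf.integral_div1 (fun z => isAlt3_apply (formE φ (e.symm z)) (frameE e z)) (hB e he)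
      (hK.image_of_continuousOn (e.continuousOn.mono hKe))
      (image_subset_iff.2 fun p hp => e.map_source (hKe hp)) (fun y hy h => h0' e he y hy fun h' =>
        h ⟨_, h', e.right_inv hy⟩)]
    exact setIntegral_congr_fun e.open_target.measurableSet fun y hy => by
      rw [divForm_symm hφ he hB hy]
  -- Off the closed set `K` the form vanishes on a whole neighbourhood of the point, hence so does
  -- its divergence.
  · have he' := chart_mem_atlas E7 p
    set e' := chartAt E7 p
    have ho : IsOpen (e'.target ∩ e'.symm ⁻¹' Kᶜ) :=
      e'.isOpen_inter_preimage_symm hKc.isOpen_compl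
    have hp' : e' p ∈ e'.target ∩ e'.symm ⁻¹' Kᶜ :=
      ⟨mem_chart_target E7 p, by rw [mem_preimage, chart_symm_apply]; exact hp⟩
    rw [divForm, div1_congr (Y := fun _ => 0) ho (fun _ _ => rfl)
      (fun z hz => h0' e' he' z hz.1 hz.2) hp']
    have e1 : ∀ i j, cov1 (comps3 e' φ) (fun _ => 0) (e' p) i j = 0 := fun i j => by
      simp [cov1, pd]
    rw [div1, tr]
    exact Finset.sum_eq_zero fun i _ => Finset.sum_eq_zero fun j _ =>
      mul_eq_zero_of_right _ (e1 i j)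

/-- The divergence theorem on a compact manifold. -/
theorem integral_divForm [T2Space M] [CompactSpace M] (hφ : IsG2Structure φ) {B : OneForm M}
    (hB : ∀ e ∈ atlas E7 M, ∀ i, ContDiffOn ℝ ∞ (fun y => comps1 e B y i) e.target) :
    ∫ p, divForm φ B p ∂volMeasure φ = 0 := by
  obtain ⟨s, ρ, hρ⟩ := exists_chartPartition (M := M)
  set D : M → OneForm M := fun i p => ρ i p • B p
  have hD : ∀ i, ∀ e ∈ atlas E7 M, ∀ j, ContDiffOn ℝ ∞ (fun y => comps1 e (D i) y j) e.target :=
    fun i e he j => (hρ.smooth i e he).mul (hB e he j)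
  have hD0 : ∀ i, ∀ p ∉ tsupport (ρ i), D i p = 0 := fun i p hp => by
    simp only [D, image_eq_zero_of_notMem_tsupport hp, zero_smul]
  have e1 : ∀ p, divForm φ B p = ∑ i ∈ s, divForm φ (D i) p := by
    intro p
    have he := chart_mem_atlas E7 p
    -- The pieces are summed before differentiating, so linearity of the divergence suffices and no
    -- derivative of the partition functions appears.
    have e2 : comps1 (chartAt E7 p) B = fun y j => ∑ i ∈ s, comps1 (chartAt E7 p) (D i) y j := by
      ext y j
      have e3 : ∀ i, comps1 (chartAt E7 p) (D i) y j =
          ρ i ((chartAt E7 p).symm y) * comps1 (chartAt E7 p) B y j := fun i => rfl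
      simp only [e3, ← Finset.sum_mul, hρ.sum, one_mul]
    rw [divForm, e2, div1_finset_sum s _ fun i j =>
      (hφ.field he).diffAt (hD i _ he j) (mem_chart_target E7 p)]
    rfl
  have h2 := fun i => integral_divForm_chart hφ (chart_mem_atlas E7 i) (hD i) (hρ.compact i)
    (isClosed_tsupport _) (hρ.subset i) (hD0 i)
  simp only [e1]
  rw [integral_finsetSum _ fun i _ => (h2 i).1]
  exact Finset.sum_eq_zero fun i _ => (h2 i).2

/-- Integration with a partition of unity. -/
theorem ChartPartition.integral {s : Finset M} {ρ : M → M → ℝ} (hρ : ChartPartition s ρ)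
    (hφ : IsG2Structure φ) {g : M → ℝ}
    (hg : ∀ e ∈ atlas E7 M, ContinuousOn (fun y => g (e.symm y)) e.target) :
    Integrable g (volMeasure φ) ∧ ∫ p, g p ∂volMeasure φ = ∑ i ∈ s,
      ∫ y in chartAt E7 i '' tsupport (ρ i), ρ i ((chartAt E7 i).symm y) *
        (g ((chartAt E7 i).symm y) * |volCoeff (comps3 (chartAt E7 i) φ y)|) := by
  have h1 := fun i => integral_volMeasure hφ (chart_mem_atlas E7 i) (hρ.compact i) (hρ.subset i)
    (g := fun p => ρ i p * g p)
    ((hρ.smooth i _ (chart_mem_atlas E7 i)).continuousOn.mul (hg _ (chart_mem_atlas E7 i)))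
    fun p hp => by rw [image_eq_zero_of_notMem_tsupport hp, zero_mul]
  have e1 : g = fun p => ∑ i ∈ s, ρ i p * g p := by
    ext p
    rw [← Finset.sum_mul, hρ.sum, one_mul]
  constructor
  · rw [e1]
    exact integrable_finsetSum _ fun i _ => (h1 i).1
  · conv_lhs => rw [e1]
    rw [integral_finsetSum _ fun i _ => (h1 i).1]
    refine Finset.sum_congr rfl fun i _ => (h1 i).2.trans ?_
    simp only [mul_assoc]
    refine setIntegral_eq_of_subset_of_forall_sdiff_eq_zero
      (chartAt E7 i).open_target.measurableSet
      (image_subset_iff.2 fun p hp => (chartAt E7 i).map_source (hρ.subset i hp)) fun y hy => ?_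
    rw [image_eq_zero_of_notMem_tsupport fun h => hy.2 ⟨_, h, (chartAt E7 i).right_inv hy.1⟩,
      zero_mul]

end Compact

set_option linter.unusedSectionVars false

theorem ip2_metric {c : C3} (hc : IsModel c) (h : C2) : ip2 c h (metric c) = tr c h := by
  have e : ∀ i b, ∑ j, cometric c j b * metric c i j = del i b := fun i b => by
    have h1 := hc.sum_cometric_metric b i
    rw [show del i b = del b i by simp [del, eq_comm], ← h1]
    exact Finset.sum_congr rfl fun j _ => by rw [hc.cometric_symm, metric_symm hc]
  have e1 : ∀ i, ∑ j, raise2 c h i j * metric c i j = ∑ a, cometric c i a * h a i := by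
    intro i
    simp only [raise2, Finset.sum_mul]
    rw [Finset.sum_comm]
    refine Finset.sum_congr rfl fun a _ => ?_
    rw [Finset.sum_comm]
    have e2 : ∀ b, ∑ j, cometric c i a * cometric c j b * h a b * metric c i j =
        cometric c i a * h a b * del i b := fun b => by
      rw [← e, Finset.mul_sum]
      exact Finset.sum_congr rfl fun j _ => by ring
    simp only [e2]
    simp [del]
  simp only [ip2, e1]
  rw [Finset.sum_comm]
  exact Finset.sum_congr rfl fun a _ => Finset.sum_congr rfl fun i _ => by rw [hc.cometric_symm]

theorem ip2_add_smul (c : C3) (h v w : C2) (r : ℝ) :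
    ip2 c h (v + r • w) = ip2 c h v + r * ip2 c h w := by
  simp only [ip2, Pi.add_apply, Pi.smul_apply, smul_eq_mul, mul_add, Finset.sum_add_distrib,
    Finset.mul_sum]
  exact congrArg _ (Finset.sum_congr rfl fun i _ => Finset.sum_congr rfl fun j _ => by ring)

/-! ### The first variation of the Hilbert functional -/

section Main

variable {M : Type*} [TopologicalSpace M] [ChartedSpace E7 M] [IsManifold 𝓘(ℝ, E7) ∞ M]
  [MeasurableSpace M] [BorelSpace M] {e : OpenPartialHomeomorph M E7}

/-- The integrand in the first variation of the Hilbert functional. -/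
def density (φ : ThreeForm M) (h : TwoTensor M) (X : OneForm M) (p : M) : ℝ :=
  innerAt2 φ p (h p) (P1 φ p) + innerAt1 φ p (X p) (P2 φ p)

theorem density_symm {φ : ThreeForm M} (hφ : IsG2Structure φ) (he : e ∈ atlas E7 M)
    (h : TwoTensor M) (X : OneForm M) {y : E7} (hy : y ∈ e.target) :
    density φ h X (e.symm y) = ip2 (comps3 e φ y) (comps2 e h y) (locP1hat (comps3 e φ) y)
      + ip1 (comps3 e φ y) (comps1 e X y) (locP2 (comps3 e φ) y)
      + lagr (comps3 e φ) y * tr (comps3 e φ y) (comps2 e h y) := by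
  rw [density, innerAt2_symm he h _ hy, innerAt1_symm he X _ hy, comps2_P1 hφ he hy,
    comps1_P2 hφ he hy, ip2_add_smul, ip2_metric (isModel_comps3 he hφ.2 hy)]
  ring

theorem continuousOn_lagrangian {φ : ThreeForm M} (hφ : IsG2Structure φ) (he : e ∈ atlas E7 M) :
    ContinuousOn (fun y => lagrangian φ (e.symm y)) e.target :=
  (contDiffOn_snd_iff.1 (hφ.field he).fam.lagr).continuousOn.congr
    fun _ hy => lagrangian_symm hφ he hy

theorem continuousOn_density {φ : ThreeForm M} (hφ : IsG2Structure φ) (he : e ∈ atlas E7 M)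
    {h : TwoTensor M} {X : OneForm M}
    (hh : ∀ i j, ContDiffOn ℝ ∞ (fun y => comps2 e h y i j) e.target)
    (hX : ∀ i, ContDiffOn ℝ ∞ (fun y => comps1 e X y i) e.target) :
    ContinuousOn (fun y => density φ h X (e.symm y)) e.target := by
  have hf := (hφ.field he).fam
  have hh' := fun i j => contDiffOn_snd_iff.2 (hh i j)
  have hX' := fun i => contDiffOn_snd_iff.2 (hX i)
  have h1 := (contDiffOn_snd_iff (u := fun y => ip2 (comps3 e φ y) (comps2 e h y)
    (locP1hat (comps3 e φ) y))).1 (hf.ip2 (v := fun _ => comps2 e h)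
    (w := fun _ => locP1hat (comps3 e φ)) hh' hf.locP1hat)
  have h2 := (contDiffOn_snd_iff (u := fun y => ip1 (comps3 e φ y) (comps1 e X y)
    (locP2 (comps3 e φ) y))).1 (hf.ip1 (X := fun _ => comps1 e X)
    (Y := fun _ => locP2 (comps3 e φ)) hX' hf.locP2)
  have h3 := contDiffOn_snd_iff.1 hf.lagr
  have h4 := (contDiffOn_snd_iff (u := fun y => tr (comps3 e φ y) (comps2 e h y))).1 (hf.tr (w := fun _ => comps2 e h) hh')
  exact ((h1.add h2).add (h3.mul h4)).continuousOn.congr fun y hy => density_symm hφ he h X hy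

theorem continuousOn_divForm {φ : ThreeForm M} (hφ : IsG2Structure φ) (he : e ∈ atlas E7 M)
    {B : OneForm M}
    (hB : ∀ e ∈ atlas E7 M, ∀ i, ContDiffOn ℝ ∞ (fun y => comps1 e B y i) e.target) :
    ContinuousOn (fun y => divForm φ B (e.symm y)) e.target := by
  have hf := (hφ.field he).fam
  have h1 := (contDiffOn_snd_iff (u := div1 (comps3 e φ) (comps1 e B))).1 (hf.tr (w := fun _ => cov1 (comps3 e φ) (comps1 e B))
    (hf.cov1 (X := fun _ => comps1 e B) fun i => contDiffOn_snd_iff.2 (hB e he i)))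
  exact h1.continuousOn.congr fun y hy => divForm_symm hφ he hB hy

variable {ε : ℝ} {φ : ℝ → ThreeForm M} {h : TwoTensor M} {X : OneForm M}

theorem smooth_variation_h (hφ : IsG2Family ε φ) (hV : HasVariation φ h X) :
    ∀ e ∈ atlas E7 M, ∀ i j, ContDiffOn ℝ ∞ (fun y => comps2 e h y i j) e.target :=
  fun _ he i j => ((variation_comps hφ hV he).smooth_h i j).mono fun _ hy => mem_slice hφ.1 hy

theorem smooth_variation_X (hφ : IsG2Family ε φ) (hV : HasVariation φ h X) :
    ∀ e ∈ atlas E7 M, ∀ i, ContDiffOn ℝ ∞ (fun y => comps1 e X y i) e.target :=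
  fun _ he i => ((variation_comps hφ hV he).smooth_X i).mono fun _ hy => mem_slice hφ.1 hy

theorem smooth_formA (hφ : IsG2Family ε φ) (hV : HasVariation φ h X) :
    ∀ e ∈ atlas E7 M, ∀ i, ContDiffOn ℝ ∞ (fun y => comps1 e (formA (φ 0) h X) y i) e.target := by
  intro e he i
  have h0 := hφ.structure hφ.zero_mem
  refine ((contDiffOn_snd_iff (u := fun y => locA (comps3 e (φ 0)) (comps2 e h) (comps1 e X) y i)).1
    ((h0.field he).fam.locA (h := fun _ => comps2 e h)
    (X := fun _ => comps1 e X) (fun i j => contDiffOn_snd_iff.2 (smooth_variation_h hφ hV e he i j))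
    (fun i => contDiffOn_snd_iff.2 (smooth_variation_X hφ hV e he i)) i)).congr fun y hy => ?_
  rw [comps1_formA h0 he (smooth_variation_h hφ hV) hy]

/-- The derivative of `𝖥 dμ` in a chart. -/
theorem dt_lagr_mul_volCoeff (hφ : IsG2Family ε φ) (hV : HasVariation φ h X) (he : e ∈ atlas E7 M)
    {y : E7} (hy : y ∈ e.target) :
    dt (fun t y => lagr (comps3 e (φ t)) y * |volCoeff (comps3 e (φ t) y)|) y =
      (density (φ 0) h X (e.symm y) + divForm (φ 0) (formA (φ 0) h X) (e.symm y)) *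
        |volCoeff (comps3 e (φ 0) y)| := by
  have h0 := hφ.structure hφ.zero_mem
  have hv := variation_comps hφ hV he
  have h1 := hv.hasDerivAt_lagr (mem_slice hφ.1 hy)
  have h2 := hasDerivAt_abs_volCoeff (isModel_comps3 he h0.2 hy) (hv.deriv y (mem_slice hφ.1 hy))
  have h3 := (h1.fun_mul h2).deriv
  rw [dt, h3, density_symm h0 he h X hy, divForm_symm h0 he (smooth_formA hφ hV) hy,
    div1_congr e.open_target (fun _ _ => rfl)
      (fun z hz => comps1_formA h0 he (smooth_variation_h hφ hV) hz) hy]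
  ring

/-- The first variation of the Hilbert functional. -/
theorem hasDerivAt_hilbertFunctional [T2Space M] [CompactSpace M] (hφ : IsG2Family ε φ)
    (hV : HasVariation φ h X) :
    Integrable (density (φ 0) h X) (volMeasure (φ 0)) ∧
      HasDerivAt (fun t => hilbertFunctional (φ t)) (∫ p, density (φ 0) h X p ∂volMeasure (φ 0)) 0 := by
  obtain ⟨s, ρ, hρ⟩ := exists_chartPartition (M := M)
  have h0 := hφ.structure hφ.zero_mem
  have hc1 := fun e (he : e ∈ atlas E7 M) => continuousOn_density h0 he
    (smooth_variation_h hφ hV e he) (smooth_variation_X hφ hV e he)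
  have hc2 := fun e (he : e ∈ atlas E7 M) => continuousOn_divForm h0 he (smooth_formA hφ hV)
  have hi1 := hρ.integral h0 hc1
  have hi2 := hρ.integral h0 hc2
  have hi3 := hρ.integral h0 (g := fun p => density (φ 0) h X p +
    divForm (φ 0) (formA (φ 0) h X) p) fun e he => (hc1 e he).add (hc2 e he)
  refine ⟨hi1.1, ?_⟩
  -- Adding `div A`, whose integral vanishes, turns the integrand into the parameter derivative of
  -- `𝖥 dμ`, which can then be compared chart by chart.
  have e1 : ∫ p, density (φ 0) h X p ∂volMeasure (φ 0) = ∫ p, (density (φ 0) h X p +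
      divForm (φ 0) (formA (φ 0) h X) p) ∂volMeasure (φ 0) := by
    rw [integral_add hi1.1 hi2.1, integral_divForm h0 (smooth_formA hφ hV), add_zero]
  rw [e1, hi3.2]
  -- In each chart the integral is over the image of the compact support of a partition function, a
  -- domain that does not depend on `t`; so only the integrand has to be differentiated.
  have hd : ∀ i ∈ s, HasDerivAt (fun t => ∫ y in chartAt E7 i '' tsupport (ρ i),
      ρ i ((chartAt E7 i).symm y) * (lagr (comps3 (chartAt E7 i) (φ t)) y *
        |volCoeff (comps3 (chartAt E7 i) (φ t) y)|))
      (∫ y in chartAt E7 i '' tsupport (ρ i), ρ i ((chartAt E7 i).symm y) *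
        ((density (φ 0) h X ((chartAt E7 i).symm y) +
          divForm (φ 0) (formA (φ 0) h X) ((chartAt E7 i).symm y)) *
          |volCoeff (comps3 (chartAt E7 i) (φ 0) y)|)) 0 := by
    intro i _
    have he := chart_mem_atlas E7 i
    have hf := hφ.fam he
    have hK : IsCompact (chartAt E7 i '' tsupport (ρ i)) :=
      (hρ.compact i).image_of_continuousOn ((chartAt E7 i).continuousOn.mono (hρ.subset i))
    have hKt : chartAt E7 i '' tsupport (ρ i) ⊆ (chartAt E7 i).target :=
      image_subset_iff.2 fun p hp => (chartAt E7 i).map_source (hρ.subset i hp)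
    have h1 := hasDerivAt_setIntegral hφ.1 (chartAt E7 i).open_target hK hKt
      (r := fun y => ρ i ((chartAt E7 i).symm y))
      (u := fun t y => lagr (comps3 (chartAt E7 i) (φ t)) y *
        |volCoeff (comps3 (chartAt E7 i) (φ t) y)|)
      ((hρ.smooth i _ he).continuousOn.mono hKt) (hf.lagr.mul hf.abs_volCoeff)
    refine h1.congr_deriv (setIntegral_congr_fun hK.measurableSet fun y hy => ?_)
    exact congrArg _ (dt_lagr_mul_volCoeff hφ hV he (hKt hy))
  refine (HasDerivAt.fun_sum hd).congr_of_eventuallyEq ?_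
  filter_upwards [Ioo_mem_nhds hφ.zero_mem.1 hφ.zero_mem.2] with t ht
  have ht' := hφ.structure ht
  rw [hilbertFunctional, (hρ.integral ht' fun e he => continuousOn_lagrangian ht' he).2]
  refine Finset.sum_congr rfl fun i _ => setIntegral_congr_fun
    ((hρ.compact i).image_of_continuousOn
      ((chartAt E7 i).continuousOn.mono (hρ.subset i))).measurableSet fun y hy => ?_
  obtain ⟨p, hp, rfl⟩ := hy
  simp only [lagrangian_symm ht' (chart_mem_atlas E7 i)
    ((chartAt E7 i).map_source (hρ.subset i hp))]

theorem integrable_lagrangian [T2Space M] [CompactSpace M] (hφ : IsG2Family ε φ) {t : ℝ}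
    (ht : t ∈ Ioo (-ε) ε) : Integrable (lagrangian (φ t)) (volMeasure (φ t)) := by
  obtain ⟨s, ρ, hρ⟩ := exists_chartPartition (M := M)
  exact (hρ.integral (hφ.structure ht)
    fun e he => continuousOn_lagrangian (hφ.structure ht) he).1

end Main

set_option linter.unusedSectionVars false

theorem ip2_symm {c : C3} (hc : IsModel c) (v w : C2) : ip2 c v w = ip2 c w v := by
  simp only [ip2, raise2, Finset.sum_mul]
  have e : ∀ u : Fin 7 → Fin 7 → Fin 7 → Fin 7 → ℝ, ∑ i, ∑ j, ∑ a, ∑ b, u i j a b =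
      ∑ a, ∑ b, ∑ i, ∑ j, u i j a b := by
    intro u
    have e1 : ∀ i, ∑ j, ∑ a, ∑ b, u i j a b = ∑ a, ∑ b, ∑ j, u i j a b := fun i => by
      rw [Finset.sum_comm]
      exact Finset.sum_congr rfl fun a _ => Finset.sum_comm
    simp only [e1]
    rw [Finset.sum_comm]
    exact Finset.sum_congr rfl fun a _ => Finset.sum_comm
  rw [e]
  refine Finset.sum_congr rfl fun a _ => Finset.sum_congr rfl fun b _ =>
    Finset.sum_congr rfl fun i _ => Finset.sum_congr rfl fun j _ => ?_
  rw [hc.cometric_symm i a, hc.cometric_symm j b]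
  ring

theorem ip1_symm {c : C3} (hc : IsModel c) (v w : C1) : ip1 c v w = ip1 c w v := by
  simp only [ip1, raise1, Finset.sum_mul]
  rw [Finset.sum_comm]
  refine Finset.sum_congr rfl fun a _ => Finset.sum_congr rfl fun i _ => ?_
  rw [hc.cometric_symm i a]
  ring

/-! ### The decomposition of 3-forms and the gradient -/

section Gradient

variable {M : Type*} [TopologicalSpace M] [ChartedSpace E7 M] [IsManifold 𝓘(ℝ, E7) ∞ M]
  {φ : ThreeForm M}

theorem symm_of_at2 {p : M} {w : Tan p →L[ℝ] Tan p →L[ℝ] ℝ}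
    (h : ∀ i j, at2 p w i j = at2 p w j i) (u v : Tan p) : w u v = w v u := by
  have e : w = ContinuousLinearMap.flip (E := E7) (F := E7) w := ext_at2 (by
    ext i j
    exact h i j)
  exact congrArg (fun w : E7 →L[ℝ] E7 →L[ℝ] ℝ => w u v) e

/-- Existence of the decomposition at the level of components makes the choice in `decomp`
meaningful; symmetry and equality of tensors are tested on the coordinate frame. -/
theorem decomp_spec (hφ : IsG2Structure φ) (p : M) (α : Tan p [⋀^Fin 3]→L[ℝ] ℝ) :
    (∀ u v, (decomp φ p α).1 u v = (decomp φ p α).1 v u) ∧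
      α = diamondAt φ p (decomp φ p α).1 + hookPsiAt φ p (decomp φ p α).2 := by
  have hm := isModel_at3 (hφ.2 p)
  obtain ⟨h, X, hh, e⟩ := exists_variation hm (isAlt3_at3 p α)
  refine Classical.epsilon_spec (p := fun q : (Tan p →L[ℝ] Tan p →L[ℝ] ℝ) × (Tan p →L[ℝ] ℝ) =>
    (∀ u v, q.1 u v = q.1 v u) ∧ α = diamondAt φ p q.1 + hookPsiAt φ p q.2)
    ⟨(tensor2Of p h, form1Of p X), symm_of_at2 fun i j => ?_, ext_at3 ?_⟩
  · rw [at2_tensor2Of, hh]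
  · rw [at3_variation hm, at2_tensor2Of, at1_form1Of, e]

theorem decomp_eq (hφ : IsG2Structure φ) (p : M) {h : Tan p →L[ℝ] Tan p →L[ℝ] ℝ}
    (hh : ∀ u v, h u v = h v u) (X : Tan p →L[ℝ] ℝ) :
    decomp φ p (diamondAt φ p h + hookPsiAt φ p X) = (h, X) := by
  have hm := isModel_at3 (hφ.2 p)
  obtain ⟨h1, h2⟩ := decomp_spec hφ p (diamondAt φ p h + hookPsiAt φ p X)
  have h3 := congrArg (at3 p) h2
  rw [at3_variation hm, at3_variation hm] at h3
  obtain ⟨e1, e2⟩ := eq_of_variation_eq hm (fun i j => hh _ _) (fun i j => h1 _ _) h3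
  exact Prod.ext (ext_at2 e1.symm) (ext_at1 e2.symm)

/-- Symmetry is needed for `P₁` and `P₂` to be the components chosen by `decomp`. The non-formal
ingredient is the symmetry of the Ricci tensor. -/
theorem P1_symm (hφ : IsG2Structure φ) (p : M) (u v : Tan p) : P1 φ p u v = P1 φ p v u := by
  have he := chart_mem_atlas E7 p
  have hy := mem_chart_target E7 p
  refine symm_of_at2 (fun i j => ?_) u v
  rw [at2_eq, comps2_P1 hφ he hy]
  simp only [Pi.add_apply, Pi.smul_apply, (hφ.field he).locP1hat_symm hy i j,
    metric_symm (isModel_comps3 he hφ.2 hy) i j]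

/-- The gradient of the Hilbert functional. -/
def gradient (φ : ThreeForm M) : ThreeForm M := fun p =>
  diamondAt φ p (P1 φ p) + hookPsiAt φ p (P2 φ p)

theorem isSmooth3_gradient (hφ : IsG2Structure φ) : IsSmooth3 (gradient φ) := by
  intro e he i j k
  have hf := (hφ.field he).fam
  have hw : ∀ i j, ContDiffOn ℝ ∞ (fun y => comps2 e (P1 φ) y i j) e.target := fun i j =>
    ((contDiffOn_snd_iff (u := fun y => locP1hat (comps3 e φ) y i j
      + lagr (comps3 e φ) y * metric (comps3 e φ y) i j)).1 ((hf.locP1hat i j).add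
        (hf.lagr.mul (hf.metric i j)))).congr fun y hy => by rw [comps2_P1 hφ he hy]; rfl
  have hX : ∀ i, ContDiffOn ℝ ∞ (fun y => comps1 e (P2 φ) y i) e.target := fun i =>
    ((contDiffOn_snd_iff (u := fun y => locP2 (comps3 e φ) y i)).1 (hf.locP2 i)).congr
      fun y hy => by rw [comps1_P2 hφ he hy]
  have h1 := hf.diamond (h := fun _ => comps2 e (P1 φ)) (fun i j => contDiffOn_snd_iff.2 (hw i j))
    i j k
  have h2 := hf.hookPsi (X := fun _ => comps1 e (P2 φ)) (fun i => contDiffOn_snd_iff.2 (hX i)) i j k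
  refine ((contDiffOn_snd_iff (u := fun y => diamond (comps3 e φ y) (comps2 e (P1 φ) y) i j k
    + hookPsi (comps3 e φ y) (comps1 e (P2 φ) y) i j k)).1 (h1.add h2)).congr fun y hy => ?_
  change comps3 e (fun p => diamondAt φ p (P1 φ p) + hookPsiAt φ p (P2 φ p)) y i j k = _
  rw [comps3_variation he hφ.2 _ _ hy]
  rfl

theorem isGradientL2_gradient [T2Space M] [CompactSpace M] [MeasurableSpace M] [BorelSpace M]
    (hφ : IsG2Structure φ) : IsGradientL2 hilbertFunctional φ (gradient φ) := by
  refine ⟨isSmooth3_gradient hφ, ?_⟩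
  rintro ε φt β hφt rfl hβ
  have hV : HasVariation φt (fun p => (decomp (φt 0) p (β p)).1)
      (fun p => (decomp (φt 0) p (β p)).2) :=
    ⟨fun p => (decomp_spec hφ p (β p)).1, fun p v => by
      rw [← (decomp_spec hφ p (β p)).2]
      exact hβ p v⟩
  -- The velocity enters through its own decomposition as `(h, X)`, and uniqueness of the
  -- decomposition returns `P₁`, `P₂` for the gradient. The two integrands then agree up to the
  -- order of the arguments of the inner products.
  convert (hasDerivAt_hilbertFunctional hφt hV).2 using 1
  refine integral_congr_ae (.of_forall fun p => ?_)
  have hm := isModel_at3 (hφ.2 p)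
  simp only [gradient, decomp_eq hφ p (P1_symm hφ p)]
  exact congrArg₂ (· + ·) (ip2_symm hm _ _) (ip1_symm hm _ _)

end Gradient

end G2Hilbert

end

theorem mainTheorem3 {M : Type*} [TopologicalSpace M] [ChartedSpace E7 M]
    [IsManifold 𝓘(ℝ, E7) ∞ M] [T2Space M] [MeasurableSpace M] [BorelSpace M]
    (φ : ThreeForm M) (hφ : IsG2Structure φ) :
    (∀ (ε : ℝ) (φt : ℝ → ThreeForm M) (h : TwoTensor M) (X : OneForm M),
      IsG2Family ε φt → φt 0 = φ → HasVariation φt h X →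
      ∀ p : M, HasDerivAt (fun t => lagrangian (φt t) p)
        (innerAt2 φ p (h p) (P1hat φ p) + innerAt1 φ p (X p) (P2 φ p) + divA φ h X p) 0) ∧
    (CompactSpace M →
      (∀ (ε : ℝ) (φt : ℝ → ThreeForm M) (h : TwoTensor M) (X : OneForm M),
        IsG2Family ε φt → φt 0 = φ → HasVariation φt h X →
        (∀ t ∈ Ioo (-ε) ε, Integrable (lagrangian (φt t)) (volMeasure (φt t))) ∧
        Integrable (fun p => innerAt2 φ p (h p) (P1 φ p) + innerAt1 φ p (X p) (P2 φ p))
          (volMeasure φ) ∧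
        HasDerivAt (fun t => hilbertFunctional (φt t))
          (∫ p, (innerAt2 φ p (h p) (P1 φ p) + innerAt1 φ p (X p) (P2 φ p)) ∂volMeasure φ) 0) ∧
      IsGradientL2 hilbertFunctional φ
        (fun p => diamondAt φ p (P1 φ p) + hookPsiAt φ p (P2 φ p))) := by
  refine ⟨?_, fun hM => ⟨?_, isGradientL2_gradient hφ⟩⟩
  · rintro ε φt h X hφt rfl hV p
    exact hasDerivAt_lagrangian hφt hV p
  · rintro ε φt h X hφt rfl hV
    exact ⟨fun t ht => integrable_lagrangian hφt ht, hasDerivAt_hilbertFunctional hφt hV⟩
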